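/- Let $d_{\mathrm{ind}}\ge 1$, $d_{\mathrm{cls}}\ge 0$, $d=d_{\mathrm{ind}}+d_{\mathrm{cls}}$. We consider a sequence of samples (the index of the sequence is suppressed; all limits, $O(\cdot)$ and $o(\cdot)$ are along it). A sample consists of $G$ clusters of nonrandom sizes $n_g\ge 1$, with $n=\sum_g n_g$, and of random variables $Y_{gj}\in\mathbb R$, $X_{gj}=(X_{gj}^{(\mathrm{ind})},X_g^{(\mathrm{cls})})\in\mathbb R^{d_{\mathrm{ind}}}\times\mathbb R^{d_{\mathrm{cls}}}$, $1\le j\le n_g$. Put $\mathbf X_g=(X_{g1},\dots,X_{gn_g})$ and $e_{gj}=Y_{gj}-m(X_{gj})$. Fix $x=(x^{(\mathrm{ind})},x^{(\mathrm{cls})})\in\mathbb R^d$ and bandwidths $h,b>0$ (depending on the sample). Write $X_{g,j_1\dots j_p}=(X_{gj_1}^{(\mathrm{ind})},\dots,X_{gj_p}^{(\mathrm{ind})};X_g^{(\mathrm{cls})})$ and $x_{[p]}=(x^{(\mathrm{ind})},\dots,x^{(\mathrm{ind})};x^{(\mathrm{cls})})$ ($p$ copies). For a neighbourhood $\mathcal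 N$ of $x$, a function of $(u_1,\dots,u_p;c)$ is said to have a property on $\mathcal N$ if it has it at all points with $(u_i,c)\in\mathcal N$ for every $i$. **Kernel.** $k:\mathbb R\to[0,\infty)$ is bounded and even, $\int k=1$, $\int u^4k(u)\,du<\infty$; $\kappa_2=\int u^2k(u)\,du$, $R_k=\int k^2$; $K(u)=\prod_q k(u^{(q)})$ in any dimension. On $\mathbb R^d$, $K$ has compact support and is Lipschitz. **Data-generating process.** The functions below do not depend on the sample. (1) The clusters are mutually independent. (2) $\mathbb E[e_{gj}\mid\mathbf X_g]=0$, $\mathbb E[e_{gj}^2\mid\mathbf X_g]=\sigma^2(X_{gj})$, and $\mathbb E[e_{gj}e_{g\ell}\mid\mathbf X_g]=\sigma(X_{g,j\ell})$ for $j\ne\ell$. (3) $\mathbb E[e_{gj}^4\mid\mathbf X_g]=\varsigma^2(X_{gj})$ and, for distinct $j,\ell,t,s$, $\mathbb E[e_{gj}^2e_{g\ell}^2\mid\mathbf X_g]=\varsigma_{2}(X_{g,j\ell})$, $\mathbb E[e_{gj}^2e_{g\ell}e_{gt}\mid\mathbf X_g]=\varsigma_{3}(X_{g,j\ell t})$,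 $\mathbb E[e_{gj}e_{g\ell}e_{gt}e_{gs}\mid\mathbf X_g]=\varsigma_{4}(X_{g,j\ell ts})$. (4) Every $X_{gj}$ has density $f$, and for $2\le p\le 8$ and distinct $j_1,\dots,j_p$ the vector $X_{g,j_1\dots j_p}$ has density $f_p$. **Smoothness.** $m,f$ are $C^2$ with bounded derivatives of order $\le 2$ and uniformly continuous second derivatives; $f_2$ is $C^1$ with bounded derivatives of order $\le1$ and uniformly continuous first derivative; $f_3,f_4,\sigma^2,\sigma$ are bounded and uniformly continuous. On some neighbourhood of $x$: $\sigma^2,\sigma,f_2$ are $C^2$, $f_3,f_4$ are $C^1$, and $f_5,\dots,f_8,\varsigma^2,\varsigma_2,\varsigma_3,\varsigma_4$ are continuous. Moreover $f(x)>0$ and $f_2(x_{[2]})>0$. **Rates.** $h\to0$, $nh^d\to\infty$, $(\max_g n_g)h^{d_{\mathrm{ind}}}=O(1)$, $nh^{d+4}=O(1)$, $\max_g n_g^4/n\to0$, and $\widehat\lambda:=\bigl(\tfrac1n\sum_g n_g^2\bigr)h^{d_{\mathrm{ind}}}\to\lambda\in[0,\infty)$. With $N=\sum_g n_g(n_g-1)/2$: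 $b\to0$, $Nb^{2d_{\mathrm{ind}}+d_{\mathrm{cls}}}\to\infty$, $(\max_g n_g^2)b^{2d_{\mathrm{ind}}}=O(1)$. Moreover $$R_k^d f(x)\sigma^2(x)+\lambda R_k^{d_{\mathrm{cls}}}f_2(x_{[2]})\,\sigma(x_{[2]})>0.$$ **Moments.** (a) For some $r\ge2$, some neighbourhood $\mathcal N$ of $x$ and some constants $\bar v,C$: $\mathbb E[|e_{gj}|^{2r}\mid X_{gj}=y]\le\bar v^2$ for (almost) all $y\in\mathcal N$, all $g,j$ and all samples; $(\sum_g n_g^r)^{1/r}\le C n^{1/4}$; and $n^{-r/2}h^{-(dr-d)}=O(1)$. (b) For some $s>2$, uniformly over $g,j$ and all samples: $\mathbb E|Y_{gj}|^s$ is bounded and $\mathbb E[|Y_{gj}|^s\mid X_{gj}=y]f(y)$ is (essentially) bounded in $y$; and $(\max_g n_g)^2\log n/(n^{1-2/s}h^d)=O(1)$. (The value $s=\infty$ is allowed; it means that the $Y_{gj}$ are uniformly bounded and that the rate condition holds with $2/s=0$.) **Range of the regressors.** Consider real sequences with $c_n=O\bigl((\max_g n_g)^{2/d}(\log n)^{1/d}\bigr)$.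 There is such a sequence with $\delta_n=\inf_{\|y\|\le c_n}f(y)>0$ and $\delta_n^{-1}\bigl((\log n/(nh^d))^{1/2}+h^2\bigr)=o(1)$; and there is such a sequence with $\Pr(\|X_{gj}\|>c_n)\to0$ uniformly in $g,j$. **Estimators.** Let $K_i(y)=K((X_i-y)/h)$, where $i$ runs over all pairs $(g,j)$. Set $\widehat f(y)=\frac1{nh^d}\sum_iK_i(y)$ and $\widehat m_{\mathrm{nw}}(y)=\sum_iK_i(y)Y_i/\sum_iK_i(y)$. The local linear estimator is $\widehat m_{\mathrm{LL}}(y)=\mathbf e_1^\top(\mathbf X_y^\top\mathbf W_y\mathbf X_y)^{-1}\mathbf X_y^\top\mathbf W_y\mathbf Y$, where $\mathbf X_y$ has rows $(1,(X_i-y)^\top)$ and $\mathbf W_y=\mathrm{diag}(h^{-d}K_i(y))$. Let $$B_{\mathrm{nw}}(x)=\kappa_2\sum_{q=1}^d\Bigl(\tfrac12\partial_{qq}m(x)+f(x)^{-1}\partial_qf(x)\,\partial_qm(x)\Bigr),\qquad B_{\mathrm{LL}}(x)=\tfrac{\kappa_2}2\sum_{q=1}^d\partial_{qq}m(x).$$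 Let $*$ be $\mathrm{nw}$ or $\mathrm{LL}$, and let $\widehat e_{gj}=Y_{gj}-\widehat m_*(X_{gj})$. With $W_{gj\ell}=K\bigl((X_{g,j\ell}-x_{[2]})/b\bigr)$, set $$\widehat\sigma^2_{\mathrm{nw}}=\frac{\sum_iK_i(x)\widehat e_i^{\,2}}{\sum_iK_i(x)},\qquad \widehat f_2=\frac{\sum_g\sum_{j<\ell}W_{gj\ell}}{Nb^{2d_{\mathrm{ind}}+d_{\mathrm{cls}}}},\qquad \widehat\sigma_{\mathrm{nw}}=\frac{\sum_g\sum_{j<\ell}W_{gj\ell}\,\widehat e_{gj}\widehat e_{g\ell}}{\sum_g\sum_{j<\ell}W_{gj\ell}}.$$ **Conclusion.** For each of the two choices $*=\mathrm{nw}$ and $*=\mathrm{LL}$, $$\Bigl(\frac{R_k^d\,\widehat\sigma^2_{\mathrm{nw}}}{\widehat f(x)}+\frac{\widehat\lambda R_k^{d_{\mathrm{cls}}}\,\widehat f_2\,\widehat\sigma_{\mathrm{nw}}}{\widehat f(x)^2}\Bigr)^{-1/2}\sqrt{nh^d}\,\bigl(\widehat m_*(x)-m(x)-h^2B_*(x)\bigr)\overset{d}{\longrightarrow}\mathrm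 N(0,1).$$ (The statistic is defined with probability tending to one; where it is not, quotients by $0$, inverses of singular matrices and negative powers $-1/2$ of nonpositive numbers are set to $0$.) -/

import Mathlib

open MeasureTheory ProbabilityTheory Filter Topology Asymptotics
open scoped NNReal ENNReal

noncomputable section

namespace ClusterKernel

/-! ## Regressor spaces -/

/-- The regressor space `ℝ^d`, `d = dI + dC`, with the Euclidean norm; the coordinates are split
into `dI` individual-level and `dC` cluster-level ones. -/
abbrev RegSpace (dI dC : ℕ) : Type := EuclideanSpace ℝ (Fin dI ⊕ Fin dC)

/-- The space `ℝ^(p * dI + dC)` of vectors `(u₁, …, u_p; c)` made of `p` individual-level vectors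
and one common cluster-level vector. -/
abbrev JointSpace (p dI dC : ℕ) : Type := EuclideanSpace ℝ ((Fin p × Fin dI) ⊕ Fin dC)

variable {dI dC : ℕ}

/-- The vector `(u; c)`. -/
def pair (u : EuclideanSpace ℝ (Fin dI)) (c : EuclideanSpace ℝ (Fin dC)) : RegSpace dI dC :=
  WithLp.toLp 2 (Sum.elim (fun q => u q) (fun q => c q))

/-- The vector `(u₁, …, u_p; c)`. -/
def stack {p : ℕ} (u : Fin p → EuclideanSpace ℝ (Fin dI)) (c : EuclideanSpace ℝ (Fin dC)) :
    JointSpace p dI dC :=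
  WithLp.toLp 2 (Sum.elim (fun q => u q.1 q.2) (fun q => c q))

/-- The `i`-th regressor vector `(u_i; c)` contained in `(u₁, …, u_p; c)`. -/
def extract {p : ℕ} (z : JointSpace p dI dC) (i : Fin p) : RegSpace dI dC :=
  WithLp.toLp 2 (Sum.elim (fun q => z (Sum.inl (i, q))) (fun q => z (Sum.inr q)))

/-- For `x = (u; c)`, the vector `(u, …, u; c)` with `p` copies of `u`. -/
def diagPt (p : ℕ) (x : RegSpace dI dC) : JointSpace p dI dC :=
  WithLp.toLp 2 (Sum.elim (fun q => x (Sum.inl q.2)) (fun q => x (Sum.inr q)))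

/-- The set of `(u₁, …, u_p; c)` with `(u_i; c) ∈ N` for every `i`. -/
def jointNbhd (p : ℕ) (N : Set (RegSpace dI dC)) : Set (JointSpace p dI dC) :=
  {z | ∀ i, extract z i ∈ N}

/-! ## Kernels -/

/-- Univariate kernel functions: nonnegative, bounded, symmetric, of integral one, with finite
second and fourth moments. -/
structure IsKernel (k : ℝ → ℝ) : Prop where
  nonneg : ∀ u, 0 ≤ k u
  bounded : ∃ C : ℝ, ∀ u, k u ≤ C
  symm : ∀ u, k (-u) = k u
  integral_one : ∫ u, k u = 1
  integrable_two : Integrable (fun u => u ^ 2 * k u)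
  integrable_four : Integrable (fun u => u ^ 4 * k u)

/-- `κ₂ = ∫ u² k(u) du`. -/
def kappaTwo (k : ℝ → ℝ) : ℝ := ∫ u, u ^ 2 * k u

/-- `R_k = ∫ k(u)² du`. -/
def roughness (k : ℝ → ℝ) : ℝ := ∫ u, k u ^ 2

/-- The product kernel `K(u) = ∏_q k(u_q)` on a Euclidean space of any dimension. -/
def prodKernel {ι : Type} [Fintype ι] (k : ℝ → ℝ) (u : EuclideanSpace ℝ ι) : ℝ := ∏ q, k (u q)

/-! ## Cluster samples -/

/-- A cluster sample on `Ω`: `G` clusters of nonrandom sizes `n_g ≥ 1`, and random variables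
`Y_{gj}`, individual-level regressors and cluster-level regressors. -/
structure ClusterSample (dI dC : ℕ) (Ω : Type*) [MeasurableSpace Ω] where
  G : ℕ
  size : Fin G → ℕ
  size_pos : ∀ g, 1 ≤ size g
  Y : (g : Fin G) → Fin (size g) → Ω → ℝ
  XI : (g : Fin G) → Fin (size g) → Ω → EuclideanSpace ℝ (Fin dI)
  XC : Fin G → Ω → EuclideanSpace ℝ (Fin dC)
  measurable_Y : ∀ g j, Measurable (Y g j)
  measurable_XI : ∀ g j, Measurable (XI g j)
  measurable_XC : ∀ g, Measurable (XC g)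

namespace ClusterSample

variable {Ω : Type*} [MeasurableSpace Ω] (S : ClusterSample dI dC Ω)

/-- `X_{gj}`. -/
def X (g : Fin S.G) (j : Fin (S.size g)) (ω : Ω) : RegSpace dI dC :=
  pair (S.XI g j ω) (S.XC g ω)

/-- `(X_{g j₁}^{ind}, …, X_{g j_p}^{ind}; X_g^{cls})`. -/
def joint {p : ℕ} (g : Fin S.G) (j : Fin p → Fin (S.size g)) (ω : Ω) : JointSpace p dI dC :=
  stack (fun i => S.XI g (j i) ω) (S.XC g ω)

/-- The σ-algebra generated by `𝐗_g = (X_{g1}, …, X_{g n_g})`. -/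
abbrev sigmaX (g : Fin S.G) : MeasurableSpace Ω :=
  MeasurableSpace.comap (fun ω (j : Fin (S.size g)) => S.X g j ω) inferInstance

/-- The number of observations `n = ∑ n_g`. -/
def n : ℕ := ∑ g, S.size g

/-- `max_g n_g`. -/
def maxSize : ℕ := Finset.univ.sup S.size

/-- The number of within-cluster pairs, `N = ∑ n_g (n_g - 1) / 2`. -/
def pairCount : ℕ := ∑ g, (S.size g).choose 2

/-- `(n⁻¹ ∑ n_g²) h^{dI}`. -/
def lambdaHat (h : ℝ) : ℝ := ((∑ g, (S.size g : ℝ) ^ 2) / S.n) * h ^ dI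

/-- The error `e_{gj} = Y_{gj} - m(X_{gj})`. -/
def err (m : RegSpace dI dC → ℝ) (g : Fin S.G) (j : Fin (S.size g)) (ω : Ω) : ℝ :=
  S.Y g j ω - m (S.X g j ω)

/-! ### Estimators -/

/-- The kernel density estimator `f̂(x)`. -/
def fHat (k : ℝ → ℝ) (h : ℝ) (x : RegSpace dI dC) (ω : Ω) : ℝ :=
  (∑ g, ∑ j, prodKernel k (h⁻¹ • (S.X g j ω - x))) / (S.n * h ^ (dI + dC))

/-- The Nadaraya–Watson estimator. -/
def mNW (k : ℝ → ℝ) (h : ℝ) (x : RegSpace dI dC) (ω : Ω) : ℝ :=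
  (∑ g, ∑ j, prodKernel k (h⁻¹ • (S.X g j ω - x)) * S.Y g j ω) /
    ∑ g, ∑ j, prodKernel k (h⁻¹ • (S.X g j ω - x))

/-- The vector `(1, v)ᵀ ∈ ℝ^(d+1)`. -/
def oneCons (v : RegSpace dI dC) : Unit ⊕ (Fin dI ⊕ Fin dC) → ℝ :=
  Sum.elim (fun _ => 1) (fun q => v q)

/-- The scaled kernel `K_h(v) = h^{-d} K(v / h)`. -/
def scaledKernel (k : ℝ → ℝ) (h : ℝ) (v : RegSpace dI dC) : ℝ :=
  prodKernel k (h⁻¹ • v) / h ^ (dI + dC)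

/-- The local design matrix `𝐗_x`, with rows `(1, (X_i - x)ᵀ)`. -/
def designMatrix (x : RegSpace dI dC) (ω : Ω) :
    Matrix (Σ g : Fin S.G, Fin (S.size g)) (Unit ⊕ (Fin dI ⊕ Fin dC)) ℝ :=
  Matrix.of fun i => oneCons (S.X i.1 i.2 ω - x)

/-- The diagonal weight matrix `𝐖_x`, with entries `K_h(X_i - x)`. -/
def weightMatrix (k : ℝ → ℝ) (h : ℝ) (x : RegSpace dI dC) (ω : Ω) :
    Matrix (Σ g : Fin S.G, Fin (S.size g)) (Σ g : Fin S.G, Fin (S.size g)) ℝ :=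
  Matrix.diagonal fun i => scaledKernel k h (S.X i.1 i.2 ω - x)

/-- `K_LL(u, x) = e₁ᵀ (𝐗_xᵀ 𝐖_x 𝐗_x)⁻¹ (1, (u - x)ᵀ)ᵀ K_h(u - x)`. -/
def kernelLL (k : ℝ → ℝ) (h : ℝ) (u x : RegSpace dI dC) (ω : Ω) : ℝ :=
  Matrix.mulVec
      ((S.designMatrix x ω).transpose * S.weightMatrix k h x ω * S.designMatrix x ω)⁻¹
      (oneCons (u - x)) (Sum.inl ()) * scaledKernel k h (u - x)

/-- The local linear estimator. -/
def mLL (k : ℝ → ℝ) (h : ℝ) (x : RegSpace dI dC) (ω : Ω) : ℝ :=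
  ∑ g, ∑ j, S.kernelLL k h (S.X g j ω) x ω * S.Y g j ω

end ClusterSample

/-- The choice of the regression estimator: Nadaraya–Watson or local linear. -/
inductive Method : Type
  | nw
  | ll

namespace ClusterSample

variable {Ω : Type*} [MeasurableSpace Ω] (S : ClusterSample dI dC Ω)

/-- The regression estimator `m̂_*`. -/
def mHat (M : Method) (k : ℝ → ℝ) (h : ℝ) (x : RegSpace dI dC) (ω : Ω) : ℝ :=
  match M with
  | .nw => S.mNW k h x ω
  | .ll => S.mLL k h x ω

/-- The residual `ê_{gj} = Y_{gj} - m̂_*(X_{gj})`. -/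
def resid (M : Method) (k : ℝ → ℝ) (h : ℝ) (g : Fin S.G) (j : Fin (S.size g)) (ω : Ω) : ℝ :=
  S.Y g j ω - S.mHat M k h (S.X g j ω) ω

/-- The estimator `σ̂²_nw(x)` of the conditional variance. -/
def sigmaSqHat (M : Method) (k : ℝ → ℝ) (h : ℝ) (x : RegSpace dI dC) (ω : Ω) : ℝ :=
  (∑ g, ∑ j, prodKernel k (h⁻¹ • (S.X g j ω - x)) * S.resid M k h g j ω ^ 2) /
    ∑ g, ∑ j, prodKernel k (h⁻¹ • (S.X g j ω - x))

/-- The weight `K(((X_{gj}^{ind}, X_{gl}^{ind}, X_g^{cls}) - (x^{ind}, x^{ind}, x^{cls})) / b)`,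
with the product kernel in dimension `2 dI + dC`. -/
def pairWeight (k : ℝ → ℝ) (b : ℝ) (x : RegSpace dI dC) (g : Fin S.G)
    (j l : Fin (S.size g)) (ω : Ω) : ℝ :=
  prodKernel k (b⁻¹ • (S.joint g ![j, l] ω - diagPt 2 x))

/-- The estimator `f̂₂(x^{ind}, x^{ind}; x^{cls})` of the joint density. -/
def fTwoHat (k : ℝ → ℝ) (b : ℝ) (x : RegSpace dI dC) (ω : Ω) : ℝ :=
  (∑ g, ∑ j, ∑ l, if j < l then S.pairWeight k b x g j l ω else 0) /
    (S.pairCount * b ^ (2 * dI + dC))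

/-- The estimator `σ̂_nw(x^{ind}, x^{ind}; x^{cls})` of the conditional covariance. -/
def sigmaCovHat (M : Method) (k : ℝ → ℝ) (h b : ℝ) (x : RegSpace dI dC) (ω : Ω) : ℝ :=
  (∑ g, ∑ j, ∑ l, if j < l then
      S.pairWeight k b x g j l ω * (S.resid M k h g j ω * S.resid M k h g l ω) else 0) /
    ∑ g, ∑ j, ∑ l, if j < l then S.pairWeight k b x g j l ω else 0

/-- The plug-in estimator of the asymptotic variance. -/
def varHat (M : Method) (k : ℝ → ℝ) (h b : ℝ) (x : RegSpace dI dC) (ω : Ω) : ℝ :=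
  roughness k ^ (dI + dC) * S.sigmaSqHat M k h x ω / S.fHat k h x ω +
    S.lambdaHat h * roughness k ^ dC * S.fTwoHat k b x ω * S.sigmaCovHat M k h b x ω /
      S.fHat k h x ω ^ 2

end ClusterSample

/-! ## Bias terms -/

/-- The partial derivative `∂_q φ(x)`. -/
def partialD (q : Fin dI ⊕ Fin dC) (φ : RegSpace dI dC → ℝ) (x : RegSpace dI dC) : ℝ :=
  fderiv ℝ φ x (EuclideanSpace.single q 1)

/-- `B_nw(x)` and `B_LL(x)`. -/
def bias (M : Method) (k : ℝ → ℝ) (m f : RegSpace dI dC → ℝ) (x : RegSpace dI dC) : ℝ :=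
  match M with
  | .nw => kappaTwo k *
      ∑ q, (1 / 2 * partialD q (partialD q m) x + (f x)⁻¹ * partialD q f x * partialD q m x)
  | .ll => kappaTwo k / 2 * ∑ q, partialD q (partialD q m) x

/-- The studentized statistic
`V̂^{-1/2} √(n h^d) (m̂_*(x) - m(x) - h² B_*(x))`. -/
def studentized {Ω : Type*} [MeasurableSpace Ω] (S : ClusterSample dI dC Ω) (M : Method)
    (k : ℝ → ℝ) (m f : RegSpace dI dC → ℝ) (h b : ℝ) (x : RegSpace dI dC) (ω : Ω) : ℝ :=
  (Real.sqrt (S.varHat M k h b x ω))⁻¹ * Real.sqrt (S.n * h ^ (dI + dC)) *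
    (S.mHat M k h x ω - m x - h ^ 2 * bias M k m f x)

/-! ## Population quantities and assumptions -/

/-- The population functions: regression function `m`, marginal density `f`, joint densities
`f_p(u₁, …, u_p; c)`, conditional variance `σ²(x)`, conditional covariance `σ(u₁, u₂; c)`, and the
conditional fourth moments of the errors: `ς²(x)` for `E[e_j⁴ | 𝐗_g]`, and, one function for each
remaining pattern of indices that occurs in products of two pairs, `ς` for
`E[e_j² e_l² | 𝐗_g]`, `E[e_j² e_l e_t | 𝐗_g]` and `E[e_j e_l e_t e_s | 𝐗_g]`. -/
structure Population (dI dC : ℕ) where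
  m : RegSpace dI dC → ℝ
  f : RegSpace dI dC → ℝ
  fJoint : (p : ℕ) → JointSpace p dI dC → ℝ
  sigmaSq : RegSpace dI dC → ℝ
  sigmaCov : JointSpace 2 dI dC → ℝ
  fourth : RegSpace dI dC → ℝ
  fourthTwo : JointSpace 2 dI dC → ℝ
  fourthThree : JointSpace 3 dI dC → ℝ
  fourthFour : JointSpace 4 dI dC → ℝ

/-- `E[Z | m] = φ` almost surely. When `Z` is integrable this is the usual statement
`P[Z | m] =ᵐ[P] φ`; in general it is only asked that `Ω` is a countable union of sets of `m` on
which `Z` is integrable, and that the identity holds on each of them. -/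
def HasCondExp {Ω : Type*} [MeasurableSpace Ω] (P : Measure Ω) (m : MeasurableSpace Ω)
    (Z φ : Ω → ℝ) : Prop :=
  ∃ A : ℕ → Set Ω, (∀ i, MeasurableSet[m] (A i)) ∧ (⋃ i, A i) = Set.univ ∧
    ∀ i, IntegrableOn Z (A i) P ∧ P[(A i).indicator Z | m] =ᵐ[P] (A i).indicator φ

/-- The data-generating process of one sample. Conditional expectations given `𝐗_g` that are
functions of some of the regressors only are automatically the conditional expectations given
those regressors. -/
structure IsGenerated {Ω : Type*} [MeasurableSpace Ω] (P : Measure Ω)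
    (S : ClusterSample dI dC Ω) (pop : Population dI dC) : Prop where
  /-- Different clusters are mutually independent. -/
  indep : iIndepFun (fun (g : Fin S.G) ω =>
    ((fun j => S.Y g j ω, fun j => S.X g j ω) :
      (Fin (S.size g) → ℝ) × (Fin (S.size g) → RegSpace dI dC))) P
  /-- `E[e_{gj} | 𝐗_g] = 0`. -/
  mean_zero : ∀ g j, HasCondExp P (S.sigmaX g) (S.err pop.m g j) (fun _ => 0)
  /-- `E[e_{gj}² | 𝐗_g] = σ²(X_{gj})`. -/
  variance : ∀ g j, HasCondExp P (S.sigmaX g) (fun ω => S.err pop.m g j ω ^ 2)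
    (fun ω => pop.sigmaSq (S.X g j ω))
  /-- `E[e_{gj} e_{gl} | 𝐗_g] = σ(X_{gj}^{ind}, X_{gl}^{ind}; X_g^{cls})` for `j ≠ l`. -/
  covariance : ∀ g j l, j ≠ l →
    HasCondExp P (S.sigmaX g) (fun ω => S.err pop.m g j ω * S.err pop.m g l ω)
      (fun ω => pop.sigmaCov (S.joint g ![j, l] ω))
  /-- All `X_{gj}` have the density `f`. -/
  density : ∀ g j, P.map (S.X g j) = volume.withDensity (fun y => ENNReal.ofReal (pop.f y))
  /-- For `2 ≤ p ≤ 8`, `p` distinct members of a cluster have the joint density `f_p`. -/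
  joint_density : ∀ p : ℕ, 2 ≤ p → p ≤ 8 → ∀ g (j : Fin p → Fin (S.size g)),
    Function.Injective j →
      P.map (S.joint g j) = volume.withDensity (fun z => ENNReal.ofReal (pop.fJoint p z))
  /-- `E[e_{gj}⁴ | 𝐗_g] = ς²(X_{gj})`. -/
  fourth : ∀ g j, HasCondExp P (S.sigmaX g) (fun ω => S.err pop.m g j ω ^ 4)
    (fun ω => pop.fourth (S.X g j ω))
  fourth_two : ∀ g j l, j ≠ l →
    HasCondExp P (S.sigmaX g) (fun ω => S.err pop.m g j ω ^ 2 * S.err pop.m g l ω ^ 2)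
      (fun ω => pop.fourthTwo (S.joint g ![j, l] ω))
  fourth_three : ∀ g j l t, j ≠ l → j ≠ t → l ≠ t →
    HasCondExp P (S.sigmaX g)
      (fun ω => S.err pop.m g j ω ^ 2 * S.err pop.m g l ω * S.err pop.m g t ω)
      (fun ω => pop.fourthThree (S.joint g ![j, l, t] ω))
  fourth_four : ∀ g j l t s, j ≠ l → j ≠ t → j ≠ s → l ≠ t → l ≠ s → t ≠ s →
    HasCondExp P (S.sigmaX g)
      (fun ω => S.err pop.m g j ω * S.err pop.m g l ω * S.err pop.m g t ω * S.err pop.m g s ω)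
      (fun ω => pop.fourthFour (S.joint g ![j, l, t, s] ω))

/-- `φ` has continuous derivatives up to order `k`, all bounded, and the `k`-th derivative is
uniformly continuous. -/
structure UnifSmooth {E : Type*} [NormedAddCommGroup E] [NormedSpace ℝ E] (k : ℕ)
    (φ : E → ℝ) : Prop where
  contDiff : ContDiff ℝ k φ
  bounded : ∀ i ≤ k, ∃ C : ℝ, ∀ y, ‖iteratedFDeriv ℝ i φ y‖ ≤ C
  unifCont : UniformContinuous (iteratedFDeriv ℝ k φ)

/-- Uniform smoothness of the population functions; `f` and the `f_p` are nonnegative, as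
densities are. -/
structure UnifRegular (pop : Population dI dC) : Prop where
  m : UnifSmooth 2 pop.m
  f : UnifSmooth 2 pop.f
  fTwo : UnifSmooth 1 (pop.fJoint 2)
  fThree : UnifSmooth 0 (pop.fJoint 3)
  fFour : UnifSmooth 0 (pop.fJoint 4)
  sigmaSq : UnifSmooth 0 pop.sigmaSq
  sigmaCov : UnifSmooth 0 pop.sigmaCov
  f_nonneg : ∀ y, 0 ≤ pop.f y
  fJoint_nonneg : ∀ p, 2 ≤ p → p ≤ 8 → ∀ z, 0 ≤ pop.fJoint p z

/-- Additional smoothness on a set `N` (a neighbourhood of the evaluation point). -/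
structure LocallyRegular (pop : Population dI dC) (N : Set (RegSpace dI dC)) : Prop where
  sigmaSq : ContDiffOn ℝ 2 pop.sigmaSq N
  sigmaCov : ContDiffOn ℝ 2 pop.sigmaCov (jointNbhd 2 N)
  fTwo : ContDiffOn ℝ 2 (pop.fJoint 2) (jointNbhd 2 N)
  fThree : ContDiffOn ℝ 1 (pop.fJoint 3) (jointNbhd 3 N)
  fFour : ContDiffOn ℝ 1 (pop.fJoint 4) (jointNbhd 4 N)
  fHigher : ∀ p, 5 ≤ p → p ≤ 8 → ContinuousOn (pop.fJoint p) (jointNbhd p N)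
  fourth : ContinuousOn pop.fourth N
  fourthTwo : ContinuousOn pop.fourthTwo (jointNbhd 2 N)
  fourthThree : ContinuousOn pop.fourthThree (jointNbhd 3 N)
  fourthFour : ContinuousOn pop.fourthFour (jointNbhd 4 N)

/-- The product kernel on `ℝ^d` vanishes outside a ball and is Lipschitz. -/
structure IsLipschitzCompact (dI dC : ℕ) (k : ℝ → ℝ) : Prop where
  compact : ∃ L : ℝ, 0 < L ∧ ∀ u : RegSpace dI dC, L < ‖u‖ → prodKernel k u = 0
  lipschitz : ∃ Λ : ℝ≥0, LipschitzWith Λ (fun u : RegSpace dI dC => prodKernel k u)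

section Sequences

variable {Ω : ℕ → Type*} [∀ ν, MeasurableSpace (Ω ν)]

/-- Rates for the bandwidths `h` and `b`, relative to the cluster sizes; `lam` is the limit of
`(n⁻¹ ∑ n_g²) h^{dI}`. -/
structure BandwidthRates (S : ∀ ν, ClusterSample dI dC (Ω ν)) (h b : ℕ → ℝ) (lam : ℝ) :
    Prop where
  h_pos : ∀ ν, 0 < h ν
  b_pos : ∀ ν, 0 < b ν
  h_zero : Tendsto h atTop (𝓝 0)
  nh_top : Tendsto (fun ν => ((S ν).n : ℝ) * h ν ^ (dI + dC)) atTop atTop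
  maxSize_h : (fun ν => ((S ν).maxSize : ℝ) * h ν ^ dI) =O[atTop] fun _ => (1 : ℝ)
  lambda : Tendsto (fun ν => (S ν).lambdaHat (h ν)) atTop (𝓝 lam)
  /-- `n h^{d+4} = O(1)`. -/
  nh_bias : (fun ν => ((S ν).n : ℝ) * h ν ^ (dI + dC + 4)) =O[atTop] fun _ => (1 : ℝ)
  maxSize_four : Tendsto (fun ν => ((S ν).maxSize : ℝ) ^ 4 / (S ν).n) atTop (𝓝 0)
  b_zero : Tendsto b atTop (𝓝 0)
  Nb_top : Tendsto (fun ν => ((S ν).pairCount : ℝ) * b ν ^ (2 * dI + dC)) atTop atTop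
  maxSize_b : (fun ν => ((S ν).maxSize : ℝ) ^ 2 * b ν ^ (2 * dI)) =O[atTop] fun _ => (1 : ℝ)

/-- For some `r ≥ 2`: a bound on `E[|e|^{2r} | X = y]` for `y` in a neighbourhood of `x`, and two
rate conditions. -/
def MomentCondition (P : ∀ ν, Measure (Ω ν)) (S : ∀ ν, ClusterSample dI dC (Ω ν))
    (pop : Population dI dC) (h : ℕ → ℝ) (x : RegSpace dI dC) : Prop :=
  ∃ r : ℝ, 2 ≤ r ∧
    -- `E[|e|^{2r} | X = y] ≤ v²` for almost every `y ∈ N`, in integrated form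
    (∃ N : Set (RegSpace dI dC), IsOpen N ∧ x ∈ N ∧ ∃ v : ℝ≥0, ∀ ν g j,
      ∀ A : Set (RegSpace dI dC), MeasurableSet A → A ⊆ N →
        ∫⁻ ω in (S ν).X g j ⁻¹' A, ‖(S ν).err pop.m g j ω‖ₑ ^ (2 * r) ∂(P ν) ≤
          (v : ℝ≥0∞) ^ 2 * P ν ((S ν).X g j ⁻¹' A)) ∧
    (∃ C : ℝ, ∀ ν,
      (∑ g, ((S ν).size g : ℝ) ^ r) ^ (1 / r) / ((S ν).n : ℝ) ^ (1 / 4 : ℝ) ≤ C) ∧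
    (fun ν => 1 / (((S ν).n : ℝ) ^ (r / 2) * h ν ^ (((dI + dC : ℕ) : ℝ) * r - (dI + dC : ℕ))))
      =O[atTop] fun _ => (1 : ℝ)

/-- For some `s > 2` (`s = ∞` meaning bounded `Y`): uniformly bounded `s`-th moments of `Y`, a
uniform bound on `E[|Y|^s | X = y] f(y)`, and
`(max n_g)² log n / (n^{1 - 2/s} h^d) = O(1)`. -/
def OutcomeCondition (P : ∀ ν, Measure (Ω ν)) (S : ∀ ν, ClusterSample dI dC (Ω ν))
    (h : ℕ → ℝ) : Prop :=
  ∃ s : ℝ≥0∞, 2 < s ∧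
    (∃ B₁ : ℝ≥0, ∀ ν g j, eLpNorm ((S ν).Y g j) s (P ν) ≤ B₁) ∧
    -- `E[|Y|^s | X = y] f(y) ≤ B₂` for almost every `y`, in integrated form
    (s ≠ ∞ → ∃ B₂ : ℝ≥0, ∀ ν g j, ∀ A : Set (RegSpace dI dC), MeasurableSet A →
      ∫⁻ ω in (S ν).X g j ⁻¹' A, ‖(S ν).Y g j ω‖ₑ ^ s.toReal ∂(P ν) ≤ B₂ * volume A) ∧
    (fun ν => ((S ν).maxSize : ℝ) ^ 2 * Real.log (S ν).n /
      (((S ν).n : ℝ) ^ (1 - (2 / s).toReal) * h ν ^ (dI + dC))) =O[atTop] fun _ => (1 : ℝ)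

/-- `c_n = O((max n_g)^{2/d} (log n)^{1/d})`. -/
def RadiusRate (S : ∀ ν, ClusterSample dI dC (Ω ν)) (c : ℕ → ℝ) : Prop :=
  c =O[atTop] fun ν => ((S ν).maxSize : ℝ) ^ (2 / ((dI + dC : ℕ) : ℝ)) *
    Real.log (S ν).n ^ (1 / ((dI + dC : ℕ) : ℝ))

/-- `δ_n = inf_{‖y‖ ≤ c} f(y)`. -/
def densityInf (f : RegSpace dI dC → ℝ) (c : ℝ) : ℝ := sInf (f '' Metric.closedBall 0 c)

/-- There is a sequence `c_n` of the above order with `δ_n > 0` and `δ_n⁻¹ (a_n + h²) = o(1)`,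
where `a_n = (log n / (n h^d))^{1/2}`. -/
def DensityFloor (S : ∀ ν, ClusterSample dI dC (Ω ν)) (pop : Population dI dC) (h : ℕ → ℝ) :
    Prop :=
  ∃ c : ℕ → ℝ, RadiusRate S c ∧ (∀ ν, 0 < densityInf pop.f (c ν)) ∧
    Tendsto (fun ν => (densityInf pop.f (c ν))⁻¹ *
      (Real.sqrt (Real.log (S ν).n / ((S ν).n * h ν ^ (dI + dC))) + h ν ^ 2)) atTop (𝓝 0)

/-- There is a sequence `c_n` of the above order such that `‖X_{gj}‖ ≤ c_n` with probability
approaching one, for every `g` and `j`. -/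
def RegressorTail (P : ∀ ν, Measure (Ω ν)) (S : ∀ ν, ClusterSample dI dC (Ω ν)) : Prop :=
  ∃ c : ℕ → ℝ, RadiusRate S c ∧ ∀ ε : ℝ≥0, 0 < ε → ∀ᶠ ν in atTop, ∀ g j,
    P ν {ω | c ν < ‖(S ν).X g j ω‖} ≤ ε

end Sequences

end ClusterKernel

end

open ClusterKernel

/-! Write a = n h^d and let Z be the sum of K((X_i - x)/h) e_i over all observations. The intercept
row of the normal equations of the local fit says that √a f̂(x) (m̂(x) - m(x)) equals a^{-1/2} Z,
plus a^{-1/2} times the kernel-weighted sum of the part of m that the fit does not reproduce, minus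
√a times a combination of the slopes. The second sum concentrates at √a h² B(x) f(x). The slope term
is absent for Nadaraya–Watson; for the local linear fit it is O_p(1) times the first empirical
moments of the kernel, which tend to 0 because the kernel is even (`eventually_linearization`,
`tendsto_localSum`, `tendsto_linearization`). What remains is a central limit theorem for Z,
consistency of the variance estimator, and Slutsky's lemma (`tendsto_studentized_sub`).

Clusters are independent, so Z is a sum of independent centred terms, one per cluster, and
Lyapunov's condition with fourth moments gives normality (`tendstoInDistribution_of_lyapunov`,
`tendstoInDistribution_of_kernErr`). In the variance, the diagonal terms contribute R_k^d f σ². Two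
different members of a cluster share the cluster-level regressor: their individual-level kernels
integrate to 1, while the shared kernel appears squared and gives R_k^{dC}. The number of such
ordered pairs times h^{2dI+dC} is a(λ̂ - h^{dI}), which produces the λ term (`integral_kernErr_sq`,
`tendsto_sum_integral_kernErr_sq`).

All moment bounds rest on one random variable, the number of members of a cluster within r of a
point. Its p-th factorial moment, p ≤ 4, is at most a constant times n_g^p r^{p dI + dC}, because p
members close to a point pay for the shared coordinates only once. As max n_g h^{dI} is bounded, the
second and fourth moments of the count are O(n_g h^d), the order of its mean bound
(`lintegral_descFactorial_le`, `lintegral_card_sq_le`, `lintegral_card_four_le`). Conditional moment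
bounds of the errors given the regressors then control sums of errors over a cluster.

The variance estimators use residuals, that is, m̂ at the random points X_gj, but only at points
near x. No uniform rate for m̂ is needed. If the local design at y is coercive, the normal equations
bound the squared estimation error at y by kernel sums of errors around y and a count
(`sq_sum_abs_le_of_coercive`, `exists_coefficients`, `errBound`). Coercivity holds for all y near x
simultaneously: d + 1 small balls around y each contain a fixed fraction of n h^d observations, by
an exponential lower tail bound and a union over a grid of O(n) points, using log n/(n h^d) → 0
(`measure_exists_card_near_le`, `eventually_card_near`). To integrate the bound at y = X_gj, the sum
is split into the clusters other than g, which are independent of cluster g so that y can be frozen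
(`lintegral_others_le`), and cluster g itself, whose crude contribution is negligible by the rate
condition on max n_g. Hence residuals may be replaced by errors (`tendsto_resid_sub_err`), and
Chebyshev's inequality over clusters gives consistency (`tendsto_varHat`).

Convergence in probability to a constant is expressed as convergence along one filter, `probFilter`,
so that Slutsky arguments become ordinary limit algebra. -/

namespace ClusterKernel

/-! ## Convergence in probability along a sequence of probability spaces -/

section ProbFilter

variable {Ω : ℕ → Type*} [∀ ν, MeasurableSpace (Ω ν)]

/-- The filter of events whose probability tends to one. Convergence in probability to a constant
is convergence along this filter. -/
def probFilter (P : ∀ ν, Measure (Ω ν)) : Filter (Σ ν, Ω ν) where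
  sets := {E | Tendsto (fun ν => P ν {ω | (⟨ν, ω⟩ : Σ ν, Ω ν) ∉ E}) atTop (𝓝 0)}
  univ_sets := by simp
  sets_of_superset {E F} hE hEF := tendsto_of_tendsto_of_tendsto_of_le_of_le tendsto_const_nhds hE
    (fun _ => zero_le) fun ν => measure_mono fun ω hω h => hω (hEF h)
  inter_sets {E F} hE hF := by
    have h := Tendsto.add hE hF
    rw [add_zero] at h
    refine tendsto_of_tendsto_of_tendsto_of_le_of_le tendsto_const_nhds h
      (fun _ => zero_le) fun ν => (measure_mono fun ω hω => ?_).trans (measure_union_le _ _)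
    simp only [Set.mem_ofPred_eq, Set.mem_inter_iff, not_and_or] at hω
    exact hω

variable {P : ∀ ν, Measure (Ω ν)}

/-- The sets need not be measurable: `P ν` acts as an outer measure. This allows events quantified
over uncountably many evaluation points. -/
lemma eventually_probFilter {q : (Σ ν, Ω ν) → Prop} :
    (∀ᶠ p in probFilter P, q p) ↔ Tendsto (fun ν => P ν {ω | ¬ q ⟨ν, ω⟩}) atTop (𝓝 0) := Iff.rfl

lemma tendsto_fst_probFilter : Tendsto Sigma.fst (probFilter P) atTop := by
  intro E hE
  refine eventually_probFilter.2 (tendsto_const_nhds.congr' ?_)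
  filter_upwards [hE] with ν hν
  simp [Set.mem_preimage.1 hν]

lemma eventually_fst {q : ℕ → Prop} (h : ∀ᶠ ν in atTop, q ν) :
    ∀ᶠ p in probFilter P, q p.1 := tendsto_fst_probFilter.eventually h

lemma tendsto_fst_comp {β : Type*} {a : ℕ → β} {l : Filter β} (h : Tendsto a atTop l) :
    Tendsto (fun p : Σ ν, Ω ν => a p.1) (probFilter P) l := h.comp tendsto_fst_probFilter

/-- Convergence in mean to zero implies convergence in probability. -/
lemma tendsto_probFilter_of_lintegral {X : ∀ ν, Ω ν → ℝ} {c : ℕ → ℝ≥0∞}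
    (hX : ∀ ν, Measurable (X ν)) (h0 : ∀ᶠ ν in atTop, ∀ ω, 0 ≤ X ν ω)
    (hle : ∀ᶠ ν in atTop, ∫⁻ ω, ENNReal.ofReal (X ν ω) ∂(P ν) ≤ c ν)
    (hc : Tendsto c atTop (𝓝 0)) :
    Tendsto (fun p : Σ ν, Ω ν => X p.1 p.2) (probFilter P) (𝓝 0) := by
  rw [Metric.tendsto_nhds]
  intro ε hε
  refine eventually_probFilter.2 ?_
  have hlim : Tendsto (fun ν => c ν / ENNReal.ofReal ε) atTop (𝓝 0) := by
    have := ENNReal.Tendsto.div_const hc (b := ENNReal.ofReal ε) (Or.inr (by simpa using hε))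
    simpa using this
  refine tendsto_of_tendsto_of_tendsto_of_le_of_le' tendsto_const_nhds hlim
    (Eventually.of_forall fun _ => zero_le) ?_
  filter_upwards [h0, hle] with ν h1 h2
  calc P ν {ω | ¬ dist (X ν ω) 0 < ε}
      ≤ P ν {ω | ENNReal.ofReal ε ≤ ENNReal.ofReal (X ν ω)} := by
        refine measure_mono fun ω hω => ?_
        simp only [Set.mem_ofPred_eq, not_lt, Real.dist_eq, sub_zero, abs_of_nonneg (h1 ω)] at hω
        exact ENNReal.ofReal_le_ofReal hω
    _ ≤ (∫⁻ ω, ENNReal.ofReal (X ν ω) ∂(P ν)) / ENNReal.ofReal ε :=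
        meas_ge_le_lintegral_div (hX ν).ennreal_ofReal.aemeasurable (by simpa using hε) (by simp)
    _ ≤ _ := by gcongr

/-- The product of a sequence bounded in mean square with a sequence tending to zero in
probability tends to zero in probability. -/
lemma tendsto_mul_probFilter {Z A : ∀ ν, Ω ν → ℝ} {C : ℝ}
    (hZ : ∀ ν, Measurable (Z ν))
    (hle : ∀ᶠ ν in atTop, ∫⁻ ω, ENNReal.ofReal (Z ν ω ^ 2) ∂(P ν) ≤ ENNReal.ofReal C)
    (hA : Tendsto (fun p : Σ ν, Ω ν => A p.1 p.2) (probFilter P) (𝓝 0)) :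
    Tendsto (fun p : Σ ν, Ω ν => Z p.1 p.2 * A p.1 p.2) (probFilter P) (𝓝 0) := by
  rw [Metric.tendsto_nhds]
  intro ε hε
  refine eventually_probFilter.2 (ENNReal.tendsto_nhds_zero.2 fun δ hδ => ?_)
  -- Truncation level: by Chebyshev, |Z| reaches K with probability at most δ/2, and below K it
  -- suffices that |A| < ε/K.
  obtain ⟨K, hK0, hK⟩ : ∃ K : ℝ, 0 < K ∧ ENNReal.ofReal C / ENNReal.ofReal (K ^ 2) ≤ δ / 2 := by
    have : Tendsto (fun K : ℝ => ENNReal.ofReal C / ENNReal.ofReal (K ^ 2)) atTop (𝓝 0) := by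
      have h1 : Tendsto (fun K : ℝ => ENNReal.ofReal (K ^ 2)) atTop (𝓝 ∞) :=
        ENNReal.tendsto_ofReal_atTop.comp (tendsto_pow_atTop two_ne_zero)
      have := ENNReal.Tendsto.const_div h1 (a := ENNReal.ofReal C) (Or.inr ENNReal.ofReal_ne_top)
      simpa using this
    have h2 := (ENNReal.tendsto_nhds_zero.1 this (δ / 2) (by simpa using hδ.ne')).and
      (eventually_gt_atTop 0)
    obtain ⟨K, hK1, hK2⟩ := h2.exists
    exact ⟨K, hK2, hK1⟩
  have hA' := eventually_probFilter.1 ((Metric.tendsto_nhds.1 hA) (ε / K) (by positivity))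
  have hA'' := ENNReal.tendsto_nhds_zero.1 hA' (δ / 2) (by simpa using hδ.ne')
  filter_upwards [hle, hA''] with ν h1 h2
  calc P ν {ω | ¬ dist (Z ν ω * A ν ω) 0 < ε}
      ≤ P ν ({ω | ENNReal.ofReal (K ^ 2) ≤ ENNReal.ofReal (Z ν ω ^ 2)} ∪
          {ω | ¬ dist (A ν ω) 0 < ε / K}) := by
        refine measure_mono fun ω hω => ?_
        by_contra hcon
        simp only [Set.mem_union, Set.mem_ofPred_eq, not_or, not_not, Real.dist_eq, sub_zero,
          not_le] at hcon hω
        refine hω ?_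
        have h3 := ENNReal.lt_ofReal_iff_toReal_lt (ENNReal.ofReal_ne_top) |>.1 hcon.1
        rw [ENNReal.toReal_ofReal (sq_nonneg _)] at h3
        have h4 : |Z ν ω| < K := abs_lt_of_sq_lt_sq h3 hK0.le
        rw [abs_mul]
        calc |Z ν ω| * |A ν ω| ≤ K * |A ν ω| := by gcongr
          _ < K * (ε / K) := by gcongr; exact hcon.2
          _ = ε := by field_simp
    _ ≤ _ := measure_union_le _ _
    _ ≤ δ / 2 + δ / 2 := by
        refine add_le_add (le_trans ?_ hK) h2
        refine (meas_ge_le_lintegral_div ((hZ ν).pow_const 2).ennreal_ofReal.aemeasurable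
          (by simpa using hK0.ne') (by simp)).trans ?_
        gcongr
    _ = δ := ENNReal.add_halves δ

end ProbFilter

/-! ## Sums of independent random variables -/

section SecondMoment

variable {Ω : Type*} [MeasurableSpace Ω] {P : Measure Ω}

lemma lintegral_ofReal_sq_eq {X : Ω → ℝ} (hX : MemLp X 2 P) :
    ∫⁻ ω, ENNReal.ofReal (X ω ^ 2) ∂P = ENNReal.ofReal (∫ ω, X ω ^ 2 ∂P) :=
  (ofReal_integral_eq_lintegral_ofReal hX.integrable_sq (ae_of_all _ fun _ => sq_nonneg _)).symm

lemma memLp_two_of_lintegral {X : Ω → ℝ} (hX : Measurable X)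
    (h : ∫⁻ ω, ENNReal.ofReal (X ω ^ 2) ∂P < ∞) : MemLp X 2 P := by
  refine (memLp_two_iff_integrable_sq hX.aestronglyMeasurable).2
    ⟨(hX.pow_const 2).aestronglyMeasurable, ?_⟩
  rw [hasFiniteIntegral_iff_ofReal (ae_of_all _ fun _ => sq_nonneg _)]
  exact h

end SecondMoment

section Independent

variable {Ω : Type*} [MeasurableSpace Ω] {P : Measure Ω} [IsProbabilityMeasure P]
  {ι : Type*}

/-- Second moment of a centred sum of independent random variables. -/
lemma lintegral_sq_sum_sub_le {T : ι → Ω → ℝ} (s : Finset ι)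
    (hT : ∀ i ∈ s, MemLp (T i) 2 P) (hind : iIndepFun T P) :
    ∫⁻ ω, ENNReal.ofReal ((∑ i ∈ s, T i ω - ∑ i ∈ s, ∫ ω, T i ω ∂P) ^ 2) ∂P ≤
      ∑ i ∈ s, ∫⁻ ω, ENNReal.ofReal (T i ω ^ 2) ∂P := by
  have hsum : MemLp (∑ i ∈ s, T i) 2 P := memLp_finsetSum' s hT
  have hvar : Var[∑ i ∈ s, T i; P] = ∑ i ∈ s, Var[T i; P] :=
    IndepFun.variance_sum hT fun i _ j _ hij => hind.indepFun hij
  have hmean : P[∑ i ∈ s, T i] = ∑ i ∈ s, ∫ ω, T i ω ∂P := by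
    simp only [Finset.sum_apply]
    exact integral_finsetSum s fun i hi => (hT i hi).integrable (by norm_num)
  have heq : (fun ω => (∑ i ∈ s, T i ω - ∑ i ∈ s, ∫ ω, T i ω ∂P)) =
      fun ω => (∑ i ∈ s, T i) ω - P[∑ i ∈ s, T i] := by
    rw [hmean]; ext ω; simp
  have h2 : MemLp (fun ω => (∑ i ∈ s, T i ω - ∑ i ∈ s, ∫ ω, T i ω ∂P)) 2 P := by
    rw [heq]; exact hsum.sub (memLp_const _)
  rw [lintegral_ofReal_sq_eq h2]
  have h3 : ∫ ω, (∑ i ∈ s, T i ω - ∑ i ∈ s, ∫ ω, T i ω ∂P) ^ 2 ∂P = Var[∑ i ∈ s, T i; P] := by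
    rw [variance_eq_integral hsum.aemeasurable]
    exact integral_congr_ae (ae_of_all _ fun ω => by
      have := congrFun heq ω
      simp only at this ⊢
      rw [this])
  rw [h3, hvar, ENNReal.ofReal_sum_of_nonneg fun i _ => variance_nonneg _ _]
  refine Finset.sum_le_sum fun i hi => ?_
  rw [lintegral_ofReal_sq_eq (hT i hi)]
  exact ENNReal.ofReal_le_ofReal (variance_le_expectation_sq (hT i hi).aestronglyMeasurable)

/-- Lower tail bound for sums of independent nonnegative random variables. -/
lemma measure_sum_le_half [Fintype ι] {T : ι → Ω → ℝ} (hTm : ∀ i, Measurable (T i))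
    (h0 : ∀ i ω, 0 ≤ T i ω) (hT : ∀ i, MemLp (T i) 2 P) (hind : iIndepFun T P)
    {a c C : ℝ} (hc : 0 < c) (hC : 0 < C)
    (hmean : c * a ≤ ∑ i, ∫ ω, T i ω ∂P) (hsq : ∑ i, ∫ ω, T i ω ^ 2 ∂P ≤ C * a) :
    P {ω | ∑ i, T i ω ≤ c * a / 2} ≤ ENNReal.ofReal (Real.exp (-(c ^ 2 / (8 * C) * a))) := by
  -- The Chernoff exponent is (-s c/2 + s² C/2) a, and this s minimizes it, with value -c² a/(8C).
  set s : ℝ := c / (2 * C) with hs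
  have hs0 : 0 < s := by positivity
  have hexp_int : ∀ i, Integrable (fun ω => Real.exp (-s * T i ω)) P := fun i =>
    Integrable.of_bound ((hTm i).const_mul (-s)).exp.aestronglyMeasurable 1
      (ae_of_all _ fun ω => by
        rw [Real.norm_eq_abs, Real.abs_exp, Real.exp_le_one_iff]
        have := h0 i ω
        nlinarith)
  have hmgf : ∀ i, mgf (T i) P (-s) ≤
      Real.exp (-s * ∫ ω, T i ω ∂P + s ^ 2 / 2 * ∫ ω, T i ω ^ 2 ∂P) := by
    intro i
    have hi1 : Integrable (T i) P := (hT i).integrable (by norm_num)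
    have hi2 : Integrable (fun ω => T i ω ^ 2) P := (hT i).integrable_sq
    have hle : mgf (T i) P (-s) ≤ ∫ ω, (1 + (-s * T i ω) + s ^ 2 / 2 * T i ω ^ 2) ∂P := by
      refine integral_mono (hexp_int i)
        (((integrable_const _).add (hi1.const_mul _)).add (hi2.const_mul _)) fun ω => ?_
      have hx : 0 ≤ s * T i ω := mul_nonneg hs0.le (h0 i ω)
      have key : Real.exp (-(s * T i ω)) ≤ 1 - s * T i ω + (s * T i ω) ^ 2 / 2 := by
        -- Since (1 + y + y²/2)(1 - y + y²/2) = 1 + y⁴/4 ≥ 1, the lower bound for exp y inverts to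
        -- exp(-y) ≤ 1 - y + y²/2. Only second moments of T enter, no upper bound on T.
        have h1 := Real.quadratic_le_exp_of_nonneg hx
        set y := s * T i ω
        rw [Real.exp_neg]
        have hpos : 0 < 1 + y + y ^ 2 / 2 := by positivity
        calc (Real.exp y)⁻¹ ≤ (1 + y + y ^ 2 / 2)⁻¹ := by gcongr
          _ ≤ 1 - y + y ^ 2 / 2 := by
            rw [inv_le_iff_one_le_mul₀ hpos]
            nlinarith [sq_nonneg (y ^ 2)]
      have e1 : -s * T i ω = -(s * T i ω) := by ring
      simp only [e1]
      refine key.trans (le_of_eq ?_)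
      ring
    have heq : ∫ ω, (1 + (-s * T i ω) + s ^ 2 / 2 * T i ω ^ 2) ∂P =
        1 + (-s * ∫ ω, T i ω ∂P) + s ^ 2 / 2 * ∫ ω, T i ω ^ 2 ∂P := by
      rw [integral_add (f := fun ω => 1 + (-s * T i ω)) ((integrable_const _).add
        (hi1.const_mul _)) (hi2.const_mul _), integral_add (integrable_const _)
        (hi1.const_mul _), integral_const_mul, integral_const_mul]
      simp
    rw [heq] at hle
    refine hle.trans ?_
    have := Real.add_one_le_exp (-s * ∫ ω, T i ω ∂P + s ^ 2 / 2 * ∫ ω, T i ω ^ 2 ∂P)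
    linarith
  have hsumint : Integrable (fun ω => Real.exp (-s * (∑ i, T i) ω)) P := by
    refine Integrable.of_bound ?_ 1 (ae_of_all _ fun ω => ?_)
    · have : Measurable (fun ω => (∑ i, T i) ω) := by
        simp only [Finset.sum_apply]
        exact Finset.measurable_sum _ fun i _ => hTm i
      exact (this.const_mul (-s)).exp.aestronglyMeasurable
    · rw [Real.norm_eq_abs, Real.abs_exp, Real.exp_le_one_iff, Finset.sum_apply]
      have := Finset.sum_nonneg fun i (_ : i ∈ Finset.univ) => h0 i ω
      nlinarith
  have hch := measure_le_le_exp_mul_mgf (μ := P) (X := ∑ i, T i) (c * a / 2)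
    (neg_nonpos.2 hs0.le) hsumint
  rw [hind.mgf_sum (fun i => hTm i)] at hch
  have hprod : ∏ i, mgf (T i) P (-s) ≤ Real.exp (-s * (c * a) + s ^ 2 / 2 * (C * a)) := by
    calc ∏ i, mgf (T i) P (-s)
        ≤ ∏ i, Real.exp (-s * ∫ ω, T i ω ∂P + s ^ 2 / 2 * ∫ ω, T i ω ^ 2 ∂P) :=
          Finset.prod_le_prod (fun i _ => mgf_nonneg) fun i _ => hmgf i
      _ = Real.exp (-s * ∑ i, ∫ ω, T i ω ∂P + s ^ 2 / 2 * ∑ i, ∫ ω, T i ω ^ 2 ∂P) := by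
          rw [← Real.exp_sum, Finset.sum_add_distrib, Finset.mul_sum, Finset.mul_sum]
      _ ≤ _ := by
          apply Real.exp_le_exp.2
          have h1 : s * (c * a) ≤ s * ∑ i, ∫ ω, T i ω ∂P := by gcongr
          have h2 : s ^ 2 / 2 * ∑ i, ∫ ω, T i ω ^ 2 ∂P ≤ s ^ 2 / 2 * (C * a) := by gcongr
          linarith
  have hfin : P.real {ω | (∑ i, T i) ω ≤ c * a / 2} ≤ Real.exp (-(c ^ 2 / (8 * C) * a)) := by
    refine hch.trans ((mul_le_mul_of_nonneg_left hprod (Real.exp_pos _).le).trans ?_)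
    rw [← Real.exp_add]
    apply Real.exp_le_exp.2
    rw [hs]
    apply le_of_eq
    field_simp
    ring
  have : P {ω | ∑ i, T i ω ≤ c * a / 2} = P {ω | (∑ i, T i) ω ≤ c * a / 2} := by
    simp only [Finset.sum_apply]
  rw [this, ← ofReal_measureReal]
  exact ENNReal.ofReal_le_ofReal hfin

/-- Integration against independent data: a bound that holds for frozen values of the first
argument can be integrated. -/
lemma lintegral_indep_le {α β : Type*} [MeasurableSpace α] [MeasurableSpace β] {A : Ω → α}
    {B : Ω → β} (hA : Measurable A) (hB : Measurable B) (hAB : IndepFun A B P)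
    {H : α × β → ℝ≥0∞} (hH : Measurable H) {ψ : α → ℝ≥0∞} (hψ : Measurable ψ)
    (hle : ∀ a, ∫⁻ ω, H (a, B ω) ∂P ≤ ψ a) :
    ∫⁻ ω, H (A ω, B ω) ∂P ≤ ∫⁻ ω, ψ (A ω) ∂P := by
  have h1 : ∫⁻ ω, H (A ω, B ω) ∂P = ∫⁻ z, H z ∂(P.map fun ω => (A ω, B ω)) :=
    (lintegral_map hH (hA.prodMk hB)).symm
  rw [h1, (indepFun_iff_map_prod_eq_prod_map_map hA.aemeasurable hB.aemeasurable).1 hAB,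
    lintegral_prod _ hH.aemeasurable, ← lintegral_map hψ hA]
  refine lintegral_mono fun a => ?_
  rw [lintegral_map (f := fun b => H (a, b)) (hH.comp measurable_prodMk_left) hB]
  exact hle a

end Independent

end ClusterKernel

namespace ClusterKernel

/-! ## A central limit theorem for triangular arrays -/

/-- Taylor's formula for |x| ≤ 1 and the triangle inequality otherwise, where all lower powers of
|x| are at most |x|³. The constant 4 is not sharp. -/
lemma norm_exp_mul_I_sub_le (x : ℝ) :
    ‖Complex.exp (x * Complex.I) - (1 + x * Complex.I - x ^ 2 / 2)‖ ≤ 4 * |x| ^ 3 := by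
  have hn : ‖(x * Complex.I : ℂ)‖ = |x| := by simp
  rcases le_or_gt |x| 1 with h | h
  · have h1 := Complex.exp_bound (x := x * Complex.I) (by rwa [hn]) (n := 3) (by norm_num)
    rw [hn] at h1
    have h2 : ∑ m ∈ Finset.range 3, (x * Complex.I : ℂ) ^ m / (m.factorial : ℂ) =
        1 + x * Complex.I - x ^ 2 / 2 := by
      simp only [Finset.sum_range_succ, Finset.sum_range_zero, Nat.factorial, mul_pow,
        Complex.I_sq]
      push_cast
      ring
    rw [h2] at h1
    refine h1.trans ?_
    have : (0 : ℝ) ≤ |x| ^ 3 := by positivity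
    norm_num [Nat.factorial]
    linarith
  · calc ‖Complex.exp (x * Complex.I) - (1 + x * Complex.I - x ^ 2 / 2)‖
        ≤ ‖Complex.exp (x * Complex.I)‖ + ‖(1 + x * Complex.I - x ^ 2 / 2 : ℂ)‖ := norm_sub_le _ _
      _ ≤ 1 + ((1 + |x|) + |x| ^ 2 / 2) := by
          rw [Complex.norm_exp_ofReal_mul_I]
          gcongr
          refine (norm_sub_le _ _).trans ?_
          gcongr
          · refine (norm_add_le _ _).trans ?_
            rw [hn]; simp
          · simp
      _ ≤ 4 * |x| ^ 3 := by
          have h2 : |x| ≤ |x| ^ 2 := by nlinarith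
          have h3 : |x| ^ 2 ≤ |x| ^ 3 := by nlinarith [sq_nonneg |x|]
          linarith

lemma abs_exp_neg_sub_le {y : ℝ} (hy : 0 ≤ y) : |Real.exp (-y) - (1 - y)| ≤ y ^ 2 := by
  rcases le_or_gt y 1 with h | h
  · have := Real.abs_exp_sub_one_sub_id_le (x := -y) (by rwa [abs_neg, abs_of_nonneg hy])
    calc |Real.exp (-y) - (1 - y)| = |Real.exp (-y) - 1 - -y| := by congr 1; ring
      _ ≤ (-y) ^ 2 := this
      _ = y ^ 2 := by ring
  · rw [abs_le]
    have h1 := Real.add_one_le_exp (-y)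
    have h2 : Real.exp (-y) ≤ 1 := Real.exp_le_one_iff.2 (by linarith)
    constructor <;> nlinarith

/-- Telescoping: the factors are exchanged one at a time, and the remaining factors have modulus at
most 1. -/
lemma norm_prod_sub_prod_le {ι : Type*} (s : Finset ι) {a b : ι → ℂ} (ha : ∀ i, ‖a i‖ ≤ 1)
    (hb : ∀ i, ‖b i‖ ≤ 1) : ‖∏ i ∈ s, a i - ∏ i ∈ s, b i‖ ≤ ∑ i ∈ s, ‖a i - b i‖ := by
  classical
  induction s using Finset.induction_on with
  | empty => simp
  | insert i s hi ih =>
    rw [Finset.prod_insert hi, Finset.prod_insert hi, Finset.sum_insert hi]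
    have hb' : ‖∏ j ∈ s, b j‖ ≤ 1 := by
      rw [norm_prod]
      exact Finset.prod_le_one (fun _ _ => norm_nonneg _) fun j _ => hb j
    calc ‖a i * ∏ j ∈ s, a j - b i * ∏ j ∈ s, b j‖
        = ‖a i * (∏ j ∈ s, a j - ∏ j ∈ s, b j) + (a i - b i) * ∏ j ∈ s, b j‖ := by
          congr 1; ring
      _ ≤ ‖a i‖ * ‖∏ j ∈ s, a j - ∏ j ∈ s, b j‖ + ‖a i - b i‖ * ‖∏ j ∈ s, b j‖ := by
          refine (norm_add_le _ _).trans ?_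
          rw [norm_mul, norm_mul]
      _ ≤ 1 * ‖∏ j ∈ s, a j - ∏ j ∈ s, b j‖ + ‖a i - b i‖ * 1 := by
          gcongr
          exact ha i
      _ ≤ _ := by rw [one_mul, mul_one, add_comm]; gcongr

section Lyapunov

variable {Ω : Type*} [MeasurableSpace Ω] {P : Measure Ω} [IsProbabilityMeasure P]
  {ι : Type*}

/-- For p ≤ 4 one has |T|^p ≤ 1 + T⁴ pointwise, and the measure is finite. -/
lemma integrable_pow_of_four {T : Ω → ℝ} (hT : Measurable T)
    (h4 : Integrable (fun ω => T ω ^ 4) P) {p : ℕ} (hp : p ≤ 4) :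
    Integrable (fun ω => |T ω| ^ p) P := by
  refine Integrable.mono' ((integrable_const (1 : ℝ)).add h4)
    ((continuous_abs.measurable.comp hT).pow_const p).aestronglyMeasurable
    (ae_of_all _ fun ω => ?_)
  simp only [Real.norm_eq_abs, abs_pow, abs_abs, Pi.add_apply]
  have e : T ω ^ 4 = |T ω| ^ 4 := by rw [← abs_pow, abs_of_nonneg (by positivity)]
  rw [e]
  rcases le_total |T ω| 1 with h | h
  · have := pow_le_one₀ (n := p) (abs_nonneg (T ω)) h
    have : 0 ≤ |T ω| ^ 4 := by positivity
    linarith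
  · have := pow_le_pow_right₀ h hp
    linarith

/-- Expansion of the characteristic function of a centred random variable with four moments. -/
lemma norm_charFun_sub_exp_le {T : Ω → ℝ} (hT : Measurable T)
    (h4 : Integrable (fun ω => T ω ^ 4) P) (h0 : ∫ ω, T ω ∂P = 0) (t : ℝ) {ε : ℝ} (hε : 0 < ε) :
    ‖charFun (P.map T) t - (Real.exp (-(t ^ 2 / 2 * ∫ ω, T ω ^ 2 ∂P)) : ℂ)‖ ≤
      2 * |t| ^ 3 * (ε * ∫ ω, T ω ^ 2 ∂P + (∫ ω, T ω ^ 4 ∂P) / ε) +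
        t ^ 4 * ∫ ω, T ω ^ 4 ∂P := by
  have hi1 : Integrable T P := by
    have := integrable_pow_of_four hT h4 (p := 1) (by norm_num)
    simp only [pow_one] at this
    exact (integrable_norm_iff hT.aestronglyMeasurable).1 this
  have hi2 : Integrable (fun ω => T ω ^ 2) P := by
    simpa using integrable_pow_of_four hT h4 (p := 2) (by norm_num)
  set v := ∫ ω, T ω ^ 2 ∂P
  set w := ∫ ω, T ω ^ 4 ∂P
  have hexp : Integrable (fun ω => Complex.exp ((t * T ω : ℝ) * Complex.I)) P := by
    refine Integrable.of_bound (Measurable.aestronglyMeasurable (by fun_prop)) 1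
      (ae_of_all _ fun ω => ?_)
    rw [Complex.norm_exp_ofReal_mul_I]
  have hpoly : Integrable (fun ω => (1 + ((t * T ω : ℝ) : ℂ) * Complex.I -
      ((t * T ω : ℝ) : ℂ) ^ 2 / 2)) P := by
    have a1 : Integrable (fun ω => ((t * T ω : ℝ) : ℂ)) P := (hi1.const_mul t).ofReal
    have a2 : Integrable (fun ω => ((t * T ω : ℝ) : ℂ) ^ 2 / 2) P := by
      have : Integrable (fun ω => ((t ^ 2 * T ω ^ 2 : ℝ) : ℂ)) P := (hi2.const_mul (t ^ 2)).ofReal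
      refine (this.div_const 2).congr (ae_of_all _ fun ω => ?_)
      push_cast
      ring
    exact ((integrable_const _).add (a1.mul_const _)).sub a2
  have hcf : charFun (P.map T) t = ∫ ω, Complex.exp ((t * T ω : ℝ) * Complex.I) ∂P := by
    rw [charFun_apply_real, integral_map hT.aemeasurable
      (Measurable.aestronglyMeasurable (by fun_prop))]
    push_cast
    rfl
  have hpv : ∫ ω, (1 + ((t * T ω : ℝ) : ℂ) * Complex.I - ((t * T ω : ℝ) : ℂ) ^ 2 / 2) ∂P =
      ((1 - t ^ 2 / 2 * v : ℝ) : ℂ) := by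
    have a1 : Integrable (fun ω => ((t * T ω : ℝ) : ℂ) * Complex.I) P :=
      ((hi1.const_mul t).ofReal).mul_const _
    have e2 : ∀ ω, ((t * T ω : ℝ) : ℂ) ^ 2 / 2 = ((t ^ 2 / 2 * T ω ^ 2 : ℝ) : ℂ) := by
      intro ω; push_cast; ring
    have a2 : Integrable (fun ω => ((t ^ 2 / 2 * T ω ^ 2 : ℝ) : ℂ)) P := (hi2.const_mul _).ofReal
    simp only [e2]
    rw [integral_sub (f := fun ω => 1 + ((t * T ω : ℝ) : ℂ) * Complex.I)
      ((integrable_const _).add a1) a2,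
      integral_add (integrable_const _) a1, integral_mul_const, integral_complex_ofReal,
      integral_complex_ofReal,
      integral_const_mul, integral_const_mul, h0]
    simp [v]
  have h1 : ‖charFun (P.map T) t - ((1 - t ^ 2 / 2 * v : ℝ) : ℂ)‖ ≤
      2 * |t| ^ 3 * (ε * v + w / ε) := by
    rw [hcf, ← hpv, ← integral_sub hexp hpoly]
    refine (norm_integral_le_integral_norm _).trans ?_
    have hb : ∀ ω, ‖Complex.exp ((t * T ω : ℝ) * Complex.I) -
        (1 + ((t * T ω : ℝ) : ℂ) * Complex.I - ((t * T ω : ℝ) : ℂ) ^ 2 / 2)‖ ≤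
        2 * |t| ^ 3 * ε * T ω ^ 2 + 2 * |t| ^ 3 / ε * T ω ^ 4 := by
      intro ω
      refine (norm_exp_mul_I_sub_le _).trans ?_
      rw [abs_mul, mul_pow]
      have e2 : T ω ^ 2 = |T ω| ^ 2 := (sq_abs _).symm
      have e4 : T ω ^ 4 = |T ω| ^ 4 := by rw [← abs_pow, abs_of_nonneg (by positivity)]
      rw [e2, e4]
      set y := |T ω|
      have hy : 0 ≤ y := abs_nonneg _
      -- The third absolute moment is traded for the second and the fourth by the
      -- arithmetic–geometric mean inequality, so that Lyapunov's condition is only needed for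
      -- fourth powers.
      have key : 2 * y ^ 3 ≤ ε * y ^ 2 + y ^ 4 / ε := by
        have : ε * y ^ 2 + y ^ 4 / ε - 2 * y ^ 3 = y ^ 2 * (ε - y) ^ 2 / ε := by
          field_simp
          ring
        have h2 : 0 ≤ y ^ 2 * (ε - y) ^ 2 / ε := by positivity
        linarith
      calc 4 * (|t| ^ 3 * y ^ 3) = 2 * |t| ^ 3 * (2 * y ^ 3) := by ring
        _ ≤ 2 * |t| ^ 3 * (ε * y ^ 2 + y ^ 4 / ε) := by gcongr
        _ = _ := by ring
    refine (integral_mono (hexp.sub hpoly).norm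
      ((hi2.const_mul (2 * |t| ^ 3 * ε)).add (h4.const_mul (2 * |t| ^ 3 / ε))) hb).trans ?_
    simp only [Pi.add_apply]
    rw [integral_add (hi2.const_mul _) (h4.const_mul _), integral_const_mul, integral_const_mul]
    apply le_of_eq
    ring
  have hv0 : 0 ≤ v := integral_nonneg fun ω => sq_nonneg _
  -- The variance of T² is nonnegative.
  have hvw : v ^ 2 ≤ w := by
    have := variance_nonneg (fun ω => T ω ^ 2) P
    rw [variance_eq_sub (by
      refine (memLp_two_iff_integrable_sq (hT.pow_const 2).aestronglyMeasurable).2 ?_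
      refine h4.congr (ae_of_all _ fun ω => ?_)
      simp only
      ring)] at this
    have e : ∫ ω, ((fun ω => T ω ^ 2) ^ 2) ω ∂P = w :=
      integral_congr_ae (ae_of_all _ fun ω => by simp only [Pi.pow_apply]; ring)
    rw [e] at this
    linarith
  have h2 : ‖((1 - t ^ 2 / 2 * v : ℝ) : ℂ) - (Real.exp (-(t ^ 2 / 2 * v)) : ℂ)‖ ≤ t ^ 4 * w := by
    rw [← Complex.ofReal_sub, Complex.norm_real, Real.norm_eq_abs, abs_sub_comm]
    refine (abs_exp_neg_sub_le (by positivity)).trans ?_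
    calc (t ^ 2 / 2 * v) ^ 2 = t ^ 4 / 4 * v ^ 2 := by ring
      _ ≤ t ^ 4 / 4 * w := by gcongr
      _ ≤ t ^ 4 * w := by
        have : 0 ≤ t ^ 4 * w := mul_nonneg (by positivity) ((sq_nonneg v).trans hvw)
        linarith
  calc _ = ‖(charFun (P.map T) t - ((1 - t ^ 2 / 2 * v : ℝ) : ℂ)) +
        (((1 - t ^ 2 / 2 * v : ℝ) : ℂ) - (Real.exp (-(t ^ 2 / 2 * v)) : ℂ))‖ := by
        congr 1; ring
    _ ≤ _ := (norm_add_le _ _).trans (add_le_add h1 h2)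

/-- Independence factorizes the characteristic function, and the Gaussian target factorizes over the
same index set; the factors are then compared one by one. -/
lemma norm_charFun_sum_sub_exp_le [Fintype ι] {T : ι → Ω → ℝ} (hT : ∀ i, Measurable (T i))
    (h4 : ∀ i, Integrable (fun ω => T i ω ^ 4) P) (h0 : ∀ i, ∫ ω, T i ω ∂P = 0)
    (hind : iIndepFun T P) (t : ℝ) {ε : ℝ} (hε : 0 < ε) :
    ‖charFun (P.map fun ω => ∑ i, T i ω) t -
        (Real.exp (-(t ^ 2 / 2 * ∑ i, ∫ ω, T i ω ^ 2 ∂P)) : ℂ)‖ ≤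
      2 * |t| ^ 3 * (ε * ∑ i, ∫ ω, T i ω ^ 2 ∂P + (∑ i, ∫ ω, T i ω ^ 4 ∂P) / ε) +
        t ^ 4 * ∑ i, ∫ ω, T i ω ^ 4 ∂P := by
  rw [hind.charFun_map_fun_sum_eq_prod (fun i => (hT i).aemeasurable)]
  have he : (Real.exp (-(t ^ 2 / 2 * ∑ i, ∫ ω, T i ω ^ 2 ∂P)) : ℂ) =
      ∏ i, (Real.exp (-(t ^ 2 / 2 * ∫ ω, T i ω ^ 2 ∂P)) : ℂ) := by
    rw [← Complex.ofReal_prod, ← Real.exp_sum, Finset.mul_sum, Finset.sum_neg_distrib]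
  rw [he, Finset.prod_apply]
  refine (norm_prod_sub_prod_le _ (fun i => ?_) fun i => ?_).trans
    ((Finset.sum_le_sum fun i _ => norm_charFun_sub_exp_le (hT i) (h4 i) (h0 i) t hε).trans
      (le_of_eq ?_))
  · have := Measure.isProbabilityMeasure_map (μ := P) (hT i).aemeasurable
    exact norm_charFun_le_one t
  · rw [Complex.norm_real, Real.norm_eq_abs, Real.abs_exp, Real.exp_le_one_iff]
    have : 0 ≤ ∫ ω, T i ω ^ 2 ∂P := integral_nonneg fun ω => sq_nonneg _
    have : 0 ≤ t ^ 2 / 2 * ∫ ω, T i ω ^ 2 ∂P := by positivity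
    linarith
  · simp only [Finset.sum_add_distrib, ← Finset.mul_sum, Finset.sum_div]

end Lyapunov

section Limit

variable {Ω : ℕ → Type*} [∀ ν, MeasurableSpace (Ω ν)] {P : ∀ ν, Measure (Ω ν)}
  [∀ ν, IsProbabilityMeasure (P ν)]

/-- Lyapunov's central limit theorem for triangular arrays, up to a remainder that tends to zero
in probability. -/
theorem tendstoInDistribution_of_lyapunov {ι : ℕ → Type*} [∀ ν, Fintype (ι ν)]
    {T : ∀ ν, ι ν → Ω ν → ℝ} {W : ∀ ν, Ω ν → ℝ} (hT : ∀ ν i, Measurable (T ν i))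
    (hW : ∀ ν, Measurable (W ν))
    (h4 : ∀ᶠ ν in atTop, ∀ i, Integrable (fun ω => T ν i ω ^ 4) (P ν))
    (h0 : ∀ᶠ ν in atTop, ∀ i, ∫ ω, T ν i ω ∂(P ν) = 0)
    (hind : ∀ ν, iIndepFun (T ν) (P ν))
    (hvar : Tendsto (fun ν => ∑ i, ∫ ω, T ν i ω ^ 2 ∂(P ν)) atTop (𝓝 1))
    (hfour : Tendsto (fun ν => ∑ i, ∫ ω, T ν i ω ^ 4 ∂(P ν)) atTop (𝓝 0))
    (hrem : Tendsto (fun p : Σ ν, Ω ν => W p.1 p.2 - ∑ i, T p.1 i p.2) (probFilter P) (𝓝 0)) :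
    TendstoInDistribution W atTop id P (gaussianReal 0 1) where
  forall_aemeasurable ν := (hW ν).aemeasurable
  aemeasurable_limit := aemeasurable_id
  tendsto := by
    refine ProbabilityMeasure.tendsto_iff_tendsto_charFun.2 fun t => ?_
    simp only [ProbabilityMeasure.coe_mk, Measure.map_id, charFun_gaussianReal]
    set S4 : ℕ → ℝ := fun ν => ∑ i, ∫ ω, T ν i ω ^ 4 ∂(P ν)
    set S2 : ℕ → ℝ := fun ν => ∑ i, ∫ ω, T ν i ω ^ 2 ∂(P ν)
    have hS4 : ∀ ν, 0 ≤ S4 ν := fun ν => Finset.sum_nonneg fun i _ =>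
      integral_nonneg fun ω => by positivity
    have hS2 : ∀ ν, 0 ≤ S2 ν := fun ν => Finset.sum_nonneg fun i _ =>
      integral_nonneg fun ω => by positivity
    -- The choice ε = √S4 balances ε S2 against S4/ε. The summand 1/(ν+1) keeps ε positive when S4
    -- vanishes and costs nothing in the limit.
    set e : ℕ → ℝ := fun ν => Real.sqrt (S4 ν) + 1 / ((ν : ℝ) + 1)
    have he0 : ∀ ν, 0 < e ν := fun ν =>
      add_pos_of_nonneg_of_pos (Real.sqrt_nonneg _) (by positivity)
    have hsq : Tendsto (fun ν => Real.sqrt (S4 ν)) atTop (𝓝 0) := by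
      simpa using hfour.sqrt
    have he : Tendsto e atTop (𝓝 0) := by
      have := hsq.add (tendsto_one_div_add_atTop_nhds_zero_nat (𝕜 := ℝ))
      rwa [add_zero] at this
    have hdiv : ∀ ν, S4 ν / e ν ≤ Real.sqrt (S4 ν) := fun ν => by
      rw [div_le_iff₀ (he0 ν)]
      have h1 := Real.mul_self_sqrt (hS4 ν)
      have h2 : 0 ≤ Real.sqrt (S4 ν) * (1 / ((ν : ℝ) + 1)) :=
        mul_nonneg (Real.sqrt_nonneg _) (by positivity)
      have h3 : Real.sqrt (S4 ν) * e ν = S4 ν + Real.sqrt (S4 ν) * (1 / ((ν : ℝ) + 1)) := by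
        simp only [e, mul_add, h1]
      linarith
    have hmain : Tendsto (fun ν => charFun ((P ν).map fun ω => ∑ i, T ν i ω) t -
        (Real.exp (-(t ^ 2 / 2 * S2 ν)) : ℂ)) atTop (𝓝 0) := by
      have hb : Tendsto (fun ν => 2 * |t| ^ 3 * (e ν * S2 ν + Real.sqrt (S4 ν)) + t ^ 4 * S4 ν)
          atTop (𝓝 (2 * |t| ^ 3 * (0 * 1 + 0) + t ^ 4 * 0)) :=
        (((he.mul hvar).add hsq).const_mul _).add (hfour.const_mul _)
      simp only [zero_mul, add_zero, mul_zero] at hb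
      refine squeeze_zero_norm' ?_ hb
      filter_upwards [h4, h0] with ν a4 a0
      refine (norm_charFun_sum_sub_exp_le (hT ν) a4 a0 (hind ν) t (he0 ν)).trans ?_
      gcongr
      exact hdiv ν
    have hexp : Tendsto (fun ν => (Real.exp (-(t ^ 2 / 2 * S2 ν)) : ℂ)) atTop
        (𝓝 (Real.exp (-(t ^ 2 / 2 * 1)) : ℂ)) :=
      (Complex.continuous_ofReal.tendsto _).comp ((Real.continuous_exp.tendsto _).comp
        ((hvar.const_mul _).neg))
    have hdiff : Tendsto (fun ν => charFun ((P ν).map (W ν)) t -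
        charFun ((P ν).map fun ω => ∑ i, T ν i ω) t) atTop (𝓝 0) := by
      have hTs : ∀ ν, Measurable fun ω => ∑ i, T ν i ω := fun ν =>
        Finset.measurable_sum _ fun i _ => hT ν i
      rw [Metric.tendsto_nhds]
      intro δ hδ
      -- The budget: off the exceptional set B the exponentials differ by at most |t| η ≤ δ/2, and
      -- on B by at most 2, which costs 2 · δ/8.
      set η : ℝ := δ / (2 * (|t| + 1))
      have hη : 0 < η := by positivity
      have h1 := eventually_probFilter.1 ((Metric.tendsto_nhds.1 hrem) η hη)
      have h2 := ENNReal.tendsto_nhds_zero.1 h1 (ENNReal.ofReal (δ / 8)) (by simpa using hδ)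
      filter_upwards [h2] with ν hν
      set B : Set (Ω ν) := {ω | ¬ dist (W ν ω - ∑ i, T ν i ω) 0 < η}
      have hB : MeasurableSet B := by
        have : Measurable fun ω => dist (W ν ω - ∑ i, T ν i ω) 0 :=
          ((hW ν).sub (hTs ν)).dist measurable_const
        exact (measurableSet_lt this measurable_const).compl
      have hint : ∀ V : Ω ν → ℝ, Measurable V →
          Integrable (fun ω => Complex.exp (t * V ω * Complex.I)) (P ν) := fun V hV => by
        refine Integrable.of_bound (Measurable.aestronglyMeasurable (by fun_prop)) 1
          (ae_of_all _ fun ω => ?_)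
        rw [← Complex.ofReal_mul, Complex.norm_exp_ofReal_mul_I]
      have hcf : ∀ V : Ω ν → ℝ, Measurable V →
          charFun ((P ν).map V) t = ∫ ω, Complex.exp (t * V ω * Complex.I) ∂(P ν) := fun V hV => by
        rw [charFun_apply_real, integral_map hV.aemeasurable
          (Measurable.aestronglyMeasurable (by fun_prop))]
      rw [dist_zero_right, hcf _ (hW ν), hcf _ (hTs ν), ← integral_sub (hint _ (hW ν))
        (hint _ (hTs ν))]
      refine (norm_integral_le_integral_norm _).trans_lt ?_
      have hpt : ∀ ω, ‖Complex.exp (t * W ν ω * Complex.I) -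
          Complex.exp (t * ((∑ i, T ν i ω : ℝ) : ℂ) * Complex.I)‖ ≤
          |t| * η + B.indicator (fun _ => (2 : ℝ)) ω := by
        intro ω
        by_cases hω : ω ∈ B
        · rw [Set.indicator_of_mem hω]
          refine (norm_sub_le _ _).trans ?_
          rw [← Complex.ofReal_mul, ← Complex.ofReal_mul, Complex.norm_exp_ofReal_mul_I,
            Complex.norm_exp_ofReal_mul_I]
          have : 0 ≤ |t| * η := by positivity
          linarith
        · rw [Set.indicator_of_notMem hω, add_zero]
          have hω' : |W ν ω - ∑ i, T ν i ω| < η := by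
            simpa [B, Real.dist_eq] using hω
          have e1 : Complex.exp (t * W ν ω * Complex.I) -
              Complex.exp (t * ((∑ i, T ν i ω : ℝ) : ℂ) * Complex.I) =
              Complex.exp ((t * ∑ i, T ν i ω : ℝ) * Complex.I) *
              (Complex.exp (Complex.I * (t * (W ν ω - ∑ i, T ν i ω) : ℝ)) - 1) := by
            rw [mul_sub, ← Complex.exp_add, mul_one]
            congr 2
            · push_cast; ring
            · push_cast; ring
          rw [e1, norm_mul, Complex.norm_exp_ofReal_mul_I, one_mul]
          refine Real.norm_exp_I_mul_ofReal_sub_one_le.trans ?_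
          rw [Real.norm_eq_abs, abs_mul]
          gcongr
      refine (integral_mono ((hint _ (hW ν)).sub (hint _ (hTs ν))).norm
        ((integrable_const _).add ((integrable_const (2 : ℝ)).indicator hB)) hpt).trans_lt ?_
      simp only [Pi.add_apply]
      rw [integral_add (integrable_const _) ((integrable_const (2 : ℝ)).indicator hB),
        integral_indicator_const _ hB, integral_const, probReal_univ]
      have hPB : (P ν).real B ≤ δ / 8 := ENNReal.toReal_le_of_le_ofReal (by positivity) hν
      have h3 : |t| * η ≤ δ / 2 := by
        simp only [η]
        rw [mul_div_assoc', div_le_div_iff₀ (by positivity) (by norm_num)]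
        nlinarith [abs_nonneg t]
      simp only [smul_eq_mul, one_mul]
      linarith
    have := (hdiff.add hmain).add hexp
    simp only [sub_add_cancel, zero_add, sub_add_sub_cancel] at this
    convert this using 2
    push_cast
    congr 1
    simp

end Limit

end ClusterKernel

namespace ClusterKernel

/-! ## Conditional expectations -/

section CondExp

variable {Ω : Type*} {m mΩ : MeasurableSpace Ω} {P : Measure Ω}
  {Z φ : Ω → ℝ}

/-- On each set of the cover, localizing Z commutes with conditioning because the set belongs to m;
countably many identities glue. -/
lemma HasCondExp.condExp_ae_eq (h : HasCondExp P m Z φ) (hZ : Integrable Z P) :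
    P[Z | m] =ᵐ[P] φ := by
  obtain ⟨A, hA, hU, hE⟩ := h
  have h1 : ∀ i, ∀ᵐ ω ∂P, ω ∈ A i → (P[Z | m]) ω = φ ω := fun i => by
    filter_upwards [condExp_indicator hZ (hA i), (hE i).2] with ω h2 h3 hω
    rw [h3, Set.indicator_of_mem hω, Set.indicator_of_mem hω] at h2
    exact h2.symm
  filter_upwards [ae_all_iff.2 h1] with ω hω
  obtain ⟨i, hi⟩ := Set.mem_iUnion.1 (hU ▸ Set.mem_univ ω)
  exact hω i hi

variable [IsProbabilityMeasure P]

/-- The bounded m-measurable factor is pulled into the conditional expectation. This is how kernel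
weights, which depend on the regressors only, see the conditional moments of the errors. -/
lemma HasCondExp.integral_mul_eq (h : HasCondExp P m Z φ) (hm : m ≤ mΩ) (hZ : Integrable Z P)
    {ψ : Ω → ℝ} (hψ : Measurable[m] ψ) {C : ℝ} (hC : ∀ ω, |ψ ω| ≤ C) :
    ∫ ω, ψ ω * Z ω ∂P = ∫ ω, ψ ω * φ ω ∂P := by
  have hint : Integrable (ψ * Z) P :=
    hZ.bdd_mul (hψ.mono hm le_rfl).aestronglyMeasurable
      (ae_of_all _ fun ω => by simpa using hC ω)
  have h1 := condExp_mul_of_stronglyMeasurable_left (μ := P) hψ.stronglyMeasurable hint hZ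
  have h2 := h.condExp_ae_eq hZ
  calc ∫ ω, ψ ω * Z ω ∂P = ∫ ω, (P[ψ * Z | m]) ω ∂P := (integral_condExp hm).symm
    _ = ∫ ω, ψ ω * φ ω ∂P := by
      refine integral_congr_ae ?_
      filter_upwards [h1, h2] with ω a1 a2
      rw [a1, Pi.mul_apply, a2]

/-- Z is nonnegative but not assumed integrable, so the bound is proved on pieces where it is
integrable and then summed. In particular it yields integrability of Z wherever φ is bounded above.
-/
lemma HasCondExp.setLIntegral_le (h : HasCondExp P m Z φ) (hm : m ≤ mΩ) (hZ : ∀ ω, 0 ≤ Z ω)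
    {D : Set Ω} (hD : MeasurableSet[m] D) {c : ℝ} (hφ : ∀ ω ∈ D, φ ω ≤ c) :
    ∫⁻ ω in D, ENNReal.ofReal (Z ω) ∂P ≤ ENNReal.ofReal c * P D := by
  obtain ⟨A, hA, hU, hE⟩ := h
  -- Disjoint pieces of D, each inside one set of the cover; monotone convergence turns bounds on
  -- the pieces into a bound on D.
  set B : ℕ → Set Ω := fun i => D ∩ disjointed A i
  have hBm : ∀ i, MeasurableSet[m] (B i) := fun i =>
    hD.inter (MeasurableSet.disjointed hA i)
  have hBsub : ∀ i, B i ⊆ A i := fun i => Set.inter_subset_right.trans (disjointed_subset A i)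
  have hBU : D = ⋃ i, B i := by
    simp only [B]
    rw [← Set.inter_iUnion, iUnion_disjointed, hU, Set.inter_univ]
  have hBd : Pairwise (Function.onFun Disjoint B) := fun i j hij =>
    (disjoint_disjointed A hij).mono Set.inter_subset_right Set.inter_subset_right
  have hle : ∀ i, ∫⁻ ω in B i, ENNReal.ofReal (Z ω) ∂P ≤ ENNReal.ofReal c * P (B i) := by
    intro i
    have hi : IntegrableOn Z (B i) P := (hE i).1.mono_set (hBsub i)
    have hiA : Integrable ((A i).indicator Z) P :=
      (integrable_indicator_iff (hm _ (hA i))).2 (hE i).1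
    rw [← ofReal_integral_eq_lintegral_ofReal hi (ae_of_all _ hZ)]
    have e1 : ∫ ω in B i, Z ω ∂P = ∫ ω in B i, (P[(A i).indicator Z | m]) ω ∂P := by
      rw [setIntegral_condExp hm hiA (hBm i)]
      refine setIntegral_congr_fun (hm _ (hBm i)) fun ω hω => ?_
      rw [Set.indicator_of_mem (hBsub i hω)]
    have e2 : ∫ ω in B i, (P[(A i).indicator Z | m]) ω ∂P ≤ ∫ ω in B i, c ∂P := by
      refine setIntegral_mono_on_ae integrable_condExp.integrableOn
        (integrable_const c).integrableOn (hm _ (hBm i)) ?_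
      filter_upwards [(hE i).2] with ω h1 hω
      rw [h1, Set.indicator_of_mem (hBsub i hω)]
      exact hφ ω hω.1
    rw [e1]
    refine (ENNReal.ofReal_le_ofReal e2).trans (le_of_eq ?_)
    rw [setIntegral_const, smul_eq_mul, mul_comm, ENNReal.ofReal_mul' measureReal_nonneg,
      ofReal_measureReal]
  rw [hBU, lintegral_iUnion (fun i => hm _ (hBm i)) hBd, measure_iUnion hBd
    (fun i => hm _ (hBm i)), ← ENNReal.tsum_mul_left]
  exact ENNReal.tsum_le_tsum hle

lemma HasCondExp.lintegral_mul_le (h : HasCondExp P m Z φ) (hm : m ≤ mΩ) (hZm : Measurable Z)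
    (hZ : ∀ ω, 0 ≤ Z ω) {D : Set Ω} (hD : MeasurableSet[m] D) {c : ℝ} (hφ : ∀ ω ∈ D, φ ω ≤ c)
    {ψ : Ω → ℝ≥0∞} (hψ : Measurable[m] ψ) (hψD : ∀ ω, ω ∉ D → ψ ω = 0) :
    ∫⁻ ω, ψ ω * ENNReal.ofReal (Z ω) ∂P ≤ ENNReal.ofReal c * ∫⁻ ω, ψ ω ∂P := by
  -- The bound on sets of m is an inequality of two measures on the σ-algebra m. Integrating an
  -- m-measurable ψ against both extends it from indicators to weights.
  have hle : ((P.restrict D).withDensity fun ω => ENNReal.ofReal (Z ω)).trim hm ≤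
      (ENNReal.ofReal c • P).trim hm := by
    refine Measure.le_iff.2 fun s hs => ?_
    rw [trim_measurableSet_eq hm hs, trim_measurableSet_eq hm hs,
      withDensity_apply _ (hm _ hs), Measure.smul_apply, smul_eq_mul,
      Measure.restrict_restrict (hm _ hs)]
    refine (h.setLIntegral_le hm hZ (hs.inter hD) (fun ω hω => hφ ω hω.2)).trans ?_
    gcongr
    exact Set.inter_subset_left
  have h1 := lintegral_mono' hle (le_refl ψ)
  rw [lintegral_trim hm hψ, lintegral_trim hm hψ, lintegral_smul_measure,
    lintegral_withDensity_eq_lintegral_mul _ hZm.ennreal_ofReal (hψ.mono hm le_rfl),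
    ← lintegral_indicator (hm _ hD)] at h1
  refine le_trans (lintegral_mono fun ω => ?_) h1
  by_cases hω : ω ∈ D
  · rw [Set.indicator_of_mem hω, Pi.mul_apply, mul_comm]
  · rw [hψD ω hω, zero_mul]
    exact zero_le

end CondExp

/-! ## Integrals on Euclidean spaces -/

section Euclid

variable {ι : Type} [Fintype ι]

lemma integral_euclidean_prod (g : ι → ℝ → ℝ) :
    ∫ u : EuclideanSpace ℝ ι, ∏ q, g q (u q) = ∏ q, ∫ t, g q t := by
  rw [← integral_fintype_prod_volume_eq_prod (E := fun _ : ι => ℝ) g]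
  exact (PiLp.volume_preserving_ofLp ι).integral_comp
    (MeasurableEquiv.toLp 2 (ι → ℝ)).symm.measurableEmbedding (fun x : ι → ℝ => ∏ q, g q (x q))

/-- A bounded measurable weight that vanishes outside a ball. -/
structure IsWeight (w : EuclideanSpace ℝ ι → ℝ) (C L : ℝ) : Prop where
  measurable : Measurable w
  bound : ∀ u, |w u| ≤ C
  support : ∀ u, L < ‖u‖ → w u = 0

lemma IsWeight.nonneg {w : EuclideanSpace ℝ ι → ℝ} {C L : ℝ} (hw : IsWeight w C L) : 0 ≤ C :=
  (abs_nonneg _).trans (hw.bound 0)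

lemma IsWeight.integrable {w : EuclideanSpace ℝ ι → ℝ} {C L : ℝ} (hw : IsWeight w C L) :
    Integrable w := by
  have h1 : IntegrableOn w (Metric.closedBall 0 L) := by
    refine Measure.integrableOn_of_bounded (M := C) (Metric.isBounded_closedBall.measure_lt_top).ne
      hw.measurable.aestronglyMeasurable (ae_of_all _ fun u => ?_)
    exact hw.bound u
  refine (integrableOn_iff_integrable_of_support_subset fun u hu => ?_).1 h1
  by_contra hcon
  exact hu (hw.support u (by simpa using hcon))

lemma IsWeight.mul {w v : EuclideanSpace ℝ ι → ℝ} {C L C' : ℝ} (hw : IsWeight w C L)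
    (hv : Measurable v) (hb : ∀ u, ‖u‖ ≤ L → |v u| ≤ C') (hC' : 0 ≤ C') :
    IsWeight (fun u => w u * v u) (C * C') L where
  measurable := hw.measurable.mul hv
  bound u := by
    rcases le_or_gt ‖u‖ L with h | h
    · rw [abs_mul]
      exact mul_le_mul (hw.bound u) (hb u h) (abs_nonneg _) hw.nonneg
    · simp only [hw.support u h, zero_mul, abs_zero]
      exact mul_nonneg hw.nonneg hC'
  support u h := by simp only [hw.support u h, zero_mul]

/-- The change of variables y = x + h u. -/
lemma integral_smul_sub (w φ : EuclideanSpace ℝ ι → ℝ) {h : ℝ} (hh : 0 < h)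
    (x : EuclideanSpace ℝ ι) :
    ∫ y, w (h⁻¹ • (y - x)) * φ y = h ^ Fintype.card ι * ∫ u, w u * φ (x + h • u) := by
  have h1 : ∫ y, w (h⁻¹ • (y - x)) * φ y = ∫ y, w (h⁻¹ • y) * φ (x + y) := by
    rw [← integral_add_left_eq_self (fun y => w (h⁻¹ • (y - x)) * φ y) x]
    simp
  have h2 : ∫ y, w (h⁻¹ • y) * φ (x + y) =
      ∫ y, (fun u => w u * φ (x + h • u)) (h⁻¹ • y) := by
    simp [smul_smul, hh.ne']
  have h3 := Measure.integral_comp_inv_smul_of_nonneg volume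
    (fun u : EuclideanSpace ℝ ι => w u * φ (x + h • u)) hh.le
  rw [h1, h2, h3]
  simp

/-- Approximation of the identity. -/
lemma tendsto_integral_weight {w : EuclideanSpace ℝ ι → ℝ} {C L : ℝ} (hw : IsWeight w C L)
    {φ : EuclideanSpace ℝ ι → ℝ} (hφ : Continuous φ) {B : ℝ} (hB : ∀ y, |φ y| ≤ B)
    (x : EuclideanSpace ℝ ι) {h : ℕ → ℝ} (h0 : Tendsto h atTop (𝓝 0)) :
    Tendsto (fun ν => ∫ u, w u * φ (x + h ν • u)) atTop (𝓝 (φ x * ∫ u, w u)) := by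
  have hlim : φ x * ∫ u, w u = ∫ u, w u * φ x := by rw [integral_mul_const, mul_comm]
  rw [hlim]
  refine tendsto_integral_of_dominated_convergence (fun u => |w u| * B) (fun ν => ?_)
    (hw.integrable.abs.mul_const B) (fun ν => ae_of_all _ fun u => ?_) (ae_of_all _ fun u => ?_)
  · exact (hw.measurable.mul (hφ.measurable.comp (by fun_prop))).aestronglyMeasurable
  · rw [Real.norm_eq_abs, abs_mul]
    gcongr
    exact hB _
  · refine Tendsto.const_mul _ ((hφ.tendsto x).comp ?_)
    have : Tendsto (fun ν => x + h ν • u) atTop (𝓝 (x + (0 : ℝ) • u)) :=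
      tendsto_const_nhds.add (h0.smul_const u)
    simpa using this

end Euclid

/-! ## Product kernels -/

/-- Continuity, boundedness and compact support of a univariate kernel. -/
structure IsCompactKernel (k : ℝ → ℝ) (C L : ℝ) : Prop where
  continuous : Continuous k
  nonneg : ∀ u, 0 ≤ k u
  le : ∀ u, k u ≤ C
  one_le : 1 ≤ C
  pos : 0 < L
  support : ∀ u, L < |u| → k u = 0
  symm : ∀ u, k (-u) = k u
  integral_one : ∫ u, k u = 1

/-- Freezing all coordinates but one at a point where k is positive recovers k, up to a positive
constant, from the product kernel on ℝ^d. Thus continuity and compact support pass to k, and from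
there to product kernels in every dimension, such as the pair kernel. -/
lemma exists_isCompactKernel {dI dC : ℕ} (hdI : 1 ≤ dI) {k : ℝ → ℝ} (hk : IsKernel k)
    (hK : IsLipschitzCompact dI dC k) : ∃ C L, IsCompactKernel k C L := by
  obtain ⟨C, hC⟩ := hk.bounded
  obtain ⟨L, hL, hsupp⟩ := hK.compact
  obtain ⟨Λ, hΛ⟩ := hK.lipschitz
  obtain ⟨u₀, hu₀⟩ : ∃ u, 0 < k u := by
    by_contra! hcon
    have h0 : k = fun _ => 0 := funext fun u => le_antisymm (hcon u) (hk.nonneg u)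
    have := hk.integral_one
    rw [h0] at this
    simp at this
  set q₀ : Fin dI ⊕ Fin dC := Sum.inl ⟨0, hdI⟩
  set v : ℝ → RegSpace dI dC := fun u => WithLp.toLp 2 (fun q => if q = q₀ then u else u₀)
  set c : ℝ := ∏ _q ∈ Finset.univ.erase q₀, k u₀
  have hc : 0 < c := Finset.prod_pos fun _ _ => hu₀
  have hval : ∀ u, prodKernel k (v u) = k u * c := fun u => by
    unfold prodKernel
    rw [← Finset.mul_prod_erase Finset.univ _ (Finset.mem_univ q₀)]
    have h1 : ∏ q ∈ Finset.univ.erase q₀, k (v u q) = c :=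
      Finset.prod_congr rfl fun q hq => by simp [v, (Finset.mem_erase.1 hq).1]
    rw [h1]
    simp [v]
  have hvc : Continuous v := by
    refine (PiLp.continuous_toLp 2 _).comp (continuous_pi fun q => ?_)
    by_cases hq : q = q₀
    · simp only [hq, if_true]; exact continuous_id
    · simp only [hq, if_false]; exact continuous_const
  -- The bound is raised to at least 1 so that different powers of it can be compared.
  refine ⟨max C 1, L, ?_, hk.nonneg, fun u => (hC u).trans (le_max_left _ _), le_max_right _ _,
    hL, fun u hu => ?_, hk.symm, hk.integral_one⟩
  · have h1 : Continuous fun u => prodKernel k (v u) / c :=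
      (hΛ.continuous.comp hvc).div_const c
    refine h1.congr fun u => ?_
    rw [hval, mul_div_assoc, div_self hc.ne', mul_one]
  · have h1 : prodKernel k (v u) = 0 := by
      refine hsupp _ (hu.trans_le ?_)
      have := PiLp.norm_apply_le (v u) q₀
      simpa [v] using this
    rw [hval] at h1
    exact (mul_eq_zero.1 h1).resolve_right hc.ne'

section Kernel

variable {ι : Type} [Fintype ι] {k : ℝ → ℝ} {C L : ℝ}

/-- The factor d in place of √d is wasteful but avoids square roots in all later radii. -/
lemma norm_le_card_mul {u : EuclideanSpace ℝ ι} {r : ℝ} (hr : 0 ≤ r) (h : ∀ q, |u q| ≤ r) :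
    ‖u‖ ≤ Fintype.card ι * r := by
  have h1 : ‖u‖ ^ 2 ≤ (Fintype.card ι * r) ^ 2 := by
    rw [EuclideanSpace.real_norm_sq_eq]
    calc ∑ q, u q ^ 2 ≤ ∑ _q : ι, r ^ 2 := Finset.sum_le_sum fun q _ => by
          rw [← sq_abs]; gcongr; exact h q
      _ = Fintype.card ι * r ^ 2 := by simp
      _ ≤ (Fintype.card ι * r) ^ 2 := by
        rw [mul_pow]
        gcongr
        have : (Fintype.card ι : ℝ) ≤ ((Fintype.card ι ^ 2 : ℕ) : ℝ) := by
          exact_mod_cast Nat.le_self_pow two_ne_zero _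
        exact_mod_cast this
  exact abs_le_of_sq_le_sq' h1 (by positivity) |>.2

lemma IsCompactKernel.prod_nonneg (hk : IsCompactKernel k C L) (u : EuclideanSpace ℝ ι) :
    0 ≤ prodKernel k u := Finset.prod_nonneg fun _ _ => hk.nonneg _

lemma IsCompactKernel.prod_le (hk : IsCompactKernel k C L) (u : EuclideanSpace ℝ ι) :
    prodKernel k u ≤ C ^ Fintype.card ι := by
  unfold prodKernel
  refine (Finset.prod_le_prod (fun q _ => hk.nonneg (u q)) fun q _ => hk.le (u q)).trans ?_
  simp

lemma IsCompactKernel.abs_le_of_ne (hk : IsCompactKernel k C L) {u : EuclideanSpace ℝ ι}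
    (hu : prodKernel k u ≠ 0) (q : ι) : |u q| ≤ L := by
  by_contra! hcon
  exact hu (Finset.prod_eq_zero (Finset.mem_univ q) (hk.support _ hcon))

lemma IsCompactKernel.continuous_prod (hk : IsCompactKernel k C L) :
    Continuous (prodKernel k : EuclideanSpace ℝ ι → ℝ) :=
  continuous_finsetProd _ fun q _ => hk.continuous.comp (by fun_prop)

lemma IsCompactKernel.isWeight (hk : IsCompactKernel k C L) :
    IsWeight (prodKernel k : EuclideanSpace ℝ ι → ℝ) (C ^ Fintype.card ι)
      (Fintype.card ι * L) where
  measurable := hk.continuous_prod.measurable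
  bound u := by rw [abs_of_nonneg (hk.prod_nonneg u)]; exact hk.prod_le u
  support u h := by
    by_contra hcon
    exact absurd (norm_le_card_mul hk.pos.le (hk.abs_le_of_ne hcon)) (not_le.2 h)

lemma IsCompactKernel.integral_prod (hk : IsCompactKernel k C L) :
    ∫ u : EuclideanSpace ℝ ι, prodKernel k u = 1 := by
  unfold prodKernel
  rw [integral_euclidean_prod (fun _ => k)]
  simp [hk.integral_one]

lemma IsCompactKernel.integral_prod_sq :
    ∫ u : EuclideanSpace ℝ ι, prodKernel k u ^ 2 = roughness k ^ Fintype.card ι := by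
  unfold prodKernel
  simp only [← Finset.prod_pow]
  rw [integral_euclidean_prod (fun _ t => k t ^ 2)]
  simp [roughness]

lemma IsCompactKernel.integral_odd (hk : IsCompactKernel k C L) : ∫ t, t * k t = 0 := by
  have h := integral_neg_eq_self (fun t => t * k t) volume
  simp only [hk.symm, neg_mul, integral_neg] at h
  linarith

/-- By Fubini the integral factorizes, and the factor of coordinate q is the integral of an odd
function. -/
lemma IsCompactKernel.integral_mul_coord (hk : IsCompactKernel k C L) (q : ι) :
    ∫ u : EuclideanSpace ℝ ι, prodKernel k u * u q = 0 := by
  classical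
  have h1 : ∀ u : EuclideanSpace ℝ ι, prodKernel k u * u q =
      ∏ p, (fun t => k t * (if p = q then t else 1)) (u p) := fun u => by
    unfold prodKernel
    simp only [Finset.prod_mul_distrib, Finset.prod_ite_eq', Finset.mem_univ, if_true]
  simp only [h1]
  rw [integral_euclidean_prod (fun p t => k t * (if p = q then t else 1))]
  refine Finset.prod_eq_zero (Finset.mem_univ q) ?_
  simp only [if_true]
  rw [← hk.integral_odd]
  congr 1; ext t; ring

/-- Fubini again: for q ≠ r an odd factor survives, and for q = r the factor of that coordinate is
the second moment of k. -/
lemma IsCompactKernel.integral_mul_coord_coord [DecidableEq ι] (hk : IsCompactKernel k C L)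
    (q r : ι) : ∫ u : EuclideanSpace ℝ ι, prodKernel k u * (u q * u r) =
      if q = r then kappaTwo k else 0 := by
  have h1 : ∀ u : EuclideanSpace ℝ ι, prodKernel k u * (u q * u r) =
      ∏ p, (fun t => k t * ((if p = q then t else 1) * (if p = r then t else 1))) (u p) := by
    intro u
    unfold prodKernel
    simp only [Finset.prod_mul_distrib, Finset.prod_ite_eq', Finset.mem_univ, if_true]
  simp only [h1]
  rw [integral_euclidean_prod
    (fun p t => k t * ((if p = q then t else 1) * (if p = r then t else 1)))]
  split_ifs with hqr
  · subst hqr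
    rw [← Finset.mul_prod_erase Finset.univ _ (Finset.mem_univ q),
      Finset.prod_eq_one fun p hp => by simp [(Finset.mem_erase.1 hp).1, hk.integral_one]]
    simp only [if_true, mul_one, kappaTwo]
    congr 1; ext t; ring
  · refine Finset.prod_eq_zero (Finset.mem_univ q) ?_
    simp only [if_true, if_neg hqr, mul_one]
    rw [← hk.integral_odd]
    congr 1; ext t; ring

lemma eq_sum_coord_smul (u : EuclideanSpace ℝ ι) [DecidableEq ι] :
    u = ∑ q, u q • EuclideanSpace.single q (1 : ℝ) := by
  ext p
  simp [Finset.sum_apply, Pi.single_apply]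

lemma IsCompactKernel.integrable_mul (hk : IsCompactKernel k C L) {φ : EuclideanSpace ℝ ι → ℝ}
    (hφ : Continuous φ) : Integrable fun u => prodKernel k u * φ u := by
  have hcs : HasCompactSupport (prodKernel k : EuclideanSpace ℝ ι → ℝ) :=
    HasCompactSupport.intro (isCompact_closedBall 0 (Fintype.card ι * L)) fun u hu =>
      hk.isWeight.support u (by simpa using hu)
  exact (hk.continuous_prod.mul hφ).integrable_of_hasCompactSupport hcs.mul_right

lemma IsCompactKernel.integral_mul_linear (hk : IsCompactKernel k C L)
    (A : EuclideanSpace ℝ ι →L[ℝ] ℝ) : ∫ u : EuclideanSpace ℝ ι, prodKernel k u * A u = 0 := by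
  classical
  have h1 : ∀ u : EuclideanSpace ℝ ι, prodKernel k u * A u =
      ∑ q, prodKernel k u * u q * A (EuclideanSpace.single q 1) := fun u => by
    have : A u = ∑ q, u q * A (EuclideanSpace.single q 1) := by
      conv_lhs => rw [eq_sum_coord_smul u]
      simp only [map_sum, map_smul, smul_eq_mul]
    rw [this, Finset.mul_sum]
    simp only [mul_assoc]
  simp only [h1]
  rw [integral_finsetSum _ fun q _ => (hk.integrable_mul (by fun_prop)).mul_const _]
  exact Finset.sum_eq_zero fun q _ => by rw [integral_mul_const, hk.integral_mul_coord, zero_mul]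

/-- The kernel has second moment matrix κ₂ times the identity, so a quadratic form integrates to κ₂
times its trace. All bias constants come from here. -/
lemma IsCompactKernel.integral_mul_bilin [DecidableEq ι] (hk : IsCompactKernel k C L)
    (B : EuclideanSpace ℝ ι →L[ℝ] EuclideanSpace ℝ ι →L[ℝ] ℝ) :
    ∫ u : EuclideanSpace ℝ ι, prodKernel k u * B u u =
      kappaTwo k * ∑ q, B (EuclideanSpace.single q 1) (EuclideanSpace.single q 1) := by
  have h1 : ∀ u : EuclideanSpace ℝ ι, prodKernel k u * B u u =
      ∑ q, ∑ r, prodKernel k u * (u q * u r) *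
        B (EuclideanSpace.single q 1) (EuclideanSpace.single r 1) := fun u => by
    have : B u u = ∑ q, ∑ r, u q * u r *
        B (EuclideanSpace.single q 1) (EuclideanSpace.single r 1) := by
      conv_lhs => rw [eq_sum_coord_smul u]
      simp only [map_sum, map_smul, smul_eq_mul, _root_.sum_apply, _root_.smul_apply,
        Finset.mul_sum, mul_assoc]
      rw [Finset.sum_comm]
      exact Finset.sum_congr rfl fun q _ => Finset.sum_congr rfl fun r _ => by ring
    rw [this, Finset.mul_sum]
    simp only [Finset.mul_sum, mul_assoc]
  simp only [h1]
  have hi : ∀ q r : ι, Integrable fun u : EuclideanSpace ℝ ι => prodKernel k u * (u q * u r) *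
      B (EuclideanSpace.single q 1) (EuclideanSpace.single r 1) := fun q r =>
    (hk.integrable_mul (by fun_prop)).mul_const _
  rw [integral_finsetSum _ fun q _ => integrable_finsetSum _ fun r _ => hi q r, Finset.mul_sum]
  refine Finset.sum_congr rfl fun q _ => ?_
  rw [integral_finsetSum _ fun r _ => hi q r]
  simp only [integral_mul_const, hk.integral_mul_coord_coord, ite_mul, zero_mul,
    Finset.sum_ite_eq, Finset.mem_univ, if_true]

end Kernel

end ClusterKernel

namespace ClusterKernel

/-! ## Smooth functions and the bias expansion -/

section Smooth

variable {E : Type*} [NormedAddCommGroup E] [NormedSpace ℝ E] {φ : E → ℝ} {n : ℕ}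

lemma UnifSmooth.continuous (h : UnifSmooth n φ) : Continuous φ := h.contDiff.continuous

lemma UnifSmooth.exists_bound (h : UnifSmooth n φ) : ∃ C : ℝ, ∀ y, |φ y| ≤ C := by
  obtain ⟨C, hC⟩ := h.bounded 0 (Nat.zero_le _)
  exact ⟨C, fun y => by simpa using hC y⟩

lemma UnifSmooth.exists_lipschitz (h : UnifSmooth 2 φ) :
    ∃ C : ℝ, 0 ≤ C ∧ ∀ x y, |φ y - φ x| ≤ C * ‖y - x‖ := by
  obtain ⟨C, hC⟩ := h.bounded 1 (by norm_num)
  refine ⟨C, (norm_nonneg _).trans (hC 0), fun x y => ?_⟩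
  exact convex_univ.norm_image_sub_le_of_norm_fderiv_le (𝕜 := ℝ)
    (fun z _ => (h.contDiff.differentiable (by norm_num)) z)
    (fun z _ => by rw [← norm_iteratedFDeriv_one]; exact hC z) (Set.mem_univ x) (Set.mem_univ y)

lemma UnifSmooth.contDiff_fderiv (h : UnifSmooth 2 φ) : ContDiff ℝ 1 (fderiv ℝ φ) :=
  h.contDiff.fderiv_right (by norm_num)

/-- A bounded second derivative makes the gradient Lipschitz, and the mean value inequality is
applied a second time. -/
lemma UnifSmooth.exists_quadratic (h : UnifSmooth 2 φ) :
    ∃ C : ℝ, 0 ≤ C ∧ ∀ x y, |φ y - φ x - fderiv ℝ φ x (y - x)| ≤ C * ‖y - x‖ ^ 2 := by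
  obtain ⟨C, hC⟩ := h.bounded 2 le_rfl
  have hd : ∀ x y, ‖fderiv ℝ φ y - fderiv ℝ φ x‖ ≤ C * ‖y - x‖ := fun x y =>
    convex_univ.norm_image_sub_le_of_norm_fderiv_le (𝕜 := ℝ)
      (fun z _ => (h.contDiff_fderiv.differentiable (by norm_num)) z)
      (fun z _ => by rw [← norm_iteratedFDeriv_one, norm_iteratedFDeriv_fderiv]; exact hC z)
      (Set.mem_univ x) (Set.mem_univ y)
  have hC0 : 0 ≤ C := (norm_nonneg _).trans (hC 0)
  refine ⟨C, hC0, fun x y => ?_⟩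
  -- On the ball of radius ‖y - x‖ the derivative of φ - φ'(x) has norm at most C ‖y - x‖.
  have h1 := (convex_closedBall x ‖y - x‖).norm_image_sub_le_of_norm_fderiv_le (𝕜 := ℝ)
    (f := fun z => φ z - fderiv ℝ φ x z) (C := C * ‖y - x‖) (x := x) (y := y)
    (fun z _ => ((h.contDiff.differentiable (by norm_num)) z).sub
      (fderiv ℝ φ x).differentiableAt) (fun z hz => ?_) (Metric.mem_closedBall_self (norm_nonneg _))
    (by rw [Metric.mem_closedBall, dist_eq_norm])
  · calc |φ y - φ x - fderiv ℝ φ x (y - x)|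
        = ‖(φ y - fderiv ℝ φ x y) - (φ x - fderiv ℝ φ x x)‖ := by
          rw [Real.norm_eq_abs, map_sub]; congr 1; ring
      _ ≤ C * ‖y - x‖ * ‖y - x‖ := h1
      _ = C * ‖y - x‖ ^ 2 := by ring
  · rw [fderiv_fun_sub ((h.contDiff.differentiable (by norm_num)) z)
      (fderiv ℝ φ x).differentiableAt, ContinuousLinearMap.fderiv]
    refine (hd x z).trans ?_
    gcongr
    rwa [Metric.mem_closedBall, dist_eq_norm] at hz

lemma tendsto_first_order (h : UnifSmooth 2 φ) (x u : E) {b : ℕ → ℝ} (hb : ∀ ν, 0 < b ν)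
    (b0 : Tendsto b atTop (𝓝 0)) :
    Tendsto (fun ν => (b ν)⁻¹ * (φ (x + b ν • u) - φ x)) atTop (𝓝 (fderiv ℝ φ x u)) := by
  have hd : HasDerivAt (fun t : ℝ => φ (x + t • u)) (fderiv ℝ φ x u) 0 := by
    have h1 : HasFDerivAt φ (fderiv ℝ φ x) (x + (0 : ℝ) • u) := by
      rw [zero_smul, add_zero]
      exact ((h.contDiff.differentiable (by norm_num)) x).hasFDerivAt
    have h2 : HasDerivAt (fun t : ℝ => x + t • u) u 0 := by
      simpa using ((hasDerivAt_id (0 : ℝ)).smul_const u).const_add x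
    exact h1.comp_hasDerivAt 0 h2
  have h3 := hd.tendsto_slope_zero
  simp only [zero_add, zero_smul, add_zero, smul_eq_mul] at h3
  exact h3.comp (tendsto_nhdsWithin_iff.2 ⟨b0, Eventually.of_forall fun ν => (hb ν).ne'⟩)

/-- Taylor's formula with Peano remainder for the function of one variable t ↦ φ(x + t u). -/
lemma tendsto_second_order (h : UnifSmooth 2 φ) (x u : E) {b : ℕ → ℝ} (hb : ∀ ν, 0 < b ν)
    (b0 : Tendsto b atTop (𝓝 0)) :
    Tendsto (fun ν => (b ν ^ 2)⁻¹ * (φ (x + b ν • u) - φ x - fderiv ℝ φ x (b ν • u))) atTop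
      (𝓝 (fderiv ℝ (fderiv ℝ φ) x u u / 2)) := by
  set g : ℝ → ℝ := fun t => φ (x + t • u)
  have hg : ContDiff ℝ (2 : ℕ) g := h.contDiff.comp (by fun_prop)
  have hline : ∀ t : ℝ, HasDerivAt (fun t : ℝ => x + t • u) u t := fun t => by
    simpa using ((hasDerivAt_id t).smul_const u).const_add x
  have hg1 : deriv g = fun t => fderiv ℝ φ (x + t • u) u := funext fun t =>
    (((h.contDiff.differentiable (by norm_num)) (x + t • u)).hasFDerivAt.comp_hasDerivAt t
      (hline t)).deriv
  have hg2 : deriv (deriv g) 0 = fderiv ℝ (fderiv ℝ φ) x u u := by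
    rw [hg1]
    have h1 : HasFDerivAt (fderiv ℝ φ) (fderiv ℝ (fderiv ℝ φ) x) (x + (0 : ℝ) • u) := by
      rw [zero_smul, add_zero]
      exact ((h.contDiff_fderiv.differentiable (by norm_num)) x).hasFDerivAt
    have h2 : HasDerivAt (fun t : ℝ => fderiv ℝ φ (x + t • u)) (fderiv ℝ (fderiv ℝ φ) x u) 0 :=
      h1.comp_hasDerivAt 0 (hline 0)
    have h3 : HasDerivAt (fun t : ℝ => fderiv ℝ φ (x + t • u) u)
        (fderiv ℝ (fderiv ℝ φ) x u u) 0 := by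
      simpa using h2.clm_apply (hasDerivAt_const 0 u)
    exact h3.deriv
  have ht := taylor_isLittleO_univ (x₀ := 0) hg
  have hT : ∀ t, taylorWithinEval g 2 Set.univ 0 t =
      g 0 + t * deriv g 0 + t ^ 2 / 2 * deriv (deriv g) 0 := fun t => by
    rw [taylorWithinEval_succ, taylorWithinEval_succ, taylor_within_zero_eval]
    simp only [iteratedDerivWithin_univ, iteratedDeriv_succ, iteratedDeriv_zero, smul_eq_mul,
      sub_zero, zero_add, Nat.factorial, pow_one]
    push_cast
    ring
  have h4 := (ht.tendsto_div_nhds_zero).comp b0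
  have h5 := h4.add_const (deriv (deriv g) 0 / 2)
  rw [zero_add, hg2] at h5
  refine h5.congr fun ν => ?_
  have hbν := (hb ν).ne'
  simp only [Function.comp_apply, hT, sub_zero, hg1, zero_smul, add_zero, g]
  rw [← hg1, hg2, map_smul, smul_eq_mul]
  field_simp
  ring

end Smooth

variable {dI dC : ℕ}

/-- What is left of `m(y) - m(x)` after the terms that the local fit reproduces exactly. -/
noncomputable def localResid (M : Method) (m : RegSpace dI dC → ℝ) (x y : RegSpace dI dC) : ℝ :=
  match M with
  | .nw => m y - m x
  | .ll => m y - m x - fderiv ℝ m x (y - x)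

lemma continuous_localResid {m : RegSpace dI dC → ℝ} (hm : UnifSmooth 2 m) (M : Method)
    (x : RegSpace dI dC) : Continuous (localResid M m x) := by
  have := hm.continuous
  unfold localResid
  cases M <;> simp only <;> fun_prop

/-- The first-order bound, valid for both methods, suffices for consistency at the regressors. The
second-order bound for the local linear fit is what keeps √(n h^d) times its slopes bounded under n
h^{d+4} = O(1). -/
lemma exists_localResid_bound {m : RegSpace dI dC → ℝ} (hm : UnifSmooth 2 m) :
    ∃ C : ℝ, 0 ≤ C ∧ (∀ M x y, |localResid M m x y| ≤ C * ‖y - x‖) ∧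
      ∀ x y, |localResid .ll m x y| ≤ C * ‖y - x‖ ^ 2 := by
  obtain ⟨C₁, h₁, hC₁⟩ := hm.exists_lipschitz
  obtain ⟨C₂, h₂, hC₂⟩ := hm.exists_quadratic
  obtain ⟨C₃, hC₃⟩ := hm.bounded 1 (by norm_num)
  have h₃ : 0 ≤ C₃ := (norm_nonneg _).trans (hC₃ 0)
  refine ⟨C₁ + C₂ + C₃, by positivity, fun M x y => ?_, fun x y => ?_⟩
  · cases M
    · refine (hC₁ x y).trans ?_
      gcongr
      linarith
    · simp only [localResid]
      have h4 : |fderiv ℝ m x (y - x)| ≤ C₃ * ‖y - x‖ := by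
        refine ((fderiv ℝ m x).le_opNorm (y - x)).trans ?_
        gcongr
        rw [← norm_iteratedFDeriv_one]
        exact hC₃ x
      have h5 := abs_sub (m y - m x) (fderiv ℝ m x (y - x))
      have h6 := hC₁ x y
      nlinarith [norm_nonneg (y - x), mul_nonneg h₂ (norm_nonneg (y - x))]
  · refine (hC₂ x y).trans ?_
    gcongr
    linarith

lemma partialD_partialD {m : RegSpace dI dC → ℝ} (hm : UnifSmooth 2 m) (x : RegSpace dI dC)
    (q : Fin dI ⊕ Fin dC) : partialD q (partialD q m) x =
      fderiv ℝ (fderiv ℝ m) x (EuclideanSpace.single q 1) (EuclideanSpace.single q 1) := by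
  unfold partialD
  rw [fderiv_clm_apply ((hm.contDiff_fderiv.differentiable (by norm_num)) x)
    (differentiableAt_const _)]
  simp

/-- The integrand divided by h² converges pointwise to half the second differential of m times f(x),
with an integrable majorant from the quadratic bound on the kernel's support. -/
lemma tendsto_bias_ll {m f : RegSpace dI dC → ℝ} (hm : UnifSmooth 2 m) (hf : UnifSmooth 2 f)
    {k : ℝ → ℝ} {C L : ℝ} (hk : IsCompactKernel k C L) (x : RegSpace dI dC) {h : ℕ → ℝ}
    (hh : ∀ ν, 0 < h ν) (h0 : Tendsto h atTop (𝓝 0)) :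
    Tendsto (fun ν => (h ν ^ 2)⁻¹ * ∫ u, prodKernel k u *
      (localResid .ll m x (x + h ν • u) * f (x + h ν • u))) atTop
      (𝓝 (f x * bias .ll k m f x)) := by
  obtain ⟨B, hB0, -, hB⟩ := exists_localResid_bound hm
  obtain ⟨F, hF⟩ := hf.exists_bound
  have hlim : f x * bias .ll k m f x =
      ∫ u, prodKernel k u * (fderiv ℝ (fderiv ℝ m) x u u / 2 * f x) := by
    have h1 : ∀ u, prodKernel k u * (fderiv ℝ (fderiv ℝ m) x u u / 2 * f x) =
        f x / 2 * (prodKernel k u * fderiv ℝ (fderiv ℝ m) x u u) := fun u => by ring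
    simp only [h1]
    rw [integral_const_mul, hk.integral_mul_bilin]
    simp only [bias, partialD_partialD hm]
    ring
  rw [hlim]
  simp_rw [← integral_const_mul]
  set R : ℝ := (Fintype.card (Fin dI ⊕ Fin dC) : ℝ) * L
  refine tendsto_integral_of_dominated_convergence
    (fun u => |prodKernel k u| * (B * R ^ 2 * F)) (fun ν => ?_)
    (hk.isWeight.integrable.abs.mul_const _) (fun ν => ae_of_all _ fun u => ?_)
    (ae_of_all _ fun u => ?_)
  · have h1 := continuous_localResid hm .ll x
    have h2 := hf.continuous
    have h3 : Continuous (prodKernel k : RegSpace dI dC → ℝ) := hk.continuous_prod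
    exact (by fun_prop : Continuous fun u => (h ν ^ 2)⁻¹ * (prodKernel k u *
      (localResid .ll m x (x + h ν • u) * f (x + h ν • u)))).aestronglyMeasurable
  · rcases le_or_gt ‖u‖ R with hu | hu
    · have h1 := hB x (x + h ν • u)
      rw [add_sub_cancel_left, norm_smul, Real.norm_of_nonneg (hh ν).le] at h1
      rw [Real.norm_eq_abs, abs_mul, abs_mul, abs_mul, abs_of_nonneg (by positivity :
        (0 : ℝ) ≤ (h ν ^ 2)⁻¹)]
      have hhν := (hh ν).ne'
      calc (h ν ^ 2)⁻¹ * (|prodKernel k u| * (|localResid .ll m x (x + h ν • u)| *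
            |f (x + h ν • u)|))
          ≤ (h ν ^ 2)⁻¹ * (|prodKernel k u| * ((B * (h ν * R) ^ 2) * F)) := by
            have h2 : B * (h ν * ‖u‖) ^ 2 ≤ B * (h ν * R) ^ 2 := by
              have := (hh ν).le
              gcongr
            gcongr
            · exact h1.trans h2
            · exact hF _
        _ = |prodKernel k u| * (B * R ^ 2 * F) := by
          have := (hh ν).ne'
          field_simp
    · rw [hk.isWeight.support u hu]
      simp
  · have h1 := tendsto_second_order hm x u hh h0
    have h2 : Tendsto (fun ν => f (x + h ν • u)) atTop (𝓝 (f x)) := by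
      refine (hf.continuous.tendsto x).comp ?_
      have : Tendsto (fun ν => x + h ν • u) atTop (𝓝 (x + (0 : ℝ) • u)) :=
        tendsto_const_nhds.add (h0.smul_const u)
      simpa using this
    refine ((h1.mul h2).const_mul (prodKernel k u)).congr fun ν => ?_
    simp only [localResid, add_sub_cancel_left]
    ring

/-- The linear term of m meets the variation of the density over the window: this is the extra
design bias of Nadaraya–Watson. -/
lemma tendsto_gradient_term {m f : RegSpace dI dC → ℝ} (hf : UnifSmooth 2 f)
    {k : ℝ → ℝ} {C L : ℝ} (hk : IsCompactKernel k C L) (x : RegSpace dI dC) {h : ℕ → ℝ}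
    (hh : ∀ ν, 0 < h ν) (h0 : Tendsto h atTop (𝓝 0)) :
    Tendsto (fun ν => (h ν ^ 2)⁻¹ * ∫ u, prodKernel k u *
      (fderiv ℝ m x (h ν • u) * f (x + h ν • u))) atTop
      (𝓝 (kappaTwo k * ∑ q, partialD q f x * partialD q m x)) := by
  obtain ⟨B, hB0, hB⟩ := hf.exists_lipschitz
  have hlim : kappaTwo k * ∑ q, partialD q f x * partialD q m x =
      ∫ u, prodKernel k u * (fderiv ℝ m x u * fderiv ℝ f x u) := by
    have := hk.integral_mul_bilin ((fderiv ℝ f x).smulRight (fderiv ℝ m x))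
    simp only [ContinuousLinearMap.smulRight_apply, _root_.smul_apply, smul_eq_mul] at this
    simp only [partialD, ← this]
    congr 1; ext u; ring
  have hfc := hf.continuous
  have hKc : Continuous (prodKernel k : RegSpace dI dC → ℝ) := hk.continuous_prod
  -- The first moment of the kernel vanishes, so f(x) can be subtracted at no cost; the second
  -- factor h then forms a difference quotient of f.
  have hsub : ∀ ν, (h ν ^ 2)⁻¹ * ∫ u, prodKernel k u *
      (fderiv ℝ m x (h ν • u) * f (x + h ν • u)) =
      ∫ u, prodKernel k u * (fderiv ℝ m x u * ((h ν)⁻¹ * (f (x + h ν • u) - f x))) := fun ν => by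
    have e : ∀ u, prodKernel k u * (fderiv ℝ m x u * ((h ν)⁻¹ * (f (x + h ν • u) - f x))) =
        (h ν ^ 2)⁻¹ * (prodKernel k u * (fderiv ℝ m x (h ν • u) * f (x + h ν • u))) -
        (h ν)⁻¹ * f x * (prodKernel k u * fderiv ℝ m x u) := fun u => by
      rw [map_smul, smul_eq_mul]
      have := (hh ν).ne'
      field_simp
    simp only [e]
    rw [integral_sub ((hk.integrable_mul (by fun_prop)).const_mul _)
      ((hk.integrable_mul (by fun_prop)).const_mul _), integral_const_mul, integral_const_mul,
      hk.integral_mul_linear, mul_zero, sub_zero]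
  rw [hlim]
  simp_rw [hsub]
  set R : ℝ := (Fintype.card (Fin dI ⊕ Fin dC) : ℝ) * L
  have hR : 0 ≤ R := mul_nonneg (Nat.cast_nonneg _) hk.pos.le
  refine tendsto_integral_of_dominated_convergence
    (fun u => |prodKernel k u| * ((‖fderiv ℝ m x‖ * R) * (B * R))) (fun ν => ?_)
    (hk.isWeight.integrable.abs.mul_const _) (fun ν => ae_of_all _ fun u => ?_)
    (ae_of_all _ fun u => ?_)
  · exact (by fun_prop : Continuous fun u => prodKernel k u *
      (fderiv ℝ m x u * ((h ν)⁻¹ * (f (x + h ν • u) - f x)))).aestronglyMeasurable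
  · rcases le_or_gt ‖u‖ R with hu | hu
    · have h1 := hB x (x + h ν • u)
      rw [add_sub_cancel_left, norm_smul, Real.norm_of_nonneg (hh ν).le] at h1
      rw [Real.norm_eq_abs, abs_mul, abs_mul]
      gcongr
      · exact ((fderiv ℝ m x).le_opNorm u).trans (by gcongr)
      · rw [abs_mul, abs_of_pos (inv_pos.2 (hh ν)), inv_mul_le_iff₀ (hh ν)]
        refine h1.trans ?_
        have := (hh ν).le
        calc B * (h ν * ‖u‖) ≤ B * (h ν * R) := by gcongr
          _ = h ν * (B * R) := by ring
    · rw [hk.isWeight.support u hu]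
      simp
  · exact ((tendsto_first_order hf x u hh h0).const_mul _).const_mul _

lemma tendsto_bias {m f : RegSpace dI dC → ℝ} (hm : UnifSmooth 2 m) (hf : UnifSmooth 2 f)
    {k : ℝ → ℝ} {C L : ℝ} (hk : IsCompactKernel k C L) (x : RegSpace dI dC) (hfx : f x ≠ 0)
    {h : ℕ → ℝ} (hh : ∀ ν, 0 < h ν) (h0 : Tendsto h atTop (𝓝 0)) (M : Method) :
    Tendsto (fun ν => (h ν ^ 2)⁻¹ * ∫ u, prodKernel k u *
      (localResid M m x (x + h ν • u) * f (x + h ν • u))) atTop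
      (𝓝 (f x * bias M k m f x)) := by
  cases M
  case ll => exact tendsto_bias_ll hm hf hk x hh h0
  case nw =>
    -- The increment m(y) - m(x) is the local linear residual plus the linear term, so the two
    -- limits add.
    have hsum := (tendsto_bias_ll hm hf hk x hh h0).add
      (tendsto_gradient_term (m := m) hf hk x hh h0)
    have hlim : f x * bias .ll k m f x + kappaTwo k * ∑ q, partialD q f x * partialD q m x =
        f x * bias .nw k m f x := by
      simp only [bias, Finset.sum_add_distrib, ← Finset.mul_sum, mul_assoc]
      field_simp
    rw [hlim] at hsum
    refine hsum.congr fun ν => ?_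
    have hfc := hf.continuous
    have h1 := continuous_localResid hm .ll x
    rw [← mul_add, ← integral_add (hk.integrable_mul (by fun_prop))
      (hk.integrable_mul (by fun_prop))]
    congr 2
    ext u
    simp only [localResid, add_sub_cancel_left]
    ring

end ClusterKernel

namespace ClusterKernel

variable {dI dC : ℕ}

/-! ## Measurability of the regressors -/

lemma measurable_of_coord {Ω : Type*} {m : MeasurableSpace Ω} {ι : Type*}
    {v : Ω → EuclideanSpace ℝ ι} (h : ∀ q, Measurable fun ω => v ω q) : Measurable v :=
  (WithLp.measurable_toLp 2 _).comp (measurable_pi_lambda _ h)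

lemma measurable_component {Ω ι β : Type*} {m : MeasurableSpace Ω} [MeasurableSpace β]
    {v : Ω → ι → β} (h : Measurable v) (i : ι) : Measurable fun ω => v ω i :=
  (measurable_pi_apply i).comp h

lemma _root_.Measurable.coord {Ω : Type*} {m : MeasurableSpace Ω} {ι : Type*}
    {v : Ω → EuclideanSpace ℝ ι} (h : Measurable v) (q : ι) : Measurable fun ω => v ω q :=
  (measurable_pi_apply q).comp ((WithLp.measurable_ofLp 2 _).comp h)

namespace ClusterSample

variable {Ω : Type*} [mΩ : MeasurableSpace Ω] (S : ClusterSample dI dC Ω)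

lemma measurable_X (g : Fin S.G) (j : Fin (S.size g)) : Measurable (S.X g j) := by
  refine measurable_of_coord fun q => ?_
  cases q with
  | inl q => exact (S.measurable_XI g j).coord q
  | inr q => exact (S.measurable_XC g).coord q

lemma sigmaX_le (g : Fin S.G) : S.sigmaX g ≤ mΩ :=
  (measurable_pi_lambda _ fun j => S.measurable_X g j).comap_le

lemma measurable_X_sigmaX (g : Fin S.G) (j : Fin (S.size g)) :
    Measurable[S.sigmaX g] (S.X g j) := by
  have h : Measurable[S.sigmaX g] fun ω (j : Fin (S.size g)) => S.X g j ω := comap_measurable _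
  exact measurable_component h j

/-- The cluster-level part is read off from one of the p members, whence p > 0. -/
lemma measurable_joint_sigmaX {p : ℕ} (hp : 0 < p) (g : Fin S.G) (j : Fin p → Fin (S.size g)) :
    Measurable[S.sigmaX g] (S.joint g j) := by
  refine measurable_of_coord fun q => ?_
  cases q with
  | inl q => exact (S.measurable_X_sigmaX g (j q.1)).coord (Sum.inl q.2)
  | inr q => exact (S.measurable_X_sigmaX g (j ⟨0, hp⟩)).coord (Sum.inr q)

lemma measurable_err {m : RegSpace dI dC → ℝ} (hm : Continuous m) (g : Fin S.G)
    (j : Fin (S.size g)) : Measurable (S.err m g j) :=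
  (S.measurable_Y g j).sub (hm.measurable.comp (S.measurable_X g j))

open Classical in
/-- The members of cluster `g` whose regressors are within `r` of `y`. -/
noncomputable def near (y : RegSpace dI dC) (r : ℝ) (g : Fin S.G) (ω : Ω) :
    Finset (Fin (S.size g)) :=
  Finset.univ.filter fun j => S.X g j ω ∈ Metric.closedBall y r

lemma mem_near {y : RegSpace dI dC} {r : ℝ} {g : Fin S.G} {ω : Ω} {j : Fin (S.size g)} :
    j ∈ S.near y r g ω ↔ S.X g j ω ∈ Metric.closedBall y r := by simp [near]

open Classical in
lemma card_near_eq {y : RegSpace dI dC} {r : ℝ} {g : Fin S.G} {ω : Ω} :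
    (S.near y r g ω).card =
      ∑ j, if S.X g j ω ∈ Metric.closedBall y r then 1 else 0 := by
  simp [near]

lemma card_near_le (y : RegSpace dI dC) (r : ℝ) (g : Fin S.G) (ω : Ω) :
    (S.near y r g ω).card ≤ S.size g :=
  (Finset.card_le_univ _).trans (by simp)

lemma measurableSet_near (y : RegSpace dI dC) (r : ℝ) (g : Fin S.G) (j : Fin (S.size g)) :
    MeasurableSet[S.sigmaX g] {ω | j ∈ S.near y r g ω} := by
  simp only [mem_near]
  exact S.measurable_X_sigmaX g j Metric.isClosed_closedBall.measurableSet

lemma measurable_card_near (y : RegSpace dI dC) (r : ℝ) (g : Fin S.G) :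
    Measurable[S.sigmaX g] fun ω => (S.near y r g ω).card := by
  classical
  simp only [card_near_eq]
  exact Finset.measurable_sum (m := S.sigmaX g) _ fun j _ => Measurable.ite
    (m := S.sigmaX g) (S.measurable_X_sigmaX g j Metric.isClosed_closedBall.measurableSet)
    measurable_const measurable_const

lemma size_le_maxSize (g : Fin S.G) : S.size g ≤ S.maxSize :=
  Finset.le_sup (f := S.size) (Finset.mem_univ g)

end ClusterSample

/-! ## Bounds on the population functions -/

/-- Global bounds, and bounds in a ball around `x`, for the population functions. -/
structure PopBound (pop : Population dI dC) (x : RegSpace dI dC) (F Q V c ρ : ℝ) : Prop where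
  F_pos : 0 < F
  Q_pos : 0 < Q
  V_pos : 0 < V
  c_pos : 0 < c
  ρ_pos : 0 < ρ
  f_le : ∀ y, pop.f y ≤ F
  fJoint_le : ∀ p, 2 ≤ p → p ≤ 4 → ∀ z, pop.fJoint p z ≤ F
  sigmaSq_le : ∀ y, |pop.sigmaSq y| ≤ Q
  fourth_le : ∀ y ∈ Metric.closedBall x ρ, pop.fourth y ≤ V
  le_f : ∀ y ∈ Metric.closedBall x ρ, c ≤ pop.f y

/-- The global bounds come from uniform smoothness. One ball around x serves both for the upper
bound on the fourth moment and for the lower bound f(x)/2 on the density. -/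
lemma exists_popBound {pop : Population dI dC} (hreg : UnifRegular pop) {x : RegSpace dI dC}
    (hf : 0 < pop.f x) {N : Set (RegSpace dI dC)} (hN : IsOpen N) (hx : x ∈ N)
    (hloc : LocallyRegular pop N) : ∃ F Q V c ρ, PopBound pop x F Q V c ρ := by
  obtain ⟨F₁, h₁⟩ := hreg.f.exists_bound
  obtain ⟨F₂, h₂⟩ := hreg.fTwo.exists_bound
  obtain ⟨F₃, h₃⟩ := hreg.fThree.exists_bound
  obtain ⟨F₄, h₄⟩ := hreg.fFour.exists_bound
  obtain ⟨Q₁, hQ₁⟩ := hreg.sigmaSq.exists_bound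
  have hfourth : ∀ᶠ y in 𝓝 x, pop.fourth y < |pop.fourth x| + 1 :=
    (hloc.fourth.continuousAt (hN.mem_nhds hx)).eventually_lt_const
      (by linarith [le_abs_self (pop.fourth x)])
  have hlow : ∀ᶠ y in 𝓝 x, pop.f x / 2 < pop.f y :=
    (hreg.f.continuous.tendsto x).eventually_const_lt (by linarith)
  obtain ⟨ρ, hρ, hball⟩ := Metric.nhds_basis_closedBall.eventually_iff.1 (hfourth.and hlow)
  have a₁ := (abs_nonneg _).trans (h₁ x)
  have a₂ := (abs_nonneg _).trans (h₂ 0)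
  have a₃ := (abs_nonneg _).trans (h₃ 0)
  have a₄ := (abs_nonneg _).trans (h₄ 0)
  have b₁ := (abs_nonneg _).trans (hQ₁ 0)
  refine ⟨F₁ + F₂ + F₃ + F₄ + 1, Q₁ + 1, |pop.fourth x| + 1, pop.f x / 2, ρ,
    by positivity, by positivity, by positivity, by positivity, hρ, fun y => ?_,
    fun p hp hp' z => ?_, fun y => ?_, fun y hy => (hball hy).1.le,
    fun y hy => (hball hy).2.le⟩
  · linarith [le_abs_self (pop.f y), h₁ y]
  · interval_cases p
    · linarith [le_abs_self (pop.fJoint 2 z), h₂ z]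
    · linarith [le_abs_self (pop.fJoint 3 z), h₃ z]
    · linarith [le_abs_self (pop.fJoint 4 z), h₄ z]
  · linarith [hQ₁ y]

/-! ## Moments of the number of cluster members near a point -/

/-- The volume factor in the bounds for small balls. -/
noncomputable def ballConst (dI dC : ℕ) : ℝ :=
  (volume (Metric.ball (0 : RegSpace dI dC) 1)).toReal + ∑ p ∈ Finset.range 5,
    (Fintype.card ((Fin p × Fin dI) ⊕ Fin dC) : ℝ) ^ (p * dI + dC) *
      (volume (Metric.ball (0 : JointSpace p dI dC) 1)).toReal

lemma ballConst_nonneg : 0 ≤ ballConst dI dC := by unfold ballConst; positivity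

section Counts

variable {Ω : Type*} [mΩ : MeasurableSpace Ω] {P : Measure Ω}
  {S : ClusterSample dI dC Ω} {pop : Population dI dC} {x : RegSpace dI dC} {F Q V c ρ : ℝ}

lemma withDensity_closedBall_le {ι : Type} [Fintype ι] {φ : EuclideanSpace ℝ ι → ℝ} {B : ℝ}
    (hB0 : 0 ≤ B) (hB : ∀ z, φ z ≤ B) (z : EuclideanSpace ℝ ι) {r : ℝ} (hr : 0 ≤ r) :
    (volume.withDensity fun z => ENNReal.ofReal (φ z)) (Metric.closedBall z r) ≤
      ENNReal.ofReal (B * (r ^ Fintype.card ι *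
        (volume (Metric.ball (0 : EuclideanSpace ℝ ι) 1)).toReal)) := by
  rw [withDensity_apply _ Metric.isClosed_closedBall.measurableSet]
  calc ∫⁻ z in Metric.closedBall z r, ENNReal.ofReal (φ z)
      ≤ ∫⁻ _ in Metric.closedBall z r, ENNReal.ofReal B :=
        lintegral_mono fun z => ENNReal.ofReal_le_ofReal (hB z)
    _ = ENNReal.ofReal B * volume (Metric.closedBall z r) := by rw [setLIntegral_const]
    _ = _ := by
      rw [Measure.addHaar_closedBall _ _ hr, ENNReal.ofReal_mul hB0,
        ENNReal.ofReal_mul (by positivity), ENNReal.ofReal_toReal Metric.isBounded_ball.measure_lt_top.ne]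
      simp

/-- The exponent p dI + dC, not p(dI + dC), is the whole effect of clustering: the members share
their cluster-level coordinates, so these are constrained only once. -/
lemma measure_near_le (hS : IsGenerated P S pop) (hB : PopBound pop x F Q V c ρ) {p : ℕ}
    (hp : 1 ≤ p) (hp' : p ≤ 4) (g : Fin S.G) (j : Fin p ↪ Fin (S.size g)) (y : RegSpace dI dC)
    {r : ℝ} (hr : 0 ≤ r) :
    P {ω | ∀ i, j i ∈ S.near y r g ω} ≤
      ENNReal.ofReal (F * ballConst dI dC * r ^ (p * dI + dC)) := by
  -- A single member is governed by the marginal density, two or more by the joint densities.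
  rcases hp.eq_or_lt with rfl | hp2
  · have h1 : {ω | ∀ i, j i ∈ S.near y r g ω} = S.X g (j 0) ⁻¹' Metric.closedBall y r := by
      ext ω
      simp only [S.mem_near, Set.mem_ofPred_eq, Set.mem_preimage]
      exact ⟨fun h => h 0, fun h i => by rwa [Subsingleton.elim i 0]⟩
    rw [h1, ← Measure.map_apply (S.measurable_X g (j 0)) Metric.isClosed_closedBall.measurableSet,
      hS.density]
    refine (withDensity_closedBall_le hB.F_pos.le hB.f_le y hr).trans (ENNReal.ofReal_le_ofReal ?_)
    have e : Fintype.card (Fin dI ⊕ Fin dC) = 1 * dI + dC := by simp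
    rw [e, mul_assoc, mul_comm (ballConst dI dC)]
    have hF := hB.F_pos
    gcongr
    unfold ballConst
    exact le_add_of_nonneg_right (by positivity)
  · set z := diagPt p y
    set n := Fintype.card ((Fin p × Fin dI) ⊕ Fin dC) with hn
    have hsub : {ω | ∀ i, j i ∈ S.near y r g ω} ⊆
        S.joint g j ⁻¹' Metric.closedBall z (n * r) := by
      intro ω hω
      rw [Set.mem_preimage, Metric.mem_closedBall, dist_eq_norm]
      have hc : ∀ i q, |S.X g (j i) ω q - y q| ≤ r := fun i q => by
        have h1 := hω i
        rw [S.mem_near, Metric.mem_closedBall, dist_eq_norm] at h1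
        exact (PiLp.norm_apply_le (S.X g (j i) ω - y) q).trans h1
      refine norm_le_card_mul hr fun q => ?_
      cases q with
      | inl q => exact hc q.1 (Sum.inl q.2)
      | inr q => exact hc ⟨0, by omega⟩ (Sum.inr q)
    have hmeas : Measurable (S.joint g j) :=
      (S.measurable_joint_sigmaX (by omega) g j).mono (S.sigmaX_le g) le_rfl
    refine (measure_mono hsub).trans ?_
    rw [← Measure.map_apply hmeas Metric.isClosed_closedBall.measurableSet,
      hS.joint_density p hp2 (by omega) g j j.injective]
    refine (withDensity_closedBall_le hB.F_pos.le (hB.fJoint_le p hp2 hp') z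
      (by positivity)).trans (ENNReal.ofReal_le_ofReal ?_)
    have e : Fintype.card ((Fin p × Fin dI) ⊕ Fin dC) = p * dI + dC := by simp
    rw [mul_assoc, mul_pow, ← hn]
    have hF := hB.F_pos
    have hle : (n : ℝ) ^ n * (volume (Metric.ball (0 : JointSpace p dI dC) 1)).toReal ≤
        ballConst dI dC := by
      unfold ballConst
      have := Finset.single_le_sum (f := fun p => (Fintype.card ((Fin p × Fin dI) ⊕ Fin dC) : ℝ) ^
        (p * dI + dC) * (volume (Metric.ball (0 : JointSpace p dI dC) 1)).toReal)
        (fun i _ => by positivity) (Finset.mem_range.2 (by omega : p < 5))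
      rw [← hn, ← e, ← hn] at this
      exact this.trans (le_add_of_nonneg_left (by positivity))
    calc F * ((n : ℝ) ^ n * r ^ n * (volume (Metric.ball (0 : JointSpace p dI dC) 1)).toReal)
        = F * (((n : ℝ) ^ n * (volume (Metric.ball (0 : JointSpace p dI dC) 1)).toReal) * r ^ n) := by
          ring
      _ ≤ F * (ballConst dI dC * r ^ n) := by gcongr
      _ = _ := by rw [hn, e]

/-- Factorial moments of the number of cluster members near `y`. -/
lemma lintegral_descFactorial_le (hS : IsGenerated P S pop) (hB : PopBound pop x F Q V c ρ)
    {p : ℕ} (hp : 1 ≤ p) (hp' : p ≤ 4) (g : Fin S.G) (y : RegSpace dI dC) {r : ℝ} (hr : 0 ≤ r) :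
    ∫⁻ ω, ((S.near y r g ω).card.descFactorial p : ℝ≥0∞) ∂P ≤
      ENNReal.ofReal (F * ballConst dI dC *
        ((S.size g).descFactorial p * r ^ (p * dI + dC))) := by
  classical
  -- The falling factorial of the count is the number of injections of p labels into the nearby
  -- members, a sum of indicators over injections into the whole cluster.
  have hcount : ∀ ω, ((S.near y r g ω).card.descFactorial p : ℝ≥0∞) =
      ∑ j : Fin p ↪ Fin (S.size g), {ω | ∀ i, j i ∈ S.near y r g ω}.indicator 1 ω := by
    intro ω
    have h1 : (S.near y r g ω).card.descFactorial p =
        Fintype.card (Fin p ↪ S.near y r g ω) := by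
      rw [Fintype.card_embedding_eq]; simp
    have h2 : Fintype.card (Fin p ↪ S.near y r g ω) =
        (Finset.univ.filter fun j : Fin p ↪ Fin (S.size g) =>
          ∀ i, j i ∈ S.near y r g ω).card := by
      rw [← Fintype.card_subtype]
      exact Fintype.card_congr ((Equiv.codRestrict (Fin p) (fun a => a ∈ S.near y r g ω)).symm)
    rw [h1, h2, Finset.card_filter]
    push_cast
    refine Finset.sum_congr rfl fun j _ => ?_
    simp [Set.indicator_apply]
  simp only [hcount]
  have hms : ∀ j : Fin p ↪ Fin (S.size g),
      MeasurableSet {ω | ∀ i, j i ∈ S.near y r g ω} := fun j => by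
    have : {ω | ∀ i, j i ∈ S.near y r g ω} = ⋂ i, {ω | j i ∈ S.near y r g ω} := by
      ext ω; simp
    rw [this]
    exact MeasurableSet.iInter fun i => S.sigmaX_le g _ (S.measurableSet_near y r g (j i))
  rw [lintegral_finsetSum _ fun j _ => measurable_one.indicator (hms j)]
  simp only [lintegral_indicator_one (hms _)]
  refine (Finset.sum_le_sum fun j _ => measure_near_le hS hB hp hp' g j y hr).trans ?_
  rw [Finset.sum_const, Finset.card_univ, Fintype.card_embedding_eq, nsmul_eq_mul,
    ← ENNReal.ofReal_natCast, ← ENNReal.ofReal_mul (by positivity)]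
  refine ENNReal.ofReal_le_ofReal (le_of_eq ?_)
  simp only [Fintype.card_fin]
  ring

end Counts

end ClusterKernel

namespace ClusterKernel

variable {dI dC : ℕ}

/-- Two ordered pairs of distinct elements share no element, one element (in 4 ways) or both (in 2
ways). -/
lemma descFactorial_two_sq (c : ℕ) :
    (c.descFactorial 2) ^ 2 = c.descFactorial 4 + 4 * c.descFactorial 3 + 2 * c.descFactorial 2 := by
  rcases c with _ | _ | _ | c
  · rfl
  · rfl
  · rfl
  · simp only [Nat.descFactorial_succ, Nat.descFactorial_zero, Nat.add_sub_cancel]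
    have h1 : c + 1 + 1 + 1 - 3 = c := by omega
    have h2 : c + 1 + 1 + 1 - 2 = c + 1 := by omega
    have h3 : c + 1 + 1 + 1 - 0 = c + 3 := by omega
    simp only [h1, h2, h3]
    ring

lemma sq_eq_descFactorial (c : ℕ) : c ^ 2 = c.descFactorial 2 + c.descFactorial 1 := by
  rcases c with _ | c
  · rfl
  · simp only [Nat.descFactorial_succ, Nat.descFactorial_zero, Nat.add_sub_cancel, Nat.sub_zero]
    ring

/-- The coefficients 1, 6, 7, 1 are the Stirling numbers of the second kind. -/
lemma pow_four_eq_descFactorial (c : ℕ) : c ^ 4 = c.descFactorial 4 + 6 * c.descFactorial 3 +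
    7 * c.descFactorial 2 + c.descFactorial 1 := by
  rcases c with _ | _ | _ | c
  · rfl
  · rfl
  · rfl
  · simp only [Nat.descFactorial_succ, Nat.descFactorial_zero, Nat.add_sub_cancel]
    have h1 : c + 1 + 1 + 1 - 3 = c := by omega
    have h2 : c + 1 + 1 + 1 - 2 = c + 1 := by omega
    have h3 : c + 1 + 1 + 1 - 0 = c + 3 := by omega
    simp only [h1, h2, h3]
    ring

/-- The constant in the bounds for the moments of the number of members near a point. -/
noncomputable def countConst (dI dC : ℕ) (F A : ℝ) : ℝ :=
  -- The polynomial dominates A + 1, A³ + 6A² + 7A + 1 and A² + 4A + 2 at once, the factors for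
  -- second moments, fourth moments and squared pair counts.
  F * ballConst dI dC * (A ^ 3 + 6 * A ^ 2 + 7 * A + 2)

lemma countConst_nonneg {F A : ℝ} (hF : 0 ≤ F) (hA : 0 ≤ A) : 0 ≤ countConst dI dC F A :=
  mul_nonneg (mul_nonneg hF ballConst_nonneg) (by positivity)

section Moments

variable {Ω : Type*} [mΩ : MeasurableSpace Ω] {P : Measure Ω}
  {S : ClusterSample dI dC Ω} {pop : Population dI dC} {x : RegSpace dI dC} {F Q V c ρ : ℝ}

/-- Each member beyond the first costs a factor n r^{dI} ≤ A. Here the boundedness of max n_g h^{dI}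
makes moments of all orders comparable to the first. -/
lemma size_descFactorial_le (n p : ℕ) {r A : ℝ} (hr : 0 ≤ r) (hA : (n : ℝ) * r ^ dI ≤ A) :
    (n.descFactorial (p + 1) : ℝ) * r ^ ((p + 1) * dI + dC) ≤ n * r ^ (dI + dC) * A ^ p := by
  have h1 : (n.descFactorial (p + 1) : ℝ) ≤ (n : ℝ) ^ (p + 1) := by
    exact_mod_cast Nat.descFactorial_le_pow n (p + 1)
  calc (n.descFactorial (p + 1) : ℝ) * r ^ ((p + 1) * dI + dC)
      ≤ (n : ℝ) ^ (p + 1) * r ^ ((p + 1) * dI + dC) := by gcongr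
    _ = n * r ^ (dI + dC) * ((n : ℝ) * r ^ dI) ^ p := by
      rw [mul_pow, ← pow_mul]
      ring
    _ ≤ n * r ^ (dI + dC) * A ^ p := by
      gcongr

/-- The same with a pair as the starting point: each member beyond the second costs a factor A. -/
lemma size_descFactorial_le' (n p : ℕ) {r A : ℝ} (hr : 0 ≤ r) (hA : (n : ℝ) * r ^ dI ≤ A) :
    (n.descFactorial (p + 2) : ℝ) * r ^ ((p + 2) * dI + dC) ≤
      n.descFactorial 2 * r ^ (2 * dI + dC) * A ^ p := by
  have h1 : (n.descFactorial (p + 2) : ℝ) ≤ n.descFactorial 2 * (n : ℝ) ^ p := by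
    have : n.descFactorial (p + 2) ≤ n.descFactorial 2 * n ^ p := by
      rw [add_comm p 2]
      induction p with
      | zero => simp
      | succ p ih =>
        rw [← add_assoc, Nat.descFactorial_succ]
        calc (n - (2 + p)) * n.descFactorial (2 + p)
            ≤ n * (n.descFactorial 2 * n ^ p) := Nat.mul_le_mul (Nat.sub_le _ _) ih
          _ = _ := by ring
    exact_mod_cast this
  calc (n.descFactorial (p + 2) : ℝ) * r ^ ((p + 2) * dI + dC)
      ≤ (n.descFactorial 2 * (n : ℝ) ^ p) * r ^ ((p + 2) * dI + dC) := by gcongr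
    _ = n.descFactorial 2 * r ^ (2 * dI + dC) * ((n : ℝ) * r ^ dI) ^ p := by
      rw [mul_pow, ← pow_mul]
      ring
    _ ≤ _ := by gcongr

variable (hS : IsGenerated P S pop) (hB : PopBound pop x F Q V c ρ) (g : Fin S.G)
  (y : RegSpace dI dC)

lemma measurable_cast_near (y : RegSpace dI dC) (r : ℝ) (g : Fin S.G) {φ : ℕ → ℝ≥0∞} :
    Measurable[S.sigmaX g] fun ω => φ (S.near y r g ω).card :=
  (measurable_from_top (f := φ)).comp (S.measurable_card_near y r g)

include hS hB

lemma lintegral_card_le {r : ℝ} (hr : 0 ≤ r) :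
    ∫⁻ ω, ((S.near y r g ω).card : ℝ≥0∞) ∂P ≤
      ENNReal.ofReal (F * ballConst dI dC * (S.size g * r ^ (dI + dC))) := by
  simpa using lintegral_descFactorial_le hS hB (p := 1) le_rfl (by norm_num) g y hr

/-- The bound has the order of the mean bound: dependence within a cluster only enters the constant.
Summed over clusters this gives O(n r^d). -/
lemma lintegral_card_sq_le {r A : ℝ} (hr : 0 ≤ r) (hA : (S.size g : ℝ) * r ^ dI ≤ A) :
    ∫⁻ ω, ((S.near y r g ω).card : ℝ≥0∞) ^ 2 ∂P ≤
      ENNReal.ofReal (countConst dI dC F A * (S.size g * r ^ (dI + dC))) := by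
  have hA0 : 0 ≤ A := le_trans (by positivity) hA
  have hF := hB.F_pos.le
  have hK := @ballConst_nonneg dI dC
  have h2 := lintegral_descFactorial_le hS hB (p := 2) (by norm_num) (by norm_num) g y hr
  have h1 := lintegral_descFactorial_le hS hB (p := 1) (by norm_num) (by norm_num) g y hr
  have e : ∀ ω, ((S.near y r g ω).card : ℝ≥0∞) ^ 2 =
      ((S.near y r g ω).card.descFactorial 2 : ℝ≥0∞) +
      ((S.near y r g ω).card.descFactorial 1 : ℝ≥0∞) := fun ω => by
    exact_mod_cast sq_eq_descFactorial (S.near y r g ω).card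
  simp only [e]
  rw [lintegral_add_left ((measurable_cast_near y r g
    (φ := fun c => (c.descFactorial 2 : ℝ≥0∞))).mono (S.sigmaX_le g) le_rfl)]
  refine (add_le_add h2 h1).trans ?_
  rw [← ENNReal.ofReal_add (by positivity) (by positivity)]
  refine ENNReal.ofReal_le_ofReal ?_
  have a1 := size_descFactorial_le (dC := dC) (S.size g) 1 hr hA
  have a0 := size_descFactorial_le (dC := dC) (S.size g) 0 hr hA
  norm_num only [pow_zero, pow_one, mul_one, zero_add, one_add_one_eq_two] at a1 a0
  rw [← mul_add]
  calc F * ballConst dI dC * (((S.size g).descFactorial 2 : ℝ) * r ^ (2 * dI + dC) +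
        (S.size g).descFactorial 1 * r ^ (1 * dI + dC))
      ≤ F * ballConst dI dC * (S.size g * r ^ (dI + dC) * A + S.size g * r ^ (dI + dC)) := by
        gcongr
    _ = F * ballConst dI dC * (A + 1) * (S.size g * r ^ (dI + dC)) := by ring
    _ ≤ _ := by
      unfold countConst
      have : A + 1 ≤ A ^ 3 + 6 * A ^ 2 + 7 * A + 2 := by
        nlinarith [pow_nonneg hA0 3, pow_nonneg hA0 2]
      gcongr

lemma lintegral_card_four_le {r A : ℝ} (hr : 0 ≤ r) (hA : (S.size g : ℝ) * r ^ dI ≤ A) :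
    ∫⁻ ω, ((S.near y r g ω).card : ℝ≥0∞) ^ 4 ∂P ≤
      ENNReal.ofReal (countConst dI dC F A * (S.size g * r ^ (dI + dC))) := by
  have hA0 : 0 ≤ A := le_trans (by positivity) hA
  have hF := hB.F_pos.le
  have hK := @ballConst_nonneg dI dC
  have h4 := lintegral_descFactorial_le hS hB (p := 4) (by norm_num) (by norm_num) g y hr
  have h3 := lintegral_descFactorial_le hS hB (p := 3) (by norm_num) (by norm_num) g y hr
  have h2 := lintegral_descFactorial_le hS hB (p := 2) (by norm_num) (by norm_num) g y hr
  have h1 := lintegral_descFactorial_le hS hB (p := 1) (by norm_num) (by norm_num) g y hr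
  have e : ∀ ω, ((S.near y r g ω).card : ℝ≥0∞) ^ 4 =
      ((S.near y r g ω).card.descFactorial 4 : ℝ≥0∞) +
      6 * ((S.near y r g ω).card.descFactorial 3 : ℝ≥0∞) +
      7 * ((S.near y r g ω).card.descFactorial 2 : ℝ≥0∞) +
      ((S.near y r g ω).card.descFactorial 1 : ℝ≥0∞) := fun ω => by
    exact_mod_cast pow_four_eq_descFactorial (S.near y r g ω).card
  have hm : ∀ p, Measurable fun ω => ((S.near y r g ω).card.descFactorial p : ℝ≥0∞) := fun p =>
    (measurable_cast_near y r g
      (φ := fun c => (c.descFactorial p : ℝ≥0∞))).mono (S.sigmaX_le g) le_rfl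
  simp only [e]
  rw [lintegral_add_right _ (hm 1), lintegral_add_right _ ((hm 2).const_mul _),
    lintegral_add_right _ ((hm 3).const_mul _), lintegral_const_mul _ (hm 3),
    lintegral_const_mul _ (hm 2)]
  refine (add_le_add (add_le_add (add_le_add h4 (mul_le_mul_right h3 6))
    (mul_le_mul_right h2 7)) h1).trans ?_
  have e6 : (6 : ℝ≥0∞) = ENNReal.ofReal 6 := by norm_num
  have e7 : (7 : ℝ≥0∞) = ENNReal.ofReal 7 := by norm_num
  rw [e6, e7, ← ENNReal.ofReal_mul (by norm_num), ← ENNReal.ofReal_mul (by norm_num),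
    ← ENNReal.ofReal_add (by positivity) (by positivity),
    ← ENNReal.ofReal_add (by positivity) (by positivity),
    ← ENNReal.ofReal_add (by positivity) (by positivity)]
  refine ENNReal.ofReal_le_ofReal ?_
  have a3 := size_descFactorial_le (dC := dC) (S.size g) 3 hr hA
  have a2 := size_descFactorial_le (dC := dC) (S.size g) 2 hr hA
  have a1 := size_descFactorial_le (dC := dC) (S.size g) 1 hr hA
  have a0 := size_descFactorial_le (dC := dC) (S.size g) 0 hr hA
  norm_num only [pow_zero, pow_one, mul_one, zero_add, one_add_one_eq_two] at a3 a2 a1 a0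
  have hFK : 0 ≤ F * ballConst dI dC := by positivity
  have hs : 0 ≤ (S.size g : ℝ) * r ^ (dI + dC) := by positivity
  unfold countConst
  have b3 := mul_le_mul_of_nonneg_left a3 hFK
  have b2 := mul_le_mul_of_nonneg_left a2 hFK
  have b1 := mul_le_mul_of_nonneg_left a1 hFK
  have b0 := mul_le_mul_of_nonneg_left a0 hFK
  have b := mul_nonneg hFK hs
  linarith

/-- Relative to its mean bound, the number of nearby pairs again has a second moment of the same
order, which is what Chebyshev's inequality for pair averages requires. -/
lemma lintegral_pairs_sq_le {r A : ℝ} (hr : 0 ≤ r) (hA : (S.size g : ℝ) * r ^ dI ≤ A) :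
    ∫⁻ ω, ((S.near y r g ω).card.descFactorial 2 : ℝ≥0∞) ^ 2 ∂P ≤
      ENNReal.ofReal (countConst dI dC F A *
        ((S.size g).descFactorial 2 * r ^ (2 * dI + dC))) := by
  have hA0 : 0 ≤ A := le_trans (by positivity) hA
  have hF := hB.F_pos.le
  have hK := @ballConst_nonneg dI dC
  have h4 := lintegral_descFactorial_le hS hB (p := 4) (by norm_num) (by norm_num) g y hr
  have h3 := lintegral_descFactorial_le hS hB (p := 3) (by norm_num) (by norm_num) g y hr
  have h2 := lintegral_descFactorial_le hS hB (p := 2) (by norm_num) (by norm_num) g y hr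
  have e : ∀ ω, ((S.near y r g ω).card.descFactorial 2 : ℝ≥0∞) ^ 2 =
      ((S.near y r g ω).card.descFactorial 4 : ℝ≥0∞) +
      4 * ((S.near y r g ω).card.descFactorial 3 : ℝ≥0∞) +
      2 * ((S.near y r g ω).card.descFactorial 2 : ℝ≥0∞) := fun ω => by
    exact_mod_cast descFactorial_two_sq (S.near y r g ω).card
  have hm : ∀ p, Measurable fun ω => ((S.near y r g ω).card.descFactorial p : ℝ≥0∞) := fun p =>
    (measurable_cast_near y r g
      (φ := fun c => (c.descFactorial p : ℝ≥0∞))).mono (S.sigmaX_le g) le_rfl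
  simp only [e]
  rw [lintegral_add_right _ ((hm 2).const_mul _),
    lintegral_add_right _ ((hm 3).const_mul _), lintegral_const_mul _ (hm 3),
    lintegral_const_mul _ (hm 2)]
  refine (add_le_add (add_le_add h4 (mul_le_mul_right h3 4))
    (mul_le_mul_right h2 2)).trans ?_
  have e4 : (4 : ℝ≥0∞) = ENNReal.ofReal 4 := by norm_num
  have e2 : (2 : ℝ≥0∞) = ENNReal.ofReal 2 := by norm_num
  rw [e4, e2, ← ENNReal.ofReal_mul (by norm_num), ← ENNReal.ofReal_mul (by norm_num),
    ← ENNReal.ofReal_add (by positivity) (by positivity),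
    ← ENNReal.ofReal_add (by positivity) (by positivity)]
  refine ENNReal.ofReal_le_ofReal ?_
  have a2 := size_descFactorial_le' (dC := dC) (S.size g) 2 hr hA
  have a1 := size_descFactorial_le' (dC := dC) (S.size g) 1 hr hA
  norm_num only [pow_zero, pow_one, mul_one, zero_add, one_add_one_eq_two] at a2 a1
  have hFK : 0 ≤ F * ballConst dI dC := by positivity
  set D := ((S.size g).descFactorial 2 : ℝ) * r ^ (2 * dI + dC)
  have hs : 0 ≤ D := by positivity
  unfold countConst
  have b2 := mul_le_mul_of_nonneg_left a2 hFK
  have b1 := mul_le_mul_of_nonneg_left a1 hFK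
  have b := mul_nonneg hFK hs
  have c1 : 0 ≤ F * ballConst dI dC * (D * A) := by positivity
  have c2 : 0 ≤ F * ballConst dI dC * (D * A ^ 2) := by positivity
  have c3 : 0 ≤ F * ballConst dI dC * (D * A ^ 3) := by positivity
  linarith

end Moments

/-! ## Moments of sums of errors over one cluster -/

lemma lintegral_sum_sum {Ω ι : Type*} [MeasurableSpace Ω] {P : Measure Ω} [Fintype ι]
    {φ : ι → ι → Ω → ℝ≥0∞} (h : ∀ j l, Measurable (φ j l)) :
    ∫⁻ ω, ∑ j, ∑ l, φ j l ω ∂P = ∑ j, ∑ l, ∫⁻ ω, φ j l ω ∂P := by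
  rw [lintegral_finsetSum _ fun j _ => Finset.measurable_sum _ fun l _ => h j l]
  exact Finset.sum_congr rfl fun j _ => lintegral_finsetSum _ fun l _ => h j l

section Errors

variable {Ω : Type*} [mΩ : MeasurableSpace Ω] {P : Measure Ω} [IsProbabilityMeasure P]
  {S : ClusterSample dI dC Ω} {pop : Population dI dC} {x : RegSpace dI dC} {F Q V c ρ : ℝ}
  (hS : IsGenerated P S pop) (hB : PopBound pop x F Q V c ρ) (hm : Continuous pop.m) (g : Fin S.G)

include hS hB hm

/-- The conditional variance is bounded everywhere, so the weight may be any function of the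
regressors; fourth moments are bounded only near x, and their weights must be localized. -/
lemma lintegral_mul_err_sq_le (j : Fin (S.size g)) {ψ : Ω → ℝ≥0∞}
    (hψ : Measurable[S.sigmaX g] ψ) :
    ∫⁻ ω, ψ ω * ENNReal.ofReal (S.err pop.m g j ω ^ 2) ∂P ≤
      ENNReal.ofReal Q * ∫⁻ ω, ψ ω ∂P :=
  (hS.variance g j).lintegral_mul_le (S.sigmaX_le g) ((S.measurable_err hm g j).pow_const 2)
    (fun _ => sq_nonneg _) (D := Set.univ) MeasurableSet.univ
    (fun _ _ => (le_abs_self _).trans (hB.sigmaSq_le _)) hψ (fun ω h => absurd (Set.mem_univ ω) h)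

lemma lintegral_mul_err_four_le (j : Fin (S.size g)) {ψ : Ω → ℝ≥0∞}
    (hψ : Measurable[S.sigmaX g] ψ)
    (h0 : ∀ ω, S.X g j ω ∉ Metric.closedBall x ρ → ψ ω = 0) :
    ∫⁻ ω, ψ ω * ENNReal.ofReal (S.err pop.m g j ω ^ 4) ∂P ≤
      ENNReal.ofReal V * ∫⁻ ω, ψ ω ∂P :=
  (hS.fourth g j).lintegral_mul_le (S.sigmaX_le g) ((S.measurable_err hm g j).pow_const 4)
    (fun _ => by positivity) (D := S.X g j ⁻¹' Metric.closedBall x ρ)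
    (S.measurable_X_sigmaX g j Metric.isClosed_closedBall.measurableSet)
    (fun ω hω => hB.fourth_le _ hω) hψ h0

lemma memLp_err (j : Fin (S.size g)) : MemLp (S.err pop.m g j) 2 P := by
  refine memLp_two_of_lintegral (S.measurable_err hm g j) ?_
  have h := lintegral_mul_err_sq_le hS hB hm g j (ψ := fun _ => 1) measurable_const
  simp only [one_mul, lintegral_const, measure_univ, mul_one] at h
  exact h.trans_lt ENNReal.ofReal_lt_top

omit hS hB hm [IsProbabilityMeasure P] in
-- Cauchy–Schwarz restricted to the members with nonzero weight, so that the count near y appears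
-- and not the cluster size.
lemma sq_sum_weighted_le {a : Fin (S.size g) → ℝ} {C : ℝ} {y : RegSpace dI dC} {r : ℝ} {ω : Ω}
    (haC : ∀ j, |a j| ≤ C) (ha0 : ∀ j, j ∉ S.near y r g ω → a j = 0) (e : Fin (S.size g) → ℝ) :
    (∑ j, a j * e j) ^ 2 ≤
      C ^ 2 * ((S.near y r g ω).card * ∑ j ∈ S.near y r g ω, e j ^ 2) := by
  have h1 : ∑ j, a j * e j = ∑ j ∈ S.near y r g ω, a j * e j :=
    (Finset.sum_subset (Finset.subset_univ _) fun j _ hj => by rw [ha0 j hj, zero_mul]).symm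
  rw [h1]
  refine sq_sum_le_card_mul_sum_sq.trans ?_
  calc ((S.near y r g ω).card : ℝ) * ∑ j ∈ S.near y r g ω, (a j * e j) ^ 2
      ≤ (S.near y r g ω).card * ∑ j ∈ S.near y r g ω, C ^ 2 * e j ^ 2 := by
        gcongr with j hj
        rw [mul_pow]
        have : a j ^ 2 ≤ C ^ 2 := by
          rw [← sq_abs]
          have := haC j
          gcongr
        gcongr
    _ = _ := by rw [← Finset.mul_sum]; ring

/-- The count and the membership indicators are functions of the regressors; conditionally on these
each squared error costs Q, and summing the indicators returns one more factor of the count. -/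
lemma lintegral_card_mul_sum_le {φ : ℕ → ℝ≥0∞} (y : RegSpace dI dC) (r : ℝ) :
    ∫⁻ ω, φ (S.near y r g ω).card *
        ENNReal.ofReal (∑ j ∈ S.near y r g ω, S.err pop.m g j ω ^ 2) ∂P ≤
      ENNReal.ofReal Q * ∫⁻ ω, φ (S.near y r g ω).card * (S.near y r g ω).card ∂P := by
  classical
  set ψ : Fin (S.size g) → Ω → ℝ≥0∞ := fun j =>
    {ω | j ∈ S.near y r g ω}.indicator fun ω => φ (S.near y r g ω).card
  have hψ : ∀ j, Measurable[S.sigmaX g] (ψ j) := fun j =>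
    (measurable_cast_near y r g).indicator (S.measurableSet_near y r g j)
  have hmono : ∀ j, Measurable (ψ j) := fun j => (hψ j).mono (S.sigmaX_le g) le_rfl
  have e1 : ∀ ω, φ (S.near y r g ω).card *
      ENNReal.ofReal (∑ j ∈ S.near y r g ω, S.err pop.m g j ω ^ 2) =
      ∑ j, ψ j ω * ENNReal.ofReal (S.err pop.m g j ω ^ 2) := fun ω => by
    rw [ENNReal.ofReal_sum_of_nonneg fun _ _ => sq_nonneg _, Finset.mul_sum,
      ← Finset.sum_subset (Finset.subset_univ (S.near y r g ω)) fun j _ hj => by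
        simp [ψ, hj]]
    exact Finset.sum_congr rfl fun j hj => by simp [ψ, hj]
  have e2 : ∀ ω, φ (S.near y r g ω).card * (S.near y r g ω).card = ∑ j, ψ j ω := fun ω => by
    rw [← Finset.sum_subset (Finset.subset_univ (S.near y r g ω)) fun j _ hj => by
        simp [ψ, hj], Finset.sum_congr rfl (g := fun _ => φ (S.near y r g ω).card)
        fun j hj => by simp [ψ, hj]]
    simp [mul_comm]
  have hmul : ∀ j, Measurable fun ω => ψ j ω * ENNReal.ofReal (S.err pop.m g j ω ^ 2) :=
    fun j => (hmono j).mul ((S.measurable_err hm g j).pow_const 2).ennreal_ofReal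
  simp only [e1, e2]
  rw [lintegral_finsetSum _ fun j _ => hmul j, lintegral_finsetSum _ fun j _ => hmono j,
    Finset.mul_sum]
  exact Finset.sum_le_sum fun j _ => lintegral_mul_err_sq_le hS hB hm g j (hψ j)

lemma lintegral_card_mul_sum_four_le {φ : ℕ → ℝ≥0∞} (y : RegSpace dI dC) (r : ℝ)
    (hyr : Metric.closedBall y r ⊆ Metric.closedBall x ρ) :
    ∫⁻ ω, φ (S.near y r g ω).card *
        ENNReal.ofReal (∑ j ∈ S.near y r g ω, S.err pop.m g j ω ^ 4) ∂P ≤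
      ENNReal.ofReal V * ∫⁻ ω, φ (S.near y r g ω).card * (S.near y r g ω).card ∂P := by
  classical
  set ψ : Fin (S.size g) → Ω → ℝ≥0∞ := fun j =>
    {ω | j ∈ S.near y r g ω}.indicator fun ω => φ (S.near y r g ω).card
  have hψ : ∀ j, Measurable[S.sigmaX g] (ψ j) := fun j =>
    (measurable_cast_near y r g).indicator (S.measurableSet_near y r g j)
  have hmono : ∀ j, Measurable (ψ j) := fun j => (hψ j).mono (S.sigmaX_le g) le_rfl
  have e1 : ∀ ω, φ (S.near y r g ω).card *
      ENNReal.ofReal (∑ j ∈ S.near y r g ω, S.err pop.m g j ω ^ 4) =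
      ∑ j, ψ j ω * ENNReal.ofReal (S.err pop.m g j ω ^ 4) := fun ω => by
    rw [ENNReal.ofReal_sum_of_nonneg fun _ _ => by positivity, Finset.mul_sum,
      ← Finset.sum_subset (Finset.subset_univ (S.near y r g ω)) fun j _ hj => by
        simp [ψ, hj]]
    exact Finset.sum_congr rfl fun j hj => by simp [ψ, hj]
  have e2 : ∀ ω, φ (S.near y r g ω).card * (S.near y r g ω).card = ∑ j, ψ j ω := fun ω => by
    rw [← Finset.sum_subset (Finset.subset_univ (S.near y r g ω)) fun j _ hj => by
        simp [ψ, hj], Finset.sum_congr rfl (g := fun _ => φ (S.near y r g ω).card)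
        fun j hj => by simp [ψ, hj]]
    simp [mul_comm]
  have hmul : ∀ j, Measurable fun ω => ψ j ω * ENNReal.ofReal (S.err pop.m g j ω ^ 4) :=
    fun j => (hmono j).mul ((S.measurable_err hm g j).pow_const 4).ennreal_ofReal
  simp only [e1, e2]
  rw [lintegral_finsetSum _ fun j _ => hmul j, lintegral_finsetSum _ fun j _ => hmono j,
    Finset.mul_sum]
  refine Finset.sum_le_sum fun j _ => lintegral_mul_err_four_le hS hB hm g j (hψ j) fun ω hω => ?_
  refine Set.indicator_of_notMem (fun hj => hω (hyr ?_)) _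
  exact S.mem_near.1 hj

/-- Second moment of a local weighted sum of errors over one cluster. -/
lemma lintegral_sq_sum_err_le {a : Fin (S.size g) → Ω → ℝ} {C : ℝ} {y : RegSpace dI dC} {r A : ℝ}
    (hr : 0 ≤ r) (hA : (S.size g : ℝ) * r ^ dI ≤ A) (haC : ∀ j ω, |a j ω| ≤ C)
    (ha0 : ∀ j ω, j ∉ S.near y r g ω → a j ω = 0) :
    ∫⁻ ω, ENNReal.ofReal ((∑ j, a j ω * S.err pop.m g j ω) ^ 2) ∂P ≤
      ENNReal.ofReal (C ^ 2 * Q * countConst dI dC F A * (S.size g * r ^ (dI + dC))) := by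
  calc ∫⁻ ω, ENNReal.ofReal ((∑ j, a j ω * S.err pop.m g j ω) ^ 2) ∂P
      ≤ ∫⁻ ω, ENNReal.ofReal (C ^ 2) * (((S.near y r g ω).card : ℝ≥0∞) *
          ENNReal.ofReal (∑ j ∈ S.near y r g ω, S.err pop.m g j ω ^ 2)) ∂P := by
        refine lintegral_mono fun ω => ?_
        refine (ENNReal.ofReal_le_ofReal (sq_sum_weighted_le g (fun j => haC j ω)
          (fun j hj => ha0 j ω hj) _)).trans (le_of_eq ?_)
        rw [ENNReal.ofReal_mul (by positivity), ENNReal.ofReal_mul (by positivity),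
          ENNReal.ofReal_natCast]
    _ ≤ ENNReal.ofReal (C ^ 2) * (ENNReal.ofReal Q *
          ∫⁻ ω, ((S.near y r g ω).card : ℝ≥0∞) ^ 2 ∂P) := by
        rw [lintegral_const_mul' _ _ ENNReal.ofReal_ne_top]
        gcongr
        simp only [sq ((S.near y r g _).card : ℝ≥0∞)]
        exact lintegral_card_mul_sum_le hS hB hm g (φ := fun c => (c : ℝ≥0∞)) y r
    _ ≤ ENNReal.ofReal (C ^ 2) * (ENNReal.ofReal Q *
          ENNReal.ofReal (countConst dI dC F A * (S.size g * r ^ (dI + dC)))) := by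
        gcongr
        exact lintegral_card_sq_le hS hB g y hr hA
    _ = _ := by
      rw [← ENNReal.ofReal_mul hB.Q_pos.le, ← ENNReal.ofReal_mul (by positivity)]
      congr 1; ring

/-- Fourth moment of a local weighted sum of errors over one cluster. -/
lemma lintegral_four_sum_err_le {a : Fin (S.size g) → Ω → ℝ} {C : ℝ} {y : RegSpace dI dC}
    {r A : ℝ} (hr : 0 ≤ r) (hA : (S.size g : ℝ) * r ^ dI ≤ A)
    (hyr : Metric.closedBall y r ⊆ Metric.closedBall x ρ) (haC : ∀ j ω, |a j ω| ≤ C)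
    (ha0 : ∀ j ω, j ∉ S.near y r g ω → a j ω = 0) :
    ∫⁻ ω, ENNReal.ofReal ((∑ j, a j ω * S.err pop.m g j ω) ^ 4) ∂P ≤
      ENNReal.ofReal (C ^ 4 * V * countConst dI dC F A * (S.size g * r ^ (dI + dC))) := by
  calc ∫⁻ ω, ENNReal.ofReal ((∑ j, a j ω * S.err pop.m g j ω) ^ 4) ∂P
      ≤ ∫⁻ ω, ENNReal.ofReal (C ^ 4) * (((S.near y r g ω).card : ℝ≥0∞) ^ 3 *
          ENNReal.ofReal (∑ j ∈ S.near y r g ω, S.err pop.m g j ω ^ 4)) ∂P := by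
        refine lintegral_mono fun ω => ?_
        -- Cauchy–Schwarz twice: the fourth power is at most C⁴ times the cube of the count times
        -- the sum of e⁴ over the nearby members.
        have h1 := sq_sum_weighted_le g (fun j => haC j ω)
          (fun j hj => ha0 j ω hj) (fun j => S.err pop.m g j ω)
        have h2 : (∑ j ∈ S.near y r g ω, S.err pop.m g j ω ^ 2) ^ 2 ≤
            (S.near y r g ω).card * ∑ j ∈ S.near y r g ω, S.err pop.m g j ω ^ 4 := by
          refine sq_sum_le_card_mul_sum_sq.trans (le_of_eq ?_)
          congr 1
          exact Finset.sum_congr rfl fun j _ => by ring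
        have h3 : (∑ j, a j ω * S.err pop.m g j ω) ^ 4 ≤ C ^ 4 * ((S.near y r g ω).card ^ 3 *
            ∑ j ∈ S.near y r g ω, S.err pop.m g j ω ^ 4) := by
          calc (∑ j, a j ω * S.err pop.m g j ω) ^ 4
              = ((∑ j, a j ω * S.err pop.m g j ω) ^ 2) ^ 2 := by ring
            _ ≤ (C ^ 2 * ((S.near y r g ω).card *
                ∑ j ∈ S.near y r g ω, S.err pop.m g j ω ^ 2)) ^ 2 := by gcongr
            _ = C ^ 4 * (S.near y r g ω).card ^ 2 *
                (∑ j ∈ S.near y r g ω, S.err pop.m g j ω ^ 2) ^ 2 := by ring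
            _ ≤ C ^ 4 * (S.near y r g ω).card ^ 2 * ((S.near y r g ω).card *
                ∑ j ∈ S.near y r g ω, S.err pop.m g j ω ^ 4) := by
              have : (0 : ℝ) ≤ C ^ 4 := by positivity
              gcongr
            _ = _ := by ring
        refine (ENNReal.ofReal_le_ofReal h3).trans (le_of_eq ?_)
        rw [ENNReal.ofReal_mul (by positivity), ENNReal.ofReal_mul (by positivity),
          ENNReal.ofReal_pow (Nat.cast_nonneg _), ENNReal.ofReal_natCast]
    _ ≤ ENNReal.ofReal (C ^ 4) * (ENNReal.ofReal V *
          ∫⁻ ω, ((S.near y r g ω).card : ℝ≥0∞) ^ 4 ∂P) := by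
        rw [lintegral_const_mul' _ _ ENNReal.ofReal_ne_top]
        gcongr
        simp only [pow_succ _ 3]
        exact lintegral_card_mul_sum_four_le hS hB hm g (φ := fun c => (c : ℝ≥0∞) ^ 3) y r hyr
    _ ≤ ENNReal.ofReal (C ^ 4) * (ENNReal.ofReal V *
          ENNReal.ofReal (countConst dI dC F A * (S.size g * r ^ (dI + dC)))) := by
        gcongr
        exact lintegral_card_four_le hS hB g y hr hA
    _ = _ := by
      rw [← ENNReal.ofReal_mul hB.V_pos.le, ← ENNReal.ofReal_mul (by positivity)]
      congr 1; ring

/-- Second moment of a local weighted sum of products of errors over one cluster. -/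
lemma lintegral_sq_sum_mul_err_le {w : Fin (S.size g) → Fin (S.size g) → Ω → ℝ}
    (hw : ∀ j l, Measurable[S.sigmaX g] (w j l)) (hw0 : ∀ j l ω, 0 ≤ w j l ω)
    (hwx : ∀ j l ω, w j l ω ≠ 0 →
      S.X g j ω ∈ Metric.closedBall x ρ ∧ S.X g l ω ∈ Metric.closedBall x ρ) :
    ∫⁻ ω, ENNReal.ofReal ((∑ j, ∑ l, w j l ω * (S.err pop.m g j ω * S.err pop.m g l ω)) ^ 2) ∂P ≤
      ENNReal.ofReal V * ∫⁻ ω, ENNReal.ofReal ((∑ j, ∑ l, w j l ω) ^ 2) ∂P := by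
  set s : Ω → ℝ := fun ω => ∑ j, ∑ l, w j l ω
  have hs : Measurable[S.sigmaX g] s :=
    Finset.measurable_sum (m := S.sigmaX g) _ fun j _ =>
      Finset.measurable_sum (m := S.sigmaX g) _ fun l _ => hw j l
  have hs0 : ∀ ω, 0 ≤ s ω := fun ω =>
    Finset.sum_nonneg fun j _ => Finset.sum_nonneg fun l _ => hw0 j l ω
  set ψ : Fin (S.size g) → Fin (S.size g) → Ω → ℝ≥0∞ := fun j l ω =>
    ENNReal.ofReal (s ω * w j l ω / 2)
  have hψ : ∀ j l, Measurable[S.sigmaX g] (ψ j l) := fun j l =>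
    ((hs.mul (hw j l)).div_const 2).ennreal_ofReal
  have hψm : ∀ j l, Measurable (ψ j l) := fun j l => (hψ j l).mono (S.sigmaX_le g) le_rfl
  have he : ∀ j, Measurable fun ω => ENNReal.ofReal (S.err pop.m g j ω ^ 4) := fun j =>
    ((S.measurable_err hm g j).pow_const 4).ennreal_ofReal
  have hpt : ∀ ω, ENNReal.ofReal
      ((∑ j, ∑ l, w j l ω * (S.err pop.m g j ω * S.err pop.m g l ω)) ^ 2) ≤
      ∑ j, ∑ l, (ψ j l ω * ENNReal.ofReal (S.err pop.m g j ω ^ 4) +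
        ψ j l ω * ENNReal.ofReal (S.err pop.m g l ω ^ 4)) := by
    intro ω
    set e := fun j => S.err pop.m g j ω
    -- Cauchy–Schwarz with respect to the nonnegative weights w, so that the total weight, a
    -- function of the regressors, splits off.
    have hcs : (∑ j, ∑ l, w j l ω * (e j * e l)) ^ 2 ≤
        s ω * ∑ j, ∑ l, w j l ω * (e j * e l) ^ 2 := by
      simp only [s, ← Finset.sum_product']
      refine Finset.sum_sq_le_sum_mul_sum_of_sq_le_mul _ (fun i _ => hw0 _ _ ω)
        (fun i _ => mul_nonneg (hw0 _ _ ω) (sq_nonneg _)) fun i _ => le_of_eq (by ring)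
    -- From e_j² e_l² ≤ (e_j⁴ + e_l⁴)/2, fourth moments of single errors suffice.
    have h2 : s ω * ∑ j, ∑ l, w j l ω * (e j * e l) ^ 2 ≤
        ∑ j, ∑ l, (s ω * w j l ω / 2 * e j ^ 4 + s ω * w j l ω / 2 * e l ^ 4) := by
      simp only [Finset.mul_sum]
      refine Finset.sum_le_sum fun j _ => Finset.sum_le_sum fun l _ => ?_
      have h3 : 0 ≤ s ω * w j l ω := mul_nonneg (hs0 ω) (hw0 j l ω)
      nlinarith [mul_nonneg h3 (sq_nonneg (e j ^ 2 - e l ^ 2))]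
    refine (ENNReal.ofReal_le_ofReal (hcs.trans h2)).trans (le_of_eq ?_)
    have h5 : ∀ j l, 0 ≤ s ω * w j l ω / 2 := fun j l =>
      div_nonneg (mul_nonneg (hs0 ω) (hw0 j l ω)) (by norm_num)
    have h6 : ∀ j l i, 0 ≤ s ω * w j l ω / 2 * e i ^ 4 := fun j l i =>
      mul_nonneg (h5 j l) (by positivity)
    rw [ENNReal.ofReal_sum_of_nonneg fun j _ => Finset.sum_nonneg fun l _ =>
      add_nonneg (h6 _ _ _) (h6 _ _ _)]
    refine Finset.sum_congr rfl fun j _ => ?_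
    rw [ENNReal.ofReal_sum_of_nonneg fun l _ => add_nonneg (h6 _ _ _) (h6 _ _ _)]
    refine Finset.sum_congr rfl fun l _ => ?_
    rw [ENNReal.ofReal_add (h6 _ _ _) (h6 _ _ _), ENNReal.ofReal_mul (h5 j l),
      ENNReal.ofReal_mul (h5 j l)]
  have hmul : ∀ j l, Measurable fun ω => ψ j l ω * ENNReal.ofReal (S.err pop.m g j ω ^ 4) +
      ψ j l ω * ENNReal.ofReal (S.err pop.m g l ω ^ 4) := fun j l =>
    ((hψm j l).mul (he j)).add ((hψm j l).mul (he l))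
  refine (lintegral_mono hpt).trans ?_
  rw [lintegral_sum_sum hmul]
  have hterm : ∀ j l, ∫⁻ ω, (ψ j l ω * ENNReal.ofReal (S.err pop.m g j ω ^ 4) +
      ψ j l ω * ENNReal.ofReal (S.err pop.m g l ω ^ 4)) ∂P ≤
      ENNReal.ofReal V * ∫⁻ ω, ENNReal.ofReal (s ω * w j l ω) ∂P := by
    intro j l
    have hz : ∀ i, (∀ ω, w j l ω ≠ 0 → S.X g i ω ∈ Metric.closedBall x ρ) →
        ∀ ω, S.X g i ω ∉ Metric.closedBall x ρ → ψ j l ω = 0 := fun i hi ω hω => by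
      have : w j l ω = 0 := by
        by_contra hne
        exact hω (hi ω hne)
      simp [ψ, this]
    have hl : Measurable fun ω => ψ j l ω * ENNReal.ofReal (S.err pop.m g j ω ^ 4) :=
      (hψm j l).mul (he j)
    rw [lintegral_add_left hl]
    refine (add_le_add
      (lintegral_mul_err_four_le hS hB hm g j (hψ j l) (hz j fun ω h => (hwx j l ω h).1))
      (lintegral_mul_err_four_le hS hB hm g l (hψ j l) (hz l fun ω h => (hwx j l ω h).2))).trans ?_
    rw [← mul_add, ← lintegral_add_left (hψm j l)]
    refine mul_le_mul_right (lintegral_mono fun ω => le_of_eq ?_) _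
    have h5 : 0 ≤ s ω * w j l ω / 2 := div_nonneg (mul_nonneg (hs0 ω) (hw0 j l ω)) (by norm_num)
    simp only [ψ]
    rw [← ENNReal.ofReal_add h5 h5]
    congr 1; ring
  have hsw : ∀ j l, Measurable fun ω => ENNReal.ofReal (s ω * w j l ω) := fun j l =>
    ((hs.mul (hw j l)).ennreal_ofReal).mono (S.sigmaX_le g) le_rfl
  refine (Finset.sum_le_sum fun j _ => Finset.sum_le_sum fun l _ => hterm j l).trans
    (le_of_eq ?_)
  simp only [← Finset.mul_sum]
  congr 1
  rw [← lintegral_sum_sum hsw]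
  refine lintegral_congr fun ω => ?_
  have h5 : ∀ j l, 0 ≤ s ω * w j l ω := fun j l => mul_nonneg (hs0 ω) (hw0 j l ω)
  simp only [← ENNReal.ofReal_sum_of_nonneg fun l _ => h5 _ l]
  rw [← ENNReal.ofReal_sum_of_nonneg fun j _ => Finset.sum_nonneg fun l _ => h5 j l]
  congr 1
  simp only [← Finset.mul_sum]
  rw [sq]

end Errors

end ClusterKernel

namespace ClusterKernel

variable {dI dC : ℕ}

/-! ## Kernel-weighted sums of errors, and their value at the regressors of one cluster -/

namespace ClusterSample

variable {Ω : Type*} [mΩ : MeasurableSpace Ω] (S : ClusterSample dI dC Ω)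

/-- The observations of cluster `g`. -/
abbrev data (g : Fin S.G) (ω : Ω) : (Fin (S.size g) → ℝ) × (Fin (S.size g) → RegSpace dI dC) :=
  (fun j => S.Y g j ω, fun j => S.X g j ω)

lemma measurable_data (g : Fin S.G) : Measurable (S.data g) :=
  (measurable_pi_lambda _ fun j => S.measurable_Y g j).prodMk
    (measurable_pi_lambda _ fun j => S.measurable_X g j)

/-- The contribution of cluster `g` to the kernel-weighted sum of errors. -/
noncomputable def kernErr (m : RegSpace dI dC → ℝ) (w : RegSpace dI dC → ℝ) (h : ℝ)
    (y : RegSpace dI dC) (g : Fin S.G) (ω : Ω) : ℝ :=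
  ∑ j, w (h⁻¹ • (S.X g j ω - y)) * S.err m g j ω

lemma measurable_kernErr {m w : RegSpace dI dC → ℝ} (hm : Continuous m) (hw : Measurable w) (h : ℝ)
    (y : RegSpace dI dC) (g : Fin S.G) : Measurable (S.kernErr m w h y g) :=
  Finset.measurable_sum _ fun j _ =>
    (hw.comp (((S.measurable_X g j).sub_const y).const_smul h⁻¹)).mul (S.measurable_err hm g j)

lemma weight_eq_zero {w : RegSpace dI dC → ℝ} {C R h : ℝ} (hw : IsWeight w C R) (hh : 0 < h)
    {y : RegSpace dI dC} {g : Fin S.G} {j : Fin (S.size g)} {ω : Ω}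
    (hj : j ∉ S.near y (R * h) g ω) : w (h⁻¹ • (S.X g j ω - y)) = 0 := by
  refine hw.support _ ?_
  rw [S.mem_near, Metric.mem_closedBall, dist_eq_norm, not_le] at hj
  rw [norm_smul, norm_inv, Real.norm_of_nonneg hh.le, inv_mul_eq_div, lt_div_iff₀ hh]
  exact hj

lemma n_eq_sum : (S.n : ℝ) = ∑ g, (S.size g : ℝ) := by simp [n]

end ClusterSample

section Decouple

variable {Ω : Type*} [mΩ : MeasurableSpace Ω] {P : Measure Ω} [IsProbabilityMeasure P]
  {S : ClusterSample dI dC Ω} {pop : Population dI dC} {x : RegSpace dI dC} {F Q V c ρ : ℝ}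

omit [IsProbabilityMeasure P] in
-- Any statistic of a cluster's own data inherits the independence of the clusters; later uses only
-- exhibit the function of the data.
lemma iIndepFun_of_data (hS : IsGenerated P S pop) {β : Type*} [MeasurableSpace β]
    {T : Fin S.G → Ω → β}
    (hT : ∀ g, ∃ τ : (Fin (S.size g) → ℝ) × (Fin (S.size g) → RegSpace dI dC) → β,
      Measurable τ ∧ ∀ ω, T g ω = τ (S.data g ω)) : iIndepFun T P := by
  choose τ hτ he using hT
  have : T = fun g => τ g ∘ S.data g := by
    funext g ω; exact he g ω
  rw [this]
  exact hS.indep.comp τ hτ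

/-- Sums over the other clusters, evaluated at a regressor of cluster `g`. -/
lemma lintegral_others_le (hS : IsGenerated P S pop) (g : Fin S.G) (j : Fin (S.size g))
    {ψ : Ω → ℝ≥0∞} (hψ : Measurable[S.sigmaX g] ψ)
    (τ : (i : Fin S.G) → RegSpace dI dC ×
      ((Fin (S.size i) → ℝ) × (Fin (S.size i) → RegSpace dI dC)) → ℝ)
    (hτ : ∀ i, Measurable (τ i)) {q : ℝ → ℝ≥0∞} (hq : Measurable q) {K : ℝ≥0∞}
    (hle : ∀ y, ∫⁻ ω, q (∑ i ∈ Finset.univ.erase g, τ i (y, S.data i ω)) ∂P ≤ K) :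
    ∫⁻ ω, ψ ω * q (∑ i ∈ Finset.univ.erase g, τ i (S.X g j ω, S.data i ω)) ∂P ≤
      K * ∫⁻ ω, ψ ω ∂P := by
  -- Doob–Dynkin: a weight measurable with respect to the regressors of cluster g is a function of
  -- them.
  obtain ⟨ψ', hψ', rfl⟩ := hψ.exists_eq_measurable_comp
  have hind := hS.indep.indepFun_finset {g} (Finset.univ.erase g) (by simp) S.measurable_data
  set A : Ω → (i : ({g} : Finset (Fin S.G))) →
    (Fin (S.size i) → ℝ) × (Fin (S.size i) → RegSpace dI dC) := fun ω i => S.data i ω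
  set B : Ω → (i : (Finset.univ.erase g : Finset (Fin S.G))) →
    (Fin (S.size i) → ℝ) × (Fin (S.size i) → RegSpace dI dC) := fun ω i => S.data i ω
  have hA : Measurable A := measurable_pi_lambda _ fun i => S.measurable_data i
  have hB : Measurable B := measurable_pi_lambda _ fun i => S.measurable_data i
  have hg : g ∈ ({g} : Finset (Fin S.G)) := Finset.mem_singleton_self g
  have hsnd : Measurable fun a : (i : ({g} : Finset (Fin S.G))) →
      (Fin (S.size i) → ℝ) × (Fin (S.size i) → RegSpace dI dC) => (a ⟨g, hg⟩).2 :=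
    measurable_snd.comp (measurable_pi_apply (⟨g, hg⟩ : ({g} : Finset (Fin S.G))))
  have hX : Measurable fun a : (i : ({g} : Finset (Fin S.G))) →
      (Fin (S.size i) → ℝ) × (Fin (S.size i) → RegSpace dI dC) => (a ⟨g, hg⟩).2 j :=
    (measurable_pi_apply j).comp hsnd
  have hsum : ∀ y ω, ∑ i : (Finset.univ.erase g : Finset (Fin S.G)), τ i (y, B ω i) =
      ∑ i ∈ Finset.univ.erase g, τ i (y, S.data i ω) := fun y ω =>
    Finset.sum_coe_sort (Finset.univ.erase g) (fun i => τ i (y, S.data i ω))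
  -- The weight and the evaluation point X_gj are functions of the data of cluster g alone; the
  -- remaining clusters are independent of it, and the bound for fixed y applies to each frozen
  -- value.
  have key := lintegral_indep_le (P := P) hA hB hind
    (H := fun z => ψ' (z.1 ⟨g, hg⟩).2 * q (∑ i : (Finset.univ.erase g : Finset (Fin S.G)),
      τ i ((z.1 ⟨g, hg⟩).2 j, z.2 i))) ?_ (ψ := fun a => K * ψ' (a ⟨g, hg⟩).2)
    ((hψ'.comp hsnd).const_mul K) ?_
  · simp only [hsum] at key
    refine key.trans (le_of_eq ?_)
    exact lintegral_const_mul _ (hψ'.comp (hsnd.comp hA))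
  · refine Measurable.mul (hψ'.comp (hsnd.comp measurable_fst)) (hq.comp ?_)
    refine Finset.measurable_sum _ fun i _ => (hτ i).comp ?_
    exact (hX.comp measurable_fst).prodMk ((measurable_pi_apply i).comp measurable_snd)
  · intro a
    simp only [hsum]
    rw [lintegral_const_mul, mul_comm]
    · exact mul_le_mul_left (hle _) _
    · refine hq.comp (Finset.measurable_sum _ fun i _ => ?_)
      exact (hτ i).comp (measurable_const.prodMk (S.measurable_data i))

variable (hS : IsGenerated P S pop) (hB : PopBound pop x F Q V c ρ) (hm : Continuous pop.m)
include hS hB hm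

lemma lintegral_kernErr_sq_le {w : RegSpace dI dC → ℝ} {C R h A : ℝ} (hw : IsWeight w C R)
    (hR : 0 ≤ R) (hh : 0 < h) (g : Fin S.G) (hA : (S.size g : ℝ) * (R * h) ^ dI ≤ A)
    (y : RegSpace dI dC) :
    ∫⁻ ω, ENNReal.ofReal (S.kernErr pop.m w h y g ω ^ 2) ∂P ≤
      ENNReal.ofReal (C ^ 2 * Q * countConst dI dC F A * (S.size g * (R * h) ^ (dI + dC))) :=
  lintegral_sq_sum_err_le hS hB hm g (y := y) (a := fun j ω => w (h⁻¹ • (S.X g j ω - y)))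
    (by positivity) hA (fun _ _ => hw.bound _) fun _ _ hj => S.weight_eq_zero hw hh hj

lemma memLp_kernErr {w : RegSpace dI dC → ℝ} {C R h : ℝ} (hw : IsWeight w C R) (y : RegSpace dI dC)
    (g : Fin S.G) : MemLp (S.kernErr pop.m w h y g) 2 P := by
  refine memLp_finsetSum _ fun j _ => ?_
  refine (memLp_err hS hB hm g j).of_le_mul (c := C)
    ((hw.measurable.comp (((S.measurable_X g j).sub_const y).const_smul h⁻¹)).mul
      (S.measurable_err hm g j)).aestronglyMeasurable (ae_of_all _ fun ω => ?_)
  rw [norm_mul]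
  gcongr
  exact hw.bound _

/-- The weights depend on the regressors, given which the errors have mean zero. This exact centring
makes the variance bound and the central limit theorem applicable. -/
lemma integral_kernErr {w : RegSpace dI dC → ℝ} {C R h : ℝ} (hw : IsWeight w C R)
    (y : RegSpace dI dC) (g : Fin S.G) : ∫ ω, S.kernErr pop.m w h y g ω ∂P = 0 := by
  unfold ClusterSample.kernErr
  have hme : ∀ j, Measurable[S.sigmaX g] fun ω => w (h⁻¹ • (S.X g j ω - y)) := fun j =>
    hw.measurable.comp (((S.measurable_X_sigmaX g j).sub_const y).const_smul h⁻¹)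
  rw [integral_finsetSum]
  · refine Finset.sum_eq_zero fun j _ => ?_
    rw [(hS.mean_zero g j).integral_mul_eq (S.sigmaX_le g)
      ((memLp_err hS hB hm g j).integrable (by norm_num)) (hme j) (fun ω => hw.bound _)]
    simp
  · intro j _
    exact ((memLp_err hS hB hm g j).integrable (by norm_num)).bdd_mul
      ((hme j).mono (S.sigmaX_le g) le_rfl).aestronglyMeasurable
      (c := C) (ae_of_all _ fun ω => hw.bound _)

omit [IsProbabilityMeasure P] hB in
lemma iIndepFun_kernErr {w : RegSpace dI dC → ℝ} (hw : Measurable w) (h : ℝ)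
    (y : RegSpace dI dC) : iIndepFun (S.kernErr pop.m w h y) P := by
  refine iIndepFun_of_data hS fun g => ⟨fun z => ∑ j, w (h⁻¹ • (z.2 j - y)) *
    (z.1 j - pop.m (z.2 j)), ?_, fun ω => rfl⟩
  have hX : ∀ j, Measurable fun z : (Fin (S.size g) → ℝ) × (Fin (S.size g) → RegSpace dI dC) =>
    z.2 j := fun j => (measurable_pi_apply j).comp measurable_snd
  have hY : ∀ j, Measurable fun z : (Fin (S.size g) → ℝ) × (Fin (S.size g) → RegSpace dI dC) =>
    z.1 j := fun j => (measurable_pi_apply j).comp measurable_fst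
  exact Finset.measurable_sum _ fun j _ =>
    (hw.comp (((hX j).sub_const y).const_smul h⁻¹)).mul ((hY j).sub (hm.measurable.comp (hX j)))

/-- Centred independent clusters have additive second moments, each O(n_g h^d). An arbitrary set of
clusters is allowed because the cluster of the evaluation point is left out later. -/
lemma lintegral_sum_kernErr_sq_le {w : RegSpace dI dC → ℝ} {C R h A : ℝ} (hw : IsWeight w C R)
    (hR : 0 ≤ R) (hh : 0 < h) (hA : ∀ g, (S.size g : ℝ) * (R * h) ^ dI ≤ A) (hA0 : 0 ≤ A)
    (s : Finset (Fin S.G)) (y : RegSpace dI dC) :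
    ∫⁻ ω, ENNReal.ofReal ((∑ g ∈ s, S.kernErr pop.m w h y g ω) ^ 2) ∂P ≤
      ENNReal.ofReal (C ^ 2 * Q * countConst dI dC F A * (S.n * (R * h) ^ (dI + dC))) := by
  have hK := countConst_nonneg (dI := dI) (dC := dC) hB.F_pos.le hA0
  have hQ := hB.Q_pos
  have h1 := lintegral_sq_sum_sub_le (P := P) s
    (fun g _ => memLp_kernErr hS hB hm hw (h := h) y g) (iIndepFun_kernErr hS hm hw.measurable h y)
  simp only [integral_kernErr hS hB hm hw, Finset.sum_const_zero, sub_zero] at h1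
  refine h1.trans ((Finset.sum_le_sum fun g _ =>
    lintegral_kernErr_sq_le hS hB hm hw hR hh g (hA g) y).trans ?_)
  rw [← ENNReal.ofReal_sum_of_nonneg fun g _ => by positivity, S.n_eq_sum, Finset.sum_mul,
    Finset.mul_sum]
  refine ENNReal.ofReal_le_ofReal (Finset.sum_le_sum_of_subset_of_nonneg (Finset.subset_univ s) ?_)
  intro g _ _
  positivity

/-- In its own cluster the evaluation point cannot be frozen, and localization is given up: all
members of the cluster are counted, at the price max n_g². -/
lemma lintegral_own_kernErr_sq_le {w : RegSpace dI dC → ℝ} {C R h : ℝ} (hw : IsWeight w C R)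
    (g : Fin S.G) (j : Fin (S.size g)) {ψ : Ω → ℝ≥0∞} (hψ : Measurable[S.sigmaX g] ψ) :
    ∫⁻ ω, ψ ω * ENNReal.ofReal (S.kernErr pop.m w h (S.X g j ω) g ω ^ 2) ∂P ≤
      ENNReal.ofReal (C ^ 2 * Q * S.maxSize ^ 2) * ∫⁻ ω, ψ ω ∂P := by
  have hQ := hB.Q_pos
  have hψ' : Measurable ψ := hψ.mono (S.sigmaX_le g) le_rfl
  have hpt : ∀ ω, ψ ω * ENNReal.ofReal (S.kernErr pop.m w h (S.X g j ω) g ω ^ 2) ≤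
      ENNReal.ofReal (C ^ 2 * S.size g) *
        ∑ l, ψ ω * ENNReal.ofReal (S.err pop.m g l ω ^ 2) := fun ω => by
    have h1 : S.kernErr pop.m w h (S.X g j ω) g ω ^ 2 ≤
        C ^ 2 * S.size g * ∑ l, S.err pop.m g l ω ^ 2 := by
      refine sq_sum_le_card_mul_sum_sq.trans ?_
      rw [Finset.card_univ, Fintype.card_fin, mul_comm (C ^ 2), mul_assoc,
        Finset.mul_sum (f := fun l => S.err pop.m g l ω ^ 2) (a := C ^ 2)]
      refine mul_le_mul_of_nonneg_left (Finset.sum_le_sum fun l _ => ?_) (by positivity)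
      rw [mul_pow]
      refine mul_le_mul_of_nonneg_right ?_ (sq_nonneg _)
      rw [← sq_abs]
      exact pow_le_pow_left₀ (abs_nonneg _) (hw.bound _) 2
    calc ψ ω * ENNReal.ofReal (S.kernErr pop.m w h (S.X g j ω) g ω ^ 2)
        ≤ ψ ω * ENNReal.ofReal (C ^ 2 * S.size g * ∑ l, S.err pop.m g l ω ^ 2) := by gcongr
      _ = _ := by
        rw [ENNReal.ofReal_mul (by positivity), ENNReal.ofReal_sum_of_nonneg fun _ _ => sq_nonneg _,
          ← Finset.mul_sum]
        ring
  refine (lintegral_mono hpt).trans ?_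
  have hme : ∀ l, Measurable fun ω => ψ ω * ENNReal.ofReal (S.err pop.m g l ω ^ 2) := fun l =>
    hψ'.mul ((S.measurable_err hm g l).pow_const 2).ennreal_ofReal
  rw [lintegral_const_mul _ (Finset.measurable_sum _ fun l _ => hme l),
    lintegral_finsetSum _ fun l _ => hme l]
  refine (mul_le_mul_right (Finset.sum_le_sum fun l _ =>
    lintegral_mul_err_sq_le hS hB hm g l hψ) _).trans ?_
  rw [Finset.sum_const, Finset.card_univ, Fintype.card_fin, nsmul_eq_mul, ← mul_assoc, ← mul_assoc,
    ← ENNReal.ofReal_natCast, ← ENNReal.ofReal_mul (by positivity),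
    ← ENNReal.ofReal_mul (by positivity)]
  refine mul_le_mul_left (ENNReal.ofReal_le_ofReal ?_) _
  have : (S.size g : ℝ) ≤ S.maxSize := by exact_mod_cast S.size_le_maxSize g
  calc C ^ 2 * S.size g * S.size g * Q = C ^ 2 * Q * (S.size g : ℝ) ^ 2 := by ring
    _ ≤ _ := by gcongr

/-- The kernel-weighted sum of errors at a regressor: the dependence on its cluster is negligible. -/
lemma lintegral_mul_sum_kernErr_sq_le {w : RegSpace dI dC → ℝ} {C R h A : ℝ} (hw : IsWeight w C R)
    (hR : 0 ≤ R) (hh : 0 < h) (hA : ∀ g, (S.size g : ℝ) * (R * h) ^ dI ≤ A) (hA0 : 0 ≤ A)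
    (g : Fin S.G) (j : Fin (S.size g)) {ψ : Ω → ℝ≥0∞} (hψ : Measurable[S.sigmaX g] ψ) :
    ∫⁻ ω, ψ ω * ENNReal.ofReal ((∑ i, S.kernErr pop.m w h (S.X g j ω) i ω) ^ 2) ∂P ≤
      ENNReal.ofReal (2 * C ^ 2 * Q * (countConst dI dC F A * (S.n * (R * h) ^ (dI + dC)) +
        S.maxSize ^ 2)) * ∫⁻ ω, ψ ω ∂P := by
  have hK := countConst_nonneg (dI := dI) (dC := dC) hB.F_pos.le hA0
  have hQ := hB.Q_pos
  have hψ' : Measurable ψ := hψ.mono (S.sigmaX_le g) le_rfl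
  have hX : ∀ i l, Measurable fun z : RegSpace dI dC × ((Fin (S.size i) → ℝ) ×
    (Fin (S.size i) → RegSpace dI dC)) => z.2.2 l := fun i l =>
    (measurable_pi_apply l).comp (measurable_snd.comp measurable_snd)
  have hY : ∀ i l, Measurable fun z : RegSpace dI dC × ((Fin (S.size i) → ℝ) ×
    (Fin (S.size i) → RegSpace dI dC)) => z.2.1 l := fun i l =>
    (measurable_pi_apply l).comp (measurable_fst.comp measurable_snd)
  have h1 := lintegral_others_le hS g j hψ
    (fun i z => ∑ l, w (h⁻¹ • (z.2.2 l - z.1)) * (z.2.1 l - pop.m (z.2.2 l)))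
    (fun i => Finset.measurable_sum _ fun l _ => Measurable.mul
      (hw.measurable.comp (((hX i l).sub measurable_fst).const_smul h⁻¹))
      ((hY i l).sub (hm.measurable.comp (hX i l))))
    (q := fun t => ENNReal.ofReal (t ^ 2)) (by fun_prop)
    (fun y => lintegral_sum_kernErr_sq_le hS hB hm hw hR hh hA hA0 (Finset.univ.erase g) y)
  have h2 := lintegral_own_kernErr_sq_le hS hB hm hw (h := h) g j hψ
  have hXm : Measurable fun ω => S.kernErr pop.m w h (S.X g j ω) g ω :=
    Finset.measurable_sum _ fun l _ =>
      (hw.measurable.comp (((S.measurable_X g l).sub (S.measurable_X g j)).const_smul h⁻¹)).mul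
        (S.measurable_err hm g l)
  -- The own cluster is split off and (a + b)² ≤ 2a² + 2b² is used.
  have hpt : ∀ ω, ψ ω * ENNReal.ofReal ((∑ i, S.kernErr pop.m w h (S.X g j ω) i ω) ^ 2) ≤
      2 * (ψ ω * ENNReal.ofReal (S.kernErr pop.m w h (S.X g j ω) g ω ^ 2)) +
      2 * (ψ ω * ENNReal.ofReal ((∑ i ∈ Finset.univ.erase g,
        S.kernErr pop.m w h (S.X g j ω) i ω) ^ 2)) := fun ω => by
    have h3 : (∑ i, S.kernErr pop.m w h (S.X g j ω) i ω) ^ 2 ≤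
        2 * S.kernErr pop.m w h (S.X g j ω) g ω ^ 2 + 2 * (∑ i ∈ Finset.univ.erase g,
        S.kernErr pop.m w h (S.X g j ω) i ω) ^ 2 := by
      rw [← Finset.add_sum_erase _ _ (Finset.mem_univ g)]
      nlinarith [sq_nonneg (S.kernErr pop.m w h (S.X g j ω) g ω - ∑ i ∈ Finset.univ.erase g,
        S.kernErr pop.m w h (S.X g j ω) i ω)]
    refine (mul_le_mul_right (ENNReal.ofReal_le_ofReal h3) _).trans (le_of_eq ?_)
    rw [ENNReal.ofReal_add (by positivity) (by positivity), ENNReal.ofReal_mul (by norm_num),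
      ENNReal.ofReal_mul (by norm_num), ENNReal.ofReal_ofNat]
    ring
  refine (lintegral_mono hpt).trans ?_
  have hm1 : Measurable fun ω => 2 * (ψ ω * ENNReal.ofReal
      (S.kernErr pop.m w h (S.X g j ω) g ω ^ 2)) :=
    (hψ'.mul (hXm.pow_const 2).ennreal_ofReal).const_mul 2
  rw [lintegral_add_left hm1, lintegral_const_mul' _ _ (by norm_num),
    lintegral_const_mul' _ _ (by norm_num)]
  refine (add_le_add (mul_le_mul_right h2 2) (mul_le_mul_right h1 2)).trans (le_of_eq ?_)
  rw [← mul_assoc, ← mul_assoc, ← add_mul]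
  congr 1
  rw [← ENNReal.ofReal_ofNat 2, ← ENNReal.ofReal_mul (by norm_num),
    ← ENNReal.ofReal_mul (by norm_num), ← ENNReal.ofReal_add (by positivity) (by positivity)]
  congr 1
  ring

omit hm in
/-- The number of observations near a regressor. -/
lemma lintegral_mul_card_near_le {r : ℝ} (hr : 0 ≤ r) (g : Fin S.G) (j : Fin (S.size g))
    {ψ : Ω → ℝ≥0∞} (hψ : Measurable[S.sigmaX g] ψ) :
    ∫⁻ ω, ψ ω * ENNReal.ofReal (∑ i, ((S.near (S.X g j ω) r i ω).card : ℝ)) ∂P ≤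
      ENNReal.ofReal (F * ballConst dI dC * (S.n * r ^ (dI + dC)) + S.maxSize) *
        ∫⁻ ω, ψ ω ∂P := by
  classical
  have hF := hB.F_pos
  have hK := @ballConst_nonneg dI dC
  have hψ' : Measurable ψ := hψ.mono (S.sigmaX_le g) le_rfl
  have hset : ∀ i l, MeasurableSet {z : RegSpace dI dC × ((Fin (S.size i) → ℝ) ×
      (Fin (S.size i) → RegSpace dI dC)) | z.2.2 l ∈ Metric.closedBall z.1 r} := fun i l => by
    have h2 : Measurable fun z : RegSpace dI dC × ((Fin (S.size i) → ℝ) ×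
      (Fin (S.size i) → RegSpace dI dC)) => z.2.2 l :=
      (measurable_pi_apply l).comp (measurable_snd.comp measurable_snd)
    exact measurableSet_le (h2.dist measurable_fst) measurable_const
  have h1 := lintegral_others_le hS g j hψ
    (fun i z => ∑ l, if z.2.2 l ∈ Metric.closedBall z.1 r then 1 else 0)
    (fun i => Finset.measurable_sum _ fun l _ => Measurable.ite (hset i l)
      measurable_const measurable_const)
    (q := fun t => ENNReal.ofReal t) (by fun_prop)
    (K := ENNReal.ofReal (F * ballConst dI dC * (S.n * r ^ (dI + dC)))) (fun y => by
      have e : ∀ i ω, (∑ l, if S.X i l ω ∈ Metric.closedBall y r then (1 : ℝ) else 0) =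
          (S.near y r i ω).card := fun i ω => by
        rw [S.card_near_eq]; push_cast; rfl
      simp only [e]
      have e2 : ∀ ω, ENNReal.ofReal (∑ i ∈ Finset.univ.erase g, ((S.near y r i ω).card : ℝ)) =
          ∑ i ∈ Finset.univ.erase g, ((S.near y r i ω).card : ℝ≥0∞) := fun ω => by
        rw [ENNReal.ofReal_sum_of_nonneg fun _ _ => by positivity]
        simp
      simp only [e2]
      rw [lintegral_finsetSum _ fun i _ => (measurable_cast_near y r i
        (φ := fun c => (c : ℝ≥0∞))).mono (S.sigmaX_le i) le_rfl]
      refine (Finset.sum_le_sum fun i _ => lintegral_card_le hS hB i y hr).trans ?_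
      rw [← ENNReal.ofReal_sum_of_nonneg fun _ _ => by positivity, S.n_eq_sum, Finset.sum_mul,
        Finset.mul_sum]
      refine ENNReal.ofReal_le_ofReal
        (Finset.sum_le_sum_of_subset_of_nonneg (Finset.subset_univ _) fun i _ _ => by positivity))
  have e : ∀ i ω, (∑ l, if S.X i l ω ∈ Metric.closedBall (S.X g j ω) r then (1 : ℝ) else 0) =
      (S.near (S.X g j ω) r i ω).card := fun i ω => by
    rw [S.card_near_eq]; push_cast; rfl
  simp only [e] at h1
  have hpt : ∀ ω, ψ ω * ENNReal.ofReal (∑ i, ((S.near (S.X g j ω) r i ω).card : ℝ)) ≤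
      ENNReal.ofReal S.maxSize * ψ ω + ψ ω * ENNReal.ofReal (∑ i ∈ Finset.univ.erase g,
        ((S.near (S.X g j ω) r i ω).card : ℝ)) := fun ω => by
    rw [← Finset.add_sum_erase _ _ (Finset.mem_univ g), ENNReal.ofReal_add (by positivity)
      (Finset.sum_nonneg fun _ _ => by positivity), mul_add, mul_comm (ENNReal.ofReal _)]
    gcongr
    exact (S.card_near_le _ r g ω).trans (S.size_le_maxSize g)
  refine (lintegral_mono hpt).trans ?_
  rw [lintegral_add_left (hψ'.const_mul _), lintegral_const_mul _ hψ', add_comm,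
    ENNReal.ofReal_add (by positivity) (by positivity), add_mul]
  gcongr

end Decouple

end ClusterKernel

namespace ClusterKernel

variable {dI dC : ℕ}

/-! ## Weighted least squares -/

/-- Testing the normal equations with their own solution gives ∑ κ s² = ∑ κ s e + ∑ κ s δ for the
fitted values s. The left side is bounded below by coercivity, the noise term by the scores ∑ κ v e,
and the deterministic term is half absorbed on the left. -/
lemma sq_sum_abs_le_of_coercive {ι π : Type*} [Fintype ι] [Fintype π] {κ : ι → ℝ} {v : ι → π → ℝ}
    {e δ : ι → ℝ} {β : π → ℝ} {c r : ℝ} (hκ : ∀ i, 0 ≤ κ i) (hc : 0 < c)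
    (hcoer : c * (∑ p, |β p|) ^ 2 ≤ ∑ i, κ i * (∑ p, β p * v i p) ^ 2)
    (heq : ∑ i, κ i * ((∑ p, β p * v i p) * (e i + δ i - ∑ p, β p * v i p)) = 0)
    (hδ : ∀ i, κ i ≠ 0 → |δ i| ≤ r) :
    (∑ p, |β p|) ^ 2 ≤ 4 / c ^ 2 * (Fintype.card π * ∑ p, (∑ i, κ i * v i p * e i) ^ 2) +
      2 / c * (r ^ 2 * ∑ i, κ i) := by
  set B := ∑ p, |β p|
  set s : ι → ℝ := fun i => ∑ p, β p * v i p
  set U : π → ℝ := fun p => ∑ i, κ i * v i p * e i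
  set W := ∑ p, |U p|
  have hB : 0 ≤ B := Finset.sum_nonneg fun _ _ => abs_nonneg _
  have h1 : ∑ i, κ i * s i ^ 2 = ∑ i, κ i * (s i * e i) + ∑ i, κ i * (s i * δ i) := by
    rw [← Finset.sum_add_distrib, ← sub_eq_zero, ← neg_eq_zero, ← heq, ← Finset.sum_sub_distrib,
      ← Finset.sum_neg_distrib]
    exact Finset.sum_congr rfl fun i _ => by ring
  have h2 : ∑ i, κ i * (s i * e i) ≤ B * W := by
    have : ∑ i, κ i * (s i * e i) = ∑ p, β p * U p := by
      simp only [s, U, Finset.sum_mul, Finset.mul_sum]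
      rw [Finset.sum_comm]
      exact Finset.sum_congr rfl fun p _ => Finset.sum_congr rfl fun i _ => by ring
    rw [this, Finset.sum_mul]
    refine Finset.sum_le_sum fun p hp => (le_abs_self _).trans ?_
    rw [abs_mul]
    exact mul_le_mul_of_nonneg_left
      (Finset.single_le_sum (f := fun p => |U p|) (fun _ _ => abs_nonneg _) hp) (abs_nonneg _)
  have h3 : ∑ i, κ i * (s i * δ i) ≤ 1 / 2 * ∑ i, κ i * s i ^ 2 + 1 / 2 * (r ^ 2 * ∑ i, κ i) := by
    rw [Finset.mul_sum, Finset.mul_sum, Finset.mul_sum, ← Finset.sum_add_distrib]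
    refine Finset.sum_le_sum fun i _ => ?_
    by_cases hi : κ i = 0
    · simp [hi]
    · have h4 : δ i ^ 2 ≤ r ^ 2 := by
        rw [← sq_abs]
        exact pow_le_pow_left₀ (abs_nonneg _) (hδ i hi) 2
      nlinarith [mul_nonneg (hκ i) (sq_nonneg (s i - δ i)), mul_le_mul_of_nonneg_left h4 (hκ i)]
  have h4 : W ^ 2 ≤ Fintype.card π * ∑ p, U p ^ 2 := by
    have := sq_sum_le_card_mul_sum_sq (s := Finset.univ) (f := fun p => |U p|)
    simpa only [sq_abs, Finset.card_univ] using this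
  set D := r ^ 2 * ∑ i, κ i
  have h5 : c * B ^ 2 ≤ 2 * (B * W) + D := by linarith
  -- From (c B - 2 W)² ≥ 0, the linear term 2 c B W is half absorbed by c² B².
  have h6 : c ^ 2 * B ^ 2 ≤ 4 * W ^ 2 + 2 * c * D := by
    have h7 : c * (c * B ^ 2) ≤ c * (2 * (B * W) + D) := mul_le_mul_of_nonneg_left h5 hc.le
    nlinarith [sq_nonneg (c * B - 2 * W)]
  have h8 : B ^ 2 ≤ 4 / c ^ 2 * W ^ 2 + 2 / c * D := by
    have : 4 / c ^ 2 * W ^ 2 + 2 / c * D = (4 * W ^ 2 + 2 * c * D) / c ^ 2 := by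
      field_simp
    rw [this, le_div_iff₀ (by positivity)]
    linarith
  refine h8.trans ?_
  gcongr

/-! ## Coercivity of local designs -/

open ClusterSample in
/-- Small balls such that the kernel is bounded away from zero on all of them, and no affine
function is small on all of them. -/
lemma IsCompactKernel.exists_cells {k : ℝ → ℝ} {C L : ℝ} (hk : IsCompactKernel k C L) :
    ∃ (z : Unit ⊕ (Fin dI ⊕ Fin dC) → RegSpace dI dC) (η κ c : ℝ), 0 < η ∧ 0 < κ ∧ 0 < c ∧
      (∀ p, ∀ u ∈ Metric.closedBall (z p) η, κ ≤ prodKernel k u) ∧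
      ∀ β : Unit ⊕ (Fin dI ⊕ Fin dC) → ℝ, ∃ p, ∀ u ∈ Metric.closedBall (z p) η,
        c * ∑ p, |β p| ≤ |∑ p, β p * oneCons u p| := by
  classical
  obtain ⟨t, ht⟩ : ∃ t, 0 < k t := by
    by_contra! hcon
    have h0 : k = fun _ => 0 := funext fun u => le_antisymm (hcon u) (hk.nonneg u)
    have := hk.integral_one
    rw [h0] at this
    simp at this
  have hev : ∀ᶠ s in 𝓝 t, k t / 2 < k s :=
    (hk.continuous.tendsto t).eventually_const_lt (by linarith)
  obtain ⟨σ, hσ, hball⟩ := Metric.nhds_basis_closedBall.eventually_iff.1 hev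
  set τ := σ / 2 with hτ
  have hτ0 : 0 < τ := by positivity
  set d : ℝ := ((Fintype.card (Fin dI ⊕ Fin dC) : ℕ) : ℝ)
  have hd : 0 ≤ d := by positivity
  -- D bounds ∑ |β| by the largest absolute value of the affine function at the nodes: each slope is
  -- a difference quotient, at most 2/τ times that value, and the intercept adds 1 plus |t| times
  -- the sum of the slopes.
  set D : ℝ := 1 + (1 + |t|) * (2 * d / τ) with hD
  have hD0 : 0 < D := by positivity
  set z₀ : RegSpace dI dC := WithLp.toLp 2 fun _ => t
  -- Interpolation nodes for affine functions: a point with all coordinates t, where k is positive,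
  -- and its shifts by τ along each axis. With τ = σ/2, balls of radius at most τ around them stay
  -- where k exceeds k(t)/2.
  set z : Unit ⊕ (Fin dI ⊕ Fin dC) → RegSpace dI dC :=
    Sum.elim (fun _ => z₀) fun q => z₀ + EuclideanSpace.single q τ
  have hz : ∀ p q, |z p q - t| ≤ τ := by
    rintro (_ | p) q
    · simp [z, z₀, hτ0.le]
    · by_cases hpq : q = p
      · subst hpq
        simp [z, z₀, abs_of_pos hτ0]
      · simp [z, z₀, hpq, hτ0.le]
  have hcoord : ∀ p η, ∀ u ∈ Metric.closedBall (z p) η, ∀ q, |u q - z p q| ≤ η :=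
    fun p η u hu q => by
      rw [Metric.mem_closedBall, dist_eq_norm] at hu
      exact (PiLp.norm_apply_le (u - z p) q).trans hu
  refine ⟨z, min τ (1 / (2 * D)), (k t / 2) ^ Fintype.card (Fin dI ⊕ Fin dC), 1 / (2 * D),
    by positivity, by positivity, by positivity, fun p u hu => ?_, fun β => ?_⟩
  · unfold prodKernel
    rw [Finset.card_univ.symm, ← Finset.prod_const]
    refine Finset.prod_le_prod (fun _ _ => by positivity) fun q _ => ?_
    refine (hball ?_).le
    rw [Metric.mem_closedBall, Real.dist_eq]
    have h1 := hcoord p _ u hu q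
    have h2 := hz p q
    have h3 := min_le_left τ (1 / (2 * D))
    calc |u q - t| = |(u q - z p q) + (z p q - t)| := by ring_nf
      _ ≤ |u q - z p q| + |z p q - t| := abs_add_le _ _
      _ ≤ σ := by linarith
  · set l : Unit ⊕ (Fin dI ⊕ Fin dC) → ℝ := fun p => ∑ r, β r * oneCons (z p) r
    set B := ∑ p, |β p| with hBdef
    have hB : 0 ≤ B := Finset.sum_nonneg fun _ _ => abs_nonneg _
    obtain ⟨p, -, hp⟩ := Finset.exists_max_image (Finset.univ : Finset (Unit ⊕ (Fin dI ⊕ Fin dC)))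
      (fun p => |l p|) Finset.univ_nonempty
    have hl0 : l (Sum.inl ()) = β (Sum.inl ()) + t * ∑ q, β (Sum.inr q) := by
      simp only [l, z, z₀, Fintype.sum_sum_type, Finset.univ_unique, Finset.sum_singleton, oneCons,
        Sum.elim_inl, Sum.elim_inr, mul_one, PUnit.default_eq_unit]
      rw [← Finset.sum_mul, ← Finset.sum_mul, ← add_mul, mul_comm]
    have hlq : ∀ q, l (Sum.inr q) - l (Sum.inl ()) = τ * β (Sum.inr q) := fun q => by
      have h1 : ∀ r, oneCons (z (Sum.inr q)) r - oneCons (z (Sum.inl ())) r =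
          if r = Sum.inr q then τ else 0 := by
        rintro (_ | r)
        · simp [oneCons]
        · by_cases hrq : r = q
          · subst hrq; simp [oneCons, z, z₀]
          · simp [oneCons, z, z₀, hrq]
      simp only [l]
      rw [← Finset.sum_sub_distrib]
      simp only [← mul_sub, h1, mul_ite, mul_zero, Finset.sum_ite_eq', Finset.mem_univ, if_true]
      ring
    have hβq : ∀ q, |β (Sum.inr q)| ≤ 2 / τ * |l p| := fun q => by
      have h1 : τ * |β (Sum.inr q)| ≤ 2 * |l p| := by
        have h2 : τ * |β (Sum.inr q)| = |l (Sum.inr q) - l (Sum.inl ())| := by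
          rw [hlq, abs_mul, abs_of_pos hτ0]
        rw [h2]
        refine (abs_sub _ _).trans ?_
        linarith [hp (Sum.inr q) (Finset.mem_univ _), hp (Sum.inl ()) (Finset.mem_univ _)]
      rw [div_mul_eq_mul_div, le_div_iff₀ hτ0]
      linarith
    have hsum : ∑ q, |β (Sum.inr q)| ≤ 2 * d / τ * |l p| := by
      refine (Finset.sum_le_sum fun q _ => hβq q).trans (le_of_eq ?_)
      rw [Finset.sum_const, Finset.card_univ, nsmul_eq_mul]
      ring
    have hβ0 : |β (Sum.inl ())| ≤ |l p| + |t| * (2 * d / τ * |l p|) := by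
      have h1 : β (Sum.inl ()) = l (Sum.inl ()) - t * ∑ q, β (Sum.inr q) := by rw [hl0]; ring
      rw [h1]
      refine (abs_sub _ _).trans (add_le_add (hp _ (Finset.mem_univ _)) ?_)
      rw [abs_mul]
      exact mul_le_mul_of_nonneg_left ((Finset.abs_sum_le_sum_abs _ _).trans hsum) (abs_nonneg _)
    have hBl : B ≤ D * |l p| := by
      have h1 : B = |β (Sum.inl ())| + ∑ q, |β (Sum.inr q)| := by
        rw [hBdef, Fintype.sum_sum_type]
        simp
      rw [h1, hD]
      linarith
    refine ⟨p, fun u hu => ?_⟩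
    -- Within distance 1/(2D) of the best node the value moves by at most half of its lower bound
    -- B/D, so half of it remains.
    have hdiff : |∑ r, β r * oneCons u r - l p| ≤ 1 / (2 * D) * B := by
      simp only [l]
      rw [← Finset.sum_sub_distrib, Finset.mul_sum]
      refine (Finset.abs_sum_le_sum_abs _ _).trans (Finset.sum_le_sum fun r _ => ?_)
      rw [← mul_sub, abs_mul, mul_comm]
      refine mul_le_mul_of_nonneg_right ?_ (abs_nonneg _)
      rcases r with _ | r
      · simp only [oneCons, Sum.elim_inl, sub_self, abs_zero]
        positivity
      · exact (hcoord p _ u hu r).trans (min_le_right _ _)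
    have h1 : B / D ≤ |l p| := by rw [div_le_iff₀ hD0]; linarith
    have h2 : |l p| ≤ |∑ r, β r * oneCons u r| + |∑ r, β r * oneCons u r - l p| := by
      have := abs_sub_abs_le_abs_sub (l p) (∑ r, β r * oneCons u r)
      rw [abs_sub_comm] at this
      linarith
    have h3 : 1 / (2 * D) * B = B / D / 2 := by field_simp
    rw [h3] at hdiff ⊢
    linarith

namespace ClusterSample

variable {Ω : Type*} [mΩ : MeasurableSpace Ω] (S : ClusterSample dI dC Ω)

/-- For each coefficient vector some cell keeps the affine function away from zero; the N
observations in that cell alone give the lower bound. -/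
lemma coercive_of_card_near {k : ℝ → ℝ} {C L h N η κ c : ℝ} (hk : IsCompactKernel k C L)
    (hh : 0 < h) {z : Unit ⊕ (Fin dI ⊕ Fin dC) → RegSpace dI dC} (hκ : 0 < κ) (hc : 0 < c)
    (hz : ∀ p, ∀ u ∈ Metric.closedBall (z p) η, κ ≤ prodKernel k u)
    (hzc : ∀ β : Unit ⊕ (Fin dI ⊕ Fin dC) → ℝ, ∃ p, ∀ u ∈ Metric.closedBall (z p) η,
        c * ∑ p, |β p| ≤ |∑ p, β p * oneCons u p|)
    {y : RegSpace dI dC} {ω : Ω}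
    (hN : ∀ p, N ≤ ∑ g, ((S.near (y + h • z p) (η * h) g ω).card : ℝ))
    (β : Unit ⊕ (Fin dI ⊕ Fin dC) → ℝ) :
    κ * c ^ 2 * N * (∑ p, |β p|) ^ 2 ≤ ∑ i : Σ g, Fin (S.size g),
      prodKernel k (h⁻¹ • (S.X i.1 i.2 ω - y)) *
        (∑ p, β p * oneCons (h⁻¹ • (S.X i.1 i.2 ω - y)) p) ^ 2 := by
  obtain ⟨p, hp⟩ := hzc β
  set B := ∑ p, |β p|
  have hB : 0 ≤ B := Finset.sum_nonneg fun _ _ => abs_nonneg _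
  rw [Fintype.sum_sigma]
  calc κ * c ^ 2 * N * B ^ 2
      ≤ κ * c ^ 2 * (∑ g, ((S.near (y + h • z p) (η * h) g ω).card : ℝ)) * B ^ 2 := by
        gcongr
        exact hN p
    _ = ∑ g, ∑ _j ∈ S.near (y + h • z p) (η * h) g ω, κ * (c * B) ^ 2 := by
        simp only [Finset.sum_const, nsmul_eq_mul]
        rw [← Finset.sum_mul]
        ring
    _ ≤ ∑ g, ∑ j ∈ S.near (y + h • z p) (η * h) g ω,
        prodKernel k (h⁻¹ • (S.X g j ω - y)) *
        (∑ p, β p * oneCons (h⁻¹ • (S.X g j ω - y)) p) ^ 2 := by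
        refine Finset.sum_le_sum fun g _ => Finset.sum_le_sum fun j hj => ?_
        have hmem : h⁻¹ • (S.X g j ω - y) ∈ Metric.closedBall (z p) η := by
          rw [S.mem_near, Metric.mem_closedBall, dist_eq_norm] at hj
          rw [Metric.mem_closedBall, dist_eq_norm]
          have : h⁻¹ • (S.X g j ω - y) - z p = h⁻¹ • (S.X g j ω - (y + h • z p)) := by
            rw [← sub_sub, smul_sub _ _ (h • z p), smul_smul, inv_mul_cancel₀ hh.ne', one_smul]
          rw [this, norm_smul, norm_inv, Real.norm_of_nonneg hh.le, inv_mul_eq_div,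
            div_le_iff₀ hh]
          exact hj
        refine mul_le_mul (hz p _ hmem) ?_ (by positivity) (hk.prod_nonneg _)
        rw [← sq_abs (∑ p, β p * _)]
        exact pow_le_pow_left₀ (by positivity) (hp _ hmem) 2
    _ ≤ _ := by
        refine Finset.sum_le_sum fun g _ => Finset.sum_le_sum_of_subset_of_nonneg
          (Finset.subset_univ _) fun j _ _ => mul_nonneg (hk.prod_nonneg _) (sq_nonneg _)

lemma oneCons_smul_sum (β : Unit ⊕ (Fin dI ⊕ Fin dC) → ℝ) (u : RegSpace dI dC) :
    ∑ p, β p * oneCons u p = β (Sum.inl ()) + ∑ q, β (Sum.inr q) * u q := by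
  rw [Fintype.sum_sum_type]
  simp [oneCons]

/-- Nadaraya–Watson is the local constant fit, so the common form of the normal equations applies
with zero slopes and only the intercept row. -/
lemma exists_normalEquations_nw {k : ℝ → ℝ} {h : ℝ} {m : RegSpace dI dC → ℝ} {y : RegSpace dI dC}
    {ω : Ω} (hpos : ∑ i : Σ g, Fin (S.size g), prodKernel k (h⁻¹ • (S.X i.1 i.2 ω - y)) ≠ 0) :
    ∃ β : Unit ⊕ (Fin dI ⊕ Fin dC) → ℝ, β (Sum.inl ()) = S.mNW k h y ω - m y ∧
      (∀ q, β (Sum.inr q) = 0) ∧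
      ∑ i : Σ g, Fin (S.size g), prodKernel k (h⁻¹ • (S.X i.1 i.2 ω - y)) *
        (S.err m i.1 i.2 ω + localResid .nw m y (S.X i.1 i.2 ω) -
          ∑ p, β p * oneCons (h⁻¹ • (S.X i.1 i.2 ω - y)) p) = 0 := by
  refine ⟨Sum.elim (fun _ => S.mNW k h y ω - m y) fun _ => 0, rfl, fun _ => rfl, ?_⟩
  have h1 : ∀ i : Σ g, Fin (S.size g), prodKernel k (h⁻¹ • (S.X i.1 i.2 ω - y)) *
        (S.err m i.1 i.2 ω + localResid .nw m y (S.X i.1 i.2 ω) -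
          ∑ p, (Sum.elim (fun _ => S.mNW k h y ω - m y) fun _ => 0 :
            Unit ⊕ (Fin dI ⊕ Fin dC) → ℝ) p * oneCons (h⁻¹ • (S.X i.1 i.2 ω - y)) p) =
      prodKernel k (h⁻¹ • (S.X i.1 i.2 ω - y)) * S.Y i.1 i.2 ω -
        prodKernel k (h⁻¹ • (S.X i.1 i.2 ω - y)) * S.mNW k h y ω := fun i => by
    rw [oneCons_smul_sum]
    simp only [Sum.elim_inl, Sum.elim_inr, zero_mul, Finset.sum_const_zero, err, localResid]
    ring
  simp only [h1]
  rw [Finset.sum_sub_distrib, ← Finset.sum_mul, sub_eq_zero]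
  unfold mNW
  rw [Fintype.sum_sigma, Fintype.sum_sigma]
  rw [Fintype.sum_sigma] at hpos
  exact (mul_div_cancel₀ _ hpos).symm

lemma mLL_eq (k : ℝ → ℝ) (h : ℝ) (y : RegSpace dI dC) (ω : Ω) :
    S.mLL k h y ω = Matrix.mulVec
      ((S.designMatrix y ω).transpose * S.weightMatrix k h y ω * S.designMatrix y ω)⁻¹
      (∑ i : Σ g, Fin (S.size g), (scaledKernel k h (S.X i.1 i.2 ω - y) * S.Y i.1 i.2 ω) •
        oneCons (S.X i.1 i.2 ω - y)) (Sum.inl ()) := by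
  unfold mLL kernelLL
  rw [Matrix.mulVec_sum, Finset.sum_apply, Fintype.sum_sigma]
  refine Finset.sum_congr rfl fun g _ => Finset.sum_congr rfl fun j _ => ?_
  rw [Matrix.mulVec_smul, Pi.smul_apply, smul_eq_mul]
  ring

lemma gram_mulVec (k : ℝ → ℝ) (h : ℝ) (y : RegSpace dI dC) (ω : Ω)
    (θ : Unit ⊕ (Fin dI ⊕ Fin dC) → ℝ) :
    Matrix.mulVec
      ((S.designMatrix y ω).transpose * S.weightMatrix k h y ω * S.designMatrix y ω) θ =
      ∑ i : Σ g, Fin (S.size g), (scaledKernel k h (S.X i.1 i.2 ω - y) *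
        ∑ p, θ p * oneCons (S.X i.1 i.2 ω - y) p) • oneCons (S.X i.1 i.2 ω - y) := by
  rw [← Matrix.mulVec_mulVec, ← Matrix.mulVec_mulVec]
  funext p
  rw [Finset.sum_apply]
  simp only [Matrix.mulVec, dotProduct, Matrix.transpose_apply, designMatrix, weightMatrix,
    Matrix.of_apply, Pi.smul_apply, smul_eq_mul, Matrix.diagonal_apply, ite_mul, zero_mul,
    Finset.sum_ite_eq, Finset.mem_univ, if_true]
  refine Finset.sum_congr rfl fun i _ => ?_
  rw [mul_comm]
  congr 2
  exact Finset.sum_congr rfl fun p _ => mul_comm _ _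

/-- Coercivity makes the Gram matrix invertible, so the estimator is the intercept of the unique
solution. Subtracting the first-order Taylor polynomial of m replaces Y by the error plus the local
residual. -/
lemma exists_normalEquations_ll {k : ℝ → ℝ} {h : ℝ} (hh : 0 < h) {m : RegSpace dI dC → ℝ}
    {y : RegSpace dI dC} {ω : Ω} {c : ℝ} (hc : 0 < c)
    (hcoer : ∀ β : Unit ⊕ (Fin dI ⊕ Fin dC) → ℝ, c * (∑ p, |β p|) ^ 2 ≤
      ∑ i : Σ g, Fin (S.size g), prodKernel k (h⁻¹ • (S.X i.1 i.2 ω - y)) *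
        (∑ p, β p * oneCons (h⁻¹ • (S.X i.1 i.2 ω - y)) p) ^ 2) :
    ∃ β : Unit ⊕ (Fin dI ⊕ Fin dC) → ℝ, β (Sum.inl ()) = S.mLL k h y ω - m y ∧
      ∀ p, ∑ i : Σ g, Fin (S.size g), prodKernel k (h⁻¹ • (S.X i.1 i.2 ω - y)) *
        (oneCons (h⁻¹ • (S.X i.1 i.2 ω - y)) p *
        (S.err m i.1 i.2 ω + localResid .ll m y (S.X i.1 i.2 ω) -
          ∑ p, β p * oneCons (h⁻¹ • (S.X i.1 i.2 ω - y)) p)) = 0 := by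
  classical
  set A := (S.designMatrix y ω).transpose * S.weightMatrix k h y ω * S.designMatrix y ω with hA
  -- The slopes of β refer to the rescaled regressors (X - y)/h and are therefore h times those of
  -- θ.
  have hscale : ∀ (θ : Unit ⊕ (Fin dI ⊕ Fin dC) → ℝ) (u : RegSpace dI dC),
      ∑ p, (Sum.elim (fun _ => θ (Sum.inl ())) (fun q => h * θ (Sum.inr q)) :
        Unit ⊕ (Fin dI ⊕ Fin dC) → ℝ) p * oneCons (h⁻¹ • u) p = ∑ p, θ p * oneCons u p := by
    intro θ u
    rw [oneCons_smul_sum, oneCons_smul_sum]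
    simp only [Sum.elim_inl, Sum.elim_inr, PiLp.smul_apply, smul_eq_mul]
    congr 1
    refine Finset.sum_congr rfl fun q _ => ?_
    field_simp
  -- A vector in the kernel of the Gram matrix has zero weighted sum of squares, so coercivity
  -- forces it to vanish.
  have hinj : Function.Injective A.mulVec := by
    intro θ₁ θ₂ heq
    have h0 : A.mulVec (θ₁ - θ₂) = 0 := by rw [Matrix.mulVec_sub, heq, sub_self]
    set θ := θ₁ - θ₂
    rw [S.gram_mulVec] at h0
    have h1 : ∑ i : Σ g, Fin (S.size g), prodKernel k (h⁻¹ • (S.X i.1 i.2 ω - y)) *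
        (∑ p, θ p * oneCons (S.X i.1 i.2 ω - y) p) ^ 2 = 0 := by
      have h2 : ∑ p, θ p * (∑ i : Σ g, Fin (S.size g), (scaledKernel k h (S.X i.1 i.2 ω - y) *
        ∑ p, θ p * oneCons (S.X i.1 i.2 ω - y) p) • oneCons (S.X i.1 i.2 ω - y)) p = 0 := by
        rw [h0]; simp
      have h3 : ∑ i : Σ g, Fin (S.size g), prodKernel k (h⁻¹ • (S.X i.1 i.2 ω - y)) *
        (∑ p, θ p * oneCons (S.X i.1 i.2 ω - y) p) ^ 2 = h ^ (dI + dC) *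
          ∑ p, θ p * (∑ i : Σ g, Fin (S.size g), (scaledKernel k h (S.X i.1 i.2 ω - y) *
        ∑ p, θ p * oneCons (S.X i.1 i.2 ω - y) p) • oneCons (S.X i.1 i.2 ω - y)) p := by
        simp only [Finset.sum_apply, Pi.smul_apply, smul_eq_mul]
        rw [Finset.sum_congr rfl fun p _ => Finset.mul_sum _ _ _, Finset.sum_comm, Finset.mul_sum]
        refine Finset.sum_congr rfl fun i _ => ?_
        have h4 : ∀ p, θ p * (scaledKernel k h (S.X i.1 i.2 ω - y) *
            (∑ p, θ p * oneCons (S.X i.1 i.2 ω - y) p) * oneCons (S.X i.1 i.2 ω - y) p) =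
            scaledKernel k h (S.X i.1 i.2 ω - y) *
            (∑ p, θ p * oneCons (S.X i.1 i.2 ω - y) p) *
              (θ p * oneCons (S.X i.1 i.2 ω - y) p) := fun p => by ring
        simp only [h4]
        rw [← Finset.mul_sum, scaledKernel]
        field_simp
      rw [h3, h2, mul_zero]
    have h5 := hcoer (Sum.elim (fun _ => θ (Sum.inl ())) fun q => h * θ (Sum.inr q))
    simp only [hscale] at h5
    rw [h1] at h5
    have h6 : (∑ p, |(Sum.elim (fun _ => θ (Sum.inl ())) (fun q => h * θ (Sum.inr q)) :
        Unit ⊕ (Fin dI ⊕ Fin dC) → ℝ) p|) = 0 := by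
      have := nonpos_of_mul_nonpos_right h5 hc
      exact pow_eq_zero_iff two_ne_zero |>.1 (le_antisymm this (sq_nonneg _))
    rw [Finset.sum_eq_zero_iff_of_nonneg fun _ _ => abs_nonneg _] at h6
    have h7 : θ = 0 := by
      funext p
      have := abs_eq_zero.1 (h6 p (Finset.mem_univ p))
      rcases p with _ | p
      · exact this
      · exact (mul_eq_zero.1 this).resolve_left hh.ne'
    exact sub_eq_zero.1 h7
  have hunit : IsUnit A := Matrix.mulVec_injective_iff_isUnit.1 hinj
  set r := ∑ i : Σ g, Fin (S.size g), (scaledKernel k h (S.X i.1 i.2 ω - y) * S.Y i.1 i.2 ω) •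
        oneCons (S.X i.1 i.2 ω - y) with hr
  set θ := A⁻¹.mulVec r with hθ
  have hAθ : A.mulVec θ = r := by
    rw [hθ, Matrix.mulVec_mulVec, Matrix.mul_nonsing_inv _ ((Matrix.isUnit_iff_isUnit_det A).1 hunit),
      Matrix.one_mulVec]
  -- The Taylor coefficients of m at y, which the local linear fit reproduces exactly.
  set G : Unit ⊕ (Fin dI ⊕ Fin dC) → ℝ :=
    Sum.elim (fun _ => m y) fun q => fderiv ℝ m y (EuclideanSpace.single q 1) with hG
  have hGu : ∀ u, ∑ p, G p * oneCons u p = m y + fderiv ℝ m y u := fun u => by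
    rw [oneCons_smul_sum]
    simp only [hG, Sum.elim_inl, Sum.elim_inr]
    congr 1
    conv_rhs => rw [eq_sum_coord_smul u]
    simp only [map_sum, map_smul, smul_eq_mul]
    exact Finset.sum_congr rfl fun q _ => mul_comm _ _
  refine ⟨Sum.elim (fun _ => (θ - G) (Sum.inl ())) fun q => h * (θ - G) (Sum.inr q), ?_, fun p => ?_⟩
  · simp only [Sum.elim_inl, Pi.sub_apply, hG]
    rw [S.mLL_eq]
  · simp only [hscale]
    have h1 : ∀ i : Σ g, Fin (S.size g), S.err m i.1 i.2 ω + localResid .ll m y (S.X i.1 i.2 ω) -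
        ∑ p, (θ - G) p * oneCons (S.X i.1 i.2 ω - y) p =
        S.Y i.1 i.2 ω - ∑ p, θ p * oneCons (S.X i.1 i.2 ω - y) p := fun i => by
      simp only [Pi.sub_apply, sub_mul, Finset.sum_sub_distrib, hGu, err, localResid]
      ring
    simp only [h1]
    have h2 : ∑ i : Σ g, Fin (S.size g), prodKernel k (h⁻¹ • (S.X i.1 i.2 ω - y)) *
        (oneCons (S.X i.1 i.2 ω - y) p *
        (S.Y i.1 i.2 ω - ∑ p, θ p * oneCons (S.X i.1 i.2 ω - y) p)) =
        h ^ (dI + dC) * (r p - A.mulVec θ p) := by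
      rw [S.gram_mulVec, hr, Finset.sum_apply, Finset.sum_apply, ← Finset.sum_sub_distrib,
        Finset.mul_sum]
      refine Finset.sum_congr rfl fun i _ => ?_
      simp only [Pi.smul_apply, smul_eq_mul, scaledKernel]
      field_simp
    rw [hAθ, sub_self, mul_zero] at h2
    rcases p with _ | q
    · exact h2
    · have h3 : ∀ u : RegSpace dI dC, oneCons (h⁻¹ • u) (Sum.inr q) =
          h⁻¹ * oneCons u (Sum.inr q) := fun u => rfl
      simp only [h3, mul_left_comm _ h⁻¹, mul_assoc h⁻¹]
      rw [← Finset.mul_sum, h2, mul_zero]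

/-- Both estimators solve normal equations, with an explicit bound for the solution. -/
lemma exists_coefficients (M : Method) {k : ℝ → ℝ} {C L h : ℝ} (hk : IsCompactKernel k C L)
    (hh : 0 < h) {m : RegSpace dI dC → ℝ} {y : RegSpace dI dC} {ω : Ω} {c r : ℝ} (hc : 0 < c)
    (hcoer : ∀ β : Unit ⊕ (Fin dI ⊕ Fin dC) → ℝ, c * (∑ p, |β p|) ^ 2 ≤
      ∑ i : Σ g, Fin (S.size g), prodKernel k (h⁻¹ • (S.X i.1 i.2 ω - y)) *
        (∑ p, β p * oneCons (h⁻¹ • (S.X i.1 i.2 ω - y)) p) ^ 2)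
    (hr : ∀ u, ‖u - y‖ ≤ Fintype.card (Fin dI ⊕ Fin dC) * L * h → |localResid M m y u| ≤ r) :
    ∃ β : Unit ⊕ (Fin dI ⊕ Fin dC) → ℝ, β (Sum.inl ()) = S.mHat M k h y ω - m y ∧
      (M = .nw → ∀ q, β (Sum.inr q) = 0) ∧
      ∑ i : Σ g, Fin (S.size g), prodKernel k (h⁻¹ • (S.X i.1 i.2 ω - y)) *
        (S.err m i.1 i.2 ω + localResid M m y (S.X i.1 i.2 ω) -
          ∑ p, β p * oneCons (h⁻¹ • (S.X i.1 i.2 ω - y)) p) = 0 ∧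
      (∑ p, |β p|) ^ 2 ≤ 4 / c ^ 2 * (Fintype.card (Unit ⊕ (Fin dI ⊕ Fin dC)) *
        ∑ p, (∑ g, S.kernErr m (fun u => prodKernel k u * oneCons u p) h y g ω) ^ 2) +
        2 / c * (r ^ 2 *
          ∑ i : Σ g, Fin (S.size g), prodKernel k (h⁻¹ • (S.X i.1 i.2 ω - y))) := by
  have hδ : ∀ i : Σ g, Fin (S.size g), prodKernel k (h⁻¹ • (S.X i.1 i.2 ω - y)) ≠ 0 →
      |localResid M m y (S.X i.1 i.2 ω)| ≤ r := fun i hi => by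
    refine hr _ ?_
    have h1 := norm_le_card_mul hk.pos.le (hk.abs_le_of_ne hi)
    rwa [norm_smul, norm_inv, Real.norm_of_nonneg hh.le, inv_mul_eq_div, div_le_iff₀ hh] at h1
  have hfin : ∀ β : Unit ⊕ (Fin dI ⊕ Fin dC) → ℝ,
      ∑ i : Σ g, Fin (S.size g), prodKernel k (h⁻¹ • (S.X i.1 i.2 ω - y)) *
        ((∑ p, β p * oneCons (h⁻¹ • (S.X i.1 i.2 ω - y)) p) *
          (S.err m i.1 i.2 ω + localResid M m y (S.X i.1 i.2 ω) -
          ∑ p, β p * oneCons (h⁻¹ • (S.X i.1 i.2 ω - y)) p)) = 0 →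
      (∑ p, |β p|) ^ 2 ≤ 4 / c ^ 2 * (Fintype.card (Unit ⊕ (Fin dI ⊕ Fin dC)) *
        ∑ p, (∑ g, S.kernErr m (fun u => prodKernel k u * oneCons u p) h y g ω) ^ 2) +
        2 / c * (r ^ 2 *
          ∑ i : Σ g, Fin (S.size g), prodKernel k (h⁻¹ • (S.X i.1 i.2 ω - y))) := fun β hβ => by
    have := sq_sum_abs_le_of_coercive (fun i => hk.prod_nonneg _) hc (hcoer β) hβ hδ
    simp only [Fintype.sum_sigma] at this ⊢
    exact this
  cases M with
  | nw =>
    have hpos : ∑ i : Σ g, Fin (S.size g), prodKernel k (h⁻¹ • (S.X i.1 i.2 ω - y)) ≠ 0 := by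
      -- Coercivity tested on the constant function 1 shows that the denominator is positive.
      have h1 := hcoer (Pi.single (Sum.inl ()) 1)
      have h2 : ∀ u : RegSpace dI dC, ∑ p, (Pi.single (Sum.inl ()) 1 :
          Unit ⊕ (Fin dI ⊕ Fin dC) → ℝ) p * oneCons u p = 1 := fun u => by
        rw [oneCons_smul_sum]; simp
      have h3 : ∑ p, |(Pi.single (Sum.inl ()) 1 : Unit ⊕ (Fin dI ⊕ Fin dC) → ℝ) p| = 1 := by
        rw [Fintype.sum_sum_type]; simp
      simp only [h2, h3, one_pow, mul_one] at h1
      exact (hc.trans_le h1).ne'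
    obtain ⟨β, h0, hq, hrow⟩ := S.exists_normalEquations_nw (m := m) hpos
    refine ⟨β, h0, fun _ => hq, hrow, hfin β ?_⟩
    have h1 : ∀ u : RegSpace dI dC, ∑ p, β p * oneCons u p = β (Sum.inl ()) := fun u => by
      rw [oneCons_smul_sum]; simp [hq]
    simp only [h1] at hrow ⊢
    simp only [mul_left_comm _ (β (Sum.inl ()))]
    rw [← Finset.mul_sum, hrow, mul_zero]
  | ll =>
    obtain ⟨β, h0, hrow⟩ := S.exists_normalEquations_ll (m := m) hh hc hcoer
    refine ⟨β, h0, nofun, ?_, hfin β ?_⟩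
    · have := hrow (Sum.inl ())
      simpa only [oneCons, Sum.elim_inl, one_mul] using this
    -- The row of each coordinate is multiplied by its coefficient and the rows are added.
    · simp only [Finset.sum_mul, Finset.mul_sum (ι := Unit ⊕ (Fin dI ⊕ Fin dC))]
      rw [Finset.sum_comm]
      refine Finset.sum_eq_zero fun p _ => ?_
      have := congrArg (fun t => β p * t) (hrow p)
      simp only [mul_zero, Finset.mul_sum (ι := Σ g, Fin (S.size g))] at this
      rw [← this]
      refine Finset.sum_congr rfl fun i _ => by ring

end ClusterSample

end ClusterKernel

namespace ClusterKernel

variable {dI dC : ℕ}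

/-! ## Many observations near every point -/

/-- Coordinates are rounded down to multiples of δ relative to x. The grid covers a cube around the
ball, so its points may lie slightly outside the ball. -/
lemma exists_grid {ι : Type} [Fintype ι] (x : EuclideanSpace ℝ ι) (ρ : ℝ) {δ : ℝ} (hδ : 0 < δ) :
    ∃ Γ : Finset (EuclideanSpace ℝ ι), Γ.card ≤ (2 * ⌈ρ / δ⌉₊ + 1) ^ Fintype.card ι ∧
      ∀ y ∈ Metric.closedBall x ρ, ∃ z ∈ Γ, ‖y - z‖ ≤ Fintype.card ι * δ := by
  classical
  set K : ℕ := ⌈ρ / δ⌉₊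
  refine ⟨(Fintype.piFinset fun _ : ι => Finset.Icc (-(K : ℤ)) K).image
    fun a => x + WithLp.toLp 2 fun q => δ * (a q : ℝ), ?_, fun y hy => ?_⟩
  · refine Finset.card_image_le.trans (le_of_eq ?_)
    rw [Fintype.card_piFinset, Finset.prod_const, Int.card_Icc, Finset.card_univ]
    congr 1
    omega
  · have hK : ρ / δ ≤ K := Nat.le_ceil _
    have hq : ∀ q, |(y q - x q) / δ| ≤ K := fun q => by
      rw [abs_div, abs_of_pos hδ]
      refine le_trans ?_ hK
      gcongr
      rw [Metric.mem_closedBall, dist_eq_norm] at hy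
      exact (PiLp.norm_apply_le (y - x) q).trans hy
    refine ⟨_, Finset.mem_image.2 ⟨fun q => ⌊(y q - x q) / δ⌋, Fintype.mem_piFinset.2 fun q =>
      Finset.mem_Icc.2 ⟨Int.le_floor.2 ?_, ?_⟩, rfl⟩, norm_le_card_mul hδ.le fun q => ?_⟩
    · push_cast
      exact (abs_le.1 (hq q)).1
    · have := (Int.floor_le ((y q - x q) / δ)).trans (abs_le.1 (hq q)).2
      have h3 : ((⌊(y q - x q) / δ⌋ : ℤ) : ℝ) ≤ ((K : ℤ) : ℝ) := by push_cast; exact this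
      exact Int.cast_le.1 h3
    · have h1 := Int.floor_le ((y q - x q) / δ)
      have h2 := (Int.lt_floor_add_one ((y q - x q) / δ)).le
      have h3 : y q - x q = δ * ((y q - x q) / δ) := by field_simp
      simp only [PiLp.sub_apply, PiLp.add_apply]
      rw [abs_le]
      constructor <;> nlinarith

section Counting

variable {Ω : Type*} [mΩ : MeasurableSpace Ω] {P : Measure Ω} [IsProbabilityMeasure P]
  {S : ClusterSample dI dC Ω} {pop : Population dI dC} {x : RegSpace dI dC} {F Q V c ρ : ℝ}

/-- The volume of the unit ball of the regressor space. -/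
noncomputable def unitVol (dI dC : ℕ) : ℝ := (volume (Metric.ball (0 : RegSpace dI dC) 1)).toReal

lemma unitVol_pos : 0 < unitVol dI dC :=
  ENNReal.toReal_pos (Metric.measure_ball_pos _ _ one_pos).ne' Metric.isBounded_ball.measure_lt_top.ne

lemma le_measure_closedBall (hS : IsGenerated P S pop) (hB : PopBound pop x F Q V c ρ)
    (g : Fin S.G) (j : Fin (S.size g)) {y : RegSpace dI dC} {s : ℝ} (hs : 0 ≤ s)
    (hys : Metric.closedBall y s ⊆ Metric.closedBall x ρ) :
    c * unitVol dI dC * s ^ (dI + dC) ≤ P.real (S.X g j ⁻¹' Metric.closedBall y s) := by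
  have hc := hB.c_pos
  have hv := @unitVol_pos dI dC
  have h1 : ENNReal.ofReal (c * unitVol dI dC * s ^ (dI + dC)) ≤
      P (S.X g j ⁻¹' Metric.closedBall y s) := by
    rw [← Measure.map_apply (S.measurable_X g j) Metric.isClosed_closedBall.measurableSet,
      hS.density, withDensity_apply _ Metric.isClosed_closedBall.measurableSet]
    calc ENNReal.ofReal (c * unitVol dI dC * s ^ (dI + dC))
        = ENNReal.ofReal c * volume (Metric.closedBall y s) := by
          rw [Measure.addHaar_closedBall _ _ hs, mul_assoc, ENNReal.ofReal_mul hc.le, unitVol,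
            mul_comm (ENNReal.toReal _), ENNReal.ofReal_mul (by positivity),
            ENNReal.ofReal_toReal Metric.isBounded_ball.measure_lt_top.ne]
          simp
      _ = ∫⁻ _ in Metric.closedBall y s, ENNReal.ofReal c := by rw [setLIntegral_const]
      _ ≤ _ := setLIntegral_mono' Metric.isClosed_closedBall.measurableSet fun u hu =>
          ENNReal.ofReal_le_ofReal (hB.le_f u (hys hu))
  exact (ENNReal.ofReal_le_iff_le_toReal (measure_ne_top _ _)).1 h1

/-- Counts are nonnegative and independent across clusters, with mean at least of order n s^d
because f is bounded below near x, and sum of second moments at most of the same order. The lower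
tail bound needs nothing else, whatever the cluster sizes. -/
lemma measure_card_near_le (hS : IsGenerated P S pop) (hB : PopBound pop x F Q V c ρ)
    {y : RegSpace dI dC} {s A : ℝ} (hs : 0 ≤ s)
    (hys : Metric.closedBall y s ⊆ Metric.closedBall x ρ) (hA0 : 0 < A)
    (hA : ∀ g, (S.size g : ℝ) * s ^ dI ≤ A) :
    P {ω | ∑ g, ((S.near y s g ω).card : ℝ) ≤
        c * unitVol dI dC * (S.n * s ^ (dI + dC)) / 2} ≤
      ENNReal.ofReal (Real.exp (-((c * unitVol dI dC) ^ 2 / (8 * (countConst dI dC F A + 1)) *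
        (S.n * s ^ (dI + dC))))) := by
  classical
  have hc := hB.c_pos
  have hv := @unitVol_pos dI dC
  have hK := countConst_nonneg (dI := dI) (dC := dC) hB.F_pos.le hA0.le
  have hm : ∀ g, Measurable fun ω => ((S.near y s g ω).card : ℝ) := fun g =>
    ((measurable_from_top (f := fun c : ℕ => (c : ℝ))).comp (S.measurable_card_near y s g)).mono
      (S.sigmaX_le g) le_rfl
  refine measure_sum_le_half hm (fun g ω => by positivity) (fun g => ?_) ?_ (by positivity)
    (by positivity) ?_ ?_
  · refine MemLp.of_bound (hm g).aestronglyMeasurable (S.size g) (ae_of_all _ fun ω => ?_)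
    rw [Real.norm_of_nonneg (by positivity)]
    exact_mod_cast S.card_near_le y s g ω
  · refine iIndepFun_of_data hS fun g => ⟨fun z => ∑ j, if z.2 j ∈ Metric.closedBall y s then
      (1 : ℝ) else 0, ?_, fun ω => ?_⟩
    · have hX : ∀ j, Measurable fun z : (Fin (S.size g) → ℝ) × (Fin (S.size g) → RegSpace dI dC) =>
        z.2 j := fun j => (measurable_pi_apply j).comp measurable_snd
      exact Finset.measurable_sum _ fun j _ => Measurable.ite
        (hX j Metric.isClosed_closedBall.measurableSet) measurable_const measurable_const
    · rw [S.card_near_eq]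
      push_cast
      rfl
  · rw [S.n_eq_sum, Finset.sum_mul, Finset.mul_sum]
    refine Finset.sum_le_sum fun g _ => ?_
    have e : ∀ ω, ((S.near y s g ω).card : ℝ) =
        ∑ j, (S.X g j ⁻¹' Metric.closedBall y s).indicator (fun _ => (1 : ℝ)) ω := fun ω => by
      rw [S.card_near_eq]
      push_cast
      rfl
    have hms : ∀ j, MeasurableSet (S.X g j ⁻¹' Metric.closedBall y s) := fun j =>
      S.measurable_X g j Metric.isClosed_closedBall.measurableSet
    simp only [e]
    rw [integral_finsetSum _ fun j _ => (integrable_const (1 : ℝ)).indicator (hms j)]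
    simp only [integral_indicator (hms _), setIntegral_const, smul_eq_mul, mul_one]
    calc c * unitVol dI dC * (S.size g * s ^ (dI + dC))
        = ∑ _j : Fin (S.size g), c * unitVol dI dC * s ^ (dI + dC) := by
          rw [Finset.sum_const, Finset.card_univ, Fintype.card_fin, nsmul_eq_mul]; ring
      _ ≤ _ := Finset.sum_le_sum fun j _ => le_measure_closedBall hS hB g j hs hys
  · rw [S.n_eq_sum, Finset.sum_mul, Finset.mul_sum]
    refine Finset.sum_le_sum fun g _ => ?_
    rw [integral_eq_lintegral_of_nonneg_ae (ae_of_all _ fun ω => by positivity)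
      ((hm g).pow_const 2).aestronglyMeasurable]
    have h1 := lintegral_card_sq_le hS hB g y hs (hA g)
    have e : ∀ ω, ENNReal.ofReal (((S.near y s g ω).card : ℝ) ^ 2) =
        ((S.near y s g ω).card : ℝ≥0∞) ^ 2 := fun ω => by
      rw [ENNReal.ofReal_pow (by positivity), ENNReal.ofReal_natCast]
    simp only [e]
    refine (ENNReal.toReal_le_of_le_ofReal (by positivity) h1).trans ?_
    gcongr
    linarith

/-- With high probability, every ball of radius `r` with centre near `x` contains many
observations. -/
lemma measure_exists_card_near_le (hS : IsGenerated P S pop) (hB : PopBound pop x F Q V c ρ)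
    {r A : ℝ} (hr : 0 < r) (hrρ : r ≤ ρ / 2) (hA0 : 0 < A)
    (hA : ∀ g, (S.size g : ℝ) * (r / 2) ^ dI ≤ A) :
    P {ω | ∃ y ∈ Metric.closedBall x (ρ / 2), ∑ g, ((S.near y r g ω).card : ℝ) ≤
        c * unitVol dI dC * (S.n * (r / 2) ^ (dI + dC)) / 2} ≤
      ENNReal.ofReal ((2 * ρ * (dI + dC + 1) / r + 3) ^ (dI + dC) *
        Real.exp (-((c * unitVol dI dC) ^ 2 / (8 * (countConst dI dC F A + 1)) *
        (S.n * (r / 2) ^ (dI + dC))))) := by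
  classical
  have hρ := hB.ρ_pos
  set E := Real.exp (-((c * unitVol dI dC) ^ 2 / (8 * (countConst dI dC F A + 1)) *
        (S.n * (r / 2) ^ (dI + dC))))
  -- The grid approximates points up to d δ, and d + 1 in the denominator keeps this at most r/2
  -- without excluding d = 0.
  set δ : ℝ := r / (2 * (dI + dC + 1)) with hδ
  have hδ0 : 0 < δ := by positivity
  have hcard : Fintype.card (Fin dI ⊕ Fin dC) = dI + dC := by simp
  obtain ⟨Γ, hΓ, hcov⟩ := exists_grid x (ρ / 2) hδ0
  rw [hcard] at hΓ hcov
  set bad : RegSpace dI dC → Set Ω := fun z => {ω | ∑ g, ((S.near z (r / 2) g ω).card : ℝ) ≤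
        c * unitVol dI dC * (S.n * (r / 2) ^ (dI + dC)) / 2}
  set Γ' := Γ.filter fun z => z ∈ Metric.closedBall x (ρ / 2 + r / 2)
  have hsub : {ω | ∃ y ∈ Metric.closedBall x (ρ / 2), ∑ g, ((S.near y r g ω).card : ℝ) ≤
        c * unitVol dI dC * (S.n * (r / 2) ^ (dI + dC)) / 2} ⊆ ⋃ z ∈ Γ', bad z := by
    rintro ω ⟨y, hy, hω⟩
    obtain ⟨z, hz, hyz⟩ := hcov y hy
    have hyz' : ‖y - z‖ ≤ r / 2 := by
      refine hyz.trans ?_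
      rw [hδ, mul_div_assoc', div_le_div_iff₀ (by positivity) (by norm_num)]
      push_cast
      nlinarith
    have hzx : z ∈ Metric.closedBall x (ρ / 2 + r / 2) := by
      rw [Metric.mem_closedBall] at hy ⊢
      have := dist_triangle z y x
      rw [dist_eq_norm z y, norm_sub_rev] at this
      linarith
    refine Set.mem_biUnion (Finset.mem_filter.2 ⟨hz, hzx⟩) (le_trans ?_ hω)
    refine Finset.sum_le_sum fun g _ => ?_
    -- A ball of radius r around y contains the ball of radius r/2 around the nearest grid point, so
    -- finitely many balls control all y.
    have : S.near z (r / 2) g ω ⊆ S.near y r g ω := fun j hj => by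
      rw [S.mem_near, Metric.mem_closedBall] at hj ⊢
      have := dist_triangle (S.X g j ω) z y
      rw [dist_eq_norm z y, norm_sub_rev] at this
      linarith
    exact_mod_cast Finset.card_le_card this
  refine (measure_mono hsub).trans ((measure_biUnion_finset_le _ _).trans ?_)
  have hbad : ∀ z ∈ Γ', P (bad z) ≤ ENNReal.ofReal E := fun z hz => by
    refine measure_card_near_le hS hB (by positivity) ?_ hA0 hA
    refine Metric.closedBall_subset_closedBall' ?_
    have := (Finset.mem_filter.1 hz).2
    rw [Metric.mem_closedBall] at this
    linarith
  refine (Finset.sum_le_sum hbad).trans ?_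
  rw [Finset.sum_const, nsmul_eq_mul, ← ENNReal.ofReal_natCast,
    ← ENNReal.ofReal_mul (by positivity)]
  refine ENNReal.ofReal_le_ofReal (mul_le_mul_of_nonneg_right ?_ (Real.exp_pos _).le)
  have h1 : (Γ'.card : ℝ) ≤ ((2 * ⌈ρ / 2 / δ⌉₊ + 1 : ℕ) : ℝ) ^ (dI + dC) := by
    exact_mod_cast (Finset.card_filter_le _ _).trans hΓ
  refine h1.trans (pow_le_pow_left₀ (by positivity) ?_ _)
  have h2 := (Nat.ceil_lt_add_one (by positivity : 0 ≤ ρ / 2 / δ)).le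
  have h3 : 2 * (ρ / 2 / δ) = 2 * ρ * (dI + dC + 1) / r := by
    rw [hδ]; field_simp
  push_cast
  linarith

end Counting

section Asymptotic

variable {Ω : ℕ → Type*} [∀ ν, MeasurableSpace (Ω ν)] {P : ∀ ν, Measure (Ω ν)}
  [∀ ν, IsProbabilityMeasure (P ν)]
  {S : ∀ ν, ClusterSample dI dC (Ω ν)} {pop : Population dI dC} {x : RegSpace dI dC}
  {F Q V c ρ : ℝ} {h b : ℕ → ℝ} {lam : ℝ}

lemma BandwidthRates.exists_maxSize_bound (hr : BandwidthRates S h b lam) (R : ℝ) (hR : 0 ≤ R) :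
    ∃ A : ℝ, 0 < A ∧ ∀ᶠ ν in atTop, ∀ g, ((S ν).size g : ℝ) * (R * h ν) ^ dI ≤ A := by
  obtain ⟨A, hA0, hA⟩ := hr.maxSize_h.exists_pos
  refine ⟨R ^ dI * A + 1, by positivity, ?_⟩
  filter_upwards [hA.bound] with ν hν g
  have h1 : ((S ν).size g : ℝ) ≤ (S ν).maxSize := by exact_mod_cast (S ν).size_le_maxSize g
  have h2 := (hr.h_pos ν).le
  rw [Real.norm_of_nonneg (by positivity), norm_one, mul_one] at hν
  calc ((S ν).size g : ℝ) * (R * h ν) ^ dI = R ^ dI * ((S ν).size g * h ν ^ dI) := by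
        rw [mul_pow]; ring
    _ ≤ R ^ dI * ((S ν).maxSize * h ν ^ dI) := by gcongr
    _ ≤ R ^ dI * A := by gcongr
    _ ≤ _ := by linarith

lemma BandwidthRates.n_top (hr : BandwidthRates S h b lam) :
    Tendsto (fun ν => ((S ν).n : ℝ)) atTop atTop := by
  refine tendsto_atTop_mono' _ ?_ hr.nh_top
  filter_upwards [hr.h_zero.eventually_le_const (show (0 : ℝ) < 1 by norm_num)] with ν hν
  exact mul_le_of_le_one_right (by positivity) (pow_le_one₀ (hr.h_pos ν).le hν)

/-- The density floor is at most F, so multiplying by its inverse cannot hide the rate. -/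
lemma tendsto_log_div (hr : BandwidthRates S h b lam) (hB : PopBound pop x F Q V c ρ)
    (hreg : UnifRegular pop) (hfloor : DensityFloor S pop h) :
    Tendsto (fun ν => Real.log (S ν).n / ((S ν).n * h ν ^ (dI + dC))) atTop (𝓝 0) := by
  obtain ⟨r, -, hpos, hlim⟩ := hfloor
  have hF := hB.F_pos
  -- A negative radius would give an empty ball, for which `sInf` takes the default value 0,
  -- contrary to positivity. Hence the origin lies in the ball.
  have hle : ∀ ν, densityInf pop.f (r ν) ≤ F := fun ν => by
    have h0 : (0 : RegSpace dI dC) ∈ Metric.closedBall (0 : RegSpace dI dC) (r ν) := by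
      rw [Metric.mem_closedBall, dist_self]
      by_contra! hneg
      have h1 := hpos ν
      rw [densityInf, Metric.closedBall_eq_empty.2 hneg, Set.image_empty, Real.sInf_empty] at h1
      exact lt_irrefl _ h1
    refine (csInf_le ⟨0, ?_⟩ (Set.mem_image_of_mem pop.f h0)).trans (hB.f_le 0)
    rintro _ ⟨u, -, rfl⟩
    exact hreg.f_nonneg u
  have hnn : ∀ ν, 0 ≤ Real.log (S ν).n / ((S ν).n * h ν ^ (dI + dC)) := fun ν => by
    have := (hr.h_pos ν).le
    exact div_nonneg (Real.log_natCast_nonneg _) (by positivity)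
  have hsq : Tendsto (fun ν => Real.sqrt (Real.log (S ν).n / ((S ν).n * h ν ^ (dI + dC)))) atTop
      (𝓝 0) := by
    have h1 := hlim.const_mul F
    rw [mul_zero] at h1
    refine squeeze_zero (fun _ => Real.sqrt_nonneg _) (fun ν => ?_) h1
    set s := Real.sqrt (Real.log (S ν).n / ((S ν).n * h ν ^ (dI + dC))) with hs
    have hs0 : 0 ≤ s := Real.sqrt_nonneg _
    have h2 : 1 ≤ F * (densityInf pop.f (r ν))⁻¹ := by
      rw [← div_eq_mul_inv, le_div_iff₀ (hpos ν), one_mul]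
      exact hle ν
    calc s = 1 * s := (one_mul s).symm
      _ ≤ F * (densityInf pop.f (r ν))⁻¹ * (s + h ν ^ 2) := by
        gcongr
        linarith [sq_nonneg (h ν)]
      _ = _ := by ring
  have h2 := hsq.pow 2
  simp only [Real.sq_sqrt (hnn _)] at h2
  simpa using h2

/-- Every ball of radius proportional to `h` with centre near `x` contains many observations. -/
lemma eventually_card_near (hS : ∀ ν, IsGenerated (P ν) (S ν) pop)
    (hr : BandwidthRates S h b lam) (hB : PopBound pop x F Q V c ρ)
    (hreg : UnifRegular pop) (hfloor : DensityFloor S pop h) {η : ℝ} (hη : 0 < η) :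
    ∃ c' > 0, ∀ᶠ p in probFilter P, ∀ y ∈ Metric.closedBall x (ρ / 2),
      c' * ((S p.1).n * h p.1 ^ (dI + dC)) ≤
        ∑ g, (((S p.1).near y (η * h p.1) g p.2).card : ℝ) := by
  have hc := hB.c_pos
  have hρ := hB.ρ_pos
  have hv := @unitVol_pos dI dC
  obtain ⟨A, hA0, hA⟩ := hr.exists_maxSize_bound (η / 2) (by positivity)
  have hK := countConst_nonneg (dI := dI) (dC := dC) hB.F_pos.le hA0.le
  refine ⟨c * unitVol dI dC * (η / 2) ^ (dI + dC) / 2, by positivity, ?_⟩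
  refine eventually_probFilter.2 ?_
  -- The tail bound is exp(-κ n h^d). Since log n/(n h^d) is eventually at most κ/2, it is at most
  -- n^{-2}, while the grid has at most D h^{-d} ≤ D n points; the union bound leaves D/n.
  set κ : ℝ := (c * unitVol dI dC) ^ 2 / (8 * (countConst dI dC F A + 1)) * (η / 2) ^ (dI + dC)
    with hκ
  have hκ0 : 0 < κ := by positivity
  set D : ℝ := (2 * ρ * (dI + dC + 1) / η + 3) ^ (dI + dC) with hD
  have hD0 : 0 ≤ D := by positivity
  have hlim : Tendsto (fun ν => ENNReal.ofReal (D * ((S ν).n : ℝ)⁻¹)) atTop (𝓝 0) := by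
    have := (hr.n_top.inv_tendsto_atTop.const_mul D)
    rw [mul_zero] at this
    simpa using ENNReal.tendsto_ofReal this
  refine tendsto_of_tendsto_of_tendsto_of_le_of_le' tendsto_const_nhds hlim
    (Eventually.of_forall fun _ => zero_le) ?_
  have hlog := (tendsto_log_div hr hB hreg hfloor).eventually_le_const
    (show (0 : ℝ) < κ / 2 by positivity)
  have hsmall : Tendsto (fun ν => η * h ν) atTop (𝓝 0) := by
    simpa using hr.h_zero.const_mul η
  filter_upwards [hA, hlog, hsmall.eventually_le_const (show (0 : ℝ) < ρ / 2 by positivity),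
    hr.h_zero.eventually_le_const (show (0 : ℝ) < 1 by norm_num),
    hr.nh_top.eventually_ge_atTop 1] with ν hAν hlogν hhρ hh1 hnh
  have hh := hr.h_pos ν
  have hn0 : 0 < ((S ν).n : ℝ) := by
    by_contra! hcon
    have h1 : ((S ν).n : ℝ) = 0 := le_antisymm hcon (by positivity)
    rw [h1, zero_mul] at hnh
    linarith
  have hAν' : ∀ g, ((S ν).size g : ℝ) * (η * h ν / 2) ^ dI ≤ A := fun g => by
    have := hAν g
    rwa [div_mul_eq_mul_div] at this
  have h1 := measure_exists_card_near_le (hS ν) hB (r := η * h ν) (by positivity) hhρ hA0 hAν'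
  refine (measure_mono ?_).trans (h1.trans (ENNReal.ofReal_le_ofReal ?_))
  · intro ω hω
    rw [Set.mem_ofPred_eq] at hω
    push Not at hω
    obtain ⟨y, hy, hlt⟩ := hω
    refine ⟨y, hy, hlt.le.trans (le_of_eq ?_)⟩
    have e1 : η * h ν / 2 = η / 2 * h ν := by ring
    rw [e1, mul_pow]
    ring
  · have hexp : Real.exp (-((c * unitVol dI dC) ^ 2 / (8 * (countConst dI dC F A + 1)) *
        ((S ν).n * (η * h ν / 2) ^ (dI + dC)))) ≤ ((S ν).n : ℝ)⁻¹ * ((S ν).n : ℝ)⁻¹ := by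
      have e1 : (c * unitVol dI dC) ^ 2 / (8 * (countConst dI dC F A + 1)) *
        ((S ν).n * (η * h ν / 2) ^ (dI + dC)) = κ * ((S ν).n * h ν ^ (dI + dC)) := by
        rw [← div_mul_eq_mul_div, mul_pow, hκ]; ring
      rw [e1]
      have h2 : 2 * Real.log (S ν).n ≤ κ * ((S ν).n * h ν ^ (dI + dC)) := by
        rw [div_le_iff₀ (by linarith)] at hlogν
        linarith
      calc Real.exp (-(κ * ((S ν).n * h ν ^ (dI + dC))))
          ≤ Real.exp (-Real.log (S ν).n + -Real.log (S ν).n) := Real.exp_le_exp.2 (by linarith)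
        _ = _ := by rw [Real.exp_add, Real.exp_neg, Real.exp_log hn0]
    have hgrid : (2 * ρ * (dI + dC + 1) / (η * h ν) + 3) ^ (dI + dC) ≤ D * (S ν).n := by
      have h3 : 2 * ρ * (dI + dC + 1) / (η * h ν) + 3 ≤
          (2 * ρ * (dI + dC + 1) / η + 3) * (h ν)⁻¹ := by
        have : 2 * ρ * (dI + dC + 1) / (η * h ν) = 2 * ρ * (dI + dC + 1) / η * (h ν)⁻¹ := by
          field_simp
        rw [this, add_mul]
        have := (one_le_inv₀ hh).2 hh1
        linarith
      refine (pow_le_pow_left₀ (by positivity) h3 _).trans ?_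
      rw [mul_pow]
      refine mul_le_mul_of_nonneg_left ?_ hD0
      rw [inv_pow, inv_le_iff_one_le_mul₀ (by positivity)]
      exact hnh
    calc _ ≤ D * (S ν).n * (((S ν).n : ℝ)⁻¹ * ((S ν).n : ℝ)⁻¹) :=
          mul_le_mul hgrid hexp (Real.exp_pos _).le (by positivity)
      _ = D * ((S ν).n : ℝ)⁻¹ := by field_simp

end Asymptotic

end ClusterKernel

namespace ClusterKernel

variable {dI dC : ℕ}

/-! ## Bounds for the estimation error of the regression function -/

open ClusterSample in
lemma IsCompactKernel.isWeight_oneCons {k : ℝ → ℝ} {C L : ℝ} (hk : IsCompactKernel k C L)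
    (q : Unit ⊕ (Fin dI ⊕ Fin dC)) :
    IsWeight (fun u : RegSpace dI dC => prodKernel k u * oneCons u q)
      (C ^ Fintype.card (Fin dI ⊕ Fin dC) * (1 + Fintype.card (Fin dI ⊕ Fin dC) * L))
      (Fintype.card (Fin dI ⊕ Fin dC) * L) := by
  have hL := hk.pos.le
  refine hk.isWeight.mul ?_ (fun u hu => ?_) (by positivity)
  · cases q with
    | inl _ => exact measurable_const
    | inr q => exact measurable_id.coord q
  · cases q with
    | inl _ =>
      simp only [oneCons, Sum.elim_inl, abs_one]
      linarith [mul_nonneg (Nat.cast_nonneg (α := ℝ) (Fintype.card (Fin dI ⊕ Fin dC))) hL]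
    | inr q =>
      simp only [oneCons, Sum.elim_inr]
      have := (PiLp.norm_apply_le u q).trans hu
      rw [Real.norm_eq_abs] at this
      linarith

lemma ClusterSample.sum_kernel_le {Ω : Type*} [MeasurableSpace Ω] (S : ClusterSample dI dC Ω)
    {k : ℝ → ℝ} {C L h : ℝ} (hk : IsCompactKernel k C L) (hh : 0 < h) (y : RegSpace dI dC)
    (g : Fin S.G) (ω : Ω) :
    ∑ j, prodKernel k (h⁻¹ • (S.X g j ω - y)) ≤ C ^ Fintype.card (Fin dI ⊕ Fin dC) *
      (S.near y (Fintype.card (Fin dI ⊕ Fin dC) * L * h) g ω).card := by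
  rw [← Finset.sum_subset (Finset.subset_univ
    (S.near y (Fintype.card (Fin dI ⊕ Fin dC) * L * h) g ω)) fun j _ hj =>
      S.weight_eq_zero hk.isWeight hh hj]
  refine (Finset.sum_le_sum fun j _ => hk.prod_le _).trans (le_of_eq ?_)
  rw [Finset.sum_const, nsmul_eq_mul, mul_comm]

lemma coefficient_bound_le {cc a K π U D D' r : ℝ} (hcc : 0 < cc) (ha : 0 < a) (hK : 0 ≤ K)
    (hπ : 0 ≤ π) (hU : 0 ≤ U) (hD : 0 ≤ D) (hD' : D' ≤ K * D) :
    4 / (cc * a) ^ 2 * (π * U) + 2 / (cc * a) * (r ^ 2 * D') ≤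
      (4 / cc ^ 2 * π + 2 / cc * K) * (U / a ^ 2 + r ^ 2 * (D / a)) := by
  have e2 : 0 ≤ 4 / cc ^ 2 * π := by positivity
  have e3 : 0 ≤ 2 / cc * K := by positivity
  calc 4 / (cc * a) ^ 2 * (π * U) + 2 / (cc * a) * (r ^ 2 * D')
      ≤ 4 / (cc * a) ^ 2 * (π * U) + 2 / (cc * a) * (r ^ 2 * (K * D)) := by gcongr
    _ = 4 / cc ^ 2 * π * (U / a ^ 2) + 2 / cc * K * (r ^ 2 * (D / a)) := by
        field_simp
    _ ≤ (4 / cc ^ 2 * π + 2 / cc * K) * (U / a ^ 2) +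
        (4 / cc ^ 2 * π + 2 / cc * K) * (r ^ 2 * (D / a)) :=
        add_le_add (mul_le_mul_of_nonneg_right (by linarith) (by positivity))
          (mul_le_mul_of_nonneg_right (by linarith) (by positivity))
    _ = _ := by ring

lemma errRate_bound_le {a π W Q K₁ K₂ M h : ℝ} (ha : 0 < a) (hπ : 0 ≤ π) (hQ : 0 ≤ Q)
    (hK₁ : 0 ≤ K₁) (hK₂ : 0 ≤ K₂) (hM : 0 ≤ M) :
    1 / a ^ 2 * π * (2 * W ^ 2 * Q * (K₁ * (a + M ^ 2))) + h ^ 2 / a * (K₂ * (a + M)) ≤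
      (π * (2 * W ^ 2 * Q * K₁) + K₂) * (1 / a + M ^ 2 / a ^ 2 + h ^ 2 * (1 + M / a)) := by
  have e1 : 1 / a ^ 2 * π * (2 * W ^ 2 * Q * (K₁ * (a + M ^ 2))) =
      π * (2 * W ^ 2 * Q * K₁) * (1 / a + M ^ 2 / a ^ 2) := by field_simp
  have e2 : h ^ 2 / a * (K₂ * (a + M)) = K₂ * (h ^ 2 * (1 + M / a)) := by field_simp
  rw [e1, e2]
  have e3 : 0 ≤ π * (2 * W ^ 2 * Q * K₁) := by positivity
  have e4 : 0 ≤ 1 / a + M ^ 2 / a ^ 2 := by positivity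
  have e5 : 0 ≤ h ^ 2 * (1 + M / a) := by positivity
  linarith [mul_nonneg e3 e5, mul_nonneg hK₂ e4]

lemma add_sq_mul_le {u D B R h : ℝ} (hu : 0 ≤ u) (hD : 0 ≤ D) :
    u + (B * (R * h)) ^ 2 * D ≤ (1 + (B * R) ^ 2) * (u + h ^ 2 * D) := by
  nlinarith [mul_nonneg (sq_nonneg (B * R)) hu, mul_nonneg (sq_nonneg h) hD]

lemma ofReal_div_add {U D a h : ℝ} (hU : 0 ≤ U) (hD : 0 ≤ D) (ha : 0 < a) :
    ENNReal.ofReal (U / a ^ 2 + h ^ 2 * (D / a)) =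
      ENNReal.ofReal (1 / a ^ 2) * ENNReal.ofReal U +
        ENNReal.ofReal (h ^ 2 / a) * ENNReal.ofReal D := by
  rw [← ENNReal.ofReal_mul (by positivity), ← ENNReal.ofReal_mul (by positivity),
    ← ENNReal.ofReal_add (by positivity) (by positivity)]
  congr 1
  field_simp

section Asymptotic

variable {Ω : ℕ → Type*} [∀ ν, MeasurableSpace (Ω ν)] {P : ∀ ν, Measure (Ω ν)}
  [∀ ν, IsProbabilityMeasure (P ν)]
  {S : ∀ ν, ClusterSample dI dC (Ω ν)} {pop : Population dI dC} {x : RegSpace dI dC}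
  {F Q V c ρ : ℝ} {h b : ℕ → ℝ} {lam : ℝ} {k : ℝ → ℝ} {C L : ℝ}

open ClusterSample in
-- One event of probability tending to one makes the designs at all y near x coercive with constant
-- of order n h^d, so a single constant serves for every y. The residual bound r stays free: it is
-- of order h for variance estimation and of order h² for the local linear expansion at x.
lemma eventually_coefficients (hS : ∀ ν, IsGenerated (P ν) (S ν) pop)
    (hr : BandwidthRates S h b lam) (hB : PopBound pop x F Q V c ρ)
    (hreg : UnifRegular pop) (hfloor : DensityFloor S pop h) (hk : IsCompactKernel k C L)
    (M : Method) :
    ∃ C₁ > 0, ∀ᶠ p in probFilter P, ∀ y ∈ Metric.closedBall x (ρ / 4), ∀ r : ℝ,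
      (∀ u, ‖u - y‖ ≤ Fintype.card (Fin dI ⊕ Fin dC) * L * h p.1 → |localResid M pop.m y u| ≤ r) →
      ∃ β : Unit ⊕ (Fin dI ⊕ Fin dC) → ℝ,
        β (Sum.inl ()) = (S p.1).mHat M k (h p.1) y p.2 - pop.m y ∧
        (M = .nw → ∀ q, β (Sum.inr q) = 0) ∧
        ∑ i : Σ g, Fin ((S p.1).size g),
          prodKernel k ((h p.1)⁻¹ • ((S p.1).X i.1 i.2 p.2 - y)) *
          ((S p.1).err pop.m i.1 i.2 p.2 + localResid M pop.m y ((S p.1).X i.1 i.2 p.2) -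
            ∑ q, β q * oneCons ((h p.1)⁻¹ • ((S p.1).X i.1 i.2 p.2 - y)) q) = 0 ∧
        (∑ q, |β q|) ^ 2 ≤ C₁ * ((∑ q, (∑ g, (S p.1).kernErr pop.m
            (fun u => prodKernel k u * oneCons u q) (h p.1) y g p.2) ^ 2) /
            ((S p.1).n * h p.1 ^ (dI + dC)) ^ 2 +
          r ^ 2 * ((∑ g, (((S p.1).near y
            (Fintype.card (Fin dI ⊕ Fin dC) * L * h p.1) g p.2).card : ℝ)) /
            ((S p.1).n * h p.1 ^ (dI + dC)))) := by
  obtain ⟨z, η, κ, c₀, hη, hκ, hc₀, hz, hzc⟩ := hk.exists_cells (dI := dI) (dC := dC)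
  obtain ⟨c', hc', hev⟩ := eventually_card_near hS hr hB hreg hfloor hη
  have hρ := hB.ρ_pos
  have hC := hk.one_le
  set cc := κ * c₀ ^ 2 * c' with hcc
  have hcc0 : 0 < cc := by positivity
  set π : ℝ := ((Fintype.card (Unit ⊕ (Fin dI ⊕ Fin dC)) : ℕ) : ℝ)
  have hπ : 0 ≤ π := by positivity
  set K := C ^ Fintype.card (Fin dI ⊕ Fin dC)
  have hK : 0 < K := by positivity
  refine ⟨4 / cc ^ 2 * π + 2 / cc * K, by positivity, ?_⟩
  -- The cells around y are centred at y + h z_p; for small h they stay in the ball of radius ρ/2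
  -- where many observations are guaranteed.
  have hshift : ∀ p, ∀ᶠ ν in atTop, ‖h ν • z p‖ ≤ ρ / 4 := fun p => by
    have h1 : Tendsto (fun ν => ‖h ν • z p‖) atTop (𝓝 0) := by
      have := (hr.h_zero.smul_const (z p)).norm
      simpa using this
    exact h1.eventually_le_const (by positivity)
  filter_upwards [hev, eventually_fst (eventually_all.2 hshift),
    eventually_fst (hr.nh_top.eventually_gt_atTop 0)] with p hp hsh ha y hy r hres
  have hh := hr.h_pos p.1
  set a := ((S p.1).n : ℝ) * h p.1 ^ (dI + dC)
  have hN : ∀ q, c' * a ≤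
      ∑ g, (((S p.1).near (y + h p.1 • z q) (η * h p.1) g p.2).card : ℝ) := fun q => by
    refine hp _ ?_
    rw [Metric.mem_closedBall, dist_eq_norm] at hy ⊢
    have : y + h p.1 • z q - x = (y - x) + h p.1 • z q := by abel
    rw [this]
    linarith [norm_add_le (y - x) (h p.1 • z q), hsh q]
  obtain ⟨β, h0, hnw, hrow, hbd⟩ := (S p.1).exists_coefficients M hk hh (m := pop.m) (y := y)
    (ω := p.2) (c := κ * c₀ ^ 2 * (c' * a)) (r := r) (by positivity)
    (fun β => (S p.1).coercive_of_card_near hk hh hκ hc₀ hz hzc hN β) hres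
  refine ⟨β, h0, hnw, hrow, hbd.trans ?_⟩
  have hsum : ∑ i : Σ g, Fin ((S p.1).size g),
      prodKernel k ((h p.1)⁻¹ • ((S p.1).X i.1 i.2 p.2 - y)) ≤ K * ∑ g, (((S p.1).near y
            (Fintype.card (Fin dI ⊕ Fin dC) * L * h p.1) g p.2).card : ℝ) := by
    rw [Fintype.sum_sigma, Finset.mul_sum]
    exact Finset.sum_le_sum fun g _ => (S p.1).sum_kernel_le hk hh y g p.2
  have e1 : κ * c₀ ^ 2 * (c' * a) = cc * a := by rw [hcc]; ring
  rw [e1]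
  exact coefficient_bound_le hcc0 ha hK.le hπ (Finset.sum_nonneg fun _ _ => sq_nonneg _)
    (Finset.sum_nonneg fun _ _ => Nat.cast_nonneg _) hsum

open ClusterSample in
/-- The quantity that bounds the squared estimation error at `y`. -/
noncomputable def errBound {Ω : Type*} [MeasurableSpace Ω] (S : ClusterSample dI dC Ω)
    (m : RegSpace dI dC → ℝ) (k : ℝ → ℝ) (R h : ℝ) (y : RegSpace dI dC) (ω : Ω) : ℝ :=
  (∑ q, (∑ g, S.kernErr m (fun u => prodKernel k u * oneCons u q) h y g ω) ^ 2) /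
    (S.n * h ^ (dI + dC)) ^ 2 +
  h ^ 2 * ((∑ g, ((S.near y (R * h) g ω).card : ℝ)) / (S.n * h ^ (dI + dC)))

lemma errBound_nonneg {Ω : Type*} [MeasurableSpace Ω] (S : ClusterSample dI dC Ω)
    (m : RegSpace dI dC → ℝ) (k : ℝ → ℝ) (R : ℝ) {h : ℝ} (hh : 0 < h) (y : RegSpace dI dC) (ω : Ω) :
    0 ≤ errBound S m k R h y ω := by
  unfold errBound
  have h1 : 0 ≤ ∑ q, (∑ g, S.kernErr m (fun u => prodKernel k u * ClusterSample.oneCons u q)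
    h y g ω) ^ 2 := Finset.sum_nonneg fun _ _ => sq_nonneg _
  positivity

/-- The estimation error is the intercept, one of the coefficients, and on the kernel's support the
local residual is of order h. -/
lemma eventually_mHat_sub_sq_le (hS : ∀ ν, IsGenerated (P ν) (S ν) pop)
    (hr : BandwidthRates S h b lam) (hB : PopBound pop x F Q V c ρ)
    (hreg : UnifRegular pop) (hfloor : DensityFloor S pop h) (hk : IsCompactKernel k C L)
    (M : Method) :
    ∃ C₁ > 0, ∀ᶠ p in probFilter P, ∀ y ∈ Metric.closedBall x (ρ / 4),
      ((S p.1).mHat M k (h p.1) y p.2 - pop.m y) ^ 2 ≤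
        C₁ * errBound (S p.1) pop.m k (Fintype.card (Fin dI ⊕ Fin dC) * L) (h p.1) y p.2 := by
  obtain ⟨C₁, hC₁, hev⟩ := eventually_coefficients hS hr hB hreg hfloor hk M
  obtain ⟨B, hB0, hres, -⟩ := exists_localResid_bound hreg.m
  set R := (Fintype.card (Fin dI ⊕ Fin dC) : ℝ) * L
  refine ⟨C₁ * (1 + (B * R) ^ 2), by positivity, ?_⟩
  filter_upwards [hev, eventually_fst (hr.nh_top.eventually_gt_atTop 0)] with p hp ha y hy
  have hh := hr.h_pos p.1
  obtain ⟨β, h0, -, -, hbd⟩ := hp y hy (B * (R * h p.1)) fun u hu => (hres M y u).trans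
    (mul_le_mul_of_nonneg_left hu hB0)
  have h1 : ((S p.1).mHat M k (h p.1) y p.2 - pop.m y) ^ 2 ≤ (∑ q, |β q|) ^ 2 := by
    rw [← h0, ← sq_abs]
    exact pow_le_pow_left₀ (abs_nonneg _)
      (Finset.single_le_sum (f := fun q => |β q|) (fun _ _ => abs_nonneg _) (Finset.mem_univ _)) 2
  refine h1.trans (hbd.trans ?_)
  unfold errBound
  rw [mul_assoc C₁]
  refine mul_le_mul_of_nonneg_left ?_ hC₁.le
  exact add_sq_mul_le (div_nonneg (Finset.sum_nonneg fun _ _ => sq_nonneg _) (sq_nonneg _))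
    (div_nonneg (Finset.sum_nonneg fun _ _ => Nat.cast_nonneg _) ha.le)

/-- The rate at which the estimation errors at the regressors vanish. -/
noncomputable def errRate {Ω : Type*} [MeasurableSpace Ω] (S : ClusterSample dI dC Ω) (h : ℝ) : ℝ :=
  1 / (S.n * h ^ (dI + dC)) + S.maxSize ^ 2 / (S.n * h ^ (dI + dC)) ^ 2 +
    h ^ 2 * (1 + S.maxSize / (S.n * h ^ (dI + dC)))

lemma measurable_errBound {Ω : Type*} [MeasurableSpace Ω] (S : ClusterSample dI dC Ω)
    {m : RegSpace dI dC → ℝ} (hm : Continuous m) (hk : IsCompactKernel k C L) (R h : ℝ)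
    (g : Fin S.G) (j : Fin (S.size g)) :
    Measurable fun ω => errBound S m k R h (S.X g j ω) ω := by
  unfold errBound
  refine Measurable.add (Measurable.div_const (Finset.measurable_sum _ fun q _ =>
    Measurable.pow_const (Finset.measurable_sum _ fun i _ => Finset.measurable_sum _ fun l _ =>
      Measurable.mul ?_ (S.measurable_err hm i l)) 2) _)
    (Measurable.const_mul (Measurable.div_const (Finset.measurable_sum _ fun i _ => ?_) _) _)
  · exact (hk.isWeight_oneCons q).measurable.comp
      (((S.measurable_X i l).sub (S.measurable_X g j)).const_smul h⁻¹)
  · classical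
    simp only [S.card_near_eq, Nat.cast_sum, Nat.cast_ite, Nat.cast_one, Nat.cast_zero]
    exact Finset.measurable_sum _ fun l _ => Measurable.ite
      (measurableSet_le ((S.measurable_X i l).dist (S.measurable_X g j)) measurable_const)
      measurable_const measurable_const

/-- The score sums have second moment O(n h^d + max n_g²) and the count has mean O(n h^d + max n_g),
even under a weight depending on the regressors of cluster g. Dividing by the powers of n h^d gives
the rate. -/
lemma exists_lintegral_mul_errBound_le (hS : ∀ ν, IsGenerated (P ν) (S ν) pop)
    (hr : BandwidthRates S h b lam) (hB : PopBound pop x F Q V c ρ)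
    (hm : Continuous pop.m) (hk : IsCompactKernel k C L) :
    ∃ C₂ > 0, ∀ᶠ ν in atTop, ∀ g j (ψ : Ω ν → ℝ≥0∞), Measurable[(S ν).sigmaX g] ψ →
      ∫⁻ ω, ψ ω * ENNReal.ofReal (errBound (S ν) pop.m k
        (Fintype.card (Fin dI ⊕ Fin dC) * L) (h ν) ((S ν).X g j ω) ω) ∂(P ν) ≤
        ENNReal.ofReal (C₂ * errRate (S ν) (h ν)) * ∫⁻ ω, ψ ω ∂(P ν) := by
  set d := Fintype.card (Fin dI ⊕ Fin dC)
  set R := (d : ℝ) * L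
  have hR : 0 ≤ R := mul_nonneg (by positivity) hk.pos.le
  set W := C ^ d * (1 + R)
  obtain ⟨A, hA0, hA⟩ := hr.exists_maxSize_bound R hR
  have hK := countConst_nonneg (dI := dI) (dC := dC) hB.F_pos.le hA0.le
  have hbc := @ballConst_nonneg dI dC
  have hQ := hB.Q_pos
  have hF := hB.F_pos
  set π : ℝ := ((Fintype.card (Unit ⊕ (Fin dI ⊕ Fin dC)) : ℕ) : ℝ)
  have hπ : 0 ≤ π := by positivity
  set K₁ := countConst dI dC F A * R ^ (dI + dC) + 1
  have hK₁ : 1 ≤ K₁ := by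
    have : 0 ≤ countConst dI dC F A * R ^ (dI + dC) := by positivity
    linarith
  set K₂ := F * ballConst dI dC * R ^ (dI + dC) + 1
  have hK₂ : 1 ≤ K₂ := by
    have : 0 ≤ F * ballConst dI dC * R ^ (dI + dC) := by positivity
    linarith
  refine ⟨π * (2 * W ^ 2 * Q * K₁) + K₂, by positivity, ?_⟩
  filter_upwards [hA, hr.nh_top.eventually_gt_atTop 0] with ν hAν ha g j ψ hψ
  have hh := hr.h_pos ν
  have hψ' : Measurable ψ := hψ.mono ((S ν).sigmaX_le g) le_rfl
  set a := ((S ν).n : ℝ) * h ν ^ (dI + dC) with ha_def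
  set Mx := ((S ν).maxSize : ℝ)
  have hM : 0 ≤ Mx := by positivity
  set I := ∫⁻ ω, ψ ω ∂(P ν)
  set T₁ : Unit ⊕ (Fin dI ⊕ Fin dC) → Ω ν → ℝ≥0∞ := fun q ω =>
    ENNReal.ofReal ((∑ i, (S ν).kernErr pop.m (fun u => prodKernel k u *
      ClusterSample.oneCons u q) (h ν) ((S ν).X g j ω) i ω) ^ 2) with hT₁
  set T₂ : Ω ν → ℝ≥0∞ := fun ω =>
    ENNReal.ofReal (∑ i, (((S ν).near ((S ν).X g j ω) (R * h ν) i ω).card : ℝ)) with hT₂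
  have hT₁m : ∀ q, Measurable (T₁ q) := fun q => by
    refine (Measurable.pow_const (Finset.measurable_sum _ fun i _ => Finset.measurable_sum _
      fun l _ => Measurable.mul ?_ ((S ν).measurable_err hm i l)) 2).ennreal_ofReal
    exact (hk.isWeight_oneCons q).measurable.comp
      ((((S ν).measurable_X i l).sub ((S ν).measurable_X g j)).const_smul (h ν)⁻¹)
  have hb₁ : ∀ q, ∫⁻ ω, ψ ω * T₁ q ω ∂(P ν) ≤
      ENNReal.ofReal (2 * W ^ 2 * Q * (K₁ * (a + Mx ^ 2))) * I := fun q => by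
    refine (lintegral_mul_sum_kernErr_sq_le (hS ν) hB hm (hk.isWeight_oneCons q) hR hh hAν hA0.le
      g j hψ).trans ?_
    refine mul_le_mul_left (ENNReal.ofReal_le_ofReal ?_) _
    refine mul_le_mul_of_nonneg_left ?_ (by positivity)
    have e1 : countConst dI dC F A * ((S ν).n * (R * h ν) ^ (dI + dC)) =
        countConst dI dC F A * R ^ (dI + dC) * a := by rw [mul_pow, ha_def]; ring
    rw [e1, mul_add]
    refine add_le_add (mul_le_mul_of_nonneg_right (by simp [K₁]) ha.le) ?_
    exact le_mul_of_one_le_left (sq_nonneg _) hK₁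
  have hb₂ : ∫⁻ ω, ψ ω * T₂ ω ∂(P ν) ≤ ENNReal.ofReal (K₂ * (a + Mx)) * I := by
    refine (lintegral_mul_card_near_le (hS ν) hB (by positivity) g j hψ).trans ?_
    refine mul_le_mul_left (ENNReal.ofReal_le_ofReal ?_) _
    have e1 : F * ballConst dI dC * ((S ν).n * (R * h ν) ^ (dI + dC)) =
        F * ballConst dI dC * R ^ (dI + dC) * a := by rw [mul_pow, ha_def]; ring
    rw [e1, mul_add]
    refine add_le_add (mul_le_mul_of_nonneg_right (by simp [K₂]) ha.le) ?_
    exact le_mul_of_one_le_left hM hK₂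
  have hpt : ∀ ω, ψ ω * ENNReal.ofReal (errBound (S ν) pop.m k R (h ν) ((S ν).X g j ω) ω) =
      ENNReal.ofReal (1 / a ^ 2) * (∑ q, ψ ω * T₁ q ω) +
        ENNReal.ofReal (h ν ^ 2 / a) * (ψ ω * T₂ ω) := fun ω => by
    unfold errBound
    rw [← ha_def, ofReal_div_add (Finset.sum_nonneg fun _ _ => sq_nonneg _)
      (Finset.sum_nonneg fun _ _ => Nat.cast_nonneg _) ha,
      ENNReal.ofReal_sum_of_nonneg fun _ _ => sq_nonneg _, ← Finset.mul_sum]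
    simp only [hT₁, hT₂]
    ring
  simp only [hpt]
  have hm1 : ∀ q, Measurable fun ω => ψ ω * T₁ q ω := fun q => hψ'.mul (hT₁m q)
  have hm2 : Measurable fun ω => ENNReal.ofReal (1 / a ^ 2) * ∑ q, ψ ω * T₁ q ω :=
    (Finset.measurable_sum _ fun q _ => hm1 q).const_mul _
  rw [lintegral_add_left hm2,
    lintegral_const_mul' _ _ ENNReal.ofReal_ne_top, lintegral_const_mul' _ _ ENNReal.ofReal_ne_top,
    lintegral_finsetSum _ fun q _ => hm1 q]
  refine (add_le_add (mul_le_mul_right (Finset.sum_le_sum fun q _ => hb₁ q) _)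
    (mul_le_mul_right hb₂ _)).trans ?_
  rw [Finset.sum_const, Finset.card_univ, nsmul_eq_mul, ← mul_assoc, ← mul_assoc,
    ← mul_assoc _ (ENNReal.ofReal (K₂ * (a + Mx))) I, ← add_mul]
  refine mul_le_mul_left ?_ _
  rw [← ENNReal.ofReal_natCast, ← ENNReal.ofReal_mul (by positivity),
    ← ENNReal.ofReal_mul (by positivity), ← ENNReal.ofReal_mul (by positivity),
    ← ENNReal.ofReal_add (by positivity) (by positivity)]
  refine ENNReal.ofReal_le_ofReal ?_
  exact errRate_bound_le ha hπ hQ.le (zero_le_one.trans hK₁) (zero_le_one.trans hK₂) hM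

omit [∀ ν, IsProbabilityMeasure (P ν)] in
-- Because log n ≥ 1 and n^{1-2/s} ≤ n eventually, the outcome rate implies max n_g² = O(n h^d).
-- Hence max n_g²/(n h^d)² = O(1/(n h^d)), and its square root controls the remaining ratio.
lemma tendsto_errRate (hr : BandwidthRates S h b lam) (hY : OutcomeCondition P S h) :
    Tendsto (fun ν => errRate (S ν) (h ν)) atTop (𝓝 0) := by
  obtain ⟨s, -, -, -, hO⟩ := hY
  obtain ⟨K, hK, hO⟩ := hO.exists_pos
  have h1 : Tendsto (fun ν => 1 / ((S ν).n * h ν ^ (dI + dC))) atTop (𝓝 0) := by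
    simp only [one_div]
    exact hr.nh_top.inv_tendsto_atTop
  have h2 : Tendsto (fun ν => ((S ν).maxSize : ℝ) ^ 2 / ((S ν).n * h ν ^ (dI + dC)) ^ 2) atTop
      (𝓝 0) := by
    have h3 := h1.const_mul K
    rw [mul_zero] at h3
    refine squeeze_zero' (Eventually.of_forall fun ν => by positivity) ?_ h3
    filter_upwards [hO.bound, hr.nh_top.eventually_gt_atTop 0,
      (Real.tendsto_log_atTop.comp hr.n_top).eventually_ge_atTop 1,
      hr.n_top.eventually_ge_atTop 1] with ν hν ha hlog hn
    have hh := hr.h_pos ν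
    simp only [Function.comp_apply] at hlog
    set n := ((S ν).n : ℝ)
    set Mx := ((S ν).maxSize : ℝ)
    have hn0 : 0 < n := by linarith
    have hpow : n ^ (1 - (2 / s).toReal) ≤ n := by
      conv_rhs => rw [← Real.rpow_one n]
      exact Real.rpow_le_rpow_of_exponent_le hn (by linarith [ENNReal.toReal_nonneg (a := 2 / s)])
    have hpow0 : 0 < n ^ (1 - (2 / s).toReal) := Real.rpow_pos_of_pos hn0 _
    rw [Real.norm_of_nonneg (by positivity), norm_one, mul_one, div_le_iff₀ (by positivity)] at hν
    have h4 : Mx ^ 2 ≤ K * (n * h ν ^ (dI + dC)) := by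
      calc Mx ^ 2 = Mx ^ 2 * 1 := (mul_one _).symm
        _ ≤ Mx ^ 2 * Real.log n := by gcongr
        _ ≤ K * (n ^ (1 - (2 / s).toReal) * h ν ^ (dI + dC)) := hν
        _ ≤ _ := by gcongr
    rw [div_le_iff₀ (by positivity)]
    refine h4.trans (le_of_eq ?_)
    field_simp
  have h5 : Tendsto (fun ν => ((S ν).maxSize : ℝ) / ((S ν).n * h ν ^ (dI + dC))) atTop (𝓝 0) := by
    have h6 := (Real.continuous_sqrt.tendsto 0).comp h2
    rw [Real.sqrt_zero] at h6
    refine h6.congr fun ν => ?_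
    have hh := hr.h_pos ν
    simp only [Function.comp_apply]
    rw [← div_pow, Real.sqrt_sq (by positivity)]
  have h7 := (h1.add h2).add ((hr.h_zero.pow 2).mul (h5.const_add 1))
  simpa [errRate] using h7

lemma errRate_pos (hr : BandwidthRates S h b lam) :
    ∀ᶠ ν in atTop, 0 < errRate (S ν) (h ν) := by
  filter_upwards [hr.nh_top.eventually_gt_atTop 0] with ν ha
  have hh := hr.h_pos ν
  unfold errRate
  positivity

/-! ## Replacing residuals by errors -/

/-- The cross terms are split by Young's inequality with a free parameter: squared errors are only
bounded in mean and must receive a vanishing factor θ. -/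
lemma abs_sub_mul_sub_sub_le {e₁ e₂ δ₁ δ₂ θ : ℝ} (hθ : 0 < θ) :
    |(e₁ - δ₁) * (e₂ - δ₂) - e₁ * e₂| ≤
      θ * (e₁ ^ 2 + e₂ ^ 2) + (1 / θ + 1) * (δ₁ ^ 2 + δ₂ ^ 2) := by
  have h1 : ∀ e δ : ℝ, |e * δ| ≤ θ * e ^ 2 + 1 / (4 * θ) * δ ^ 2 := fun e δ => by
    have h2 : θ * e ^ 2 + 1 / (4 * θ) * δ ^ 2 - |e * δ| = θ * (|e| - |δ| / (2 * θ)) ^ 2 := by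
      rw [abs_mul, ← sq_abs e, ← sq_abs δ]
      field_simp
      ring
    have h3 : 0 ≤ θ * (|e| - |δ| / (2 * θ)) ^ 2 := by positivity
    linarith
  have h4 : (e₁ - δ₁) * (e₂ - δ₂) - e₁ * e₂ = -(e₁ * δ₂) + -(e₂ * δ₁) + δ₁ * δ₂ := by ring
  have h5 : |δ₁ * δ₂| ≤ δ₁ ^ 2 + δ₂ ^ 2 := by
    rw [abs_mul, ← sq_abs δ₁, ← sq_abs δ₂]
    nlinarith [sq_nonneg (|δ₁| - |δ₂|), sq_nonneg (|δ₁| + |δ₂|)]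
  have h6 : 1 / (4 * θ) ≤ 1 / θ := one_div_le_one_div_of_le hθ (by linarith)
  rw [h4]
  refine (abs_add_le _ _).trans ((add_le_add ((abs_add_le _ _).trans (add_le_add (abs_neg _).le
    (abs_neg _).le)) h5).trans ?_)
  nlinarith [h1 e₁ δ₂, h1 e₂ δ₁, mul_le_mul_of_nonneg_right h6 (sq_nonneg δ₁),
    mul_le_mul_of_nonneg_right h6 (sq_nonneg δ₂)]

/-- A weight with two indices covers the variance estimator (weights on the diagonal) and the
covariance estimator (weights on pairs). The weights are functions of the regressors supported near
x, which makes the conditional moment bounds and the pointwise estimation bound applicable. -/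
lemma tendsto_resid_sub_err (hS : ∀ ν, IsGenerated (P ν) (S ν) pop)
    (hr : BandwidthRates S h b lam) (hB : PopBound pop x F Q V c ρ)
    (hreg : UnifRegular pop) (hfloor : DensityFloor S pop h) (hY : OutcomeCondition P S h)
    (hk : IsCompactKernel k C L) (M : Method)
    {w : ∀ ν g, Fin ((S ν).size g) → Fin ((S ν).size g) → Ω ν → ℝ} {N : ℕ → ℝ} {C₃ : ℝ}
    (hw0 : ∀ ν g j l ω, 0 ≤ w ν g j l ω)
    (hwm : ∀ ν g j l, Measurable[(S ν).sigmaX g] (w ν g j l))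
    (hwx : ∀ᶠ ν in atTop, ∀ g j l ω, w ν g j l ω ≠ 0 →
      (S ν).X g j ω ∈ Metric.closedBall x (ρ / 4) ∧ (S ν).X g l ω ∈ Metric.closedBall x (ρ / 4))
    (hN : ∀ᶠ ν in atTop, 0 < N ν)
    (hwN : ∀ᶠ ν in atTop, ∑ g, ∑ j, ∑ l, ∫⁻ ω, ENNReal.ofReal (w ν g j l ω) ∂(P ν) ≤
      ENNReal.ofReal (C₃ * N ν)) :
    Tendsto (fun p : Σ ν, Ω ν => (∑ g, ∑ j, ∑ l, w p.1 g j l p.2 *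
        ((S p.1).resid M k (h p.1) g j p.2 * (S p.1).resid M k (h p.1) g l p.2)) / N p.1 -
      (∑ g, ∑ j, ∑ l, w p.1 g j l p.2 *
        ((S p.1).err pop.m g j p.2 * (S p.1).err pop.m g l p.2)) / N p.1)
      (probFilter P) (𝓝 0) := by
  have hm := hreg.m.continuous
  have hQ := hB.Q_pos
  obtain ⟨C₁, hC₁, hev⟩ := eventually_mHat_sub_sq_le hS hr hB hreg hfloor hk M
  obtain ⟨C₂, hC₂, hint⟩ := exists_lintegral_mul_errBound_le hS hr hB hm hk
  set R := (Fintype.card (Fin dI ⊕ Fin dC) : ℝ) * L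
  -- With mean squared estimation error of order `errRate`, this choice balances θ against
  -- `errRate`/θ.
  set θ : ℕ → ℝ := fun ν => Real.sqrt (errRate (S ν) (h ν)) with hθ
  set D : ∀ ν g, Fin ((S ν).size g) → Ω ν → ℝ := fun ν g j ω =>
    errBound (S ν) pop.m k R (h ν) ((S ν).X g j ω) ω with hD
  have hD0 : ∀ ν g j ω, 0 ≤ D ν g j ω := fun ν g j ω => errBound_nonneg _ _ _ _ (hr.h_pos ν) _ _
  have hDm : ∀ ν g j, Measurable (D ν g j) := fun ν g j => measurable_errBound (S ν) hm hk R (h ν) g j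
  set α : ℕ → ℝ := fun ν => (1 / θ ν + 1) * C₁
  set Z : ∀ ν, Ω ν → ℝ := fun ν ω => (N ν)⁻¹ * ∑ g, ∑ j, ∑ l, w ν g j l ω *
    (θ ν * ((S ν).err pop.m g j ω ^ 2 + (S ν).err pop.m g l ω ^ 2) +
      α ν * (D ν g j ω + D ν g l ω)) with hZ
  have hθ0 : ∀ᶠ ν in atTop, 0 < θ ν := by
    filter_upwards [errRate_pos hr] with ν hν
    exact Real.sqrt_pos.2 hν
  have herr := tendsto_errRate hr hY
  have hθlim : Tendsto θ atTop (𝓝 0) := by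
    have := (Real.continuous_sqrt.tendsto 0).comp herr
    rwa [Real.sqrt_zero] at this
  -- The majorant Z tends to zero in mean: under the weights, e² costs Q, the estimation bound costs
  -- `errRate`, and the total mass of the weights is at most C₃ N.
  have hZlim : Tendsto (fun p : Σ ν, Ω ν => Z p.1 p.2) (probFilter P) (𝓝 0) := by
    refine tendsto_probFilter_of_lintegral (c := fun ν => ENNReal.ofReal
      ((2 * Q * θ ν + 2 * C₁ * C₂ * (θ ν + errRate (S ν) (h ν))) * C₃)) (fun ν => ?_) ?_ ?_ ?_
    · refine Measurable.const_mul (Finset.measurable_sum _ fun g _ => Finset.measurable_sum _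
        fun j _ => Finset.measurable_sum _ fun l _ => Measurable.mul
          ((hwm ν g j l).mono ((S ν).sigmaX_le g) le_rfl) ?_) _
      have h1 := (S ν).measurable_err hm g j
      have h2 := (S ν).measurable_err hm g l
      have h3 := hDm ν g j
      have h4 := hDm ν g l
      fun_prop
    · filter_upwards [hθ0, hN] with ν hθν hNν ω
      refine mul_nonneg (inv_nonneg.2 hNν.le) (Finset.sum_nonneg fun g _ => Finset.sum_nonneg
        fun j _ => Finset.sum_nonneg fun l _ => mul_nonneg (hw0 ν g j l ω) ?_)
      have h1 := hD0 ν g j ω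
      have h2 := hD0 ν g l ω
      positivity
    · filter_upwards [hθ0, hN, hint, hwN, errRate_pos hr] with ν hθν hNν hintν hwNν hεν
      have hα : 0 < α ν := by positivity
      set ψ : ∀ g, Fin ((S ν).size g) → Fin ((S ν).size g) → Ω ν → ℝ≥0∞ := fun g j l ω =>
        ENNReal.ofReal (w ν g j l ω)
      have hψ : ∀ g j l, Measurable[(S ν).sigmaX g] (ψ g j l) := fun g j l =>
        (hwm ν g j l).ennreal_ofReal
      have hψm : ∀ g j l, Measurable (ψ g j l) := fun g j l =>
        (hψ g j l).mono ((S ν).sigmaX_le g) le_rfl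
      have hEm : ∀ g j, Measurable fun ω => ENNReal.ofReal ((S ν).err pop.m g j ω ^ 2) :=
        fun g j => (((S ν).measurable_err hm g j).pow_const 2).ennreal_ofReal
      have hDm' : ∀ g j, Measurable fun ω => ENNReal.ofReal (D ν g j ω) :=
        fun g j => (hDm ν g j).ennreal_ofReal
      set T : ∀ g, Fin ((S ν).size g) → Fin ((S ν).size g) → Ω ν → ℝ≥0∞ := fun g j l ω =>
        ENNReal.ofReal (θ ν) * (ψ g j l ω * ENNReal.ofReal ((S ν).err pop.m g j ω ^ 2) +
          ψ g j l ω * ENNReal.ofReal ((S ν).err pop.m g l ω ^ 2)) +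
        ENNReal.ofReal (α ν) * (ψ g j l ω * ENNReal.ofReal (D ν g j ω) +
          ψ g j l ω * ENNReal.ofReal (D ν g l ω)) with hT
      have hTm : ∀ g j l, Measurable (T g j l) := fun g j l =>
        ((((hψm g j l).mul (hEm g j)).add ((hψm g j l).mul (hEm g l))).const_mul _).add
          ((((hψm g j l).mul (hDm' g j)).add ((hψm g j l).mul (hDm' g l))).const_mul _)
      have hpt : ∀ ω, ENNReal.ofReal (Z ν ω) =
          ENNReal.ofReal (N ν)⁻¹ * ∑ g, ∑ j, ∑ l, T g j l ω := fun ω => by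
        have hterm : ∀ g j l, 0 ≤ w ν g j l ω *
            (θ ν * ((S ν).err pop.m g j ω ^ 2 + (S ν).err pop.m g l ω ^ 2) +
              α ν * (D ν g j ω + D ν g l ω)) := fun g j l => by
          have h1 := hD0 ν g j ω
          have h2 := hD0 ν g l ω
          have h3 := hw0 ν g j l ω
          positivity
        rw [hZ, ENNReal.ofReal_mul (inv_nonneg.2 hNν.le), ENNReal.ofReal_sum_of_nonneg fun g _ =>
          Finset.sum_nonneg fun j _ => Finset.sum_nonneg fun l _ => hterm g j l]
        congr 1
        refine Finset.sum_congr rfl fun g _ => ?_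
        rw [ENNReal.ofReal_sum_of_nonneg fun j _ => Finset.sum_nonneg fun l _ => hterm g j l]
        refine Finset.sum_congr rfl fun j _ => ?_
        rw [ENNReal.ofReal_sum_of_nonneg fun l _ => hterm g j l]
        refine Finset.sum_congr rfl fun l _ => ?_
        have h1 := hD0 ν g j ω
        have h2 := hD0 ν g l ω
        rw [ENNReal.ofReal_mul (hw0 ν g j l ω), ENNReal.ofReal_add (by positivity) (by positivity),
          ENNReal.ofReal_mul hθν.le, ENNReal.ofReal_mul hα.le, ENNReal.ofReal_add (sq_nonneg _)
          (sq_nonneg _), ENNReal.ofReal_add h1 h2]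
        simp only [hT, ψ]
        ring
      have hTint : ∀ g j l, ∫⁻ ω, T g j l ω ∂(P ν) ≤
          ENNReal.ofReal (2 * Q * θ ν + 2 * C₁ * C₂ * (θ ν + errRate (S ν) (h ν))) *
            ∫⁻ ω, ψ g j l ω ∂(P ν) := fun g j l => by
        have hm1 : Measurable fun ω => ENNReal.ofReal (θ ν) *
          (ψ g j l ω * ENNReal.ofReal ((S ν).err pop.m g j ω ^ 2) +
          ψ g j l ω * ENNReal.ofReal ((S ν).err pop.m g l ω ^ 2)) :=
          (((hψm g j l).mul (hEm g j)).add ((hψm g j l).mul (hEm g l))).const_mul _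
        have hm2 : Measurable fun ω => ψ g j l ω * ENNReal.ofReal ((S ν).err pop.m g j ω ^ 2) :=
          (hψm g j l).mul (hEm g j)
        have hm3 : Measurable fun ω => ψ g j l ω * ENNReal.ofReal (D ν g j ω) :=
          (hψm g j l).mul (hDm' g j)
        rw [hT, lintegral_add_left hm1, lintegral_const_mul' _ _ ENNReal.ofReal_ne_top,
          lintegral_const_mul' _ _ ENNReal.ofReal_ne_top, lintegral_add_left hm2,
          lintegral_add_left hm3]
        refine (add_le_add (mul_le_mul_right (add_le_add
          (lintegral_mul_err_sq_le (hS ν) hB hm g j (hψ g j l))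
          (lintegral_mul_err_sq_le (hS ν) hB hm g l (hψ g j l))) _)
          (mul_le_mul_right (add_le_add (hintν g j _ (hψ g j l)) (hintν g l _ (hψ g j l))) _)).trans
          (le_of_eq ?_)
        rw [← two_mul, ← two_mul, ← mul_assoc, ← mul_assoc, ← mul_assoc, ← mul_assoc, ← add_mul]
        congr 1
        rw [← ENNReal.ofReal_ofNat 2, ← ENNReal.ofReal_mul hθν.le, ← ENNReal.ofReal_mul
          (by positivity), ← ENNReal.ofReal_mul hα.le, ← ENNReal.ofReal_mul (by positivity),
          ← ENNReal.ofReal_add (by positivity) (by positivity)]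
        congr 1
        have h1 : errRate (S ν) (h ν) = θ ν * θ ν := (Real.mul_self_sqrt hεν.le).symm
        simp only [α]
        rw [h1]
        field_simp
      simp only [hpt]
      rw [lintegral_const_mul' _ _ ENNReal.ofReal_ne_top, lintegral_finsetSum _ fun g _ =>
        Finset.measurable_sum _ fun j _ => Finset.measurable_sum _ fun l _ => hTm g j l]
      simp only [lintegral_sum_sum (hTm _)]
      calc ENNReal.ofReal (N ν)⁻¹ * ∑ g, ∑ j, ∑ l, ∫⁻ ω, T g j l ω ∂(P ν)
          ≤ ENNReal.ofReal (N ν)⁻¹ * ∑ g, ∑ j, ∑ l,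
            ENNReal.ofReal (2 * Q * θ ν + 2 * C₁ * C₂ * (θ ν + errRate (S ν) (h ν))) *
            ∫⁻ ω, ψ g j l ω ∂(P ν) := by
            gcongr
            exact hTint _ _ _
        _ = ENNReal.ofReal (N ν)⁻¹ *
            (ENNReal.ofReal (2 * Q * θ ν + 2 * C₁ * C₂ * (θ ν + errRate (S ν) (h ν))) *
            ∑ g, ∑ j, ∑ l, ∫⁻ ω, ψ g j l ω ∂(P ν)) := by
            simp only [Finset.mul_sum]
        _ ≤ ENNReal.ofReal (N ν)⁻¹ *
            (ENNReal.ofReal (2 * Q * θ ν + 2 * C₁ * C₂ * (θ ν + errRate (S ν) (h ν))) *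
            ENNReal.ofReal (C₃ * N ν)) := by
            gcongr
        _ = _ := by
            rw [← ENNReal.ofReal_mul (by positivity), ← ENNReal.ofReal_mul (by positivity)]
            congr 1
            field_simp
    · have h1 := (((hθlim.const_mul (2 * Q)).add
        ((hθlim.add herr).const_mul (2 * C₁ * C₂))).mul_const C₃)
      have := ENNReal.tendsto_ofReal h1
      simpa using this
  refine squeeze_zero_norm' ?_ hZlim
  filter_upwards [hev, eventually_fst hθ0, eventually_fst hN, eventually_fst hwx] with p hp hθp hNp
    hwp
  rw [Real.norm_eq_abs, ← sub_div, abs_div, abs_of_pos hNp, div_eq_inv_mul, hZ]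
  refine mul_le_mul_of_nonneg_left ?_ (inv_nonneg.2 hNp.le)
  simp only [← Finset.sum_sub_distrib]
  refine (Finset.abs_sum_le_sum_abs _ _).trans (Finset.sum_le_sum fun g _ => ?_)
  refine (Finset.abs_sum_le_sum_abs _ _).trans (Finset.sum_le_sum fun j _ => ?_)
  refine (Finset.abs_sum_le_sum_abs _ _).trans (Finset.sum_le_sum fun l _ => ?_)
  rw [← mul_sub, abs_mul, abs_of_nonneg (hw0 _ _ _ _ _)]
  by_cases hw : w p.1 g j l p.2 = 0
  · rw [hw, zero_mul, zero_mul]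
  refine mul_le_mul_of_nonneg_left ?_ (hw0 _ _ _ _ _)
  obtain ⟨hj, hl⟩ := hwp g j l p.2 hw
  have e : ∀ i, (S p.1).resid M k (h p.1) g i p.2 = (S p.1).err pop.m g i p.2 -
      ((S p.1).mHat M k (h p.1) ((S p.1).X g i p.2) p.2 - pop.m ((S p.1).X g i p.2)) := fun i => by
    unfold ClusterSample.resid ClusterSample.err
    ring
  rw [e, e]
  refine (abs_sub_mul_sub_sub_le hθp).trans ?_
  have hα : 0 ≤ 1 / θ p.1 + 1 := by positivity
  have h1 := mul_le_mul_of_nonneg_left (add_le_add (hp _ hj) (hp _ hl)) hα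
  simp only [α, hD]
  linarith

end Asymptotic

end ClusterKernel

namespace ClusterKernel

variable {dI dC : ℕ}

/-! ## Laws of large numbers -/

section Centered

variable {Ω : ℕ → Type*} [∀ ν, MeasurableSpace (Ω ν)] {P : ∀ ν, Measure (Ω ν)}
  [∀ ν, IsProbabilityMeasure (P ν)] {ι : ℕ → Type*} [∀ ν, Fintype (ι ν)]

/-- Sums of independent variables, centred and divided by a bound for their standard deviation. -/
lemma tendsto_centered_div {T : ∀ ν, ι ν → Ω ν → ℝ} {c N : ℕ → ℝ}
    (hT : ∀ ν i, Measurable (T ν i)) (hind : ∀ ν, iIndepFun (T ν) (P ν))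
    (hsq : ∀ᶠ ν in atTop, ∑ i, ∫⁻ ω, ENNReal.ofReal (T ν i ω ^ 2) ∂(P ν) ≤ ENNReal.ofReal (c ν))
    (hc : Tendsto (fun ν => c ν / N ν ^ 2) atTop (𝓝 0)) :
    Tendsto (fun p : Σ ν, Ω ν => (∑ i, T p.1 i p.2 - ∑ i, ∫ ω, T p.1 i ω ∂(P p.1)) / N p.1)
      (probFilter P) (𝓝 0) := by
  have h1 : Tendsto (fun p : Σ ν, Ω ν =>
      ((∑ i, T p.1 i p.2 - ∑ i, ∫ ω, T p.1 i ω ∂(P p.1)) / N p.1) ^ 2) (probFilter P) (𝓝 0) := by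
    refine tendsto_probFilter_of_lintegral (X := fun ν ω =>
      ((∑ i, T ν i ω - ∑ i, ∫ ω, T ν i ω ∂(P ν)) / N ν) ^ 2)
      (c := fun ν => ENNReal.ofReal (c ν / N ν ^ 2)) (fun ν => ?_)
      (Eventually.of_forall fun ν ω => sq_nonneg _) ?_ (by simpa using ENNReal.tendsto_ofReal hc)
    · exact (((Finset.measurable_sum _ fun i _ => hT ν i).sub_const _).div_const _).pow_const 2
    · filter_upwards [hsq] with ν hν
      -- Square integrability of each term is implied by the finite bound on the sum of second
      -- moments.
      have hmem : ∀ i, MemLp (T ν i) 2 (P ν) := fun i =>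
        memLp_two_of_lintegral (hT ν i) (((Finset.single_le_sum (fun _ _ => zero_le)
          (Finset.mem_univ i)).trans hν).trans_lt ENNReal.ofReal_lt_top)
      have h2 := (lintegral_sq_sum_sub_le (P := P ν) Finset.univ (fun i _ => hmem i)
        (hind ν)).trans hν
      simp only [div_pow]
      simp only [div_eq_inv_mul, ENNReal.ofReal_mul (inv_nonneg.2 (sq_nonneg (N ν)))]
      rw [lintegral_const_mul' _ _ ENNReal.ofReal_ne_top]
      exact mul_le_mul_right h2 _
  have h3 := (Real.continuous_sqrt.tendsto 0).comp h1
  rw [Real.sqrt_zero] at h3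
  refine squeeze_zero_norm (fun p => ?_) h3
  simp only [Function.comp_apply, Real.sqrt_sq_eq_abs, Real.norm_eq_abs, le_refl]

/-- If the sum of second moments is O(N), the variance after division by N is O(1/N), so only
convergence of the means is left. -/
lemma tendsto_sum_div {T : ∀ ν, ι ν → Ω ν → ℝ} {N : ℕ → ℝ} {C l : ℝ}
    (hT : ∀ ν i, Measurable (T ν i)) (hind : ∀ ν, iIndepFun (T ν) (P ν))
    (hsq : ∀ᶠ ν in atTop, ∑ i, ∫⁻ ω, ENNReal.ofReal (T ν i ω ^ 2) ∂(P ν) ≤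
      ENNReal.ofReal (C * N ν)) (hN : Tendsto N atTop atTop)
    (hmean : Tendsto (fun ν => (∑ i, ∫ ω, T ν i ω ∂(P ν)) / N ν) atTop (𝓝 l)) :
    Tendsto (fun p : Σ ν, Ω ν => (∑ i, T p.1 i p.2) / N p.1) (probFilter P) (𝓝 l) := by
  have h1 : Tendsto (fun ν => C * N ν / N ν ^ 2) atTop (𝓝 0) := by
    have := hN.inv_tendsto_atTop.const_mul C
    rw [mul_zero] at this
    refine this.congr' ?_
    filter_upwards [hN.eventually_gt_atTop 0] with ν hν
    rw [Pi.inv_apply]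
    field_simp
  have h2 := (tendsto_centered_div hT hind hsq h1).add
    (tendsto_fst_comp (P := P) hmean)
  rw [zero_add] at h2
  refine h2.congr fun p => ?_
  rw [← add_div, sub_add_cancel]

end Centered

section Population

variable {Ω : Type*} [mΩ : MeasurableSpace Ω] {P : Measure Ω}
  {S : ClusterSample dI dC Ω} {pop : Population dI dC} {x : RegSpace dI dC} {F Q V c ρ : ℝ}

lemma integral_comp_of_density {ι : Type} [Fintype ι] {φ H : EuclideanSpace ℝ ι → ℝ}
    {Z : Ω → EuclideanSpace ℝ ι} (hZ : Measurable Z) (hφ : Measurable φ) (hφ0 : ∀ z, 0 ≤ φ z)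
    (hmap : P.map Z = volume.withDensity fun z => ENNReal.ofReal (φ z)) (hH : Measurable H) :
    ∫ ω, H (Z ω) ∂P = ∫ z, H z * φ z := by
  rw [← integral_map hZ.aemeasurable hH.aestronglyMeasurable, hmap]
  have h1 : (fun z => ENNReal.ofReal (φ z)) = fun z => ((φ z).toNNReal : ℝ≥0∞) := rfl
  rw [h1, integral_withDensity_eq_integral_smul hφ.real_toNNReal]
  refine integral_congr_ae (ae_of_all _ fun z => ?_)
  simp only [NNReal.smul_def, Real.coe_toNNReal _ (hφ0 z), smul_eq_mul, mul_comm]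

lemma integral_weight_X (hS : IsGenerated P S pop) (hreg : UnifRegular pop) {w : RegSpace dI dC → ℝ}
    (hw : Measurable w) {φ : RegSpace dI dC → ℝ} (hφ : Measurable φ) {h : ℝ} (hh : 0 < h)
    (g : Fin S.G) (j : Fin (S.size g)) :
    ∫ ω, w (h⁻¹ • (S.X g j ω - x)) * φ (S.X g j ω) ∂P =
      h ^ (dI + dC) * ∫ u, w u * (φ (x + h • u) * pop.f (x + h • u)) := by
  rw [integral_comp_of_density (H := fun y => w (h⁻¹ • (y - x)) * φ y) (S.measurable_X g j)
    hreg.f.continuous.measurable hreg.f_nonneg (hS.density g j)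
    ((hw.comp (by fun_prop)).mul hφ)]
  simp only [mul_assoc]
  rw [integral_smul_sub w (fun y => φ y * pop.f y) hh x]
  simp

/-- The volume factor has exponent 2 dI + dC because the pair lives in the space with one copy of
the cluster-level coordinates. -/
lemma integral_weight_joint (hS : IsGenerated P S pop) (hreg : UnifRegular pop)
    {w : JointSpace 2 dI dC → ℝ} (hw : Measurable w) {φ : JointSpace 2 dI dC → ℝ}
    (hφ : Measurable φ) {h : ℝ} (hh : 0 < h) (z : JointSpace 2 dI dC)
    (g : Fin S.G) {j l : Fin (S.size g)} (hjl : j ≠ l) :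
    ∫ ω, w (h⁻¹ • (S.joint g ![j, l] ω - z)) * φ (S.joint g ![j, l] ω) ∂P =
      h ^ (2 * dI + dC) * ∫ u, w u * (φ (z + h • u) * pop.fJoint 2 (z + h • u)) := by
  have hinj : Function.Injective ![j, l] := by
    intro a b hab
    fin_cases a <;> fin_cases b <;> simp_all [eq_comm]
  rw [integral_comp_of_density (H := fun y => w (h⁻¹ • (y - z)) * φ y)
    ((S.measurable_joint_sigmaX (by norm_num) g ![j, l]).mono (S.sigmaX_le g) le_rfl)
    hreg.fTwo.continuous.measurable (hreg.fJoint_nonneg 2 le_rfl (by norm_num))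
    (hS.joint_density 2 le_rfl (by norm_num) g _ hinj)
    ((hw.comp (by fun_prop)).mul hφ)]
  simp only [mul_assoc]
  rw [integral_smul_sub w (fun y => φ y * pop.fJoint 2 y) hh z]
  simp

/-- The vector `(u₁, u₂; c)` made of two regressor vectors with the same `c`. -/
noncomputable def joinPair (u v : RegSpace dI dC) : JointSpace 2 dI dC :=
  WithLp.toLp 2 (Sum.elim (fun q => (![u, v] q.1) (Sum.inl q.2)) fun q => u (Sum.inr q))

lemma ClusterSample.joint_eq_joinPair (g : Fin S.G) (j l : Fin (S.size g)) (ω : Ω) :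
    S.joint g ![j, l] ω = joinPair (S.X g j ω) (S.X g l ω) := by
  ext q
  rcases q with ⟨i, q⟩ | q
  · fin_cases i <;> rfl
  · rfl

lemma measurable_joinPair : Measurable fun z : RegSpace dI dC × RegSpace dI dC =>
    joinPair z.1 z.2 := by
  refine measurable_of_coord fun q => ?_
  rcases q with ⟨i, q⟩ | q
  · fin_cases i
    · exact (measurable_fst).coord (Sum.inl q)
    · exact (measurable_snd).coord (Sum.inl q)
  · exact (measurable_fst).coord (Sum.inr q)

/-- The kernel weights of the ordered pairs of members of a cluster. -/
noncomputable def pairKernel (S : ClusterSample dI dC Ω) (k : ℝ → ℝ) (b : ℝ) (x : RegSpace dI dC)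
    (g : Fin S.G) (j l : Fin (S.size g)) (ω : Ω) : ℝ :=
  if j < l then S.pairWeight k b x g j l ω else 0

variable {k : ℝ → ℝ} {C L : ℝ}

lemma pairKernel_nonneg (hk : IsCompactKernel k C L) (b : ℝ) (g : Fin S.G) (j l : Fin (S.size g))
    (ω : Ω) : 0 ≤ pairKernel S k b x g j l ω := by
  unfold pairKernel
  split_ifs
  · exact hk.prod_nonneg _
  · exact le_rfl

lemma measurable_pairKernel (hk : IsCompactKernel k C L) (b : ℝ) (g : Fin S.G)
    (j l : Fin (S.size g)) : Measurable[S.sigmaX g] (pairKernel S k b x g j l) := by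
  unfold pairKernel ClusterSample.pairWeight
  split_ifs
  · exact hk.continuous_prod.measurable.comp
      (((S.measurable_joint_sigmaX (by norm_num) g ![j, l]).sub_const _).const_smul b⁻¹)
  · exact measurable_const

/-- The pair kernel is a product over coordinates, so each coordinate of both members is within L b
of x. -/
lemma mem_near_of_pairKernel_ne (hk : IsCompactKernel k C L) {b : ℝ} (hb : 0 < b) {g : Fin S.G}
    {j l : Fin (S.size g)} {ω : Ω} (hne : pairKernel S k b x g j l ω ≠ 0) :
    j ≠ l ∧ j ∈ S.near x (Fintype.card (Fin dI ⊕ Fin dC) * L * b) g ω ∧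
      l ∈ S.near x (Fintype.card (Fin dI ⊕ Fin dC) * L * b) g ω := by
  unfold pairKernel at hne
  split_ifs at hne with hjl
  · refine ⟨hjl.ne, ?_⟩
    have h1 := hk.abs_le_of_ne hne
    have hL := hk.pos.le
    have h2 : ∀ q, |(S.joint g ![j, l] ω - diagPt 2 x) q| ≤ L * b := fun q => by
      have := h1 q
      rw [PiLp.smul_apply, smul_eq_mul, abs_mul, abs_inv, abs_of_pos hb, inv_mul_eq_div,
        div_le_iff₀ hb] at this
      exact this
    simp only [S.mem_near, Metric.mem_closedBall, dist_eq_norm, mul_assoc]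
    refine ⟨norm_le_card_mul (by positivity) fun q => ?_,
      norm_le_card_mul (by positivity) fun q => ?_⟩
    · rcases q with q | q
      · exact h2 (Sum.inl (0, q))
      · exact h2 (Sum.inr q)
    · rcases q with q | q
      · exact h2 (Sum.inl (1, q))
      · exact h2 (Sum.inr q)
  · exact absurd rfl hne

lemma pairKernel_le (hk : IsCompactKernel k C L) (b : ℝ) (g : Fin S.G) (j l : Fin (S.size g))
    (ω : Ω) : pairKernel S k b x g j l ω ≤ C ^ Fintype.card ((Fin 2 × Fin dI) ⊕ Fin dC) := by
  unfold pairKernel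
  split_ifs
  · exact hk.prod_le _
  · have := hk.one_le
    positivity

/-- Only ordered pairs of distinct nearby members contribute, and their number is the second falling
factorial of the count. -/
lemma sum_pairKernel_le (hk : IsCompactKernel k C L) {b : ℝ} (hb : 0 < b) (g : Fin S.G) (ω : Ω) :
    ∑ j, ∑ l, pairKernel S k b x g j l ω ≤ C ^ Fintype.card ((Fin 2 × Fin dI) ⊕ Fin dC) *
      (S.near x (Fintype.card (Fin dI ⊕ Fin dC) * L * b) g ω).card.descFactorial 2 := by
  classical
  have hC := hk.one_le
  set s := S.near x (Fintype.card (Fin dI ⊕ Fin dC) * L * b) g ω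
  set K := C ^ Fintype.card ((Fin 2 × Fin dI) ⊕ Fin dC)
  have hcard : s.offDiag.card = s.card.descFactorial 2 := by
    rw [Finset.offDiag_card, Nat.descFactorial_succ, Nat.descFactorial_one, Nat.sub_mul, one_mul]
  rw [← Finset.sum_product', ← hcard, mul_comm, ← nsmul_eq_mul, ← Finset.sum_const,
    Finset.univ_product_univ]
  rw [← Finset.sum_subset (Finset.subset_univ s.offDiag)]
  · exact Finset.sum_le_sum fun p _ => pairKernel_le hk b g p.1 p.2 ω
  · intro p _ hp
    by_contra hne
    obtain ⟨h1, h2, h3⟩ := mem_near_of_pairKernel_ne hk hb hne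
    exact hp (Finset.mem_offDiag.2 ⟨h2, h3, h1⟩)

lemma lintegral_sq_sum_pairKernel_le (hS : IsGenerated P S pop) (hB : PopBound pop x F Q V c ρ)
    (hk : IsCompactKernel k C L) {b A : ℝ} (hb : 0 < b) (g : Fin S.G)
    (hA : (S.size g : ℝ) * (Fintype.card (Fin dI ⊕ Fin dC) * L * b) ^ dI ≤ A) :
    ∫⁻ ω, ENNReal.ofReal ((∑ j, ∑ l, pairKernel S k b x g j l ω) ^ 2) ∂P ≤
      ENNReal.ofReal ((C ^ Fintype.card ((Fin 2 × Fin dI) ⊕ Fin dC)) ^ 2 * (countConst dI dC F A *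
        ((S.size g).descFactorial 2 *
          (Fintype.card (Fin dI ⊕ Fin dC) * L * b) ^ (2 * dI + dC)))) := by
  have hC := hk.one_le
  have hL := hk.pos.le
  set R := Fintype.card (Fin dI ⊕ Fin dC) * L * b
  set K := C ^ Fintype.card ((Fin 2 × Fin dI) ⊕ Fin dC)
  calc ∫⁻ ω, ENNReal.ofReal ((∑ j, ∑ l, pairKernel S k b x g j l ω) ^ 2) ∂P
      ≤ ∫⁻ ω, ENNReal.ofReal (K ^ 2) * ((S.near x R g ω).card.descFactorial 2 : ℝ≥0∞) ^ 2 ∂P := by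
        refine lintegral_mono fun ω => ?_
        rw [← ENNReal.ofReal_natCast, ← ENNReal.ofReal_pow (by positivity),
          ← ENNReal.ofReal_mul (by positivity), ← mul_pow]
        refine ENNReal.ofReal_le_ofReal (pow_le_pow_left₀ ?_ (sum_pairKernel_le hk hb g ω) 2)
        exact Finset.sum_nonneg fun j _ => Finset.sum_nonneg fun l _ =>
          pairKernel_nonneg hk b g j l ω
    _ ≤ _ := by
        rw [lintegral_const_mul' _ _ ENNReal.ofReal_ne_top, ENNReal.ofReal_mul (by positivity)]
        exact mul_le_mul_right (lintegral_pairs_sq_le hS hB g x (by positivity) hA) _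

lemma lintegral_sq_sum_near_le (hS : IsGenerated P S pop) (hB : PopBound pop x F Q V c ρ)
    {ζ : RegSpace dI dC → ℝ} {B r A : ℝ} (hr : 0 ≤ r) (g : Fin S.G)
    (hA : (S.size g : ℝ) * r ^ dI ≤ A) (hζ : ∀ y, |ζ y| ≤ B)
    (hζ0 : ∀ y, y ∉ Metric.closedBall x r → ζ y = 0) :
    ∫⁻ ω, ENNReal.ofReal ((∑ j, ζ (S.X g j ω)) ^ 2) ∂P ≤
      ENNReal.ofReal (B ^ 2 * (countConst dI dC F A * (S.size g * r ^ (dI + dC)))) := by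
  calc ∫⁻ ω, ENNReal.ofReal ((∑ j, ζ (S.X g j ω)) ^ 2) ∂P
      ≤ ∫⁻ ω, ENNReal.ofReal (B ^ 2) * ((S.near x r g ω).card : ℝ≥0∞) ^ 2 ∂P := by
        refine lintegral_mono fun ω => ?_
        rw [← ENNReal.ofReal_natCast, ← ENNReal.ofReal_pow (by positivity),
          ← ENNReal.ofReal_mul (by positivity), ← mul_pow, ← sq_abs (∑ j, _)]
        refine ENNReal.ofReal_le_ofReal (pow_le_pow_left₀ (abs_nonneg _) ?_ 2)
        rw [← Finset.sum_subset (Finset.subset_univ (S.near x r g ω)) fun j _ hj =>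
          hζ0 _ (by rwa [← S.mem_near])]
        refine (Finset.abs_sum_le_sum_abs _ _).trans
          ((Finset.sum_le_sum fun j _ => hζ _).trans (le_of_eq ?_))
        rw [Finset.sum_const, nsmul_eq_mul, mul_comm]
    _ ≤ _ := by
        rw [lintegral_const_mul' _ _ ENNReal.ofReal_ne_top, ENNReal.ofReal_mul (by positivity)]
        exact mul_le_mul_right (lintegral_card_sq_le hS hB g x hr hA) _

lemma sum_ite_lt_const (n : ℕ) (a : ℝ) :
    ∑ j : Fin n, ∑ l : Fin n, (if j < l then a else 0) = n.choose 2 * a := by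
  have h1 : ∀ j : Fin n, ∑ l : Fin n, (if j < l then a else 0) = ((n - 1 - j : ℕ) : ℝ) * a :=
    fun j => by
      rw [← Finset.sum_filter, Finset.sum_const, nsmul_eq_mul]
      congr 2
      have : Finset.univ.filter (fun l => j < l) = Finset.Ioi j := by ext; simp
      rw [this, Fin.card_Ioi]
  simp only [h1]
  rw [← Finset.sum_mul]
  congr 1
  rw [← Nat.cast_sum, Fin.sum_univ_eq_sum_range (fun i => n - 1 - i), Finset.sum_range_reflect
    (fun i => i), Finset.sum_range_id, Nat.choose_two_right]

end Population

end ClusterKernel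

namespace ClusterKernel

variable {dI dC : ℕ}

/-! ## Consistency of the estimators of the asymptotic variance -/

section Asymptotic

variable {Ω : ℕ → Type*} [∀ ν, MeasurableSpace (Ω ν)] {P : ∀ ν, Measure (Ω ν)}
  [∀ ν, IsProbabilityMeasure (P ν)]
  {S : ∀ ν, ClusterSample dI dC (Ω ν)} {pop : Population dI dC} {x : RegSpace dI dC}
  {F Q V c ρ : ℝ} {h b : ℕ → ℝ} {lam : ℝ} {k : ℝ → ℝ} {C L : ℝ}

lemma measurable_weight_term {Ω : Type*} [MeasurableSpace Ω] (S : ClusterSample dI dC Ω)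
    {w : RegSpace dI dC → ℝ} (hw : Measurable w) (h : ℝ) (x : RegSpace dI dC) (g : Fin S.G)
    (j : Fin (S.size g)) : Measurable[S.sigmaX g] fun ω => w (h⁻¹ • (S.X g j ω - x)) :=
  hw.comp (((S.measurable_X_sigmaX g j).sub_const x).const_smul h⁻¹)

lemma integrable_weight_term {Ω : Type*} [MeasurableSpace Ω] {P : Measure Ω}
    [IsProbabilityMeasure P] (S : ClusterSample dI dC Ω) {w : RegSpace dI dC → ℝ} {C R : ℝ}
    (hw : IsWeight w C R) (h : ℝ) (x : RegSpace dI dC) (g : Fin S.G) (j : Fin (S.size g)) :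
    Integrable (fun ω => w (h⁻¹ • (S.X g j ω - x))) P :=
  Integrable.of_bound ((measurable_weight_term S hw.measurable h x g j).mono (S.sigmaX_le g)
    le_rfl).aestronglyMeasurable C (ae_of_all _ fun _ => hw.bound _)

/-- A general weight in place of the kernel serves two purposes: the density estimator and the
empirical first moments of the kernel in the local linear expansion. -/
lemma tendsto_sum_weight (hS : ∀ ν, IsGenerated (P ν) (S ν) pop)
    (hr : BandwidthRates S h b lam) (hB : PopBound pop x F Q V c ρ) (hreg : UnifRegular pop)
    {w : RegSpace dI dC → ℝ} {B R : ℝ} (hw : IsWeight w B R) (hR : 0 ≤ R) :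
    Tendsto (fun p : Σ ν, Ω ν => (∑ g, ∑ j, w ((h p.1)⁻¹ • ((S p.1).X g j p.2 - x))) /
      ((S p.1).n * h p.1 ^ (dI + dC))) (probFilter P) (𝓝 (pop.f x * ∫ u, w u)) := by
  obtain ⟨A, hA0, hA⟩ := hr.exists_maxSize_bound R hR
  have hK := countConst_nonneg (dI := dI) (dC := dC) hB.F_pos.le hA0.le
  refine tendsto_sum_div (ι := fun ν => Fin (S ν).G)
    (N := fun ν => (S ν).n * h ν ^ (dI + dC)) (T := fun ν g ω => ∑ j, w ((h ν)⁻¹ • ((S ν).X g j ω - x)))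
    (C := B ^ 2 * (countConst dI dC F A * R ^ (dI + dC))) (fun ν g => ?_) (fun ν => ?_) ?_
    hr.nh_top ?_
  · exact Finset.measurable_sum _ fun j _ =>
      (measurable_weight_term (S ν) hw.measurable (h ν) x g j).mono ((S ν).sigmaX_le g) le_rfl
  · refine iIndepFun_of_data (hS ν) fun g => ⟨fun z => ∑ j, w ((h ν)⁻¹ • (z.2 j - x)), ?_,
      fun ω => rfl⟩
    have hX : ∀ j, Measurable fun z : (Fin ((S ν).size g) → ℝ) ×
      (Fin ((S ν).size g) → RegSpace dI dC) => z.2 j :=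
      fun j => (measurable_pi_apply j).comp measurable_snd
    exact Finset.measurable_sum _ fun j _ => hw.measurable.comp
      (((hX j).sub_const x).const_smul (h ν)⁻¹)
  · filter_upwards [hA] with ν hAν
    have hh := hr.h_pos ν
    refine (Finset.sum_le_sum fun g _ => lintegral_sq_sum_near_le (hS ν) hB
      (r := R * h ν) (ζ := fun y => w ((h ν)⁻¹ • (y - x))) (B := B)
      (by positivity) g (hAν g) (fun y => hw.bound _) fun y hy => hw.support _ ?_).trans ?_
    · rw [Metric.mem_closedBall, dist_eq_norm, not_le] at hy
      rwa [norm_smul, norm_inv, Real.norm_of_nonneg hh.le, inv_mul_eq_div, lt_div_iff₀ hh]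
    · rw [← ENNReal.ofReal_sum_of_nonneg fun _ _ => by positivity, (S ν).n_eq_sum, Finset.sum_mul,
        Finset.mul_sum]
      refine ENNReal.ofReal_le_ofReal (Finset.sum_le_sum fun g _ => le_of_eq ?_)
      rw [mul_pow]
      ring
  · obtain ⟨D, hD⟩ := hreg.f.exists_bound
    refine (tendsto_integral_weight hw hreg.f.continuous hD x hr.h_zero).congr' ?_
    filter_upwards [hr.nh_top.eventually_gt_atTop 0] with ν ha
    rw [eq_div_iff ha.ne', (S ν).n_eq_sum, Finset.sum_mul, Finset.mul_sum]
    refine Finset.sum_congr rfl fun g _ => ?_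
    rw [integral_finsetSum _ fun j _ => integrable_weight_term (S ν) hw (h ν) x g j]
    have h1 : ∀ j, ∫ ω, w ((h ν)⁻¹ • ((S ν).X g j ω - x)) ∂(P ν) =
        h ν ^ (dI + dC) * ∫ u, w u * pop.f (x + h ν • u) := fun j => by
      simpa using integral_weight_X (hS ν) hreg hw.measurable (φ := fun _ => 1) (x := x)
        measurable_const (hr.h_pos ν) g j
    simp only [h1]
    rw [Finset.sum_const, Finset.card_univ, Fintype.card_fin, nsmul_eq_mul]
    ring

lemma IsWeight.sq {ι : Type} [Fintype ι] {w : EuclideanSpace ℝ ι → ℝ} {B R : ℝ}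
    (hw : IsWeight w B R) : IsWeight (fun u => w u ^ 2) (B ^ 2) R where
  measurable := hw.measurable.pow_const 2
  bound u := by
    rw [abs_pow]
    exact pow_le_pow_left₀ (abs_nonneg _) (hw.bound u) 2
  support u hu := by simp only [hw.support u hu, ne_eq, OfNat.ofNat_ne_zero, not_false_eq_true,
    zero_pow]

/-- The second conditional moment of the errors under a kernel weight. -/
lemma integral_weight_mul_err_sq {Ω : Type*} [MeasurableSpace Ω] {P : Measure Ω}
    [IsProbabilityMeasure P] {S : ClusterSample dI dC Ω} (hS : IsGenerated P S pop)
    (hB : PopBound pop x F Q V c ρ) (hreg : UnifRegular pop)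
    {w : RegSpace dI dC → ℝ} {B R : ℝ} (hw : IsWeight w B R) {h : ℝ} (hh : 0 < h)
    (g : Fin S.G) (j : Fin (S.size g)) :
    ∫ ω, w (h⁻¹ • (S.X g j ω - x)) * S.err pop.m g j ω ^ 2 ∂P =
      h ^ (dI + dC) * ∫ u, w u * (pop.sigmaSq (x + h • u) * pop.f (x + h • u)) := by
  rw [(hS.variance g j).integral_mul_eq (S.sigmaX_le g)
    (memLp_err hS hB hreg.m.continuous g j).integrable_sq
    (measurable_weight_term S hw.measurable h x g j) (fun ω => hw.bound _)]
  exact integral_weight_X hS hreg hw.measurable hreg.sigmaSq.continuous.measurable hh g j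

lemma integrable_weight_mul_err_sq {Ω : Type*} [MeasurableSpace Ω] {P : Measure Ω}
    [IsProbabilityMeasure P] {S : ClusterSample dI dC Ω} (hS : IsGenerated P S pop)
    (hB : PopBound pop x F Q V c ρ) (hreg : UnifRegular pop)
    {w : RegSpace dI dC → ℝ} {B R : ℝ} (hw : IsWeight w B R) (h : ℝ)
    (g : Fin S.G) (j : Fin (S.size g)) :
    Integrable (fun ω => w (h⁻¹ • (S.X g j ω - x)) * S.err pop.m g j ω ^ 2) P :=
  (memLp_err hS hB hreg.m.continuous g j).integrable_sq.bdd_mul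
    ((measurable_weight_term S hw.measurable h x g j).mono (S.sigmaX_le g)
      le_rfl).aestronglyMeasurable (c := B) (ae_of_all _ fun _ => hw.bound _)

lemma tendsto_integral_mul_density {ι : Type} [Fintype ι] {φ f w : EuclideanSpace ℝ ι → ℝ}
    {kφ kf : ℕ} (hφ : UnifSmooth kφ φ) (hf : UnifSmooth kf f) {B R : ℝ} (hw : IsWeight w B R)
    (z : EuclideanSpace ℝ ι) {h : ℕ → ℝ} (h0 : Tendsto h atTop (𝓝 0)) :
    Tendsto (fun ν => ∫ u, w u * (φ (z + h ν • u) * f (z + h ν • u))) atTop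
      (𝓝 (φ z * f z * ∫ u, w u)) := by
  obtain ⟨D₁, hD₁⟩ := hφ.exists_bound
  obtain ⟨D₂, hD₂⟩ := hf.exists_bound
  refine tendsto_integral_weight hw (φ := fun y => φ y * f y) (hφ.continuous.mul hf.continuous)
    (B := D₁ * D₂) (fun y => ?_) z h0
  rw [abs_mul]
  exact mul_le_mul (hD₁ y) (hD₂ y) (abs_nonneg _) ((abs_nonneg _).trans (hD₁ y))

lemma eventually_closedBall_subset (hρ : 0 < ρ) {a : ℕ → ℝ} (ha : Tendsto a atTop (𝓝 0)) (R : ℝ)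
    (x : RegSpace dI dC) :
    ∀ᶠ ν in atTop, Metric.closedBall x (R * a ν) ⊆ Metric.closedBall x ρ := by
  have h1 : Tendsto (fun ν => R * a ν) atTop (𝓝 0) := by simpa using ha.const_mul R
  filter_upwards [h1.eventually_le_const hρ] with ν hν
  exact Metric.closedBall_subset_closedBall hν

/-- The cluster sums have second moment O(n_g h^d) once the shrinking support lies in the ball where
fourth moments are bounded; the mean is an approximate identity applied to σ² f. -/
lemma tendsto_sum_weight_err_sq (hS : ∀ ν, IsGenerated (P ν) (S ν) pop)
    (hr : BandwidthRates S h b lam) (hB : PopBound pop x F Q V c ρ) (hreg : UnifRegular pop)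
    {w : RegSpace dI dC → ℝ} {B R : ℝ} (hw : IsWeight w B R) (hR : 0 ≤ R) :
    Tendsto (fun p : Σ ν, Ω ν => (∑ g, ∑ j, w ((h p.1)⁻¹ • ((S p.1).X g j p.2 - x)) *
        (S p.1).err pop.m g j p.2 ^ 2) / ((S p.1).n * h p.1 ^ (dI + dC)))
      (probFilter P) (𝓝 (pop.sigmaSq x * pop.f x * ∫ u, w u)) := by
  have hm := hreg.m.continuous
  obtain ⟨A, hA0, hA⟩ := hr.exists_maxSize_bound R hR
  have hK := countConst_nonneg (dI := dI) (dC := dC) hB.F_pos.le hA0.le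
  have hV := hB.V_pos
  refine tendsto_sum_div (ι := fun ν => Fin (S ν).G)
    (N := fun ν => (S ν).n * h ν ^ (dI + dC)) (T := fun ν g ω => ∑ j, w ((h ν)⁻¹ • ((S ν).X g j ω - x)) *
      (S ν).err pop.m g j ω ^ 2)
    (C := B ^ 2 * V * (countConst dI dC F A * R ^ (dI + dC))) (fun ν g => ?_) (fun ν => ?_) ?_
    hr.nh_top ?_
  · exact Finset.measurable_sum _ fun j _ => Measurable.mul
      ((measurable_weight_term (S ν) hw.measurable (h ν) x g j).mono ((S ν).sigmaX_le g) le_rfl)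
      (((S ν).measurable_err hm g j).pow_const 2)
  · refine iIndepFun_of_data (hS ν) fun g => ⟨fun z => ∑ j, w ((h ν)⁻¹ • (z.2 j - x)) *
      (z.1 j - pop.m (z.2 j)) ^ 2, ?_, fun ω => rfl⟩
    have hX : ∀ j, Measurable fun z : (Fin ((S ν).size g) → ℝ) ×
      (Fin ((S ν).size g) → RegSpace dI dC) => z.2 j :=
      fun j => (measurable_pi_apply j).comp measurable_snd
    have hY : ∀ j, Measurable fun z : (Fin ((S ν).size g) → ℝ) ×
      (Fin ((S ν).size g) → RegSpace dI dC) => z.1 j :=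
      fun j => (measurable_pi_apply j).comp measurable_fst
    exact Finset.measurable_sum _ fun j _ => (hw.measurable.comp
      (((hX j).sub_const x).const_smul (h ν)⁻¹)).mul (((hY j).sub (hm.measurable.comp (hX j))).pow_const 2)
  · filter_upwards [hA, eventually_closedBall_subset hB.ρ_pos hr.h_zero R x] with ν hAν hsub
    have hh := hr.h_pos ν
    have hterm : ∀ g, ∫⁻ ω, ENNReal.ofReal ((∑ j, w ((h ν)⁻¹ • ((S ν).X g j ω - x)) *
        (S ν).err pop.m g j ω ^ 2) ^ 2) ∂(P ν) ≤ ENNReal.ofReal (B ^ 2 * V *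
        (countConst dI dC F A * ((S ν).size g * (R * h ν) ^ (dI + dC)))) := fun g => by
      calc _ ≤ ∫⁻ ω, ENNReal.ofReal (B ^ 2) * ((((S ν).near x (R * h ν) g ω).card : ℝ≥0∞) *
            ENNReal.ofReal (∑ j ∈ (S ν).near x (R * h ν) g ω, (S ν).err pop.m g j ω ^ 4)) ∂(P ν) := by
            refine lintegral_mono fun ω => ?_
            refine (ENNReal.ofReal_le_ofReal (sq_sum_weighted_le g (fun j => hw.bound _)
              (fun j hj => (S ν).weight_eq_zero hw hh hj) _)).trans (le_of_eq ?_)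
            rw [ENNReal.ofReal_mul (by positivity), ENNReal.ofReal_mul (by positivity),
              ENNReal.ofReal_natCast]
            simp only [← pow_mul]
        _ ≤ ENNReal.ofReal (B ^ 2) * (ENNReal.ofReal V *
            ∫⁻ ω, (((S ν).near x (R * h ν) g ω).card : ℝ≥0∞) ^ 2 ∂(P ν)) := by
            rw [lintegral_const_mul' _ _ ENNReal.ofReal_ne_top]
            refine mul_le_mul_right ?_ _
            have := lintegral_card_mul_sum_four_le (hS ν) hB hm g (φ := fun c => (c : ℝ≥0∞)) x
              (R * h ν) hsub
            simpa only [sq] using this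
        _ ≤ _ := by
            rw [ENNReal.ofReal_mul (by positivity), ENNReal.ofReal_mul (by positivity), mul_assoc]
            exact mul_le_mul_right (mul_le_mul_right
              (lintegral_card_sq_le (hS ν) hB g x (by positivity) (hAν g)) _) _
    refine (Finset.sum_le_sum fun g _ => hterm g).trans ?_
    rw [← ENNReal.ofReal_sum_of_nonneg fun _ _ => by positivity, (S ν).n_eq_sum, Finset.sum_mul,
      Finset.mul_sum]
    refine ENNReal.ofReal_le_ofReal (Finset.sum_le_sum fun g _ => le_of_eq ?_)
    rw [mul_pow]
    ring
  · refine (tendsto_integral_mul_density hreg.sigmaSq hreg.f hw x hr.h_zero).congr' ?_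
    filter_upwards [hr.nh_top.eventually_gt_atTop 0] with ν ha
    rw [eq_div_iff ha.ne', (S ν).n_eq_sum, Finset.sum_mul, Finset.mul_sum]
    refine Finset.sum_congr rfl fun g _ => ?_
    rw [integral_finsetSum _ fun j _ => integrable_weight_mul_err_sq (hS ν) hB hreg hw (h ν) g j]
    simp only [integral_weight_mul_err_sq (hS ν) hB hreg hw (hr.h_pos ν)]
    rw [Finset.sum_const, Finset.card_univ, Fintype.card_fin, nsmul_eq_mul]
    ring

/-! ### Pairs -/

/-- The rate for b is stated for squares; its square root is the condition under which the count
bounds hold at scale b. -/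
lemma BandwidthRates.exists_maxSize_bound_pair (hr : BandwidthRates S h b lam) (R : ℝ)
    (hR : 0 ≤ R) :
    ∃ A : ℝ, 0 < A ∧ ∀ᶠ ν in atTop, ∀ g, ((S ν).size g : ℝ) * (R * b ν) ^ dI ≤ A := by
  obtain ⟨A, hA0, hA⟩ := hr.maxSize_b.exists_pos
  refine ⟨R ^ dI * Real.sqrt A + 1, by positivity, ?_⟩
  filter_upwards [hA.bound] with ν hν g
  have h1 : ((S ν).size g : ℝ) ≤ (S ν).maxSize := by exact_mod_cast (S ν).size_le_maxSize g
  have h2 := (hr.b_pos ν).le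
  rw [Real.norm_of_nonneg (by positivity), norm_one, mul_one] at hν
  have h3 : ((S ν).maxSize : ℝ) * b ν ^ dI ≤ Real.sqrt A := by
    refine Real.le_sqrt_of_sq_le (le_trans (le_of_eq ?_) hν)
    rw [mul_pow, ← pow_mul, mul_comm dI 2]
  calc ((S ν).size g : ℝ) * (R * b ν) ^ dI = R ^ dI * ((S ν).size g * b ν ^ dI) := by
        rw [mul_pow]; ring
    _ ≤ R ^ dI * ((S ν).maxSize * b ν ^ dI) := by gcongr
    _ ≤ R ^ dI * Real.sqrt A := by gcongr
    _ ≤ _ := by linarith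

lemma sum_descFactorial_two {Ω : Type*} [MeasurableSpace Ω] (S : ClusterSample dI dC Ω) :
    ∑ g, ((S.size g).descFactorial 2 : ℝ) = 2 * S.pairCount := by
  simp only [Nat.descFactorial_eq_factorial_mul_choose, ClusterSample.pairCount]
  push_cast
  rw [Finset.mul_sum]
  simp

/-- Averages of pair kernels, weighted by products of errors or unweighted. -/
lemma tendsto_sum_pairKernel_mul (hS : ∀ ν, IsGenerated (P ν) (S ν) pop)
    (hr : BandwidthRates S h b lam) (hB : PopBound pop x F Q V c ρ) (hreg : UnifRegular pop)
    (hk : IsCompactKernel k C L) (τ : (RegSpace dI dC × ℝ) → ℝ) (hτ : Measurable τ)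
    {φ : JointSpace 2 dI dC → ℝ} (hφ : UnifSmooth 0 φ) {V' : ℝ} (hV' : 0 ≤ V')
    (hsq : ∀ᶠ ν in atTop, ∀ g, ∫⁻ ω, ENNReal.ofReal ((∑ j, ∑ l,
        pairKernel (S ν) k (b ν) x g j l ω * (τ ((S ν).X g j ω, (S ν).Y g j ω) *
          τ ((S ν).X g l ω, (S ν).Y g l ω))) ^ 2) ∂(P ν) ≤
      ENNReal.ofReal V' * ∫⁻ ω, ENNReal.ofReal ((∑ j, ∑ l,
        pairKernel (S ν) k (b ν) x g j l ω) ^ 2) ∂(P ν))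
    (hint : ∀ ν g j l, j ≠ l → Integrable (fun ω => τ ((S ν).X g j ω, (S ν).Y g j ω) *
          τ ((S ν).X g l ω, (S ν).Y g l ω)) (P ν))
    (hmean : ∀ ν g j l, j ≠ l → HasCondExp (P ν) ((S ν).sigmaX g)
      (fun ω => τ ((S ν).X g j ω, (S ν).Y g j ω) * τ ((S ν).X g l ω, (S ν).Y g l ω))
      (fun ω => φ ((S ν).joint g ![j, l] ω))) :
    Tendsto (fun p : Σ ν, Ω ν => (∑ g, ∑ j, ∑ l, pairKernel (S p.1) k (b p.1) x g j l p.2 *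
        (τ ((S p.1).X g j p.2, (S p.1).Y g j p.2) * τ ((S p.1).X g l p.2, (S p.1).Y g l p.2))) /
        ((S p.1).pairCount * b p.1 ^ (2 * dI + dC)))
      (probFilter P) (𝓝 (φ (diagPt 2 x) * pop.fJoint 2 (diagPt 2 x))) := by
  have hL := hk.pos.le
  have hC := hk.one_le
  set R := (Fintype.card (Fin dI ⊕ Fin dC) : ℝ) * L
  have hR : 0 ≤ R := by positivity
  obtain ⟨A, hA0, hA⟩ := hr.exists_maxSize_bound_pair R hR
  have hK := countConst_nonneg (dI := dI) (dC := dC) hB.F_pos.le hA0.le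
  set Kp := C ^ Fintype.card ((Fin 2 × Fin dI) ⊕ Fin dC)
  have hpw : ∀ ν g j l, ∀ ω, |pairKernel (S ν) k (b ν) x g j l ω| ≤ Kp := fun ν g j l ω => by
    rw [abs_of_nonneg (pairKernel_nonneg hk _ g j l ω)]
    exact pairKernel_le hk _ g j l ω
  have hτm : ∀ ν g j, Measurable fun ω => τ ((S ν).X g j ω, (S ν).Y g j ω) := fun ν g j =>
    hτ.comp (((S ν).measurable_X g j).prodMk ((S ν).measurable_Y g j))
  refine tendsto_sum_div (ι := fun ν => Fin (S ν).G)
    (N := fun ν => (S ν).pairCount * b ν ^ (2 * dI + dC)) (T := fun ν g ω => ∑ j, ∑ l, pairKernel (S ν) k (b ν) x g j l ω *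
        (τ ((S ν).X g j ω, (S ν).Y g j ω) * τ ((S ν).X g l ω, (S ν).Y g l ω)))
    (C := V' * Kp ^ 2 * (countConst dI dC F A * R ^ (2 * dI + dC) * 2)) (fun ν g => ?_)
    (fun ν => ?_) ?_ hr.Nb_top ?_
  · exact Finset.measurable_sum _ fun j _ => Finset.measurable_sum _ fun l _ =>
      ((measurable_pairKernel hk (b ν) g j l).mono ((S ν).sigmaX_le g) le_rfl).mul
        ((hτm ν g j).mul (hτm ν g l))
  -- The joint vector of a pair is rebuilt from the two regressor vectors, which exhibits the
  -- cluster sum as a function of the cluster's data.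
  · refine iIndepFun_of_data (hS ν) fun g => ⟨fun z => ∑ j, ∑ l,
      (if j < l then prodKernel k ((b ν)⁻¹ • (joinPair (z.2 j) (z.2 l) - diagPt 2 x)) else 0) *
      (τ (z.2 j, z.1 j) * τ (z.2 l, z.1 l)), ?_, fun ω => ?_⟩
    · have hX : ∀ j, Measurable fun z : (Fin ((S ν).size g) → ℝ) ×
        (Fin ((S ν).size g) → RegSpace dI dC) => z.2 j :=
        fun j => (measurable_pi_apply j).comp measurable_snd
      have hY : ∀ j, Measurable fun z : (Fin ((S ν).size g) → ℝ) ×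
        (Fin ((S ν).size g) → RegSpace dI dC) => z.1 j :=
        fun j => (measurable_pi_apply j).comp measurable_fst
      have hJ : ∀ j l, Measurable fun z : (Fin ((S ν).size g) → ℝ) ×
        (Fin ((S ν).size g) → RegSpace dI dC) => joinPair (z.2 j) (z.2 l) :=
        fun j l => measurable_joinPair.comp ((hX j).prodMk (hX l))
      refine Finset.measurable_sum _ fun j _ => Finset.measurable_sum _ fun l _ => Measurable.mul ?_
        ((hτ.comp ((hX j).prodMk (hY j))).mul (hτ.comp ((hX l).prodMk (hY l))))
      split_ifs
      · exact hk.continuous_prod.measurable.comp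
          (((hJ j l).sub_const (diagPt 2 x)).const_smul (b ν)⁻¹)
      · exact measurable_const
    · simp only [pairKernel, ClusterSample.pairWeight, ClusterSample.joint_eq_joinPair]
  · filter_upwards [hA, hsq] with ν hAν hsqν
    have hb := hr.b_pos ν
    have hterm : ∀ g, ∫⁻ ω, ENNReal.ofReal ((∑ j, ∑ l, pairKernel (S ν) k (b ν) x g j l ω *
        (τ ((S ν).X g j ω, (S ν).Y g j ω) * τ ((S ν).X g l ω, (S ν).Y g l ω))) ^ 2) ∂(P ν) ≤
        ENNReal.ofReal (V' * (Kp ^ 2 * (countConst dI dC F A *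
          (((S ν).size g).descFactorial 2 * (R * b ν) ^ (2 * dI + dC))))) := fun g => by
      refine (hsqν g).trans ?_
      rw [ENNReal.ofReal_mul hV']
      exact mul_le_mul_right (lintegral_sq_sum_pairKernel_le (hS ν) hB hk hb g (hAν g)) _
    refine (Finset.sum_le_sum fun g _ => hterm g).trans ?_
    rw [← ENNReal.ofReal_sum_of_nonneg fun _ _ => by positivity]
    refine ENNReal.ofReal_le_ofReal (le_of_eq ?_)
    rw [← Finset.mul_sum, ← Finset.mul_sum, ← Finset.mul_sum, ← Finset.sum_mul,
      sum_descFactorial_two, mul_pow]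
    ring
  · have hlim := tendsto_integral_mul_density hφ hreg.fTwo (hk.isWeight (ι := (Fin 2 × Fin dI) ⊕
      Fin dC)) (diagPt 2 x) hr.b_zero
    rw [hk.integral_prod, mul_one] at hlim
    refine hlim.congr' ?_
    filter_upwards [hr.Nb_top.eventually_gt_atTop 0] with ν ha
    rw [eq_div_iff ha.ne', ClusterSample.pairCount, Nat.cast_sum, Finset.sum_mul, Finset.mul_sum]
    refine Finset.sum_congr rfl fun g _ => ?_
    set I := ∫ u, prodKernel k u * (φ (diagPt 2 x + b ν • u) *
      pop.fJoint 2 (diagPt 2 x + b ν • u)) with hI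
    have hterm : ∀ j l, ∫ ω, pairKernel (S ν) k (b ν) x g j l ω *
        (τ ((S ν).X g j ω, (S ν).Y g j ω) * τ ((S ν).X g l ω, (S ν).Y g l ω)) ∂(P ν) =
        if j < l then b ν ^ (2 * dI + dC) * I else 0 := fun j l => by
      by_cases hjl : j < l
      · rw [if_pos hjl, (hmean ν g j l hjl.ne).integral_mul_eq ((S ν).sigmaX_le g)
          (hint ν g j l hjl.ne) (measurable_pairKernel hk (b ν) g j l) (hpw ν g j l)]
        simp only [pairKernel, if_pos hjl, ClusterSample.pairWeight]
        exact integral_weight_joint (hS ν) hreg hk.continuous_prod.measurable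
          hφ.continuous.measurable (hr.b_pos ν) (diagPt 2 x) g hjl.ne
      · simp [pairKernel, hjl]
    have hi : ∀ j l, Integrable (fun ω => pairKernel (S ν) k (b ν) x g j l ω *
        (τ ((S ν).X g j ω, (S ν).Y g j ω) * τ ((S ν).X g l ω, (S ν).Y g l ω))) (P ν) :=
      fun j l => by
        -- On the diagonal the strict inequality in the pair kernel gives zero, so only products of
        -- distinct members need be integrable.
        by_cases hjl : j = l
        · have : ∀ ω, pairKernel (S ν) k (b ν) x g j l ω = 0 := fun ω => by
            simp [pairKernel, hjl]
          simp only [this, zero_mul]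
          exact integrable_zero _ _ _
        · exact (hint ν g j l hjl).bdd_mul ((measurable_pairKernel hk (b ν) g j l).mono
            ((S ν).sigmaX_le g) le_rfl).aestronglyMeasurable (c := Kp)
            (ae_of_all _ fun ω => hpw ν g j l ω)
    rw [integral_finsetSum _ fun j _ => integrable_finsetSum _ fun l _ => hi j l]
    simp only [integral_finsetSum _ fun l _ => hi _ l, hterm]
    rw [sum_ite_lt_const]
    ring

end Asymptotic

end ClusterKernel

namespace ClusterKernel

variable {dI dC : ℕ}

section Asymptotic

variable {Ω : ℕ → Type*} [∀ ν, MeasurableSpace (Ω ν)] {P : ∀ ν, Measure (Ω ν)}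
  [∀ ν, IsProbabilityMeasure (P ν)]
  {S : ∀ ν, ClusterSample dI dC (Ω ν)} {pop : Population dI dC} {x : RegSpace dI dC}
  {F Q V c ρ : ℝ} {h b : ℕ → ℝ} {lam : ℝ} {k : ℝ → ℝ} {C L : ℝ}

lemma tendsto_fHat (hS : ∀ ν, IsGenerated (P ν) (S ν) pop)
    (hr : BandwidthRates S h b lam) (hB : PopBound pop x F Q V c ρ) (hreg : UnifRegular pop)
    (hk : IsCompactKernel k C L) :
    Tendsto (fun p : Σ ν, Ω ν => (S p.1).fHat k (h p.1) x p.2) (probFilter P) (𝓝 (pop.f x)) := by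
  have h1 := tendsto_sum_weight hS hr hB hreg hk.isWeight (by have := hk.pos; positivity)
  rwa [hk.integral_prod, mul_one] at h1

lemma UnifSmooth.const {E : Type*} [NormedAddCommGroup E] [NormedSpace ℝ E] (a : ℝ) :
    UnifSmooth 0 (fun _ : E => a) where
  contDiff := contDiff_const
  bounded i hi := ⟨|a|, fun y => by
    rw [Nat.le_zero.1 hi, norm_iteratedFDeriv_zero, Real.norm_eq_abs]⟩
  unifCont := by
    rw [iteratedFDeriv_zero_eq_comp]
    exact uniformContinuous_const

lemma hasCondExp_const {Ω : Type*} {m mΩ : MeasurableSpace Ω} {P : Measure Ω}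
    [IsProbabilityMeasure P] (hm : m ≤ mΩ) (a : ℝ) :
    HasCondExp P m (fun _ => a) (fun _ => a) := by
  refine ⟨fun _ => Set.univ, fun _ => MeasurableSet.univ, Set.iUnion_const _,
    fun _ => ⟨integrable_const a |>.integrableOn, ?_⟩⟩
  simp only [Set.indicator_univ]
  rw [condExp_const hm]

/-- The general pair average with all marks equal to 1. -/
lemma tendsto_fTwoHat (hS : ∀ ν, IsGenerated (P ν) (S ν) pop)
    (hr : BandwidthRates S h b lam) (hB : PopBound pop x F Q V c ρ) (hreg : UnifRegular pop)
    (hk : IsCompactKernel k C L) :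
    Tendsto (fun p : Σ ν, Ω ν => (S p.1).fTwoHat k (b p.1) x p.2) (probFilter P)
      (𝓝 (pop.fJoint 2 (diagPt 2 x))) := by
  have h1 := tendsto_sum_pairKernel_mul hS hr hB hreg hk (fun _ => 1) measurable_const
    (φ := fun _ => 1) (UnifSmooth.const 1) (V' := 1) zero_le_one
    (Eventually.of_forall fun ν g => by simp)
    (fun ν g j l _ => integrable_const _)
    (fun ν g j l _ => by simpa using hasCondExp_const ((S ν).sigmaX_le g) 1)
  simp only [mul_one, one_mul] at h1
  exact h1

/-- The general pair average with the errors as marks; the second moment condition holds as soon as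
the kernel's support lies in the ball where fourth moments are bounded. -/
lemma tendsto_sum_pairKernel_err (hS : ∀ ν, IsGenerated (P ν) (S ν) pop)
    (hr : BandwidthRates S h b lam) (hB : PopBound pop x F Q V c ρ) (hreg : UnifRegular pop)
    (hk : IsCompactKernel k C L) :
    Tendsto (fun p : Σ ν, Ω ν => (∑ g, ∑ j, ∑ l, pairKernel (S p.1) k (b p.1) x g j l p.2 *
        ((S p.1).err pop.m g j p.2 * (S p.1).err pop.m g l p.2)) /
        ((S p.1).pairCount * b p.1 ^ (2 * dI + dC)))
      (probFilter P) (𝓝 (pop.sigmaCov (diagPt 2 x) * pop.fJoint 2 (diagPt 2 x))) := by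
  have hm := hreg.m.continuous
  refine tendsto_sum_pairKernel_mul hS hr hB hreg hk (fun z => z.2 - pop.m z.1)
    (measurable_snd.sub (hm.measurable.comp measurable_fst)) hreg.sigmaCov hB.V_pos.le ?_
    (fun ν g j l _ => (memLp_err (hS ν) hB hm g j).integrable_mul (memLp_err (hS ν) hB hm g l))
    (fun ν g j l hjl => (hS ν).covariance g j l hjl)
  filter_upwards [eventually_closedBall_subset hB.ρ_pos hr.b_zero
    (Fintype.card (Fin dI ⊕ Fin dC) * L) x] with ν hν g
  refine lintegral_sq_sum_mul_err_le (hS ν) hB hm g (measurable_pairKernel hk (b ν) g)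
    (pairKernel_nonneg hk (b ν) g) fun j l ω hne => ?_
  obtain ⟨-, h1, h2⟩ := mem_near_of_pairKernel_ne hk (hr.b_pos ν) hne
  exact ⟨hν ((S ν).mem_near.1 h1), hν ((S ν).mem_near.1 h2)⟩

lemma sum_lintegral_ofReal {Ω ι : Type*} [MeasurableSpace Ω] {P : Measure Ω} [Fintype ι]
    {w : ι → ι → Ω → ℝ} (hw : ∀ j l, Measurable (w j l)) (hw0 : ∀ j l ω, 0 ≤ w j l ω) :
    ∑ j, ∑ l, ∫⁻ ω, ENNReal.ofReal (w j l ω) ∂P =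
      ∫⁻ ω, ENNReal.ofReal (∑ j, ∑ l, w j l ω) ∂P := by
  rw [← lintegral_sum_sum fun j l => (hw j l).ennreal_ofReal]
  refine lintegral_congr fun ω => ?_
  rw [ENNReal.ofReal_sum_of_nonneg fun j _ => Finset.sum_nonneg fun l _ => hw0 j l ω]
  exact Finset.sum_congr rfl fun j _ => (ENNReal.ofReal_sum_of_nonneg fun l _ => hw0 j l ω).symm

lemma lintegral_ofReal_le_const_mul {Ω : Type*} [MeasurableSpace Ω] {P : Measure Ω} {Z : Ω → ℝ}
    {B D : ℝ} {N : Ω → ℕ} (hB : 0 ≤ B) (hle : ∀ ω, Z ω ≤ B * N ω)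
    (hN : ∫⁻ ω, (N ω : ℝ≥0∞) ∂P ≤ ENNReal.ofReal D) :
    ∫⁻ ω, ENNReal.ofReal (Z ω) ∂P ≤ ENNReal.ofReal (B * D) := by
  calc _ ≤ ∫⁻ ω, ENNReal.ofReal B * (N ω : ℝ≥0∞) ∂P := lintegral_mono fun ω => by
        refine (ENNReal.ofReal_le_ofReal (hle ω)).trans (le_of_eq ?_)
        rw [ENNReal.ofReal_mul hB, ENNReal.ofReal_natCast]
    _ ≤ _ := by
        rw [lintegral_const_mul' _ _ ENNReal.ofReal_ne_top, ENNReal.ofReal_mul hB]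
        exact mul_le_mul_right hN _

lemma tendsto_sigmaSqHat (hS : ∀ ν, IsGenerated (P ν) (S ν) pop)
    (hr : BandwidthRates S h b lam) (hB : PopBound pop x F Q V c ρ)
    (hreg : UnifRegular pop) (hfx : 0 < pop.f x) (hfloor : DensityFloor S pop h)
    (hY : OutcomeCondition P S h) (hk : IsCompactKernel k C L) (M : Method) :
    Tendsto (fun p : Σ ν, Ω ν => (S p.1).sigmaSqHat M k (h p.1) x p.2) (probFilter P)
      (𝓝 (pop.sigmaSq x)) := by
  have hL := hk.pos
  have hC : 0 ≤ C := zero_le_one.trans hk.one_le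
  have hR : 0 ≤ (Fintype.card (Fin dI ⊕ Fin dC) : ℝ) * L := by positivity
  have hρ : 0 < ρ / 4 := by have := hB.ρ_pos; positivity
  set R := (Fintype.card (Fin dI ⊕ Fin dC) : ℝ) * L
  -- Weights on the diagonal turn the double sum over a cluster into the sum of squares.
  set w : ∀ ν g, Fin ((S ν).size g) → Fin ((S ν).size g) → Ω ν → ℝ := fun ν g j l ω =>
    if j = l then prodKernel k ((h ν)⁻¹ • ((S ν).X g j ω - x)) else 0 with hw
  have hsum : ∀ ν g ω (a : Fin ((S ν).size g) → ℝ), ∑ j, ∑ l, w ν g j l ω * (a j * a l) =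
      ∑ j, prodKernel k ((h ν)⁻¹ • ((S ν).X g j ω - x)) * a j ^ 2 := fun ν g ω a => by
    simp [hw, ite_mul, sq]
  have hw0 : ∀ ν g j l ω, 0 ≤ w ν g j l ω := fun ν g j l ω => by
    simp only [hw]
    split_ifs
    exacts [hk.prod_nonneg _, le_rfl]
  have hwm : ∀ ν g j l, Measurable[(S ν).sigmaX g] (w ν g j l) := fun ν g j l => by
    by_cases hjl : j = l
    · simp only [hw, if_pos hjl]
      exact measurable_weight_term (S ν) hk.continuous_prod.measurable (h ν) x g j
    · simp only [hw, if_neg hjl]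
      exact measurable_const
  have h1 := tendsto_resid_sub_err hS hr hB hreg hfloor hY hk M (w := w)
    (N := fun ν => (S ν).n * h ν ^ (dI + dC))
    (C₃ := C ^ Fintype.card (Fin dI ⊕ Fin dC) * (F * ballConst dI dC * R ^ (dI + dC)))
    hw0 hwm ?_ (hr.nh_top.eventually_gt_atTop 0) ?_
  · have h2 := tendsto_sum_weight_err_sq hS hr hB hreg hk.isWeight hR
    have h3 := tendsto_fHat hS hr hB hreg hk
    rw [hk.integral_prod, mul_one] at h2
    have h4 := ((h1.add h2).div h3 hfx.ne')
    rw [zero_add, mul_div_cancel_right₀ _ hfx.ne'] at h4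
    refine h4.congr' ?_
    filter_upwards [eventually_fst (P := P) (hr.nh_top.eventually_gt_atTop 0)] with p hp
    simp only [hsum, Pi.div_apply, sub_add_cancel, ClusterSample.fHat,
      ClusterSample.sigmaSqHat]
    rw [div_div_div_cancel_right₀ hp.ne']
  · filter_upwards [eventually_closedBall_subset hρ hr.h_zero R x] with ν hν g j l ω hne
    have hjl : j = l := by
      by_contra hcon
      exact hne (by simp [hw, hcon])
    subst hjl
    have hj : j ∈ (S ν).near x (R * h ν) g ω := by
      by_contra hcon
      refine hne ?_
      simp only [hw, if_true]
      exact (S ν).weight_eq_zero hk.isWeight (hr.h_pos ν) hcon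
    exact ⟨hν ((S ν).mem_near.1 hj), hν ((S ν).mem_near.1 hj)⟩
  · refine Eventually.of_forall fun ν => ?_
    have hh := hr.h_pos ν
    have hF := hB.F_pos
    have hbc := ballConst_nonneg (dI := dI) (dC := dC)
    calc _ ≤ ∑ g, ENNReal.ofReal (C ^ Fintype.card (Fin dI ⊕ Fin dC) * (F * ballConst dI dC *
          ((S ν).size g * (R * h ν) ^ (dI + dC)))) := Finset.sum_le_sum fun g _ => by
          rw [sum_lintegral_ofReal (fun j l => (hwm ν g j l).mono ((S ν).sigmaX_le g) le_rfl)
            (hw0 ν g)]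
          refine lintegral_ofReal_le_const_mul (by positivity) (fun ω => ?_)
            (lintegral_card_le (hS ν) hB g (y := x) (by positivity))
          refine le_trans (le_of_eq ?_) ((S ν).sum_kernel_le hk hh x g ω)
          simpa using hsum ν g ω (fun _ => 1)
      _ = _ := by
          rw [← ENNReal.ofReal_sum_of_nonneg fun _ _ => by positivity, (S ν).n_eq_sum,
            Finset.sum_mul, Finset.mul_sum]
          congr 1
          refine Finset.sum_congr rfl fun g _ => ?_
          rw [mul_pow]
          ring

/-- Residuals are replaced by errors, and the normalization N b^{2dI+dC} cancels between the error
sum and the density estimator; positivity of the joint density at the diagonal point permits the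
division. -/
lemma tendsto_sigmaCovHat (hS : ∀ ν, IsGenerated (P ν) (S ν) pop)
    (hr : BandwidthRates S h b lam) (hB : PopBound pop x F Q V c ρ)
    (hreg : UnifRegular pop) (hf₂ : 0 < pop.fJoint 2 (diagPt 2 x)) (hfloor : DensityFloor S pop h)
    (hY : OutcomeCondition P S h) (hk : IsCompactKernel k C L) (M : Method) :
    Tendsto (fun p : Σ ν, Ω ν => (S p.1).sigmaCovHat M k (h p.1) (b p.1) x p.2) (probFilter P)
      (𝓝 (pop.sigmaCov (diagPt 2 x))) := by
  have hL := hk.pos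
  have hC : 0 ≤ C := zero_le_one.trans hk.one_le
  have hR : 0 ≤ (Fintype.card (Fin dI ⊕ Fin dC) : ℝ) * L := by positivity
  have hρ : 0 < ρ / 4 := by have := hB.ρ_pos; positivity
  have h1 := tendsto_resid_sub_err hS hr hB hreg hfloor hY hk M
    (w := fun ν g => pairKernel (S ν) k (b ν) x g)
    (N := fun ν => (S ν).pairCount * b ν ^ (2 * dI + dC))
    (C₃ := C ^ Fintype.card ((Fin 2 × Fin dI) ⊕ Fin dC) * (F * ballConst dI dC *
      (2 * (Fintype.card (Fin dI ⊕ Fin dC) * L) ^ (2 * dI + dC))))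
    (fun ν g => pairKernel_nonneg hk (b ν) g) (fun ν g => measurable_pairKernel hk (b ν) g) ?_
    (hr.Nb_top.eventually_gt_atTop 0) ?_
  · have h2 := tendsto_sum_pairKernel_err hS hr hB hreg hk
    have h3 := tendsto_fTwoHat hS hr hB hreg hk
    have h4 := ((h1.add h2).div h3 hf₂.ne')
    rw [zero_add, mul_div_cancel_right₀ _ hf₂.ne'] at h4
    refine h4.congr' ?_
    filter_upwards [eventually_fst (P := P) (hr.Nb_top.eventually_gt_atTop 0)] with p hp
    simp only [Pi.div_apply, sub_add_cancel, ClusterSample.fTwoHat,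
      ClusterSample.sigmaCovHat, pairKernel, ite_mul, zero_mul]
    rw [div_div_div_cancel_right₀ hp.ne']
  · filter_upwards [eventually_closedBall_subset hρ hr.b_zero
      (Fintype.card (Fin dI ⊕ Fin dC) * L) x] with ν hν g j l ω hne
    obtain ⟨-, h1, h2⟩ := mem_near_of_pairKernel_ne hk (hr.b_pos ν) hne
    exact ⟨hν ((S ν).mem_near.1 h1), hν ((S ν).mem_near.1 h2)⟩
  · refine Eventually.of_forall fun ν => ?_
    have hb := hr.b_pos ν
    have hF := hB.F_pos
    have hbc := ballConst_nonneg (dI := dI) (dC := dC)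
    set R := (Fintype.card (Fin dI ⊕ Fin dC) : ℝ) * L with hRd
    calc _ ≤ ∑ g, ENNReal.ofReal (C ^ Fintype.card ((Fin 2 × Fin dI) ⊕ Fin dC) *
          (F * ballConst dI dC * (((S ν).size g).descFactorial 2 *
            (R * b ν) ^ (2 * dI + dC)))) := Finset.sum_le_sum fun g _ => by
          rw [sum_lintegral_ofReal (fun j l => (measurable_pairKernel hk (b ν) g j l).mono
            ((S ν).sigmaX_le g) le_rfl) (pairKernel_nonneg hk (b ν) g)]
          exact lintegral_ofReal_le_const_mul (by positivity)
            (fun ω => sum_pairKernel_le hk hb g ω)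
            (lintegral_descFactorial_le (hS ν) hB one_le_two (by norm_num) g x (by positivity))
      _ = _ := by
          rw [← ENNReal.ofReal_sum_of_nonneg fun _ _ => by positivity]
          congr 1
          rw [← Finset.mul_sum, ← Finset.mul_sum, ← Finset.sum_mul, sum_descFactorial_two, mul_pow]
          ring

/-- Consistency of the plug-in estimator of the asymptotic variance. -/
lemma tendsto_varHat (hS : ∀ ν, IsGenerated (P ν) (S ν) pop)
    (hr : BandwidthRates S h b lam) (hB : PopBound pop x F Q V c ρ)
    (hreg : UnifRegular pop) (hfx : 0 < pop.f x) (hf₂ : 0 < pop.fJoint 2 (diagPt 2 x))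
    (hfloor : DensityFloor S pop h) (hY : OutcomeCondition P S h) (hk : IsCompactKernel k C L)
    (M : Method) :
    Tendsto (fun p : Σ ν, Ω ν => (S p.1).varHat M k (h p.1) (b p.1) x p.2) (probFilter P)
      (𝓝 ((roughness k ^ (dI + dC) * pop.f x * pop.sigmaSq x + lam * roughness k ^ dC *
        pop.fJoint 2 (diagPt 2 x) * pop.sigmaCov (diagPt 2 x)) / pop.f x ^ 2)) := by
  have h1 := tendsto_fHat hS hr hB hreg hk
  have h2 := tendsto_fTwoHat hS hr hB hreg hk
  have h3 := tendsto_sigmaSqHat hS hr hB hreg hfx hfloor hY hk M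
  have h4 := tendsto_sigmaCovHat hS hr hB hreg hf₂ hfloor hY hk M
  have h5 := tendsto_fst_comp (P := P) hr.lambda
  have h6 := ((h3.const_mul (roughness k ^ (dI + dC))).div h1 hfx.ne').add
    ((((h5.mul_const (roughness k ^ dC)).mul h2).mul h4).div (h1.pow 2) (pow_ne_zero 2 hfx.ne'))
  refine (h6.congr fun p => rfl).trans (le_of_eq ?_)
  congr 1
  field_simp

end Asymptotic

end ClusterKernel

namespace ClusterKernel

variable {dI dC : ℕ}

/-! ## The central limit theorem for kernel-weighted sums of errors -/

/-- The product of the kernels at two regressor vectors that share the cluster-level part. -/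
noncomputable def crossWeight (k : ℝ → ℝ) (z : JointSpace 2 dI dC) : ℝ :=
  ∏ q, Sum.elim (fun _ => k) (fun _ t => k t ^ 2) q (z q)

section Cross

variable {k : ℝ → ℝ} {C L : ℝ}

/-- The shared coordinates occur in both factors, whence the squares in the cross weight. -/
lemma prodKernel_mul_prodKernel {Ω : Type*} [MeasurableSpace Ω] (S : ClusterSample dI dC Ω)
    (h : ℝ) (x : RegSpace dI dC) (g : Fin S.G) (j l : Fin (S.size g)) (ω : Ω) :
    prodKernel k (h⁻¹ • (S.X g j ω - x)) * prodKernel k (h⁻¹ • (S.X g l ω - x)) =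
      crossWeight k (h⁻¹ • (S.joint g ![j, l] ω - diagPt 2 x)) := by
  simp only [prodKernel, crossWeight, Fintype.prod_sum_type, Fintype.prod_prod_type,
    Fin.prod_univ_two, Sum.elim_inl, Sum.elim_inr, Finset.prod_pow, PiLp.smul_apply,
    PiLp.sub_apply, ClusterSample.X, ClusterSample.joint, pair, stack, diagPt,
    Matrix.cons_val_zero, Matrix.cons_val_one]
  ring

/-- Each individual-level factor integrates to 1, each shared factor to the roughness; this is the
constant R_k^{dC} of the λ term. -/
lemma integral_crossWeight (hk : IsCompactKernel k C L) :
    ∫ z : JointSpace 2 dI dC, crossWeight k z = roughness k ^ dC := by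
  simp only [crossWeight]
  rw [integral_euclidean_prod, Fintype.prod_sum_type]
  simp [hk.integral_one, roughness]

lemma isWeight_crossWeight (hk : IsCompactKernel k C L) :
    IsWeight (crossWeight k : JointSpace 2 dI dC → ℝ)
      ((C ^ 2) ^ Fintype.card ((Fin 2 × Fin dI) ⊕ Fin dC))
      (Fintype.card ((Fin 2 × Fin dI) ⊕ Fin dC) * L) where
  measurable := by
    refine Finset.measurable_prod _ fun q _ => ?_
    have hq : Measurable fun z : JointSpace 2 dI dC => z q := measurable_id.coord q
    rcases q with q | q
    · exact hk.continuous.measurable.comp hq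
    · exact (hk.continuous.measurable.comp hq).pow_const 2
  bound z := by
    rw [crossWeight, Finset.abs_prod]
    refine (Finset.prod_le_prod (g := fun _ => C ^ 2) (fun _ _ => abs_nonneg _)
      fun q _ => ?_).trans (by simp)
    have h1 := hk.one_le
    rcases q with q | q
    · simp only [Sum.elim_inl, abs_of_nonneg (hk.nonneg _)]
      nlinarith [hk.le (z (Sum.inl q))]
    · simp only [Sum.elim_inr, abs_pow, abs_of_nonneg (hk.nonneg _)]
      exact pow_le_pow_left₀ (hk.nonneg _) (hk.le _) 2
  support z hz := by
    by_contra hne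
    rw [crossWeight, ← ne_eq, Finset.prod_ne_zero_iff] at hne
    refine hz.not_ge (norm_le_card_mul hk.pos.le fun q => ?_)
    by_contra! hq
    refine hne q (Finset.mem_univ q) ?_
    rcases q with q | q
    · exact hk.support _ hq
    · simp only [Sum.elim_inr, hk.support _ hq, ne_eq, OfNat.ofNat_ne_zero, not_false_eq_true,
        zero_pow]

end Cross

section Moments

variable {Ω : Type*} [MeasurableSpace Ω] {P : Measure Ω} [IsProbabilityMeasure P]
  {S : ClusterSample dI dC Ω} {pop : Population dI dC} {x : RegSpace dI dC} {F Q V c ρ : ℝ}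
  {k : ℝ → ℝ} {C L : ℝ}

lemma sum_sum_ite_eq_const (n : ℕ) (a b : ℝ) :
    ∑ j : Fin n, ∑ l : Fin n, (if j = l then a else b) = n * a + n * (n - 1) * b := by
  have h1 : ∀ j l : Fin n, (if j = l then a else b) = b + if j = l then a - b else 0 :=
    fun j l => by split_ifs <;> ring
  simp only [h1, Finset.sum_add_distrib, Finset.sum_ite_eq, Finset.mem_univ, if_true,
    Finset.sum_const, Finset.card_univ, Fintype.card_fin, nsmul_eq_mul]
  ring

/-- The variance of a kernel-weighted sum of errors over one cluster. -/
lemma integral_kernErr_sq (hS : IsGenerated P S pop) (hB : PopBound pop x F Q V c ρ)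
    (hreg : UnifRegular pop) (hk : IsCompactKernel k C L) {h : ℝ} (hh : 0 < h) (g : Fin S.G) :
    ∫ ω, S.kernErr pop.m (prodKernel k) h x g ω ^ 2 ∂P =
      S.size g * (h ^ (dI + dC) * ∫ u, prodKernel k u ^ 2 *
        (pop.sigmaSq (x + h • u) * pop.f (x + h • u))) +
      S.size g * (S.size g - 1) * (h ^ (2 * dI + dC) * ∫ u, crossWeight k u *
        (pop.sigmaCov (diagPt 2 x + h • u) * pop.fJoint 2 (diagPt 2 x + h • u))) := by
  have hm := hreg.m.continuous
  have hw : IsWeight (prodKernel k : RegSpace dI dC → ℝ) _ _ := hk.isWeight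
  set κ : Fin (S.size g) → Ω → ℝ := fun j ω => prodKernel k (h⁻¹ • (S.X g j ω - x)) with hκ
  have hκm : ∀ j, Measurable[S.sigmaX g] (κ j) := fun j =>
    measurable_weight_term S hw.measurable h x g j
  have hκb : ∀ j ω, |κ j ω| ≤ C ^ Fintype.card (Fin dI ⊕ Fin dC) := fun j ω => hw.bound _
  have hκκ : ∀ j l ω, |κ j ω * κ l ω| ≤ (C ^ Fintype.card (Fin dI ⊕ Fin dC)) ^ 2 :=
    fun j l ω => by
      rw [abs_mul, sq]
      exact mul_le_mul (hκb j ω) (hκb l ω) (abs_nonneg _) hw.nonneg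
  have hee : ∀ j l, Integrable (fun ω => S.err pop.m g j ω * S.err pop.m g l ω) P :=
    fun j l => (memLp_err hS hB hm g j).integrable_mul (memLp_err hS hB hm g l)
  have hi : ∀ j l, Integrable (fun ω => κ j ω * κ l ω *
      (S.err pop.m g j ω * S.err pop.m g l ω)) P := fun j l =>
    (hee j l).bdd_mul (((hκm j).mul (hκm l)).mono (S.sigmaX_le g) le_rfl).aestronglyMeasurable
      (c := (C ^ Fintype.card (Fin dI ⊕ Fin dC)) ^ 2) (ae_of_all _ fun ω => hκκ j l ω)
  have hexp : ∀ ω, S.kernErr pop.m (prodKernel k) h x g ω ^ 2 = ∑ j, ∑ l, κ j ω * κ l ω *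
      (S.err pop.m g j ω * S.err pop.m g l ω) := fun ω => by
    rw [ClusterSample.kernErr, sq, Finset.sum_mul_sum]
    exact Finset.sum_congr rfl fun j _ => Finset.sum_congr rfl fun l _ => by
      simp only [hκ]; ring
  simp only [hexp]
  rw [integral_finsetSum _ fun j _ => integrable_finsetSum _ fun l _ => hi j l]
  simp only [integral_finsetSum _ fun l _ => hi _ l]
  -- The right side is rewritten as a double sum with one value on the diagonal and one off it, so
  -- that the two sides can be compared termwise.
  rw [← sum_sum_ite_eq_const]
  refine Finset.sum_congr rfl fun j _ => Finset.sum_congr rfl fun l _ => ?_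
  by_cases hjl : j = l
  · subst hjl
    rw [if_pos rfl, ← integral_weight_mul_err_sq hS hB hreg hw.sq hh g j]
    refine integral_congr_ae (ae_of_all _ fun ω => ?_)
    simp only [hκ]
    ring
  · rw [if_neg hjl, (hS.covariance g j l hjl).integral_mul_eq (ψ := fun ω => κ j ω * κ l ω)
      (S.sigmaX_le g) (hee j l) ((hκm j).mul (hκm l)) (hκκ j l)]
    simp only [hκ, prodKernel_mul_prodKernel]
    exact integral_weight_joint hS hreg (isWeight_crossWeight hk).measurable
      hreg.sigmaCov.continuous.measurable hh (diagPt 2 x) g hjl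

lemma lintegral_kernErr_four_le (hS : IsGenerated P S pop) (hB : PopBound pop x F Q V c ρ)
    (hm : Continuous pop.m) {w : RegSpace dI dC → ℝ} {R h A : ℝ} (hw : IsWeight w C R)
    (hR : 0 ≤ R) (hh : 0 < h) (g : Fin S.G) (hA : (S.size g : ℝ) * (R * h) ^ dI ≤ A)
    (hx : Metric.closedBall x (R * h) ⊆ Metric.closedBall x ρ) :
    ∫⁻ ω, ENNReal.ofReal (S.kernErr pop.m w h x g ω ^ 4) ∂P ≤
      ENNReal.ofReal (C ^ 4 * V * countConst dI dC F A * (S.size g * (R * h) ^ (dI + dC))) :=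
  lintegral_four_sum_err_le hS hB hm g (by positivity) hA hx (fun j ω => hw.bound _)
    fun j ω hj => S.weight_eq_zero hw hh hj

end Moments

section Asymptotic

variable {Ω : ℕ → Type*} [∀ ν, MeasurableSpace (Ω ν)] {P : ∀ ν, Measure (Ω ν)}
  [∀ ν, IsProbabilityMeasure (P ν)]
  {S : ∀ ν, ClusterSample dI dC (Ω ν)} {pop : Population dI dC} {x : RegSpace dI dC}
  {F Q V c ρ : ℝ} {h b : ℕ → ℝ} {lam : ℝ} {k : ℝ → ℝ} {C L : ℝ}

/-- Both kernel integrals are approximate identities; the prefactor of the off-diagonal one tends to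
λ. -/
lemma tendsto_sum_integral_kernErr_sq (hdI : 1 ≤ dI) (hS : ∀ ν, IsGenerated (P ν) (S ν) pop)
    (hr : BandwidthRates S h b lam) (hB : PopBound pop x F Q V c ρ) (hreg : UnifRegular pop)
    (hk : IsCompactKernel k C L) :
    Tendsto (fun ν => (∑ g, ∫ ω, (S ν).kernErr pop.m (prodKernel k) (h ν) x g ω ^ 2 ∂(P ν)) /
      ((S ν).n * h ν ^ (dI + dC))) atTop
      (𝓝 (roughness k ^ (dI + dC) * pop.f x * pop.sigmaSq x + lam * roughness k ^ dC *
        pop.fJoint 2 (diagPt 2 x) * pop.sigmaCov (diagPt 2 x))) := by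
  have h1 := tendsto_integral_mul_density hreg.sigmaSq hreg.f hk.isWeight.sq x hr.h_zero
  have h2 := tendsto_integral_mul_density hreg.sigmaCov hreg.fTwo (isWeight_crossWeight hk)
    (diagPt 2 x) hr.h_zero
  rw [IsCompactKernel.integral_prod_sq] at h1
  rw [integral_crossWeight hk] at h2
  -- Excluding the diagonal replaces ∑ n_g² by ∑ n_g² - n, so the prefactor is λ̂ - h^{dI}; the
  -- correction vanishes because dI ≥ 1.
  have h3 : Tendsto (fun ν => h ν ^ dI) atTop (𝓝 0) := by
    simpa [(Nat.one_le_iff_ne_zero.1 hdI)] using hr.h_zero.pow dI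
  have h4 := h1.add ((hr.lambda.sub h3).mul h2)
  have hl : pop.sigmaSq x * pop.f x * roughness k ^ Fintype.card (Fin dI ⊕ Fin dC) + (lam - 0) *
      (pop.sigmaCov (diagPt 2 x) * pop.fJoint 2 (diagPt 2 x) * roughness k ^ dC) =
      roughness k ^ (dI + dC) * pop.f x * pop.sigmaSq x + lam * roughness k ^ dC *
        pop.fJoint 2 (diagPt 2 x) * pop.sigmaCov (diagPt 2 x) := by
    simp only [Fintype.card_sum, Fintype.card_fin]
    ring
  rw [hl] at h4
  refine h4.congr' ?_
  filter_upwards [hr.n_top.eventually_gt_atTop 0] with ν hn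
  have hh := hr.h_pos ν
  simp only [integral_kernErr_sq (hS ν) hB hreg hk hh]
  set I₁ := ∫ u, prodKernel k u ^ 2 * (pop.sigmaSq (x + h ν • u) * pop.f (x + h ν • u))
  set I₂ := ∫ u, crossWeight k u * (pop.sigmaCov (diagPt 2 x + h ν • u) *
    pop.fJoint 2 (diagPt 2 x + h ν • u))
  rw [Finset.sum_add_distrib, ← Finset.sum_mul, ← Finset.sum_mul, ← (S ν).n_eq_sum]
  have h5 : ∑ g, ((S ν).size g : ℝ) * ((S ν).size g - 1) =
      ∑ g, ((S ν).size g : ℝ) ^ 2 - (S ν).n := by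
    rw [(S ν).n_eq_sum, ← Finset.sum_sub_distrib]
    exact Finset.sum_congr rfl fun g _ => by ring
  rw [h5, ClusterSample.lambdaHat]
  have h6 : h ν ^ (2 * dI + dC) = h ν ^ (dI + dC) * h ν ^ dI := by rw [← pow_add]; congr 1; ring
  rw [h6]
  have h7 := (pow_pos hh (dI + dC)).ne'
  field_simp

lemma div_sqrt_pow_four {a u : ℝ} (ha : 0 ≤ a) : ((Real.sqrt a)⁻¹ * u) ^ 4 = (a ^ 2)⁻¹ * u ^ 4 := by
  rw [mul_pow, inv_pow, show Real.sqrt a ^ 4 = (Real.sqrt a ^ 2) ^ 2 by ring, Real.sq_sqrt ha]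

/-- A statistic that differs from the standardized kernel-weighted sum of errors by a remainder
converging to zero in probability is asymptotically standard normal. -/
theorem tendstoInDistribution_of_kernErr (hdI : 1 ≤ dI) (hS : ∀ ν, IsGenerated (P ν) (S ν) pop)
    (hr : BandwidthRates S h b lam) (hB : PopBound pop x F Q V c ρ) (hreg : UnifRegular pop)
    (hk : IsCompactKernel k C L) {v : ℝ} (hv : 0 < v)
    (hvar : v = roughness k ^ (dI + dC) * pop.f x * pop.sigmaSq x + lam * roughness k ^ dC *
        pop.fJoint 2 (diagPt 2 x) * pop.sigmaCov (diagPt 2 x))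
    {W : ∀ ν, Ω ν → ℝ} (hW : ∀ ν, Measurable (W ν))
    (hrem : Tendsto (fun p : Σ ν, Ω ν => W p.1 p.2 -
      (Real.sqrt ((S p.1).n * h p.1 ^ (dI + dC) * v))⁻¹ *
        ∑ g, (S p.1).kernErr pop.m (prodKernel k) (h p.1) x g p.2) (probFilter P) (𝓝 0)) :
    TendstoInDistribution W atTop id P (gaussianReal 0 1) := by
  have hm := hreg.m.continuous
  have hw : IsWeight (prodKernel k : RegSpace dI dC → ℝ) _ _ := hk.isWeight
  have hL := hk.pos
  have hV := hB.V_pos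
  have hR : 0 ≤ (Fintype.card (Fin dI ⊕ Fin dC) : ℝ) * L := by positivity
  obtain ⟨A, hA0, hA⟩ := hr.exists_maxSize_bound _ hR
  have hK := countConst_nonneg (dI := dI) (dC := dC) hB.F_pos.le hA0.le
  set R := (Fintype.card (Fin dI ⊕ Fin dC) : ℝ) * L
  set D := (C ^ Fintype.card (Fin dI ⊕ Fin dC)) ^ 4 * V * countConst dI dC F A
  have hD : 0 ≤ D := by positivity
  set a : ℕ → ℝ := fun ν => (S ν).n * h ν ^ (dI + dC) with ha
  have ha_top : Tendsto a atTop atTop := hr.nh_top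
  have hfour : ∀ᶠ ν in atTop, ∀ g,
      Integrable (fun ω => (S ν).kernErr pop.m (prodKernel k) (h ν) x g ω ^ 4) (P ν) ∧
      ∫ ω, (S ν).kernErr pop.m (prodKernel k) (h ν) x g ω ^ 4 ∂(P ν) ≤
        D * ((S ν).size g * (R * h ν) ^ (dI + dC)) := by
    filter_upwards [hA, eventually_closedBall_subset hB.ρ_pos hr.h_zero R x] with ν hAν hx g
    have hh := hr.h_pos ν
    have h1 := lintegral_kernErr_four_le (hS ν) hB hm hw hR hh g (hAν g) hx
    have hmeas := ((S ν).measurable_kernErr hm hw.measurable (h ν) x g).pow_const 4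
    have h0 : ∀ ω, 0 ≤ (S ν).kernErr pop.m (prodKernel k) (h ν) x g ω ^ 4 := fun ω => by positivity
    refine ⟨(lintegral_ofReal_ne_top_iff_integrable hmeas.aestronglyMeasurable
      (ae_of_all _ h0)).1 (h1.trans_lt ENNReal.ofReal_lt_top).ne, ?_⟩
    rw [integral_eq_lintegral_of_nonneg_ae (ae_of_all _ h0) hmeas.aestronglyMeasurable]
    exact ENNReal.toReal_le_of_le_ofReal (by positivity) h1
  refine tendstoInDistribution_of_lyapunov (ι := fun ν => Fin (S ν).G)
    (T := fun ν g ω => (Real.sqrt (a ν * v))⁻¹ *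
      (S ν).kernErr pop.m (prodKernel k) (h ν) x g ω)
    (fun ν g => ((S ν).measurable_kernErr hm hw.measurable (h ν) x g).const_mul _) hW ?_
    (Eventually.of_forall fun ν g => ?_) (fun ν => ?_) ?_ ?_ ?_
  · filter_upwards [hfour] with ν hν g
    simp only [mul_pow]
    exact (hν g).1.const_mul _
  · rw [integral_const_mul, integral_kernErr (hS ν) hB hm hw, mul_zero]
  · exact (iIndepFun_kernErr (hS ν) hm hw.measurable (h ν) x).comp
      (fun _ t => (Real.sqrt (a ν * v))⁻¹ * t) fun _ => measurable_const_mul _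
  · have h1 := (tendsto_sum_integral_kernErr_sq hdI hS hr hB hreg hk).div_const v
    rw [← hvar, div_self hv.ne'] at h1
    refine h1.congr' ?_
    filter_upwards [ha_top.eventually_gt_atTop 0] with ν hν
    simp only [mul_pow, integral_const_mul]
    rw [← Finset.mul_sum, inv_pow, Real.sq_sqrt (by positivity), div_div, inv_mul_eq_div]
  -- The fourth moments of the clusters sum to O(n h^d) and are divided by (n h^d v)², so Lyapunov's
  -- ratio is O(1/(n h^d)).
  · have h1 : Tendsto (fun ν => D * R ^ (dI + dC) / v ^ 2 * (a ν)⁻¹) atTop (𝓝 0) := by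
      simpa using ha_top.inv_tendsto_atTop.const_mul (D * R ^ (dI + dC) / v ^ 2)
    refine squeeze_zero' (Eventually.of_forall fun ν => Finset.sum_nonneg fun g _ =>
      integral_nonneg fun ω => by positivity) ?_ h1
    filter_upwards [ha_top.eventually_gt_atTop 0, hfour] with ν hν h4
    simp only [div_sqrt_pow_four (mul_pos hν hv).le, integral_const_mul]
    rw [← Finset.mul_sum]
    calc _ ≤ ((a ν * v) ^ 2)⁻¹ * ∑ g, D * ((S ν).size g * (R * h ν) ^ (dI + dC)) :=
          mul_le_mul_of_nonneg_left (Finset.sum_le_sum fun g _ => (h4 g).2) (by positivity)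
      _ = ((a ν * v) ^ 2)⁻¹ * (D * (R ^ (dI + dC) * a ν)) := by
          rw [← Finset.mul_sum, ← Finset.sum_mul, ← (S ν).n_eq_sum, mul_pow]
          simp only [ha]
          ring
      _ = _ := by field_simp
  · refine hrem.congr fun p => ?_
    rw [Finset.mul_sum]

end Asymptotic

end ClusterKernel

namespace ClusterKernel

variable {dI dC : ℕ}

/-! ## Linearization of the regression estimators -/

section Linearization

variable {Ω : Type*} [mΩ : MeasurableSpace Ω]

/-- The kernel-weighted sum of the local approximation errors of the regression function. -/
noncomputable def localSum (S : ClusterSample dI dC Ω) (M : Method) (m : RegSpace dI dC → ℝ)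
    (k : ℝ → ℝ) (h : ℝ) (x : RegSpace dI dC) (g : Fin S.G) (ω : Ω) : ℝ :=
  ∑ j, prodKernel k (h⁻¹ • (S.X g j ω - x)) * localResid M m x (S.X g j ω)

/-- The kernel-weighted average of a coordinate of `(1, (X - x) / h)`. -/
noncomputable def localMoment (S : ClusterSample dI dC Ω) (k : ℝ → ℝ) (h : ℝ) (x : RegSpace dI dC)
    (q : Unit ⊕ (Fin dI ⊕ Fin dC)) (ω : Ω) : ℝ :=
  (∑ g, ∑ j, prodKernel k (h⁻¹ • (S.X g j ω - x)) *
    ClusterSample.oneCons (h⁻¹ • (S.X g j ω - x)) q) / (S.n * h ^ (dI + dC))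

/-- A bound, up to a constant, for `n h^d` times the squared local linear coefficients. -/
noncomputable def coefBound (S : ClusterSample dI dC Ω) (m : RegSpace dI dC → ℝ) (k : ℝ → ℝ)
    (R h : ℝ) (x : RegSpace dI dC) (ω : Ω) : ℝ :=
  (S.n * h ^ (dI + dC))⁻¹ * ∑ q, (∑ g, S.kernErr m
    (fun u => prodKernel k u * ClusterSample.oneCons u q) h x g ω) ^ 2 +
    h ^ 4 * ∑ g, ((S.near x (R * h) g ω).card : ℝ)

lemma measurable_coefBound (S : ClusterSample dI dC Ω) {m : RegSpace dI dC → ℝ}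
    (hm : Continuous m) {k : ℝ → ℝ} {C L : ℝ} (hk : IsCompactKernel k C L) (R h : ℝ)
    (x : RegSpace dI dC) : Measurable (coefBound S m k R h x) := by
  refine ((Finset.measurable_sum _ fun q _ => (Finset.measurable_sum _ fun g _ =>
    S.measurable_kernErr hm (hk.isWeight_oneCons q).measurable h x g).pow_const 2).const_mul
    _).add ((Finset.measurable_sum _ fun g _ => ?_).const_mul _)
  exact (measurable_of_countable fun n : ℕ => (n : ℝ)).comp
    ((S.measurable_card_near x (R * h) g).mono (S.sigmaX_le g) le_rfl)

/-- The squared scores have mean O(n h^d), which the prefactor normalizes. The count has mean O(n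
h^d), and h⁴ times it stays bounded exactly because n h^{d+4} = O(1). -/
lemma lintegral_coefBound_le {P : Measure Ω} [IsProbabilityMeasure P] {S : ClusterSample dI dC Ω}
    {pop : Population dI dC} {x : RegSpace dI dC} {F Q V c ρ : ℝ} (hS : IsGenerated P S pop)
    (hB : PopBound pop x F Q V c ρ) (hm : Continuous pop.m) {k : ℝ → ℝ} {C L : ℝ}
    (hk : IsCompactKernel k C L) {h A E : ℝ} (hh : 0 < h) (hn : 0 < (S.n * h ^ (dI + dC) : ℝ))
    (hA0 : 0 ≤ A)
    (hA : ∀ g, (S.size g : ℝ) * (Fintype.card (Fin dI ⊕ Fin dC) * L * h) ^ dI ≤ A)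
    (hE : (S.n : ℝ) * h ^ (dI + dC + 4) ≤ E) :
    ∫⁻ ω, ENNReal.ofReal (coefBound S pop.m k (Fintype.card (Fin dI ⊕ Fin dC) * L) h x ω) ∂P ≤
      ENNReal.ofReal ((Fintype.card (Unit ⊕ (Fin dI ⊕ Fin dC)) *
        ((C ^ Fintype.card (Fin dI ⊕ Fin dC) * (1 + Fintype.card (Fin dI ⊕ Fin dC) * L)) ^ 2 * Q *
          countConst dI dC F A) + F * ballConst dI dC * E) *
        (Fintype.card (Fin dI ⊕ Fin dC) * L) ^ (dI + dC)) := by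
  have hL := hk.pos
  have hF := hB.F_pos
  have hQ := hB.Q_pos
  have hK := countConst_nonneg (dI := dI) (dC := dC) hB.F_pos.le hA0
  have hbc := ballConst_nonneg (dI := dI) (dC := dC)
  have hC : 0 ≤ C := zero_le_one.trans hk.one_le
  have hE0 : 0 ≤ E := le_trans (by positivity) hE
  have hR : 0 ≤ (Fintype.card (Fin dI ⊕ Fin dC) : ℝ) * L := by positivity
  set R := (Fintype.card (Fin dI ⊕ Fin dC) : ℝ) * L with hRd
  set B := (C ^ Fintype.card (Fin dI ⊕ Fin dC) * (1 + R)) ^ 2 * Q * countConst dI dC F A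
  have hB0 : 0 ≤ B := by positivity
  have hU : ∀ q, Measurable fun ω => ENNReal.ofReal ((∑ g, S.kernErr pop.m
      (fun u => prodKernel k u * ClusterSample.oneCons u q) h x g ω) ^ 2) := fun q =>
    ((Finset.measurable_sum _ fun g _ => S.measurable_kernErr hm
      (hk.isWeight_oneCons q).measurable h x g).pow_const 2).ennreal_ofReal
  have hU' : Measurable fun ω => ENNReal.ofReal (S.n * h ^ (dI + dC))⁻¹ * ∑ q,
      ENNReal.ofReal ((∑ g, S.kernErr pop.m
        (fun u => prodKernel k u * ClusterSample.oneCons u q) h x g ω) ^ 2) :=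
    (Finset.measurable_sum _ fun q _ => hU q).const_mul _
  have h1 : ∀ ω, ENNReal.ofReal (coefBound S pop.m k R h x ω) =
      ENNReal.ofReal (S.n * h ^ (dI + dC))⁻¹ * ∑ q, ENNReal.ofReal ((∑ g, S.kernErr pop.m
        (fun u => prodKernel k u * ClusterSample.oneCons u q) h x g ω) ^ 2) +
      ENNReal.ofReal (h ^ 4) * ∑ g, ((S.near x (R * h) g ω).card : ℝ≥0∞) := fun ω => by
    have h0 : 0 ≤ ∑ q, (∑ g, S.kernErr pop.m
        (fun u => prodKernel k u * ClusterSample.oneCons u q) h x g ω) ^ 2 :=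
      Finset.sum_nonneg fun q _ => sq_nonneg _
    have h0' : 0 ≤ ∑ g, ((S.near x (R * h) g ω).card : ℝ) :=
      Finset.sum_nonneg fun g _ => Nat.cast_nonneg _
    rw [coefBound, ENNReal.ofReal_add (mul_nonneg (inv_nonneg.2 hn.le) h0)
      (mul_nonneg (by positivity) h0'), ENNReal.ofReal_mul (inv_nonneg.2 hn.le),
      ENNReal.ofReal_mul (by positivity), ENNReal.ofReal_sum_of_nonneg fun _ _ => sq_nonneg _,
      ENNReal.ofReal_sum_of_nonneg fun _ _ => Nat.cast_nonneg _]
    simp only [ENNReal.ofReal_natCast]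
  simp only [h1]
  rw [lintegral_add_left hU', lintegral_const_mul' _ _ ENNReal.ofReal_ne_top,
    lintegral_const_mul' _ _ ENNReal.ofReal_ne_top, lintegral_finsetSum _ fun q _ => hU q,
    lintegral_finsetSum _ fun g _ =>
      (measurable_cast_near x (R * h) g (φ := fun c => (c : ℝ≥0∞))).mono (S.sigmaX_le g) le_rfl]
  have h2 : ∑ q, ∫⁻ ω, ENNReal.ofReal ((∑ g, S.kernErr pop.m
      (fun u => prodKernel k u * ClusterSample.oneCons u q) h x g ω) ^ 2) ∂P ≤
      ENNReal.ofReal (Fintype.card (Unit ⊕ (Fin dI ⊕ Fin dC)) *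
        (B * (S.n * (R * h) ^ (dI + dC)))) := by
    refine (Finset.sum_le_sum fun q _ => lintegral_sum_kernErr_sq_le hS hB hm
      (hk.isWeight_oneCons q) hR hh hA hA0 Finset.univ x).trans ?_
    rw [Finset.sum_const, Finset.card_univ, nsmul_eq_mul, ENNReal.ofReal_mul (Nat.cast_nonneg _),
      ENNReal.ofReal_natCast]
  have h3 : ∑ g, ∫⁻ ω, ((S.near x (R * h) g ω).card : ℝ≥0∞) ∂P ≤
      ENNReal.ofReal (F * ballConst dI dC * (S.n * (R * h) ^ (dI + dC))) := by
    refine (Finset.sum_le_sum fun g _ => lintegral_card_le hS hB g (y := x)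
      (r := R * h) (by positivity)).trans ?_
    rw [← ENNReal.ofReal_sum_of_nonneg fun _ _ => by positivity, ← Finset.mul_sum,
      ← Finset.sum_mul, ← S.n_eq_sum]
  refine (add_le_add (mul_le_mul_right h2 _) (mul_le_mul_right h3 _)).trans ?_
  rw [← ENNReal.ofReal_mul (inv_nonneg.2 hn.le), ← ENNReal.ofReal_mul (by positivity),
    ← ENNReal.ofReal_add (by positivity) (by positivity)]
  refine ENNReal.ofReal_le_ofReal ?_
  rw [add_mul]
  refine add_le_add (le_of_eq ?_) ?_
  · have hn' := hn.ne'
    rw [mul_pow R h, show (Fintype.card (Unit ⊕ (Fin dI ⊕ Fin dC)) : ℝ) *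
      (B * (S.n * (R ^ (dI + dC) * h ^ (dI + dC)))) = S.n * h ^ (dI + dC) *
      (Fintype.card (Unit ⊕ (Fin dI ⊕ Fin dC)) * B * R ^ (dI + dC)) by ring,
      inv_mul_cancel_left₀ hn']
  · calc _ = F * ballConst dI dC * (S.n * h ^ (dI + dC + 4)) * R ^ (dI + dC) := by
          rw [mul_pow, pow_add h (dI + dC) 4]; ring
      _ ≤ _ := by gcongr

/-- Multiplying the bound for the squared coefficients by a gives the expression under the square
root, of order one in mean; the remaining factor z carries the convergence to zero. -/
lemma sqrt_mul_coef_le {a s t z U D C₁ B R h : ℝ} (ha : 0 < a) (hC : 0 ≤ C₁) (hU : 0 ≤ U)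
    (hD : 0 ≤ D) (hz : 0 ≤ z) (hs : s ^ 2 ≤ C₁ * (U / a ^ 2 + (B * (R * h) ^ 2) ^ 2 * (D / a)))
    (ht : |t| ≤ s * z) :
    |Real.sqrt a * t| ≤
      Real.sqrt (C₁ * (1 + (B * R ^ 2) ^ 2)) * (Real.sqrt (a⁻¹ * U + h ^ 4 * D) * z) := by
  have h1 : Real.sqrt a * s ≤ Real.sqrt (C₁ * (1 + (B * R ^ 2) ^ 2)) *
      Real.sqrt (a⁻¹ * U + h ^ 4 * D) := by
    rw [← Real.sqrt_mul (by positivity)]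
    refine Real.le_sqrt_of_sq_le ?_
    rw [mul_pow, Real.sq_sqrt ha.le]
    calc a * s ^ 2 ≤ a * (C₁ * (U / a ^ 2 + (B * (R * h) ^ 2) ^ 2 * (D / a))) := by gcongr
      _ = C₁ * (a⁻¹ * U + (B * R ^ 2) ^ 2 * (h ^ 4 * D)) := by field_simp
      _ ≤ C₁ * ((1 + (B * R ^ 2) ^ 2) * (a⁻¹ * U + h ^ 4 * D)) := by
          have h2 : 0 ≤ (B * R ^ 2) ^ 2 * (a⁻¹ * U) := by positivity
          have h3 : 0 ≤ h ^ 4 * D := by positivity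
          gcongr
          linarith
      _ = _ := by ring
  rw [abs_mul, abs_of_nonneg (Real.sqrt_nonneg a)]
  calc Real.sqrt a * |t| ≤ Real.sqrt a * (s * z) := by gcongr
    _ = Real.sqrt a * s * z := by ring
    _ ≤ _ := by rw [← mul_assoc]; gcongr

lemma linearization_identity {a fh δ Z s T β₀ b : ℝ} (ha : 0 < a)
    (heq : Z + s - β₀ * (a * fh) - a * T = 0) (hβ : β₀ = δ) :
    fh * (Real.sqrt a * (δ - b)) - ((Real.sqrt a)⁻¹ * Z) -
      ((Real.sqrt a)⁻¹ * s - Real.sqrt a * b * fh) = -(Real.sqrt a * T) := by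
  have h1 : Real.sqrt a ≠ 0 := (Real.sqrt_pos.2 ha).ne'
  have h2 : Real.sqrt a * Real.sqrt a = a := Real.mul_self_sqrt ha.le
  subst hβ
  field_simp
  rw [show Real.sqrt a ^ 2 = a from Real.sq_sqrt ha.le]
  linarith

end Linearization

section Asymptotic

variable {Ω : ℕ → Type*} [∀ ν, MeasurableSpace (Ω ν)] {P : ∀ ν, Measure (Ω ν)}
  [∀ ν, IsProbabilityMeasure (P ν)]
  {S : ∀ ν, ClusterSample dI dC (Ω ν)} {pop : Population dI dC} {x : RegSpace dI dC}
  {F Q V c ρ : ℝ} {h b : ℕ → ℝ} {lam : ℝ} {k : ℝ → ℝ} {C L : ℝ}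

/-- The limit is f(x) times a first moment of the kernel, which is zero by symmetry. -/
lemma tendsto_localMoment (hS : ∀ ν, IsGenerated (P ν) (S ν) pop)
    (hr : BandwidthRates S h b lam) (hB : PopBound pop x F Q V c ρ) (hreg : UnifRegular pop)
    (hk : IsCompactKernel k C L) (q : Fin dI ⊕ Fin dC) :
    Tendsto (fun p : Σ ν, Ω ν => localMoment (S p.1) k (h p.1) x (Sum.inr q) p.2)
      (probFilter P) (𝓝 0) := by
  have h1 := tendsto_sum_weight hS hr hB hreg (hk.isWeight_oneCons (Sum.inr q))
    (by have := hk.pos; positivity)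
  have h2 : ∫ u : RegSpace dI dC, prodKernel k u * ClusterSample.oneCons u (Sum.inr q) = 0 :=
    hk.integral_mul_coord q
  rwa [h2, mul_zero] at h1

/-- The remainder of the linearization of the regression estimator. -/
lemma eventually_linearization (hS : ∀ ν, IsGenerated (P ν) (S ν) pop)
    (hr : BandwidthRates S h b lam) (hB : PopBound pop x F Q V c ρ)
    (hreg : UnifRegular pop) (hfloor : DensityFloor S pop h) (hk : IsCompactKernel k C L)
    (M : Method) (B : ℝ) :
    ∃ C₂ : ℝ, 0 ≤ C₂ ∧ ∀ᶠ p in probFilter P,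
      |(S p.1).fHat k (h p.1) x p.2 * (Real.sqrt ((S p.1).n * h p.1 ^ (dI + dC)) *
          ((S p.1).mHat M k (h p.1) x p.2 - pop.m x - h p.1 ^ 2 * B)) -
        (Real.sqrt ((S p.1).n * h p.1 ^ (dI + dC)))⁻¹ *
          ∑ g, (S p.1).kernErr pop.m (prodKernel k) (h p.1) x g p.2 -
        ((Real.sqrt ((S p.1).n * h p.1 ^ (dI + dC)))⁻¹ *
          ∑ g, localSum (S p.1) M pop.m k (h p.1) x g p.2 -
          Real.sqrt ((S p.1).n * h p.1 ^ (dI + dC)) * (h p.1 ^ 2 * B) *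
            (S p.1).fHat k (h p.1) x p.2)| ≤
        C₂ * (Real.sqrt (coefBound (S p.1) pop.m k (Fintype.card (Fin dI ⊕ Fin dC) * L)
          (h p.1) x p.2) *
          ∑ q, |localMoment (S p.1) k (h p.1) x (Sum.inr q) p.2|) := by
  obtain ⟨C₁, hC₁, hcoef⟩ := eventually_coefficients hS hr hB hreg hfloor hk M
  obtain ⟨Br, hBr, hres, hres'⟩ := exists_localResid_bound hreg.m
  have hL := hk.pos
  set R := (Fintype.card (Fin dI ⊕ Fin dC) : ℝ) * L with hRd
  have hR : 0 ≤ R := by positivity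
  refine ⟨Real.sqrt (C₁ * (1 + (Br * R ^ 2) ^ 2)), Real.sqrt_nonneg _, ?_⟩
  filter_upwards [hcoef, eventually_fst (P := P) (hr.nh_top.eventually_gt_atTop 0)] with p hp ha
  have hh := hr.h_pos p.1
  -- For Nadaraya–Watson any admissible r will do, since the slopes vanish; the local linear case
  -- relies on the bound of order h².
  obtain ⟨r, hr1, hr2⟩ : ∃ r, (∀ u, ‖u - x‖ ≤ R * h p.1 → |localResid M pop.m x u| ≤ r) ∧
      (M = .ll → r = Br * (R * h p.1) ^ 2) := by
    cases M with
    | nw => exact ⟨Br * (R * h p.1), fun u hu => (hres .nw x u).trans (by gcongr), nofun⟩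
    | ll => exact ⟨Br * (R * h p.1) ^ 2, fun u hu => (hres' x u).trans (by gcongr), fun _ => rfl⟩
  obtain ⟨β, hβ0, hβ, hrow, hβs⟩ := hp x (Metric.mem_closedBall_self
    (by have := hB.ρ_pos; positivity)) r hr1
  set a := (S p.1).n * h p.1 ^ (dI + dC) with had
  set T := ∑ q, β (Sum.inr q) * localMoment (S p.1) k (h p.1) x (Sum.inr q) p.2 with hT
  -- The intercept row, sorted into errors, local residuals, the intercept times the density
  -- estimator, and the slopes times the local moments T.
  have heq : ∑ g, (S p.1).kernErr pop.m (prodKernel k) (h p.1) x g p.2 +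
      ∑ g, localSum (S p.1) M pop.m k (h p.1) x g p.2 -
      β (Sum.inl ()) * (a * (S p.1).fHat k (h p.1) x p.2) - a * T = 0 := by
    rw [← hrow]
    have h1 : a * (S p.1).fHat k (h p.1) x p.2 = ∑ g, ∑ j,
        prodKernel k ((h p.1)⁻¹ • ((S p.1).X g j p.2 - x)) := mul_div_cancel₀ _ ha.ne'
    have h2 : a * T = ∑ q, β (Sum.inr q) * ∑ g, ∑ j,
        prodKernel k ((h p.1)⁻¹ • ((S p.1).X g j p.2 - x)) *
          ClusterSample.oneCons ((h p.1)⁻¹ • ((S p.1).X g j p.2 - x)) (Sum.inr q) := by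
      rw [hT, Finset.mul_sum]
      refine Finset.sum_congr rfl fun q _ => ?_
      rw [localMoment, mul_left_comm, mul_div_cancel₀ _ ha.ne']
    rw [h1, h2, Fintype.sum_sigma]
    simp only [ClusterSample.kernErr, localSum, Finset.mul_sum]
    rw [Finset.sum_comm (s := (Finset.univ : Finset (Fin dI ⊕ Fin dC)))]
    simp only [Finset.sum_comm (s := (Finset.univ : Finset (Fin dI ⊕ Fin dC)))]
    rw [← Finset.sum_add_distrib, ← Finset.sum_sub_distrib, ← Finset.sum_sub_distrib]
    refine Finset.sum_congr rfl fun g _ => ?_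
    rw [← Finset.sum_add_distrib, ← Finset.sum_sub_distrib, ← Finset.sum_sub_distrib]
    refine Finset.sum_congr rfl fun j _ => ?_
    have h3 : ∑ q, β (Sum.inr q) * (prodKernel k ((h p.1)⁻¹ • ((S p.1).X g j p.2 - x)) *
          ClusterSample.oneCons ((h p.1)⁻¹ • ((S p.1).X g j p.2 - x)) (Sum.inr q)) =
        prodKernel k ((h p.1)⁻¹ • ((S p.1).X g j p.2 - x)) * ∑ q, β (Sum.inr q) *
          ClusterSample.oneCons ((h p.1)⁻¹ • ((S p.1).X g j p.2 - x)) (Sum.inr q) := by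
      rw [Finset.mul_sum]
      exact Finset.sum_congr rfl fun q _ => by ring
    have h4 : ∑ u : Unit, β (Sum.inl u) * ClusterSample.oneCons
        ((h p.1)⁻¹ • ((S p.1).X g j p.2 - x)) (Sum.inl u) = β (Sum.inl ()) := by
      rw [Finset.univ_unique, Finset.sum_singleton]
      exact mul_one _
    have h5 : ∑ q, β q * ClusterSample.oneCons ((h p.1)⁻¹ • ((S p.1).X g j p.2 - x)) q =
        β (Sum.inl ()) + ∑ q, β (Sum.inr q) *
          ClusterSample.oneCons ((h p.1)⁻¹ • ((S p.1).X g j p.2 - x)) (Sum.inr q) :=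
      (Fintype.sum_sum_type _).trans (congrArg (· + _) h4)
    rw [h3, h5]
    ring
  rw [linearization_identity ha heq hβ0, abs_neg]
  have hz : 0 ≤ ∑ q, |localMoment (S p.1) k (h p.1) x (Sum.inr q) p.2| :=
    Finset.sum_nonneg fun _ _ => abs_nonneg _
  cases M with
  | nw =>
    have hT0 : T = 0 := Finset.sum_eq_zero fun q _ => by rw [hβ rfl q, zero_mul]
    rw [hT0, mul_zero, abs_zero]
    exact mul_nonneg (Real.sqrt_nonneg _) (mul_nonneg (Real.sqrt_nonneg _) hz)
  | ll =>
    rw [hr2 rfl] at hβs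
    refine sqrt_mul_coef_le ha hC₁.le (Finset.sum_nonneg fun q _ => sq_nonneg _)
      (Finset.sum_nonneg fun g _ => Nat.cast_nonneg _) hz hβs ?_
    refine (Finset.abs_sum_le_sum_abs _ _).trans ?_
    rw [Finset.mul_sum]
    refine Finset.sum_le_sum fun q _ => ?_
    rw [abs_mul]
    exact mul_le_mul_of_nonneg_right (Finset.single_le_sum (f := fun q => |β q|)
      (fun _ _ => abs_nonneg _) (Finset.mem_univ (Sum.inr q))) (abs_nonneg _)

end Asymptotic

end ClusterKernel

namespace ClusterKernel

variable {dI dC : ℕ}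

/-! ## Measurability of the statistic -/

section Measurability

variable {Ω : Type*} [mΩ : MeasurableSpace Ω]

lemma measurable_det {ι : Type*} [Fintype ι] [DecidableEq ι] {A : Ω → Matrix ι ι ℝ}
    (hA : ∀ i j, Measurable fun ω => A ω i j) : Measurable fun ω => (A ω).det := by
  simp only [Matrix.det_apply']
  exact Finset.measurable_sum _ fun σ _ =>
    (Finset.measurable_prod _ fun i _ => hA (σ i) i).const_mul _

/-- The inverse is the adjugate times the inverse of the determinant, with the default value 0 at
singular matrices; both factors are measurable everywhere, so no restriction to the regular set is
needed. -/
lemma measurable_matrix_inv {ι : Type*} [Fintype ι] [DecidableEq ι] {A : Ω → Matrix ι ι ℝ}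
    (hA : ∀ i j, Measurable fun ω => A ω i j) (i j : ι) : Measurable fun ω => (A ω)⁻¹ i j := by
  simp only [Matrix.inv_def, Ring.inverse_eq_inv', Matrix.smul_apply, smul_eq_mul,
    Matrix.adjugate_apply]
  refine (measurable_det hA).inv.mul (measurable_det fun p q => ?_)
  simp only [Matrix.updateRow_apply]
  by_cases hp : p = j
  · simp only [if_pos hp]
    exact measurable_const
  · simp only [if_neg hp]
    exact hA p q

lemma measurable_matrix_mul {ι κ τ : Type*} [Fintype κ] {A : Ω → Matrix ι κ ℝ}
    {B : Ω → Matrix κ τ ℝ} (hA : ∀ i j, Measurable fun ω => A ω i j)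
    (hB : ∀ i j, Measurable fun ω => B ω i j) (i : ι) (j : τ) :
    Measurable fun ω => (A ω * B ω) i j := by
  simp only [Matrix.mul_apply]
  exact Finset.measurable_sum _ fun q _ => (hA i q).mul (hB q j)

variable (S : ClusterSample dI dC Ω) {k : ℝ → ℝ} {C L : ℝ} {Y : Ω → RegSpace dI dC}

lemma measurable_kernel_term (hk : IsCompactKernel k C L) (hY : Measurable Y) (h : ℝ)
    (g : Fin S.G) (j : Fin (S.size g)) :
    Measurable fun ω => prodKernel k (h⁻¹ • (S.X g j ω - Y ω)) :=
  hk.continuous_prod.measurable.comp (((S.measurable_X g j).sub hY).const_smul h⁻¹)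

lemma measurable_oneCons {v : Ω → RegSpace dI dC} (hv : Measurable v)
    (q : Unit ⊕ (Fin dI ⊕ Fin dC)) : Measurable fun ω => ClusterSample.oneCons (v ω) q := by
  rcases q with q | q
  · exact measurable_const
  · exact hv.coord q

/-- The evaluation point is random because the residuals evaluate the estimator at the regressors
themselves. -/
lemma measurable_mHat (hk : IsCompactKernel k C L) (M : Method) (h : ℝ) (hY : Measurable Y) :
    Measurable fun ω => S.mHat M k h (Y ω) ω := by
  have hK := measurable_kernel_term S hk hY h
  cases M with
  | nw =>
    exact (Finset.measurable_sum _ fun g _ => Finset.measurable_sum _ fun j _ =>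
      (hK g j).mul (S.measurable_Y g j)).div
        (Finset.measurable_sum _ fun g _ => Finset.measurable_sum _ fun j _ => hK g j)
  | ll =>
    have hD : ∀ i q, Measurable fun ω => S.designMatrix (Y ω) ω i q := fun i q =>
      measurable_oneCons ((S.measurable_X i.1 i.2).sub hY) q
    have hW : ∀ i j, Measurable fun ω => S.weightMatrix k h (Y ω) ω i j := fun i j => by
      simp only [ClusterSample.weightMatrix, Matrix.diagonal_apply]
      split_ifs
      · exact (hK i.1 i.2).div_const _
      · exact measurable_const
    have hG := measurable_matrix_inv (measurable_matrix_mul (measurable_matrix_mul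
      (A := fun ω => (S.designMatrix (Y ω) ω).transpose) (fun q i => hD i q) hW) hD)
    have hL : ∀ g j, Measurable fun ω => S.kernelLL k h (S.X g j ω) (Y ω) ω := fun g j => by
      simp only [ClusterSample.kernelLL, Matrix.mulVec, dotProduct]
      exact Measurable.mul (Finset.measurable_sum _ fun q _ => (hG (Sum.inl ()) q).mul
        (measurable_oneCons ((S.measurable_X g j).sub hY) q)) ((hK g j).div_const _)
    simp only [ClusterSample.mHat, ClusterSample.mLL]
    exact Finset.measurable_sum _ fun g _ => Finset.measurable_sum _ fun j _ =>
      (hL g j).mul (S.measurable_Y g j)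

lemma measurable_studentized (hk : IsCompactKernel k C L) (M : Method)
    (m f : RegSpace dI dC → ℝ) (h b : ℝ) (x : RegSpace dI dC) :
    Measurable (studentized S M k m f h b x) := by
  have hK := measurable_kernel_term S hk (measurable_const (a := x)) h
  have hres : ∀ g j, Measurable (S.resid M k h g j) := fun g j =>
    (S.measurable_Y g j).sub (measurable_mHat S hk M h (S.measurable_X g j))
  have hP : ∀ g j l, Measurable (pairKernel S k b x g j l) := fun g j l =>
    (measurable_pairKernel hk b g j l).mono (S.sigmaX_le g) le_rfl
  have hsumK : Measurable fun ω => ∑ g, ∑ j, prodKernel k (h⁻¹ • (S.X g j ω - x)) :=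
    Finset.measurable_sum _ fun g _ => Finset.measurable_sum _ fun j _ => hK g j
  have hf : Measurable (S.fHat k h x) := hsumK.div_const _
  have hsig : Measurable (S.sigmaSqHat M k h x) :=
    (Finset.measurable_sum _ fun g _ => Finset.measurable_sum _ fun j _ =>
      (hK g j).mul ((hres g j).pow_const 2)).div hsumK
  have hsumP : Measurable fun ω => ∑ g, ∑ j, ∑ l, pairKernel S k b x g j l ω :=
    Finset.measurable_sum _ fun g _ => Finset.measurable_sum _ fun j _ =>
      Finset.measurable_sum _ fun l _ => hP g j l
  have hf₂ : Measurable (S.fTwoHat k b x) := hsumP.div_const _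
  have hnum : Measurable fun ω => ∑ g, ∑ j, ∑ l, if j < l then
      S.pairWeight k b x g j l ω * (S.resid M k h g j ω * S.resid M k h g l ω) else 0 := by
    refine Finset.measurable_sum _ fun g _ => Finset.measurable_sum _ fun j _ =>
      Finset.measurable_sum _ fun l _ => ?_
    have h1 := (hP g j l).mul ((hres g j).mul (hres g l))
    by_cases hjl : j < l
    · simp only [if_pos hjl]
      convert h1 using 2
      simp [pairKernel, hjl]
    · simp only [if_neg hjl]
      exact measurable_const
  have hcov : Measurable (S.sigmaCovHat M k h b x) := hnum.div hsumP
  have hvar : Measurable (S.varHat M k h b x) :=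
    ((hsig.const_mul _).div hf).add (((hf₂.const_mul _).mul hcov).div (hf.pow_const 2))
  exact (hvar.sqrt.inv.mul_const _).mul
    (((measurable_mHat S hk M h measurable_const).sub_const _).sub_const _)

end Measurability

/-! ## Asymptotic normality -/

lemma tendsto_bounded_mul {α : Type*} {l : Filter α} {u v : α → ℝ} {K : ℝ}
    (hu : ∀ᶠ p in l, |u p| ≤ K) (hv : Tendsto v l (𝓝 0)) :
    Tendsto (fun p => u p * v p) l (𝓝 0) := by
  refine squeeze_zero_norm' (a := fun p => K * |v p|) ?_ (by simpa using hv.abs.const_mul K)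
  filter_upwards [hu] with p hp
  rw [Real.norm_eq_abs, abs_mul]
  gcongr

lemma tendsto_of_abs_sub_sub_le {α : Type*} {l : Filter α} {u z e w : α → ℝ} {K : ℝ}
    (hle : ∀ᶠ p in l, |u p - z p - e p| ≤ K * w p) (hw : Tendsto w l (𝓝 0))
    (he : Tendsto e l (𝓝 0)) : Tendsto (fun p => u p - z p) l (𝓝 0) := by
  have h1 : Tendsto (fun p => u p - z p - e p) l (𝓝 0) :=
    squeeze_zero_norm' hle (by simpa using hw.const_mul K)
  simpa using h1.add he

section Asymptotic

variable {Ω : ℕ → Type*} [∀ ν, MeasurableSpace (Ω ν)] {P : ∀ ν, Measure (Ω ν)}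
  [∀ ν, IsProbabilityMeasure (P ν)]
  {S : ∀ ν, ClusterSample dI dC (Ω ν)} {pop : Population dI dC} {x : RegSpace dI dC}
  {F Q V c ρ : ℝ} {h b : ℕ → ℝ} {lam : ℝ} {k : ℝ → ℝ} {C L : ℝ}

lemma BandwidthRates.exists_nh_bound (hr : BandwidthRates S h b lam) :
    ∃ E : ℝ, 0 < E ∧ ∀ᶠ ν in atTop, ((S ν).n : ℝ) * h ν ^ (dI + dC + 4) ≤ E := by
  obtain ⟨E, hE0, hE⟩ := hr.nh_bias.exists_pos
  refine ⟨E, hE0, ?_⟩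
  filter_upwards [hE.bound] with ν hν
  rw [norm_one, mul_one] at hν
  exact (le_abs_self _).trans hν

lemma sqrt_mul_sq_le {a h E : ℝ} (ha : 0 ≤ a) (hE : a * h ^ 4 ≤ E) :
    |Real.sqrt a * h ^ 2| ≤ Real.sqrt E := by
  rw [abs_of_nonneg (by positivity)]
  refine Real.le_sqrt_of_sq_le (le_trans (le_of_eq ?_) hE)
  rw [mul_pow, Real.sq_sqrt ha, ← pow_mul]

lemma abs_kernel_mul_localResid_le (hk : IsCompactKernel k C L) {m : RegSpace dI dC → ℝ}
    {Br : ℝ} (hBr : 0 ≤ Br) (M : Method) (hres : ∀ y, |localResid M m x y| ≤ Br * ‖y - x‖)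
    {h : ℝ} (hh : 0 < h) (y : RegSpace dI dC) :
    |prodKernel k (h⁻¹ • (y - x)) * localResid M m x y| ≤ C ^ Fintype.card (Fin dI ⊕ Fin dC) *
      (Br * (Fintype.card (Fin dI ⊕ Fin dC) * L * h)) := by
  have hL := hk.pos
  have hC : 0 ≤ C := zero_le_one.trans hk.one_le
  by_cases hy : ‖y - x‖ ≤ Fintype.card (Fin dI ⊕ Fin dC) * L * h
  · rw [abs_mul, abs_of_nonneg (hk.prod_nonneg _)]
    exact mul_le_mul (hk.prod_le _) ((hres y).trans (by gcongr)) (abs_nonneg _) (by positivity)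
  · rw [hk.isWeight.support, zero_mul, abs_zero]
    · positivity
    · rwa [norm_smul, norm_inv, Real.norm_of_nonneg hh.le, inv_mul_eq_div, lt_div_iff₀ hh, ← not_le]

/-- The local approximation errors contribute the asymptotic bias. -/
lemma tendsto_localSum (hS : ∀ ν, IsGenerated (P ν) (S ν) pop)
    (hr : BandwidthRates S h b lam) (hB : PopBound pop x F Q V c ρ)
    (hreg : UnifRegular pop) (hfx : 0 < pop.f x) (hk : IsCompactKernel k C L) (M : Method) :
    Tendsto (fun p : Σ ν, Ω ν => (Real.sqrt ((S p.1).n * h p.1 ^ (dI + dC)))⁻¹ *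
        ∑ g, localSum (S p.1) M pop.m k (h p.1) x g p.2 -
      Real.sqrt ((S p.1).n * h p.1 ^ (dI + dC)) * (h p.1 ^ 2 * bias M k pop.m pop.f x) *
        (S p.1).fHat k (h p.1) x p.2) (probFilter P) (𝓝 0) := by
  obtain ⟨Br, hBr, hres, -⟩ := exists_localResid_bound hreg.m
  have hL := hk.pos
  have hR : 0 ≤ (Fintype.card (Fin dI ⊕ Fin dC) : ℝ) * L := by positivity
  obtain ⟨A, hA0, hA⟩ := hr.exists_maxSize_bound _ hR
  obtain ⟨E, hE0, hE⟩ := hr.exists_nh_bound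
  have hK := countConst_nonneg (dI := dI) (dC := dC) hB.F_pos.le hA0.le
  have hbound := fun ν => abs_kernel_mul_localResid_le hk hBr M (hres M x) (hr.h_pos ν)
  set R := (Fintype.card (Fin dI ⊕ Fin dC) : ℝ) * L
  set D := C ^ Fintype.card (Fin dI ⊕ Fin dC)
  have hcont := continuous_localResid hreg.m M x
  have hX : ∀ ν g j, Measurable fun ω => prodKernel k ((h ν)⁻¹ • ((S ν).X g j ω - x)) *
      localResid M pop.m x ((S ν).X g j ω) := fun ν g j =>
    (measurable_kernel_term (S ν) hk measurable_const (h ν) g j).mul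
      (hcont.measurable.comp ((S ν).measurable_X g j))
  have hloc : ∀ ν g, Measurable (localSum (S ν) M pop.m k (h ν) x g) := fun ν g =>
    Finset.measurable_sum _ fun j _ => hX ν g j
  set I : ℕ → ℝ := fun ν => ∫ u, prodKernel k u *
    (localResid M pop.m x (x + h ν • u) * pop.f (x + h ν • u)) with hI
  have hmean : ∀ ν, ∑ g, ∫ ω, localSum (S ν) M pop.m k (h ν) x g ω ∂(P ν) =
      (S ν).n * h ν ^ (dI + dC) * I ν := fun ν => by
    rw [(S ν).n_eq_sum, Finset.sum_mul, Finset.sum_mul]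
    refine Finset.sum_congr rfl fun g _ => ?_
    simp only [localSum]
    rw [integral_finsetSum _ fun j _ => Integrable.of_bound (hX ν g j).aestronglyMeasurable _
      (ae_of_all _ fun ω => hbound ν ((S ν).X g j ω))]
    simp only [integral_weight_X (hS ν) hreg hk.continuous_prod.measurable hcont.measurable
      (hr.h_pos ν)]
    rw [Finset.sum_const, Finset.card_univ, Fintype.card_fin, nsmul_eq_mul]
    ring
  -- On the kernel's support the local residual is O(h), so the variance of the sum is O(h² n h^d)
  -- and vanishes after division by √(n h^d).
  have hcentered : Tendsto (fun p : Σ ν, Ω ν => (∑ g, localSum (S p.1) M pop.m k (h p.1) x g p.2 -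
      ∑ g, ∫ ω, localSum (S p.1) M pop.m k (h p.1) x g ω ∂(P p.1)) /
      Real.sqrt ((S p.1).n * h p.1 ^ (dI + dC))) (probFilter P) (𝓝 0) := by
    refine tendsto_centered_div (ι := fun ν => Fin (S ν).G)
      (N := fun ν => Real.sqrt ((S ν).n * h ν ^ (dI + dC)))
      (T := fun ν g ω => localSum (S ν) M pop.m k (h ν) x g ω)
      (c := fun ν => (D * (Br * (R * h ν))) ^ 2 * (countConst dI dC F A *
        ((S ν).n * (R * h ν) ^ (dI + dC)))) hloc (fun ν => ?_) ?_ ?_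
    · refine iIndepFun_of_data (hS ν) fun g => ⟨fun z => ∑ j,
        prodKernel k ((h ν)⁻¹ • (z.2 j - x)) * localResid M pop.m x (z.2 j), ?_, fun ω => rfl⟩
      have hz : ∀ j, Measurable fun z : (Fin ((S ν).size g) → ℝ) ×
        (Fin ((S ν).size g) → RegSpace dI dC) => z.2 j :=
        fun j => (measurable_pi_apply j).comp measurable_snd
      exact Finset.measurable_sum _ fun j _ => (hk.continuous_prod.measurable.comp
        (((hz j).sub_const x).const_smul (h ν)⁻¹)).mul (hcont.measurable.comp (hz j))
    · filter_upwards [hA] with ν hAν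
      have hh := hr.h_pos ν
      refine (Finset.sum_le_sum fun g _ => lintegral_sq_sum_near_le (hS ν) hB
        (r := R * h ν) (ζ := fun y => prodKernel k ((h ν)⁻¹ • (y - x)) * localResid M pop.m x y)
        (B := D * (Br * (R * h ν))) (by positivity) g (hAν g) (hbound ν) fun y hy => ?_).trans ?_
      · rw [Metric.mem_closedBall, dist_eq_norm, not_le] at hy
        rw [hk.isWeight.support, zero_mul]
        rwa [norm_smul, norm_inv, Real.norm_of_nonneg hh.le, inv_mul_eq_div, lt_div_iff₀ hh]
      · rw [← ENNReal.ofReal_sum_of_nonneg fun _ _ => by positivity, (S ν).n_eq_sum,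
          Finset.sum_mul, Finset.mul_sum, Finset.mul_sum]
    · have h1 : Tendsto (fun ν => (D * (Br * R)) ^ 2 * countConst dI dC F A * R ^ (dI + dC) *
          h ν ^ 2) atTop (𝓝 0) := by
        simpa using (hr.h_zero.pow 2).const_mul
          ((D * (Br * R)) ^ 2 * countConst dI dC F A * R ^ (dI + dC))
      refine h1.congr' ?_
      filter_upwards [hr.nh_top.eventually_gt_atTop 0] with ν ha
      rw [Real.sq_sqrt ha.le, eq_div_iff ha.ne', mul_pow R (h ν)]
      ring
  have hu : ∀ᶠ p in probFilter P,
      |Real.sqrt ((S p.1).n * h p.1 ^ (dI + dC)) * h p.1 ^ 2| ≤ Real.sqrt E := by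
    refine eventually_fst (q := fun ν => |Real.sqrt ((S ν).n * h ν ^ (dI + dC)) * h ν ^ 2| ≤
      Real.sqrt E) ?_
    filter_upwards [hE] with ν hν
    have hh := hr.h_pos ν
    refine sqrt_mul_sq_le (by positivity) (le_trans (le_of_eq ?_) hν)
    rw [pow_add _ (dI + dC) 4]
    ring
  have hb : Tendsto (fun p : Σ ν, Ω ν => (h p.1 ^ 2)⁻¹ * I p.1 - pop.f x *
      bias M k pop.m pop.f x) (probFilter P) (𝓝 0) := by
    have h1 := tendsto_fst_comp (P := P)
      (tendsto_bias hreg.m hreg.f hk x hfx.ne' hr.h_pos hr.h_zero M)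
    simpa using h1.sub_const (pop.f x * bias M k pop.m pop.f x)
  -- The bias is subtracted with the factor f̂(x), whereas the mean produces f(x); the difference is
  -- covered by the boundedness of √(n h^d) h².
  have hf : Tendsto (fun p : Σ ν, Ω ν => bias M k pop.m pop.f x *
      (pop.f x - (S p.1).fHat k (h p.1) x p.2)) (probFilter P) (𝓝 0) := by
    simpa using ((tendsto_fHat hS hr hB hreg hk).const_sub (pop.f x)).const_mul
      (bias M k pop.m pop.f x)
  have hbf := hb.add hf
  rw [add_zero] at hbf
  have hsum := hcentered.add (tendsto_bounded_mul hu hbf)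
  simp only [add_zero] at hsum
  refine hsum.congr' ?_
  filter_upwards [eventually_fst (P := P) (hr.nh_top.eventually_gt_atTop 0)] with p ha
  rw [hmean]
  have hh := (hr.h_pos p.1).ne'
  have hs : Real.sqrt ((S p.1).n * h p.1 ^ (dI + dC)) ≠ 0 := (Real.sqrt_pos.2 ha).ne'
  have hss := Real.mul_self_sqrt ha.le
  -- With a written as s², the identity is purely algebraic.
  generalize Real.sqrt ((S p.1).n * h p.1 ^ (dI + dC)) = s at hs hss ⊢
  rw [← hss]
  field_simp
  ring

lemma tendsto_linearization (hS : ∀ ν, IsGenerated (P ν) (S ν) pop)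
    (hr : BandwidthRates S h b lam) (hB : PopBound pop x F Q V c ρ)
    (hreg : UnifRegular pop) (hfx : 0 < pop.f x) (hfloor : DensityFloor S pop h)
    (hk : IsCompactKernel k C L) (M : Method) :
    Tendsto (fun p : Σ ν, Ω ν =>
      (S p.1).fHat k (h p.1) x p.2 * (Real.sqrt ((S p.1).n * h p.1 ^ (dI + dC)) *
          ((S p.1).mHat M k (h p.1) x p.2 - pop.m x - h p.1 ^ 2 * bias M k pop.m pop.f x)) -
        (Real.sqrt ((S p.1).n * h p.1 ^ (dI + dC)))⁻¹ *
          ∑ g, (S p.1).kernErr pop.m (prodKernel k) (h p.1) x g p.2) (probFilter P) (𝓝 0) := by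
  have hm := hreg.m.continuous
  have hL := hk.pos
  obtain ⟨C₂, -, hlin⟩ := eventually_linearization hS hr hB hreg hfloor hk M
    (bias M k pop.m pop.f x)
  obtain ⟨A, hA0, hA⟩ := hr.exists_maxSize_bound (Fintype.card (Fin dI ⊕ Fin dC) * L)
    (by positivity)
  obtain ⟨E, hE0, hE⟩ := hr.exists_nh_bound
  have h1 : Tendsto (fun p : Σ ν, Ω ν => ∑ q, |localMoment (S p.1) k (h p.1) x (Sum.inr q) p.2|)
      (probFilter P) (𝓝 0) := by
    simpa using tendsto_finsetSum Finset.univ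
      fun q _ => (tendsto_localMoment hS hr hB hreg hk q).abs
  -- The slope remainder is a factor bounded in mean square times the local moments, which tend to
  -- zero.
  have h2 := tendsto_mul_probFilter (P := P)
    (Z := fun ν ω => Real.sqrt (coefBound (S ν) pop.m k (Fintype.card (Fin dI ⊕ Fin dC) * L)
      (h ν) x ω)) (A := fun ν ω => ∑ q, |localMoment (S ν) k (h ν) x (Sum.inr q) ω|)
    (fun ν => (measurable_coefBound (S ν) hm hk _ (h ν) x).sqrt) (by
      filter_upwards [hA, hE, hr.nh_top.eventually_gt_atTop 0] with ν hAν hEν ha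
      refine le_trans (le_of_eq (lintegral_congr fun ω => ?_))
        (lintegral_coefBound_le (hS ν) hB hm hk (hr.h_pos ν) ha hA0.le hAν hEν)
      rw [Real.sq_sqrt]
      have hh := hr.h_pos ν
      exact add_nonneg (mul_nonneg (inv_nonneg.2 ha.le) (Finset.sum_nonneg fun _ _ => sq_nonneg _))
        (mul_nonneg (by positivity) (Finset.sum_nonneg fun _ _ => Nat.cast_nonneg _))) h1
  exact tendsto_of_abs_sub_sub_le hlin h2 (tendsto_localSum hS hr hB hreg hfx hk M)

/-- The variance estimator tends to v/f(x)²; the factor 1/f̂(x) from solving the linearization for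
m̂ cancels the denominator in the limit. -/
lemma inv_sqrt_div_sq {v f : ℝ} (hf : 0 < f) :
    (Real.sqrt (v / f ^ 2))⁻¹ * f⁻¹ = (Real.sqrt v)⁻¹ := by
  rw [Real.sqrt_div' _ (sq_nonneg f), Real.sqrt_sq hf.le]
  field_simp

/-- The studentized statistic is asymptotically equivalent to the standardized kernel-weighted sum
of errors. -/
lemma tendsto_studentized_sub (hS : ∀ ν, IsGenerated (P ν) (S ν) pop)
    (hr : BandwidthRates S h b lam) (hB : PopBound pop x F Q V c ρ)
    (hreg : UnifRegular pop) (hfx : 0 < pop.f x) (hf₂ : 0 < pop.fJoint 2 (diagPt 2 x))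
    (hfloor : DensityFloor S pop h) (hY : OutcomeCondition P S h) (hk : IsCompactKernel k C L)
    (M : Method) {v : ℝ} (hv : 0 < v)
    (hvar : v = roughness k ^ (dI + dC) * pop.f x * pop.sigmaSq x + lam * roughness k ^ dC *
        pop.fJoint 2 (diagPt 2 x) * pop.sigmaCov (diagPt 2 x)) :
    Tendsto (fun p : Σ ν, Ω ν => studentized (S p.1) M k pop.m pop.f (h p.1) (b p.1) x p.2 -
      (Real.sqrt ((S p.1).n * h p.1 ^ (dI + dC) * v))⁻¹ *
        ∑ g, (S p.1).kernErr pop.m (prodKernel k) (h p.1) x g p.2) (probFilter P) (𝓝 0) := by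
  have hm := hreg.m.continuous
  have hL := hk.pos
  have hQ := hB.Q_pos
  have hw : IsWeight (prodKernel k : RegSpace dI dC → ℝ) _ _ := hk.isWeight
  have hR : 0 ≤ (Fintype.card (Fin dI ⊕ Fin dC) : ℝ) * L := by positivity
  obtain ⟨A, hA0, hA⟩ := hr.exists_maxSize_bound _ hR
  have hV := tendsto_varHat hS hr hB hreg hfx hf₂ hfloor hY hk M
  rw [← hvar] at hV
  have hf := tendsto_fHat hS hr hB hreg hk
  have hκ := ((hV.sqrt.inv₀ (Real.sqrt_pos.2 (by positivity)).ne').mul (hf.inv₀ hfx.ne'))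
  rw [inv_sqrt_div_sq hfx] at hκ
  have h1 := hκ.mul (tendsto_linearization hS hr hB hreg hfx hfloor hk M)
  rw [mul_zero] at h1
  have hκ₀ := hκ.sub_const (Real.sqrt v)⁻¹
  rw [sub_self] at hκ₀
  set R := (Fintype.card (Fin dI ⊕ Fin dC) : ℝ) * L
  -- Slutsky's step: the standardized error sum is bounded in mean square, and the random scale
  -- minus its limit tends to zero.
  have h2 := tendsto_mul_probFilter (P := P)
    (Z := fun ν ω => (Real.sqrt ((S ν).n * h ν ^ (dI + dC)))⁻¹ *
      ∑ g, (S ν).kernErr pop.m (prodKernel k) (h ν) x g ω)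
    (A := fun ν ω => (Real.sqrt ((S ν).varHat M k (h ν) (b ν) x ω))⁻¹ *
      ((S ν).fHat k (h ν) x ω)⁻¹ - (Real.sqrt v)⁻¹)
    (C := (C ^ Fintype.card (Fin dI ⊕ Fin dC)) ^ 2 * Q * countConst dI dC F A * R ^ (dI + dC))
    (fun ν => (Finset.measurable_sum _ fun g _ =>
      (S ν).measurable_kernErr hm hw.measurable (h ν) x g).const_mul _) (by
      filter_upwards [hA, hr.nh_top.eventually_gt_atTop 0] with ν hAν ha
      have h3 := lintegral_sum_kernErr_sq_le (hS ν) hB hm hw hR (hr.h_pos ν) hAν hA0.le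
        Finset.univ x
      simp only [mul_pow, inv_pow, Real.sq_sqrt ha.le,
        ENNReal.ofReal_mul (inv_nonneg.2 ha.le)]
      rw [lintegral_const_mul' _ _ ENNReal.ofReal_ne_top]
      refine (mul_le_mul_right h3 _).trans (le_of_eq ?_)
      rw [← ENNReal.ofReal_mul (inv_nonneg.2 ha.le)]
      congr 1
      rw [inv_mul_eq_div, div_eq_iff ha.ne', mul_pow R (h ν)]
      ring) hκ₀
  have h3 := h2.add h1
  rw [add_zero] at h3
  refine h3.congr' ?_
  filter_upwards [hf.eventually_ne hfx.ne', eventually_fst (P := P)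
    (hr.nh_top.eventually_gt_atTop 0)] with p hp ha
  rw [Real.sqrt_mul ha.le, mul_inv, studentized]
  generalize (Real.sqrt ((S p.1).varHat M k (h p.1) (b p.1) x p.2))⁻¹ = u
  generalize (S p.1).fHat k (h p.1) x p.2 = f at hp ⊢
  generalize ∑ g, (S p.1).kernErr pop.m (prodKernel k) (h p.1) x g p.2 = Z
  generalize (Real.sqrt v)⁻¹ = w
  generalize (S p.1).mHat M k (h p.1) x p.2 - pop.m x - h p.1 ^ 2 * bias M k pop.m pop.f x = δ
  have hff : f⁻¹ * f = 1 := inv_mul_cancel₀ hp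
  -- The random scale times the linearization remainder, plus the scale error times the normalized
  -- error sum, telescopes to the claim once f̂(x) is cancelled against its inverse.
  linear_combination (u * (Real.sqrt ((S p.1).n * h p.1 ^ (dI + dC)) * δ)) * hff

end Asymptotic

end ClusterKernel

open ClusterKernel
theorem mainTheorem9 {dI dC : ℕ} (hdI : 1 ≤ dI)
    {Ω : ℕ → Type*} [∀ ν, MeasurableSpace (Ω ν)]
    (P : ∀ ν, Measure (Ω ν)) [∀ ν, IsProbabilityMeasure (P ν)]
    (S : ∀ ν, ClusterSample dI dC (Ω ν)) (pop : Population dI dC)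
    (k : ℝ → ℝ) (h b : ℕ → ℝ) (lam : ℝ) (x : RegSpace dI dC)
    (hk : IsKernel k) (hK : IsLipschitzCompact dI dC k)
    (hdgp : ∀ ν, IsGenerated (P ν) (S ν) pop)
    (hrates : BandwidthRates S h b lam)
    (hreg : UnifRegular pop)
    (hloc : ∃ N : Set (RegSpace dI dC), IsOpen N ∧ x ∈ N ∧ LocallyRegular pop N)
    (hf : 0 < pop.f x) (hf₂ : 0 < pop.fJoint 2 (diagPt 2 x))
    (hmom : MomentCondition P S pop h x)
    (hvar : 0 < roughness k ^ (dI + dC) * pop.f x * pop.sigmaSq x +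
      lam * roughness k ^ dC * pop.fJoint 2 (diagPt 2 x) * pop.sigmaCov (diagPt 2 x))
    (hY : OutcomeCondition P S h)
    (hfloor : DensityFloor S pop h)
    (htail : RegressorTail P S)
    (M : Method) :
    TendstoInDistribution (fun ν => studentized (S ν) M k pop.m pop.f (h ν) (b ν) x)
      atTop id P (gaussianReal 0 1) := by
  obtain ⟨C, L, hkc⟩ := exists_isCompactKernel hdI hk hK
  obtain ⟨N, hN, hxN, hlocN⟩ := hloc
  obtain ⟨F, Q, V, c, ρ, hB⟩ := exists_popBound hreg hf hN hxN hlocN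
  exact tendstoInDistribution_of_kernErr hdI hdgp hrates hB hreg hkc hvar rfl
    (fun ν => measurable_studentized (S ν) hkc M pop.m pop.f (h ν) (b ν) x)
    (tendsto_studentized_sub hdgp hrates hB hreg hf hf₂ hfloor hY hkc M hvar rfl)
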